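/- \textbf{Conventions.} The background theory is $\mathsf{ZF}$ (no choice), so the theorem is asserted in every model of $\mathsf{ZF}$. $\omega$, formulas and satisfaction are those of the universe of sets in question. An ordinal is \emph{even} if it is $\eta+2m$ with $m<\omega$ and $\eta$ equal to $0$ or a limit ordinal. $\Sigma_0=\Pi_0$ formulas have only bounded quantifiers; a $\Sigma_{n+1}$ formula is a block of existential quantifiers followed by a $\Pi_n$ formula, and $\Pi_{n+1}$ formulas are the negations of $\Sigma_{n+1}$ formulas. $\mathscr E_n(M)$ (resp. $\mathscr E(M)$) is the set of all $\Sigma_n$-elementary (resp. fully elementary) maps $j:M\to M$. Ordered pairs $\lceil x,y\rceil$ are Quine--Rosser pairs: with $s(m)=m+1$ for $m<\omega$ and $s(u)=u$ for $u\notin\omega$, $\lceil x,y\rceil=\{s``u: u\in x\}\cup\{(s``u)\cup\{\emptyset\}:u\in y\}$. Let $\lambda$ be even and $\mu$ an ultrafilter over $V_{\lambda+1}$. Then $\mu$ is \emph{pre-Reinhardt} if (i) $\{A: A\preccurlyeq V_\lambda$ and the transitive collapse of $A$ is $V_\lambda\}\in\mu$; (ii) $\{A: x\in A\subseteq V_\lambda\}\in\mu$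 for each $x\in V_\lambda$; (iii) for each sequence $\langle\sigma_x\rangle_{x\in V_\lambda}$ of elements of $\mu$, $\{A\subseteq V_\lambda: A\in\sigma_x\text{ for each }x\in A\}\in\mu$. A relation $R$ is \emph{$\mu$-uniformized} by a function $f$ with domain $V_{\lambda+1}$ if for $\mu$-almost all $k$, if there is $x$ with $(k,x)\in R$ then $(k,f(k))\in R$. $\mu$ is \emph{$\Sigma_1^{\lambda+2}$-Reinhardt} if it is pre-Reinhardt and every $R\subseteq V_{\lambda+1}\times V_{\lambda+1}$ can be $\mu$-uniformized; $\mu$ is \emph{$\Sigma_{n+2}^{\lambda+2}$-Reinhardt} if it is pre-Reinhardt and every $R\subseteq V_{\lambda+1}\times V_{\lambda+2}$ that is $\Pi_n$-definable over $V_{\lambda+2}$ from parameters can be $\mu$-uniformized. $\mathrm{Ult}(V_{\lambda+2},\mu)$ consists of the classes $[f]$ modulo $\mu$ of all functions $f:V_{\lambda+1}\to V_{\lambda+2}$, with the membership relation induced by $\mu$; its ultrapower map is $x\mapsto[c_x]$, with $c_x$ the constant function. If $\mathrm{Ult}(V_{\lambda+2},\mu)$ is wellfounded and extensional it is identified with its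 transitive collapse. For $j:V_{\lambda+2}\to V_{\lambda+2}$ put $\mu_j=\{\sigma\subseteq V_{\lambda+1}: j``V_\lambda\in j(\sigma)\}$. Let $(a)_x=\{y:\lceil x,y\rceil\in a\}$ and $(a\mid b)=\{(a)_x:x\in b\}$. For $k\in\mathscr E(V_\lambda)$ and $X\in V_{\lambda+1}$ let $k^+(X)=\bigcup\{(k(a)\mid k(b)): a,b\in V_\lambda,\ (a\mid b)\subseteq X\}$. For $x\in V_{\lambda+2}$ let $f_x:V_{\lambda+1}\to V_{\lambda+2}$ be given by $f_x(A)=\{y\in V_{\lambda+1}:k^+(y)\in x\}$ if $A=k``V_\lambda$ with $k\in\mathscr E(V_\lambda)$ (such a $k$ is unique), and $f_x(A)=\emptyset$ otherwise. For $f:V_{\lambda+1}\to V_{\lambda+2}$ and $s\in V_{\lambda+1}$ write $j(f)(s)=(j(\widetilde f))_s$, where $\widetilde f=\{\lceil a,y\rceil: a\in V_{\lambda+1},\ y\in f(a)\}$. \textbf{Theorem.} Let $\lambda$ be even and $n<\omega$. 1. If $j\in\mathscr E_{n+1}(V_{\lambda+2})$, then $\mu_j$ is a $\Sigma_{n+1}^{\lambda+2}$-Reinhardt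 ultrafilter, $\mathrm{Ult}(V_{\lambda+2},\mu_j)$ is wellfounded and extensional with transitive collapse $V_{\lambda+2}$, and $j$ is the ultrapower map of $\mathrm{Ult}(V_{\lambda+2},\mu_j)$. 2. Let $\mu$ be a $\Sigma_{n+1}^{\lambda+2}$-Reinhardt ultrafilter, $U=\mathrm{Ult}(V_{\lambda+2},\mu)$, and let $j:V_{\lambda+2}\to U$ be the ultrapower map. Then (a) $U$ is extensional and wellfounded, $U=V_{\lambda+2}$, $\mu=\mu_j$, $[\mathrm{id}]=j``V_\lambda$, and, if $\lambda$ is infinite, $x=[f_x]=j(f_x)(j``V_\lambda)$ for each $x\in V_{\lambda+2}$; (b) $j\in\mathscr E_{n+1}(V_{\lambda+2})$. -/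

import Mathlib

universe u

/-! ## Models of ZF

The background theory is ZF, without the axiom of choice. A theorem of ZF is a statement that
holds in every model of ZF, so everything below is interpreted inside an arbitrary first-order
model `M` of ZF. All sets, functions, filters, natural numbers and (codes of) formulas that occur
are elements of `M`, and all quantifiers range over `M`. -/

/-- The only symbol of the language of set theory: the binary membership symbol. -/
inductive ZFSymbol : ℕ → Type
  | mem : ZFSymbol 2

/-- The first-order language of set theory. -/
def Lset : FirstOrder.Language.{0, 0} := ⟨fun _ => Empty, ZFSymbol⟩

instance setStructure (M : Type u) [Membership M M] : Lset.Structure M where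
  funMap := fun f _ => Empty.elim f
  RelMap := fun r v => match r with
    | ZFSymbol.mem => v 0 ∈ v 1

/-- `(M, ∈)` is a model of the Zermelo-Fraenkel axioms (no choice). The two schemata range over all
first-order formulas with parameters. -/
class ModelsZF (M : Type u) [Membership M M] : Prop where
  extensionality : ∀ x y : M, (∀ z : M, z ∈ x ↔ z ∈ y) → x = y
  foundation : ∀ x : M, (∃ y : M, y ∈ x) → ∃ y : M, y ∈ x ∧ ∀ z : M, z ∈ x → ¬ z ∈ y
  pairing : ∀ x y : M, ∃ p : M, ∀ z : M, z ∈ p ↔ (z = x ∨ z = y)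
  union : ∀ x : M, ∃ v : M, ∀ z : M, z ∈ v ↔ ∃ y : M, y ∈ x ∧ z ∈ y
  powerset : ∀ x : M, ∃ p : M, ∀ z : M, z ∈ p ↔ ∀ w : M, w ∈ z → w ∈ x
  infinity : ∃ I : M, (∃ e : M, e ∈ I ∧ ∀ z : M, ¬ z ∈ e) ∧
    ∀ x : M, x ∈ I → ∃ y : M, y ∈ I ∧ ∀ z : M, z ∈ y ↔ (z ∈ x ∨ z = x)
  separation : ∀ P : Set M, Set.Definable₁ (Set.univ : Set M) Lset P →
    ∀ a : M, ∃ b : M, ∀ z : M, z ∈ b ↔ (z ∈ a ∧ z ∈ P)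
  replacement : ∀ R : Set (M × M), Set.Definable₂ (Set.univ : Set M) Lset R →
    ∀ a : M, (∀ x : M, x ∈ a → ∀ y y' : M, (x, y) ∈ R → (x, y') ∈ R → y = y') →
      ∃ b : M, ∀ y : M, y ∈ b ↔ ∃ x : M, x ∈ a ∧ (x, y) ∈ R

noncomputable section

namespace ZFModel

variable {M : Type u} [Membership M M] [Nonempty M]

/-! ## Basic set theory inside the model -/

/-- The set `{x | P x}` of the model. It is only used for `P` for which ZF proves that this class
is a set. -/
def compr (P : M → Prop) : M := Classical.epsilon fun s : M => ∀ x : M, x ∈ s ↔ P x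

def Sub (a b : M) : Prop := ∀ z : M, z ∈ a → z ∈ b

def empty : M := compr fun _ => False

def succ (a : M) : M := compr fun x => x ∈ a ∨ x = a

def inter (a b : M) : M := compr fun x => x ∈ a ∧ x ∈ b

def diff (a b : M) : M := compr fun x => x ∈ a ∧ ¬ x ∈ b

def num : ℕ → M
  | 0 => empty
  | n + 1 => succ (num n)

def IsInductive (I : M) : Prop := empty ∈ I ∧ ∀ x : M, x ∈ I → succ x ∈ I

/-- The set `ω` of natural numbers of the model. -/
def omega : M := compr fun n => ∀ I : M, IsInductive I → n ∈ I

def IsTransitive (x : M) : Prop := ∀ y : M, y ∈ x → Sub y x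

def IsOrdinal (x : M) : Prop :=
  IsTransitive x ∧ ∀ y z : M, y ∈ x → z ∈ x → (y ∈ z ∨ y = z ∨ z ∈ y)

def IsLimit (x : M) : Prop := IsOrdinal x ∧ x ≠ empty ∧ ∀ y : M, y ∈ x → succ y ∈ x

/-! ## Quine-Rosser pairs and functions -/

open Classical in
/-- `s n = n + 1` for `n ∈ ω`, and `s u = u` otherwise. -/
def shift (x : M) : M := if x ∈ (omega : M) then succ x else x

def tagZero (x : M) : M := compr fun z => ∃ v : M, v ∈ x ∧ z = shift v

def tagOne (x : M) : M := compr fun z => z = empty ∨ ∃ v : M, v ∈ x ∧ z = shift v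

/-- The Quine-Rosser pair of `x` and `y`. All pairs, relations and functions are formed
with it. -/
def pair (x y : M) : M :=
  compr fun z => (∃ v : M, v ∈ x ∧ z = tagZero v) ∨ (∃ v : M, v ∈ y ∧ z = tagOne v)

/-- `f` is a function with domain `d`. -/
def IsFunOn (f d : M) : Prop :=
  (∀ z : M, z ∈ f → ∃ x y : M, x ∈ d ∧ z = pair x y) ∧
    ∀ x : M, x ∈ d → ∃! y : M, pair x y ∈ f

/-- The value `f(x)`. -/
def app (f x : M) : M := Classical.epsilon fun y : M => pair x y ∈ f

/-- `f` is a function from `a` to `b`. -/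
def IsFun (f a b : M) : Prop := IsFunOn f a ∧ ∀ x : M, x ∈ a → app f x ∈ b

/-- The pointwise image of `d` under `f`. -/
def image (f d : M) : M := compr fun y => ∃ x : M, x ∈ d ∧ y = app f x

/-- The function with domain `d` and values `F x`. -/
def lam (d : M) (F : M → M) : M := compr fun z => ∃ x : M, x ∈ d ∧ z = pair x (F x)

/-! ## The cumulative hierarchy and even ordinals -/

/-- `F` is the function `β ↦ V_β` on the ordinal `d`. -/
def IsCumulative (F d : M) : Prop :=
  IsFunOn F d ∧ ∀ β : M, β ∈ d → ∀ x : M, x ∈ app F β ↔ ∃ γ : M, γ ∈ β ∧ Sub x (app F γ)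

/-- The rank initial segment `V_α`, for an ordinal `α`. -/
def V (α : M) : M := compr fun x => ∃ F : M, IsCumulative F (succ α) ∧ x ∈ app F α

/-- `α = η + 2n` for some `n ∈ ω`, where `η` is `0` or a limit ordinal. -/
def IsEven (α : M) : Prop :=
  ∃ η f n : M, (η = empty ∨ IsLimit η) ∧ IsFunOn f omega ∧ app f empty = η ∧
    (∀ m : M, m ∈ (omega : M) → app f (succ m) = succ (succ (app f m))) ∧
    n ∈ (omega : M) ∧ α = app f n

/-! ## Formulas of the language of set theory, coded as sets

Variables are `v_i` for `i ∈ ω`. -/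

def fMem (i j : M) : M := pair (num 0) (pair i j)
def fEq (i j : M) : M := pair (num 1) (pair i j)
def fNot (φ : M) : M := pair (num 2) φ
def fAnd (φ ψ : M) : M := pair (num 3) (pair φ ψ)
def fEx (i φ : M) : M := pair (num 4) (pair i φ)

/-- The bounded quantification `∃ v_i ∈ v_j, φ` (used for `i ≠ j`). -/
def fBddEx (i j φ : M) : M := fEx i (fAnd (fMem i j) φ)

def ContainsAtomic (X : M) : Prop :=
  ∀ i j : M, i ∈ (omega : M) → j ∈ (omega : M) → fMem i j ∈ X ∧ fEq i j ∈ X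

def ClosedBoolean (X : M) : Prop :=
  (∀ φ : M, φ ∈ X → fNot φ ∈ X) ∧ ∀ φ ψ : M, φ ∈ X → ψ ∈ X → fAnd φ ψ ∈ X

/-- `φ` is a formula: it lies in the least set that contains the atomic formulas and is closed
under the connectives and quantification. -/
def IsFormula (φ : M) : Prop :=
  ∀ X : M, ContainsAtomic X → ClosedBoolean X →
    (∀ i ψ : M, i ∈ (omega : M) → ψ ∈ X → fEx i ψ ∈ X) → φ ∈ X

/-- `φ` is a `Σ_0` formula: all its quantifiers are bounded. -/
def IsSigmaZero (φ : M) : Prop :=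
  ∀ X : M, ContainsAtomic X → ClosedBoolean X →
    (∀ i j ψ : M, i ∈ (omega : M) → j ∈ (omega : M) → i ≠ j → ψ ∈ X → fBddEx i j ψ ∈ X) → φ ∈ X

/-- `φ` is a `Σ_n` formula, for `n ∈ ω`. The least set `X` as below consists of the pairs `(n, φ)`
where either `n = 0` and `φ` is `Σ_0`, or `n = m + 1` and `φ` is a block of existential quantifiers
followed by a `Π_m` formula, the `Π_0` formulas being the `Σ_0` formulas and the `Π_(m+1)` formulas
being the negations of the `Σ_(m+1)` formulas. -/
def IsSigma (n φ : M) : Prop :=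
  ∀ X : M,
    (∀ ψ : M, IsSigmaZero ψ → pair (num 0) ψ ∈ X ∧ pair (num 1) ψ ∈ X) →
    (∀ m ψ : M, m ∈ (omega : M) → pair (succ m) ψ ∈ X → pair (succ (succ m)) (fNot ψ) ∈ X) →
    (∀ m i ψ : M, m ∈ (omega : M) → i ∈ (omega : M) → pair (succ m) ψ ∈ X →
      pair (succ m) (fEx i ψ) ∈ X) →
    pair n φ ∈ X

/-- `φ` is a `Π_n` formula. -/
def IsPi (n φ : M) : Prop :=
  (n = empty ∧ IsSigmaZero φ) ∨ (n ≠ empty ∧ ∃ ψ : M, IsSigma n ψ ∧ φ = fNot ψ)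

/-! ## Satisfaction and elementarity -/

/-- `s` assigns an element of `A` to every variable. -/
def IsAssignment (A s : M) : Prop := IsFun s omega A

open Classical in
/-- The assignment `s` with the value at `v_i` changed to `a`. -/
def update (s i a : M) : M := lam omega fun m => if m = i then a else app s m

/-- `S` obeys Tarski's clauses for the structure `(A, ∈)`. -/
def IsSatRelation (A S : M) : Prop :=
  ∀ s : M, IsAssignment A s →
    (∀ i j : M, i ∈ (omega : M) → j ∈ (omega : M) →
      ((pair (fMem i j) s ∈ S ↔ app s i ∈ app s j) ∧
        (pair (fEq i j) s ∈ S ↔ app s i = app s j))) ∧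
    (∀ φ : M, IsFormula φ → (pair (fNot φ) s ∈ S ↔ ¬ pair φ s ∈ S)) ∧
    (∀ φ ψ : M, IsFormula φ → IsFormula ψ →
      (pair (fAnd φ ψ) s ∈ S ↔ pair φ s ∈ S ∧ pair ψ s ∈ S)) ∧
    (∀ i φ : M, i ∈ (omega : M) → IsFormula φ →
      (pair (fEx i φ) s ∈ S ↔ ∃ a : M, a ∈ A ∧ pair φ (update s i a) ∈ S))

/-- `(A, ∈) ⊨ φ[s]`. -/
def Sat (A φ s : M) : Prop := ∃ S : M, IsSatRelation A S ∧ pair φ s ∈ S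

/-- `j : A → B` preserves and reflects the truth of all formulas of the class `Γ`. -/
def IsElementaryFor (Γ : M → Prop) (A B j : M) : Prop :=
  IsFun j A B ∧ ∀ φ s : M, Γ φ → IsAssignment A s →
    (Sat A φ s ↔ Sat B φ (lam omega fun m => app j (app s m)))

/-- `j ∈ ℰ(A)`: `j : A → A` is fully elementary. -/
def IsElementarySelf (A j : M) : Prop := IsElementaryFor IsFormula A A j

/-- `j ∈ ℰ_n(A)`: `j : A → A` is `Σ_n`-elementary. -/
def IsSigmaElementarySelf (n A j : M) : Prop := IsElementaryFor (IsSigma n) A A j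

/-- `A ≼ B`. -/
def IsElementarySub (A B : M) : Prop :=
  Sub A B ∧ ∀ φ s : M, IsFormula φ → IsAssignment A s → (Sat A φ s ↔ Sat B φ s)

/-- `R ⊆ X × W` is `Π_n`-definable over `W` from (finitely many) parameters in `W`: they are the
values of `s` at the free variables other than `v_0`, `v_1` of the defining formula. -/
def IsPiDefinable (n W R : M) : Prop :=
  ∃ φ s : M, IsPi n φ ∧ IsAssignment W s ∧ ∀ k x : M, k ∈ W → x ∈ W →
    (pair k x ∈ R ↔ Sat W φ (update (update s (num 0) k) (num 1) x))

/-! ## Ultrafilters and ultrapowers -/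

/-- `μ` is an ultrafilter over `X`. -/
def IsUltrafilter (X μ : M) : Prop :=
  (∀ σ : M, σ ∈ μ → Sub σ X) ∧ X ∈ μ ∧ ¬ empty ∈ μ ∧
    (∀ σ τ : M, σ ∈ μ → τ ∈ μ → inter σ τ ∈ μ) ∧
    (∀ σ τ : M, σ ∈ μ → Sub σ τ → Sub τ X → τ ∈ μ) ∧
    ∀ σ : M, Sub σ X → σ ∈ μ ∨ diff X σ ∈ μ

/-- `P x` holds for `μ`-almost all `x ∈ X`. -/
def AlmostAll (X μ : M) (P : M → Prop) : Prop := compr (fun x => x ∈ X ∧ P x) ∈ μ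

/-- The class `[f]` of `f : X → W` modulo `μ`. -/
def ultClass (X W μ f : M) : M :=
  compr fun g => IsFun g X W ∧ AlmostAll X μ fun x => app f x = app g x

/-- The universe of `Ult(W, μ)`, formed with all functions `f : X → W`. -/
def ult (X W μ : M) : M := compr fun c => ∃ f : M, IsFun f X W ∧ c = ultClass X W μ f

/-- The membership relation of `Ult(W, μ)`. -/
def ultMem (X W μ c d : M) : Prop :=
  ∃ f g : M, IsFun f X W ∧ IsFun g X W ∧ c = ultClass X W μ f ∧ d = ultClass X W μ g ∧
    AlmostAll X μ fun x => app f x ∈ app g x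

def UltWellfounded (X W μ : M) : Prop :=
  ∀ S : M, Sub S (ult X W μ) → S ≠ empty →
    ∃ c : M, c ∈ S ∧ ∀ d : M, d ∈ S → ¬ ultMem X W μ d c

def UltExtensional (X W μ : M) : Prop :=
  ∀ c d : M, c ∈ ult X W μ → d ∈ ult X W μ → c ≠ d →
    ∃ e : M, e ∈ ult X W μ ∧ (ultMem X W μ e c ↔ ¬ ultMem X W μ e d)

/-- `π` is the Mostowski collapsing isomorphism of `Ult(W, μ)` onto the transitive set `N`. -/
def IsUltCollapse (X W μ π N : M) : Prop :=
  IsTransitive N ∧ IsFun π (ult X W μ) N ∧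
    (∀ y : M, y ∈ N → ∃ c : M, c ∈ ult X W μ ∧ app π c = y) ∧
    (∀ c d : M, c ∈ ult X W μ → d ∈ ult X W μ →
      ((app π c = app π d → c = d) ∧ (ultMem X W μ c d ↔ app π c ∈ app π d)))

/-- `j` is the ultrapower map `x ↦ [c_x]` of `Ult(W, μ)`, after the identification of `Ult(W, μ)`
with `N` by the collapse `π`. -/
def IsUltMap (X W μ π N j : M) : Prop :=
  IsFun j W N ∧ ∀ x : M, x ∈ W → app j x = app π (ultClass X W μ (lam X fun _ => x))

/-! ## Canonical extensions -/

/-- `(a)_x = {y : ⌜x, y⌝ ∈ a}`. -/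
def sect (a x : M) : M := compr fun y => pair x y ∈ a

/-- `(a ∣ b) = {(a)_x : x ∈ b}`. -/
def coded (a b : M) : M := compr fun z => ∃ x : M, x ∈ b ∧ z = sect a x

/-- `k⁺(X)`, for `k : V_δ → V_δ` and `X ∈ V_(δ+1)`: the union of all `(k(a) ∣ k(b))` with
`a, b ∈ V_δ` and `(a ∣ b) ⊆ X`. -/
def canonExt (δ k X : M) : M :=
  compr fun c => ∃ a b : M, a ∈ V δ ∧ b ∈ V δ ∧ Sub (coded a b) X ∧ c ∈ coded (app k a) (app k b)

/-! ## Reinhardt ultrafilters -/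

/-- The ultrafilter `μ_j` over `V_(δ+1)` derived from `j` with seed the range of `j ↾ V_δ`. -/
def derived (δ j : M) : M :=
  compr fun σ => Sub σ (V (succ δ)) ∧ image j (V δ) ∈ app j σ

/-- The transitive collapse of `A` is the transitive set `N`. -/
def HasTransitiveCollapse (A N : M) : Prop :=
  ∃ π : M, IsFun π A N ∧ (∀ y : M, y ∈ N → ∃ x : M, x ∈ A ∧ app π x = y) ∧
    ∀ x y : M, x ∈ A → y ∈ A →
      ((app π x = app π y → x = y) ∧ (x ∈ y ↔ app π x ∈ app π y))

def IsRankJonsson (δ μ : M) : Prop :=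
  (compr fun A => IsElementarySub A (V δ) ∧ HasTransitiveCollapse A (V δ)) ∈ μ

def IsFine (δ μ : M) : Prop :=
  ∀ x : M, x ∈ V δ → (compr fun A => x ∈ A ∧ Sub A (V δ)) ∈ μ

/-- Closure under the diagonal intersections of all sequences `σ : V_δ → μ`. -/
def IsNormal (δ μ : M) : Prop :=
  ∀ σ : M, IsFun σ (V δ) μ →
    (compr fun A => Sub A (V δ) ∧ ∀ x : M, x ∈ A → A ∈ app σ x) ∈ μ

def IsPreReinhardt (δ μ : M) : Prop :=
  IsUltrafilter (V (succ δ)) μ ∧ IsRankJonsson δ μ ∧ IsFine δ μ ∧ IsNormal δ μ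

def IsRelation (R A B : M) : Prop :=
  ∀ z : M, z ∈ R → ∃ x y : M, x ∈ A ∧ y ∈ B ∧ z = pair x y

/-- `R` can be `μ`-uniformized: some function `f` on `X` satisfies, for `μ`-almost all `k ∈ X`,
that `(k, f(k)) ∈ R` if there is any `x` with `(k, x) ∈ R`. -/
def HasUniformization (X μ R : M) : Prop :=
  ∃ f : M, IsFunOn f X ∧
    AlmostAll X μ fun k => (∃ x : M, pair k x ∈ R) → pair k (app f k) ∈ R

/-- `μ` is `Σ_(n+1)^(δ+2)`-Reinhardt, for `n ∈ ω`. -/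
def IsReinhardt (δ n μ : M) : Prop :=
  IsPreReinhardt δ μ ∧
    (n = empty → ∀ R : M, IsRelation R (V (succ δ)) (V (succ δ)) →
      HasUniformization (V (succ δ)) μ R) ∧
    ∀ m : M, m ∈ (omega : M) → n = succ m →
      ∀ R : M, IsRelation R (V (succ δ)) (V (succ (succ δ))) →
        IsPiDefinable m (V (succ (succ δ))) R → HasUniformization (V (succ δ)) μ R

/-- `f_x : V_(δ+1) → V_(δ+2)`. An embedding `k ∈ ℰ(V_δ)` is identified with its range `A`, and
`f_x(A)` is the preimage of `x` under `k⁺`; `f_x(A)` is empty if `A` is not such a range. -/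
def seedFun (δ x : M) : M :=
  lam (V (succ δ)) fun A => compr fun y => y ∈ V (succ δ) ∧
    ∃ k : M, IsElementarySelf (V δ) k ∧ image k (V δ) = A ∧ canonExt δ k y ∈ x

/-- The code `{⌜a, y⌝ : a ∈ X, y ∈ f(a)}` of a function `f` with domain `X`. -/
def code (X f : M) : M := compr fun z => ∃ a y : M, a ∈ X ∧ y ∈ app f a ∧ z = pair a y

/-- `j(f)(s)` for a function `f` with domain `X`, where `j(f)` is the function whose code is the
image under `j` of the code of `f`. -/
def liftApp (j X f s : M) : M := sect (app j (code X f)) s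

end ZFModel

end

set_option linter.unusedSectionVars false
set_option linter.unusedVariables false

noncomputable section

namespace ZFModel

open FirstOrder

/-! ## Definable functions and classes -/

/-! Write `N` for `V_λ`, `X` for `P(N)` and `W` for `P(P(N))`. Finite `λ` is degenerate:
`Σ_0`-elementary maps fix hereditarily finite sets, so `j` is the identity and the only Reinhardt
ultrafilter is the principal one generated by `N`. For infinite `λ` the proof rests on canonical
representatives for the elements of the ultrapower, found without choice, and on Łoś's theorem.

Elements of `X`. For almost all `A` there is a unique isomorphism `k : N → A`. Put `pre N z A =
k⁻¹[z]` for `z ∈ X`. By normality and fineness every function into `X` agrees almost everywhere with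
exactly one of these (`IsRein.exists_eq_pre`, `IsRein.pre_inj`). So `[A ↦ pre N z A]` has to
collapse to `z`, and `[F]` to `val N μ F`, the set of those `z` with `pre N z A ∈ F A` for almost
all `A`. Extensionality requires picking a point of the symmetric difference of `F A` and `G A`;
there uniformization of relations on `X` enters (`IsRein.val_inj`). Normality and fineness also give
`[id] = j``N` (`IsRein.val_id`), hence `μ = μ_j`.

Elements of `W`. The function `f_x(A) = {y : k⁺(y) ∈ x}` represents `x` once `k⁺(k⁻¹[z]) = z` for
almost all `A` (`IsRein.cext_pre`). This needs every element of `N` to lie in some `(k(a) ∣ k(b))`,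
the property `Covers`. At limits it holds because ranks do not drop. It passes from `N` to `W`
because an elementary `k : W → W` is the ultrapower map of its own derived ultrafilter, so that each
`c ∈ W` is the section at `k``N` of the image of the code of `f_c` (`Covers.pow`). This is an
induction along the even ordinals.

Truth. In Łoś's theorem for `Σ_(k+1)` formulas, witnesses pass from the ultrapower to the factors
through the functions `f_x` (`IsSigma.los_factors`), and from the factors to the ultrapower through
uniformization of a `Π_k` relation (`IsSigma.los_ultrapower`). A `Σ_(n+1)^(λ+2)`-Reinhardt
ultrafilter thus satisfies Łoś's theorem for `Σ_n`, and its map is `Σ_(n+1)`-elementary, since the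
last level uses only the first of these directions. Conversely, let `j` be `Σ_(k+2)`-elementary and
`R` a `Π_k` relation. If almost every `A` has a partner under `R`, then so has `j``N`, and `f_x` for
such a partner `x` uniformizes `R` (`unif_der`).

Two technical layers support this. Since `M` is an arbitrary model, each instance of comprehension
needs a first-order definition; `Def` and `DefF` automate this, and `D0` does the same for `Σ_0`
relations. Since formulas are elements of `M`, their blocks of quantifiers need not be finite in the
metatheory. Quine–Rosser pairs do not raise ranks at these levels, so a whole assignment into `W` is
coded by one element of `W`, and formulas are translated to speak about the coded assignment. -/

/-- Types of tuples, with a notion of a definable family indexed by finite tuples. -/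
class Ctx (M : Type u) [Membership M M] (α : Type u) where
  IsDef : ∀ {ι : Type} [Finite ι], ((ι → M) → α) → Prop
  const : ∀ {ι : Type} [Finite ι] (a : α), IsDef (fun _ : ι → M => a)
  comp : ∀ {ι κ : Type} [Finite ι] [Finite κ] (c : (ι → M) → α) (e : ι → κ),
    IsDef c → IsDef fun w : κ → M => c (w ∘ e)

variable {M : Type u} [Membership M M]

theorem definable_mem {ι : Type} [Finite ι] (i j : ι) :
    (Set.univ : Set M).Definable Lset {w : ι → M | w i ∈ w j} := by
  let r : Lset.Relations 2 := ZFSymbol.mem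
  refine Set.Definable.mono (A := ∅) ?_ (Set.empty_subset _)
  rw [Set.empty_definable_iff]
  refine ⟨r.formula₂ (FirstOrder.Language.Term.var i) (FirstOrder.Language.Term.var j), ?_⟩
  ext w
  simp [FirstOrder.Language.Formula.realize_rel₂]
  rfl

instance : Ctx M M where
  IsDef c := (Set.univ : Set M).DefinableFun Lset c
  const a := Lset.definableFun_const _ (Set.mem_univ a)
  comp c e h := Set.DefinableFun.comp (g := fun w => w ∘ e) (fun i => by
    exact Set.DefinableFun.proj Lset) h

instance {α β : Type u} [Ctx M α] [Ctx M β] : Ctx M (α × β) where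
  IsDef c := Ctx.IsDef (M := M) (fun v => (c v).1) ∧ Ctx.IsDef (M := M) (fun v => (c v).2)
  const _ := ⟨Ctx.const _, Ctx.const _⟩
  comp _ e h := ⟨Ctx.comp _ e h.1, Ctx.comp _ e h.2⟩

/-- Definable functions between types of tuples. -/
@[fun_prop]
def DefF (M : Type u) [Membership M M] {α β : Type u} [Ctx M α] [Ctx M β] (f : α → β) : Prop :=
  ∀ {ι : Type} [Finite ι] (c : (ι → M) → α), Ctx.IsDef (M := M) c → Ctx.IsDef (M := M) (f ∘ c)

/-- Definable classes of tuples. -/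
@[fun_prop]
def Def (M : Type u) [Membership M M] {α : Type u} [Ctx M α] (P : α → Prop) : Prop :=
  ∀ {ι : Type} [Finite ι] (c : (ι → M) → α), Ctx.IsDef (M := M) c →
    (Set.univ : Set M).Definable Lset {v | P (c v)}

section closure

variable {α β γ : Type u} [Ctx M α] [Ctx M β] [Ctx M γ]

@[fun_prop] theorem DefF.id : DefF M fun x : α => x := fun _ h => h

@[fun_prop] theorem DefF.const (b : β) : DefF M fun _ : α => b := fun _ _ => Ctx.const b

@[fun_prop] theorem DefF.comp {f : β → γ} {g : α → β} (hf : DefF M f) (hg : DefF M g) :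
    DefF M fun x => f (g x) := fun c h => hf _ (hg c h)

@[fun_prop] theorem DefF.fst {f : α → β × γ} (hf : DefF M f) : DefF M fun x => (f x).1 :=
  fun c h => (hf c h).1

@[fun_prop] theorem DefF.snd {f : α → β × γ} (hf : DefF M f) : DefF M fun x => (f x).2 :=
  fun c h => (hf c h).2

@[fun_prop] theorem DefF.prodMk {f : α → β} {g : α → γ} (hf : DefF M f) (hg : DefF M g) :
    DefF M fun x => (f x, g x) := fun c h => ⟨hf c h, hg c h⟩

@[fun_prop] theorem Def.const (p : Prop) : Def M fun _ : α => p := fun c _ => by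
  by_cases hp : p
  · simp [hp]
  · simp [hp]

@[fun_prop] theorem Def.comp {P : β → Prop} {g : α → β} (hP : Def M P) (hg : DefF M g) :
    Def M fun x => P (g x) := fun c h => hP _ (hg c h)

@[fun_prop] theorem Def.not {P : α → Prop} (hP : Def M P) : Def M fun x => ¬ P x :=
  fun c h => (hP c h).compl

@[fun_prop] theorem Def.and {P Q : α → Prop} (hP : Def M P) (hQ : Def M Q) :
    Def M fun x => P x ∧ Q x := fun c h => (hP c h).inter (hQ c h)

@[fun_prop] theorem Def.or {P Q : α → Prop} (hP : Def M P) (hQ : Def M Q) :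
    Def M fun x => P x ∨ Q x := fun c h => (hP c h).union (hQ c h)

@[fun_prop] theorem Def.imp {P Q : α → Prop} (hP : Def M P) (hQ : Def M Q) :
    Def M fun x => P x → Q x := by
  simp only [imp_iff_not_or]; fun_prop

@[fun_prop] theorem Def.iff {P Q : α → Prop} (hP : Def M P) (hQ : Def M Q) :
    Def M fun x => P x ↔ Q x := by
  simp only [iff_def, imp_iff_not_or]; fun_prop

@[fun_prop] theorem Def.eq {f g : α → M} (hf : DefF M f) (hg : DefF M g) :
    Def M fun x => f x = g x := fun c h =>
  Set.DefinableFun.ofPred_eq (hf c h) (hg c h)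

@[fun_prop] theorem Def.mem {f g : α → M} (hf : DefF M f) (hg : DefF M g) :
    Def M fun x => f x ∈ g x := fun c h => by
  have hF : (Set.univ : Set M).DefinableMap Lset (fun v => ![f (c v), g (c v)]) := by
    intro i
    fin_cases i
    · exact hf c h
    · exact hg c h
  exact (definable_mem (0 : Fin 2) 1).preimage_map hF

@[fun_prop] theorem Def.ex {P : α → M → Prop} (hP : Def M fun p : α × M => P p.1 p.2) :
    Def M fun x => ∃ y, P x y := fun {ι} _ c h => by
  -- The bound variable becomes one more index; restriction along `Sum.inl` projects it away.
  have h1 := hP (fun w : ι ⊕ Fin 1 → M => (c (w ∘ Sum.inl), w (Sum.inr 0)))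
    ⟨Ctx.comp c Sum.inl h, Set.DefinableFun.proj Lset⟩
  refine (congrArg _ ?_).mp (h1.image_comp (Sum.inl : ι → ι ⊕ Fin 1))
  ext v
  constructor
  · rintro ⟨w, hw, rfl⟩
    exact ⟨_, hw⟩
  · rintro ⟨y, hy⟩
    exact ⟨Sum.elim v fun _ => y, hy, rfl⟩

@[fun_prop] theorem Def.all {P : α → M → Prop} (hP : Def M fun p : α × M => P p.1 p.2) :
    Def M fun x => ∀ y, P x y := by
  have : (fun x => ∀ y, P x y) = fun x => ¬ ∃ y, ¬ P x y := by simp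
  rw [this]; fun_prop

/-- Operations introduced by `epsilon` or by cases have no term in the language; a first-order
description of the graph is enough to make them definable. -/
theorem DefF.of_graph {F : α → M} (h : Def M fun p : α × M => p.2 = F p.1) : DefF M F :=
  fun {ι} _ c hc => by
    have h1 := h (fun w : Option ι → M => (c (w ∘ some), w none))
      ⟨Ctx.comp c some hc, Set.DefinableFun.proj Lset⟩
    change (Set.univ : Set M).Definable Lset (Function.tupleGraph _)
    refine (congrArg _ ?_).mp h1
    ext w
    simp [Function.tupleGraph, eq_comm]

end closure

end ZFModel

end

noncomputable section
namespace ZFModel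
variable {M : Type u} [Membership M M] [Nonempty M]

/-! ## Comprehension -/

section compr
variable {α : Type u} [Ctx M α]

theorem mem_compr {P : M → Prop} (h : ∃ s : M, ∀ x, x ∈ s ↔ P x) (x : M) :
    x ∈ compr P ↔ P x :=
  Classical.epsilon_spec (p := fun s : M => ∀ x : M, x ∈ s ↔ P x) h x

variable [ModelsZF M]

theorem ext_iff' {a b : M} : a = b ↔ ∀ z : M, z ∈ a ↔ z ∈ b :=
  ⟨by rintro rfl; simp, ModelsZF.extensionality a b⟩

theorem ext' {a b : M} (h : ∀ z : M, z ∈ a ↔ z ∈ b) : a = b := ModelsZF.extensionality a b h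

/-- The default value is one fixed element of `M`, which a definition may use as a parameter. This
keeps partially defined operations definable everywhere. -/
theorem epsilon_eq_of_not_ex {p q : M → Prop} (hp : ¬ ∃ x, p x) (hq : ¬ ∃ x, q x) :
    Classical.epsilon p = Classical.epsilon q := by
  have : p = q := by
    funext x
    exact propext ⟨fun h => (hp ⟨x, h⟩).elim, fun h => (hq ⟨x, h⟩).elim⟩
  rw [this]

theorem eq_compr_iff {P : M → Prop} {y : M} : y = compr P ↔
    (∀ z, z ∈ y ↔ P z) ∨ ((¬ ∃ s : M, ∀ z, z ∈ s ↔ P z) ∧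
      y = Classical.epsilon fun _ : M => False) := by
  by_cases h : ∃ s : M, ∀ z, z ∈ s ↔ P z
  · simp only [h, not_true_eq_false, false_and, or_false]
    constructor
    · rintro rfl; exact mem_compr h
    · intro h'; exact ext' fun z => (h' z).trans (mem_compr h z).symm
  · have h2 : ¬ ∀ z, z ∈ y ↔ P z := fun h' => h ⟨y, h'⟩
    simp only [h, h2, false_or, not_false_eq_true, true_and]
    rw [compr, epsilon_eq_of_not_ex h (q := fun _ : M => False) (by simp)]

-- It need not be known that the class is a set, because `eq_compr_iff` describes the default value
-- too. Definability and existence can thus be treated separately.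
@[fun_prop] theorem DefF.compr {P : α → M → Prop} (hP : Def M fun p : α × M => P p.1 p.2) :
    DefF M fun x => compr fun z => P x z := by
  apply DefF.of_graph
  simp only [eq_compr_iff]
  fun_prop

/-- Comprehension below a set. -/
theorem mem_compr_of_sub {P : M → Prop} (a : M) (h : ∀ x, P x → x ∈ a)
    (hP : Def M P := by fun_prop (disch := assumption)) (x : M) : x ∈ compr P ↔ P x := by
  apply mem_compr
  have h1 : Set.Definable₁ (Set.univ : Set M) Lset {x | P x} :=
    hP (fun v : Fin 1 → M => v 0) (Set.DefinableFun.proj Lset)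
  obtain ⟨b, hb⟩ := ModelsZF.separation _ h1 a
  exact ⟨b, fun z => (hb z).trans ⟨fun h => h.2, fun h' => ⟨h z h', h'⟩⟩⟩

theorem mem_sep {P : M → Prop} {a : M} (hP : Def M P := by fun_prop (disch := assumption)) {x : M} :
    x ∈ compr (fun x : M => x ∈ a ∧ P x) ↔ x ∈ a ∧ P x :=
  mem_compr_of_sub a (fun _ h => h.1) (by fun_prop) x

theorem mem_replace {F : M → M} {a : M} (hF : DefF M F := by fun_prop (disch := assumption)) {y : M} :
    y ∈ compr (fun y : M => ∃ x : M, x ∈ a ∧ y = F x) ↔ ∃ x : M, x ∈ a ∧ y = F x := by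
  apply mem_compr
  have h1 : Set.Definable₂ (Set.univ : Set M) Lset {p : M × M | p.2 = F p.1} := by
    have h2 : Def M fun p : M × M => p.2 = F p.1 := by fun_prop
    exact h2 (fun v : Fin 2 → M => (v 0, v 1))
      ⟨Set.DefinableFun.proj Lset, Set.DefinableFun.proj Lset⟩
  obtain ⟨b, hb⟩ := ModelsZF.replacement _ h1 a
    (fun x _ y y' h h' => (show y = F x from h).trans (show y' = F x from h').symm)
  exact ⟨b, hb⟩

/-- Foundation for definable classes of elements of a set. -/
theorem exists_minimal {P : M → Prop} {a x : M} (hx : x ∈ a) (hPx : P x)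
    (hP : Def M P := by fun_prop (disch := assumption)) : ∃ y : M, y ∈ a ∧ P y ∧ ∀ z : M, z ∈ y → z ∈ a → ¬ P z := by
  obtain ⟨y, hy, hm⟩ := ModelsZF.foundation (compr fun x : M => x ∈ a ∧ P x)
    ⟨x, (mem_sep).2 ⟨hx, hPx⟩⟩
  rw [mem_sep] at hy
  exact ⟨y, hy.1, hy.2, fun z hz hza hPz => hm z ((mem_sep).2 ⟨hza, hPz⟩) hz⟩

theorem mem_irrefl (x : M) : ¬ x ∈ x := by
  obtain ⟨p, hp⟩ := ModelsZF.pairing x x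
  obtain ⟨y, hy, hm⟩ := ModelsZF.foundation p ⟨x, (hp x).2 (Or.inl rfl)⟩
  have : y = x := by simpa using (hp y).1 hy
  subst this
  exact fun h => hm y hy h

theorem mem_asymm {x y : M} (h : x ∈ y) : ¬ y ∈ x := by
  obtain ⟨p, hp⟩ := ModelsZF.pairing x y
  obtain ⟨z, hz, hm⟩ := ModelsZF.foundation p ⟨x, (hp x).2 (Or.inl rfl)⟩
  rcases (hp z).1 hz with rfl | rfl
  · exact fun h' => hm y ((hp y).2 (Or.inr rfl)) h'
  · exact fun _ => hm x ((hp x).2 (Or.inl rfl)) h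

end compr

/-! ## Elementary operations -/

section basic
variable {α : Type u} [Ctx M α] [ModelsZF M]

@[fun_prop] theorem Def.sub {f g : α → M} (hf : DefF M f) (hg : DefF M g) :
    Def M fun x => Sub (f x) (g x) := by unfold Sub; fun_prop
@[fun_prop] theorem DefF.succ {f : α → M} (hf : DefF M f) : DefF M fun x => succ (f x) := by
  unfold ZFModel.succ; fun_prop
@[fun_prop] theorem DefF.inter {f g : α → M} (hf : DefF M f) (hg : DefF M g) :
    DefF M fun x => inter (f x) (g x) := by unfold ZFModel.inter; fun_prop
@[fun_prop] theorem Def.isInductive {f : α → M} (hf : DefF M f) :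
    Def M fun x => IsInductive (f x) := by unfold IsInductive; fun_prop
@[fun_prop] theorem Def.isTransitive {f : α → M} (hf : DefF M f) :
    Def M fun x => IsTransitive (f x) := by unfold IsTransitive; fun_prop
@[fun_prop] theorem Def.isOrdinal {f : α → M} (hf : DefF M f) :
    Def M fun x => IsOrdinal (f x) := by unfold IsOrdinal; fun_prop

/-- The power set. -/
def pow (a : M) : M := compr fun x => Sub x a
/-- The union of the elements of a set. -/
def sUnion (a : M) : M := compr fun x => ∃ y : M, y ∈ a ∧ x ∈ y
def union (a b : M) : M := compr fun x => x ∈ a ∨ x ∈ b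
/-- The unordered pair. -/
def dbl (a b : M) : M := compr fun x => x = a ∨ x = b

@[fun_prop] theorem DefF.pow {f : α → M} (hf : DefF M f) : DefF M fun x => pow (f x) := by
  unfold ZFModel.pow; fun_prop
@[fun_prop] theorem DefF.sUnion {f : α → M} (hf : DefF M f) : DefF M fun x => sUnion (f x) := by
  unfold ZFModel.sUnion; fun_prop
@[fun_prop] theorem DefF.union {f g : α → M} (hf : DefF M f) (hg : DefF M g) :
    DefF M fun x => union (f x) (g x) := by unfold ZFModel.union; fun_prop
@[fun_prop] theorem DefF.dbl {f g : α → M} (hf : DefF M f) (hg : DefF M g) :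
    DefF M fun x => dbl (f x) (g x) := by unfold ZFModel.dbl; fun_prop

theorem Sub.refl (a : M) : Sub a a := fun _ h => h
theorem Sub.trans {a b c : M} (h : Sub a b) (h' : Sub b c) : Sub a c := fun z hz => h' z (h z hz)
theorem Sub.antisymm {a b : M} (h : Sub a b) (h' : Sub b a) : a = b :=
  ext' fun z => ⟨h z, h' z⟩

@[simp] theorem mem_pow {a x : M} : x ∈ pow a ↔ Sub x a :=
  mem_compr (by obtain ⟨p, hp⟩ := ModelsZF.powerset a; exact ⟨p, hp⟩) x
@[simp] theorem mem_sUnion {a x : M} : x ∈ sUnion a ↔ ∃ y : M, y ∈ a ∧ x ∈ y :=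
  mem_compr (ModelsZF.union a) x
@[simp] theorem mem_dbl {a b x : M} : x ∈ dbl a b ↔ x = a ∨ x = b :=
  mem_compr (ModelsZF.pairing a b) x
@[simp] theorem mem_union {a b x : M} : x ∈ union a b ↔ x ∈ a ∨ x ∈ b :=
  mem_compr ⟨sUnion (dbl a b), fun z => by simp⟩ x
@[simp] theorem mem_inter {a b x : M} : x ∈ inter a b ↔ x ∈ a ∧ x ∈ b := mem_sep
@[simp] theorem mem_diff {a b x : M} : x ∈ diff a b ↔ x ∈ a ∧ ¬ x ∈ b := mem_sep
@[simp] theorem mem_succ {a x : M} : x ∈ succ a ↔ x ∈ a ∨ x = a :=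
  mem_compr ⟨union a (dbl a a), fun z => by simp⟩ x
@[simp] theorem not_mem_empty {x : M} : ¬ x ∈ (empty : M) := by
  have a : M := Classical.arbitrary M
  have := mem_compr_of_sub (P := fun _ : M => False) a (by simp) (by fun_prop) x
  exact fun h => this.1 h

theorem eq_empty_iff {a : M} : a = empty ↔ ∀ x : M, ¬ x ∈ a := by
  rw [ext_iff']; simp
theorem ne_empty_iff {a : M} : a ≠ empty ↔ ∃ x : M, x ∈ a := by
  rw [Ne, eq_empty_iff]; simp
theorem empty_sub (a : M) : Sub empty a := fun z hz => (not_mem_empty hz).elim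

theorem succ_ne_empty (a : M) : succ a ≠ empty := ne_empty_iff.2 ⟨a, by simp⟩
theorem mem_succ_self (a : M) : a ∈ succ a := by simp

theorem succ_inj {a b : M} (h : succ a = succ b) : a = b := by
  have h1 : a ∈ succ b := h ▸ mem_succ_self a
  have h2 : b ∈ succ a := h.symm ▸ mem_succ_self b
  rw [mem_succ] at h1 h2
  rcases h1 with h1 | h1
  · rcases h2 with h2 | h2
    · exact (mem_asymm h1 h2).elim
    · exact h2.symm
  · exact h1

/-! ## The natural numbers of the model -/

theorem exists_inductive : ∃ I : M, IsInductive I := by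
  obtain ⟨I, ⟨e, heI, he⟩, hs⟩ := ModelsZF.infinity (M := M)
  have : e = empty := eq_empty_iff.2 he
  subst this
  refine ⟨I, heI, fun x hx => ?_⟩
  obtain ⟨y, hy, hys⟩ := hs x hx
  have : y = succ x := ext' fun z => by rw [hys, mem_succ]
  exact this ▸ hy

theorem mem_omega {n : M} : n ∈ (omega : M) ↔ ∀ I : M, IsInductive I → n ∈ I := by
  obtain ⟨I, hI⟩ := exists_inductive (M := M)
  exact mem_compr_of_sub I (fun x h => h I hI) (by fun_prop) n

theorem empty_mem_omega : (empty : M) ∈ (omega : M) := mem_omega.2 fun _ h => h.1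
theorem succ_mem_omega {n : M} (h : n ∈ (omega : M)) : succ n ∈ (omega : M) :=
  mem_omega.2 fun I hI => hI.2 n (mem_omega.1 h I hI)
theorem num_mem_omega (n : ℕ) : (num n : M) ∈ (omega : M) := by
  induction n with
  | zero => exact empty_mem_omega
  | succ n ih => exact succ_mem_omega ih

theorem omega_sub {I : M} (h : IsInductive I) : Sub omega I := fun _ hn => mem_omega.1 hn I h

theorem omega_induction {P : M → Prop} (h0 : P empty)
    (hs : ∀ n : M, n ∈ (omega : M) → P n → P (succ n)) {n : M} (hn : n ∈ (omega : M))
    (hP : Def M P := by fun_prop (disch := assumption)) : P n := by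
  have h : IsInductive (compr fun n : M => n ∈ (omega : M) ∧ P n) :=
    ⟨(mem_sep).2 ⟨empty_mem_omega, h0⟩, fun x hx => by
      rw [mem_sep] at hx ⊢
      exact ⟨succ_mem_omega hx.1, hs x hx.1 hx.2⟩⟩
  exact ((mem_sep).1 (omega_sub h n hn)).2

theorem omega_cases {n : M} (hn : n ∈ (omega : M)) :
    n = empty ∨ ∃ m : M, m ∈ (omega : M) ∧ n = succ m :=
  omega_induction (P := fun n : M => n = empty ∨ ∃ m : M, m ∈ (omega : M) ∧ n = succ m)
    (Or.inl rfl) (fun n hn _ => Or.inr ⟨n, hn, rfl⟩) hn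

theorem omega_transitive : IsTransitive (omega : M) := fun n hn =>
  omega_induction (P := fun n : M => Sub n omega) (empty_sub _)
    (fun n hn ih z hz => by
      rcases mem_succ.1 hz with h | rfl
      · exact ih z h
      · exact hn) hn

theorem num_injective : Function.Injective (num : ℕ → M) := by
  intro m
  induction m with
  | zero =>
    intro n h
    cases n with
    | zero => rfl
    | succ n => exact (succ_ne_empty _ h.symm).elim
  | succ m ih =>
    intro n h
    cases n with
    | zero => exact (succ_ne_empty _ h).elim
    | succ n => rw [ih (succ_inj h)]

theorem num_ne {m n : ℕ} (h : m ≠ n) : (num m : M) ≠ num n := fun h' => h (num_injective h')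

theorem mem_trans_omega {a b c : M} (hc : c ∈ (omega : M)) : a ∈ b → b ∈ c → a ∈ c := by
  refine omega_induction (P := fun c : M => a ∈ b → b ∈ c → a ∈ c) (by simp) ?_ hc
  intro n _ ih hab hb
  rcases mem_succ.1 hb with h | rfl
  · exact mem_succ.2 (Or.inl (ih hab h))
  · exact mem_succ.2 (Or.inl hab)

/-! ## Quine-Rosser pairs -/

theorem shift_of_mem {x : M} (h : x ∈ (omega : M)) : shift x = succ x := if_pos h
theorem shift_of_not_mem {x : M} (h : ¬ x ∈ (omega : M)) : shift x = x := if_neg h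

theorem eq_shift_iff {x y : M} : y = shift x ↔
    (x ∈ (omega : M) ∧ y = succ x) ∨ (¬ x ∈ (omega : M) ∧ y = x) := by
  by_cases h : x ∈ (omega : M)
  · simp [shift_of_mem, h]
  · simp [shift_of_not_mem, h]

@[fun_prop] theorem DefF.shift {f : α → M} (hf : DefF M f) : DefF M fun x => shift (f x) := by
  have : DefF M (ZFModel.shift : M → M) := by
    apply DefF.of_graph
    simp only [eq_shift_iff]; fun_prop
  fun_prop
@[fun_prop] theorem DefF.tagZero {f : α → M} (hf : DefF M f) : DefF M fun x => tagZero (f x) := by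
  unfold ZFModel.tagZero; fun_prop
@[fun_prop] theorem DefF.tagOne {f : α → M} (hf : DefF M f) : DefF M fun x => tagOne (f x) := by
  unfold ZFModel.tagOne; fun_prop
@[fun_prop] theorem DefF.pair {f g : α → M} (hf : DefF M f) (hg : DefF M g) :
    DefF M fun x => pair (f x) (g x) := by unfold ZFModel.pair; fun_prop

theorem shift_ne_empty (x : M) : shift x ≠ empty := by
  by_cases h : x ∈ (omega : M)
  · rw [shift_of_mem h]; exact succ_ne_empty x
  · rw [shift_of_not_mem h]; rintro rfl; exact h empty_mem_omega

theorem shift_inj {x y : M} (h : shift x = shift y) : x = y := by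
  by_cases hx : x ∈ (omega : M) <;> by_cases hy : y ∈ (omega : M)
  · rw [shift_of_mem hx, shift_of_mem hy] at h; exact succ_inj h
  · rw [shift_of_mem hx, shift_of_not_mem hy] at h; exact (hy (h ▸ succ_mem_omega hx)).elim
  · rw [shift_of_not_mem hx, shift_of_mem hy] at h; exact (hx (h ▸ succ_mem_omega hy)).elim
  · rwa [shift_of_not_mem hx, shift_of_not_mem hy] at h

theorem mem_tagZero {x z : M} : z ∈ tagZero x ↔ ∃ v : M, v ∈ x ∧ z = shift v := mem_replace

theorem mem_tagOne {x z : M} : z ∈ tagOne x ↔ z = empty ∨ ∃ v : M, v ∈ x ∧ z = shift v :=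
  mem_compr ⟨union (dbl empty empty) (tagZero x), fun z => by simp [mem_tagZero]⟩ z

theorem shift_mem_tagZero {v x : M} : shift v ∈ tagZero x ↔ v ∈ x := by
  rw [mem_tagZero]
  exact ⟨fun ⟨w, hw, h⟩ => shift_inj h ▸ hw, fun h => ⟨v, h, rfl⟩⟩

theorem shift_mem_tagOne {v x : M} : shift v ∈ tagOne x ↔ v ∈ x := by
  rw [mem_tagOne]
  exact ⟨fun h => h.elim (fun h => (shift_ne_empty v h).elim) fun ⟨w, hw, h⟩ => shift_inj h ▸ hw,
    fun h => Or.inr ⟨v, h, rfl⟩⟩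

theorem tagZero_inj {x y : M} (h : tagZero x = tagZero y) : x = y :=
  ext' fun z => by rw [← shift_mem_tagZero, h, shift_mem_tagZero]

theorem tagOne_inj {x y : M} (h : tagOne x = tagOne y) : x = y :=
  ext' fun z => by rw [← shift_mem_tagOne, h, shift_mem_tagOne]

/-- A shifted set is never empty, so the presence of `∅` tells the two kinds of tags apart. -/
theorem tagZero_ne_tagOne (x y : M) : tagZero x ≠ tagOne y := fun h => by
  have h1 : empty ∈ tagZero x := h ▸ mem_tagOne.2 (Or.inl rfl)
  obtain ⟨v, _, hv⟩ := mem_tagZero.1 h1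
  exact shift_ne_empty v hv.symm

theorem mem_pair {x y z : M} : z ∈ pair x y ↔
    (∃ v : M, v ∈ x ∧ z = tagZero v) ∨ (∃ v : M, v ∈ y ∧ z = tagOne v) := by
  refine mem_compr ⟨union (compr fun z : M => ∃ v : M, v ∈ x ∧ z = tagZero v)
    (compr fun z : M => ∃ v : M, v ∈ y ∧ z = tagOne v), fun z => ?_⟩ z
  rw [mem_union, mem_replace, mem_replace]

theorem tagZero_mem_pair {x y v : M} : tagZero v ∈ pair x y ↔ v ∈ x := by
  rw [mem_pair]
  constructor
  · rintro (⟨w, hw, h⟩ | ⟨w, hw, h⟩)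
    · exact tagZero_inj h ▸ hw
    · exact (tagZero_ne_tagOne _ _ h).elim
  · exact fun h => Or.inl ⟨v, h, rfl⟩

theorem tagOne_mem_pair {x y v : M} : tagOne v ∈ pair x y ↔ v ∈ y := by
  rw [mem_pair]
  constructor
  · rintro (⟨w, hw, h⟩ | ⟨w, hw, h⟩)
    · exact (tagZero_ne_tagOne _ _ h.symm).elim
    · exact tagOne_inj h ▸ hw
  · exact fun h => Or.inr ⟨v, h, rfl⟩

@[simp] theorem pair_inj {x y x' y' : M} : pair x y = pair x' y' ↔ x = x' ∧ y = y' := by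
  constructor
  · intro h
    exact ⟨ext' fun z => by rw [← tagZero_mem_pair (y := y), h, tagZero_mem_pair],
      ext' fun z => by rw [← tagOne_mem_pair (x := x), h, tagOne_mem_pair]⟩
  · rintro ⟨rfl, rfl⟩; rfl

end basic
end ZFModel

end

noncomputable section

namespace ZFModel

variable {M : Type u} [Membership M M] [Nonempty M] [ModelsZF M] {α : Type u} [Ctx M α]

/-! ## Functions -/

def Functional (f : M) : Prop := ∀ x y y' : M, pair x y ∈ f → pair x y' ∈ f → y = y'

open Classical in
/-- A definable version of `app`, which agrees with it on functions. -/
def ap (f x : M) : M :=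
  if h : ∃ y : M, pair x y ∈ f ∧ ∀ y' : M, pair x y' ∈ f → y' = y then h.choose
  else Classical.epsilon fun _ : M => False

theorem eq_ap_iff {f x y : M} : y = ap f x ↔
    (pair x y ∈ f ∧ ∀ y' : M, pair x y' ∈ f → y' = y) ∨
    ((¬ ∃ y : M, pair x y ∈ f ∧ ∀ y' : M, pair x y' ∈ f → y' = y) ∧
      y = Classical.epsilon fun _ : M => False) := by
  unfold ap
  split_ifs with h
  · constructor
    · rintro rfl; exact Or.inl h.choose_spec
    · rintro (h' | h')
      · exact h.choose_spec.2 y h'.1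
      · exact (h'.1 h).elim
  · constructor
    · rintro rfl; exact Or.inr ⟨h, rfl⟩
    · rintro (h' | h')
      · exact (h ⟨y, h'⟩).elim
      · exact h'.2

@[fun_prop] theorem DefF.ap {f g : α → M} (hf : DefF M f) (hg : DefF M g) :
    DefF M fun x => ap (f x) (g x) := by
  apply DefF.of_graph
  simp only [eq_ap_iff]; fun_prop

/-- `app` makes an arbitrary choice among several values, so it is not definable in a variable `f`.
On functional sets it agrees with `ap`, including the default value outside the domain. -/
theorem app_eq_ap {f : M} (hf : Functional f) (x : M) : app f x = ap f x := by
  rw [eq_ap_iff]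
  by_cases h : ∃ y : M, pair x y ∈ f
  · have : pair x (app f x) ∈ f := Classical.epsilon_spec h
    exact Or.inl ⟨this, fun y' h' => hf _ _ _ h' this⟩
  · refine Or.inr ⟨fun ⟨y, hy, _⟩ => h ⟨y, hy⟩, epsilon_eq_of_not_ex h (by simp)⟩

theorem IsFunOn.functional {f d : M} (hf : IsFunOn f d) : Functional f := by
  intro x y y' h h'
  obtain ⟨x', y'', hx', he⟩ := hf.1 _ h
  rw [pair_inj] at he
  obtain ⟨w, _, hw⟩ := hf.2 x (he.1 ▸ hx')
  rw [hw y h, hw y' h']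

theorem IsFun.functional {f a b : M} (hf : IsFun f a b) : Functional f := hf.1.functional

@[fun_prop] theorem DefF.app_of_functional {f : M} (hf : Functional f) {g : α → M}
    (hg : DefF M g) : DefF M fun x => app f (g x) := by
  simp only [app_eq_ap hf]; fun_prop

theorem app_eq {f x y : M} (hf : Functional f) (h : pair x y ∈ f) : app f x = y :=
  hf _ _ _ (Classical.epsilon_spec (p := fun y : M => pair x y ∈ f) ⟨y, h⟩) h

theorem IsFunOn.pair_app_mem {f d x : M} (hf : IsFunOn f d) (hx : x ∈ d) :
    pair x (app f x) ∈ f :=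
  Classical.epsilon_spec (p := fun y : M => pair x y ∈ f) (hf.2 x hx).exists

theorem IsFunOn.mem_iff {f d z : M} (hf : IsFunOn f d) :
    z ∈ f ↔ ∃ x : M, x ∈ d ∧ z = pair x (app f x) := by
  constructor
  · intro h
    obtain ⟨x, y, hx, rfl⟩ := hf.1 z h
    exact ⟨x, hx, by rw [app_eq hf.functional h]⟩
  · rintro ⟨x, hx, rfl⟩; exact hf.pair_app_mem hx

theorem IsFunOn.ext {f g d : M} (hf : IsFunOn f d) (hg : IsFunOn g d)
    (h : ∀ x : M, x ∈ d → app f x = app g x) : f = g := by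
  apply ext'
  intro z
  rw [hf.mem_iff, hg.mem_iff]
  refine exists_congr fun x => and_congr_right fun hx => by rw [h x hx]

@[fun_prop] theorem Def.isFunOn {f g : α → M} (hf : DefF M f) (hg : DefF M g) :
    Def M fun x => IsFunOn (f x) (g x) := by
  unfold IsFunOn ExistsUnique; fun_prop

theorem isFun_iff {f a b : M} : IsFun f a b ↔ IsFunOn f a ∧ ∀ x : M, x ∈ a → ap f x ∈ b :=
  and_congr_right fun h => by simp only [app_eq_ap h.functional]

@[fun_prop] theorem Def.isFun {f g h : α → M} (hf : DefF M f) (hg : DefF M g) (hh : DefF M h) :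
    Def M fun x => IsFun (f x) (g x) (h x) := by
  simp only [isFun_iff]; fun_prop

@[fun_prop] theorem DefF.lam {d : α → M} {F : α → M → M} (hd : DefF M d)
    (hF : DefF M fun p : α × M => F p.1 p.2) : DefF M fun x => lam (d x) (fun y => F x y) := by
  unfold ZFModel.lam; fun_prop

theorem mem_lam {d z : M} {F : M → M} (hF : DefF M F := by fun_prop (disch := assumption)) :
    z ∈ lam d F ↔ ∃ x : M, x ∈ d ∧ z = pair x (F x) := mem_replace

theorem pair_mem_lam {d x y : M} {F : M → M} (hF : DefF M F := by fun_prop (disch := assumption)) :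
    pair x y ∈ lam d F ↔ x ∈ d ∧ y = F x := by
  rw [mem_lam]
  constructor
  · rintro ⟨x', h, he⟩
    rw [pair_inj] at he
    obtain ⟨rfl, rfl⟩ := he
    exact ⟨h, rfl⟩
  · rintro ⟨h, rfl⟩; exact ⟨x, h, rfl⟩

theorem isFunOn_lam {d : M} {F : M → M} (hF : DefF M F := by fun_prop (disch := assumption)) :
    IsFunOn (lam d F) d := by
  constructor
  · intro z hz
    obtain ⟨x, hx, rfl⟩ := (mem_lam).1 hz
    exact ⟨x, _, hx, rfl⟩
  · exact fun x hx => ⟨F x, (pair_mem_lam).2 ⟨hx, rfl⟩, fun y hy => ((pair_mem_lam).1 hy).2⟩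

theorem app_lam {d x : M} {F : M → M} (hx : x ∈ d) (hF : DefF M F := by fun_prop (disch := assumption)) :
    app (lam d F) x = F x :=
  app_eq (isFunOn_lam).functional ((pair_mem_lam).2 ⟨hx, rfl⟩)

theorem isFun_lam {d b : M} {F : M → M} (h : ∀ x : M, x ∈ d → F x ∈ b)
    (hF : DefF M F := by fun_prop (disch := assumption)) : IsFun (lam d F) d b :=
  ⟨isFunOn_lam, fun x hx => by rw [app_lam hx]; exact h x hx⟩

theorem mem_image {f d y : M} (hf : Functional f) :
    y ∈ image f d ↔ ∃ x : M, x ∈ d ∧ y = app f x := mem_replace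

open Classical in
@[fun_prop] theorem DefF.ite {P : α → Prop} {f g : α → M} (hP : Def M P) (hf : DefF M f)
    (hg : DefF M g) : DefF M fun x => if P x then f x else g x := by
  apply DefF.of_graph
  have : (fun p : α × M => p.2 = if P p.1 then f p.1 else g p.1) =
      fun p => (P p.1 ∧ p.2 = f p.1) ∨ (¬ P p.1 ∧ p.2 = g p.1) := by
    funext p; by_cases h : P p.1 <;> simp [h]
  rw [this]; fun_prop

/-! ## Ordinals -/

theorem no_cycle {x y z : M} (h1 : x ∈ y) (h2 : y ∈ z) : ¬ z ∈ x := by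
  intro h3
  have hm : ∀ w : M, w ∈ union (dbl x y) (dbl z z) ↔ w = x ∨ w = y ∨ w = z := by
    intro w; simp [or_assoc]
  obtain ⟨w, hw, hmin⟩ := ModelsZF.foundation (union (dbl x y) (dbl z z)) ⟨x, by simp⟩
  rcases (hm w).1 hw with rfl | rfl | rfl
  · exact hmin z ((hm _).2 (by simp)) h3
  · exact hmin x ((hm _).2 (by simp)) h1
  · exact hmin y ((hm _).2 (by simp)) h2

theorem IsOrdinal.mem {a b : M} (ha : IsOrdinal a) (hb : b ∈ a) : IsOrdinal b := by
  refine ⟨fun y hy z hz => ?_, fun y z hy hz => ha.2 y z (ha.1 b hb y hy) (ha.1 b hb z hz)⟩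
  have hya := ha.1 b hb y hy
  rcases ha.2 z b (ha.1 y hya z hz) hb with h | rfl | h
  · exact h
  · exact (mem_asymm hy hz).elim
  · exact (no_cycle hz hy h).elim

theorem IsOrdinal.succ {a : M} (ha : IsOrdinal a) : IsOrdinal (succ a) := by
  refine ⟨fun y hy z hz => ?_, fun y z hy hz => ?_⟩
  · rw [mem_succ] at hy ⊢
    rcases hy with hy | rfl
    · exact Or.inl (ha.1 y hy z hz)
    · exact Or.inl hz
  · rw [mem_succ] at hy hz
    rcases hy with hy | rfl <;> rcases hz with hz | rfl
    · exact ha.2 y z hy hz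
    · exact Or.inl hy
    · exact Or.inr (Or.inr hz)
    · exact Or.inr (Or.inl rfl)

theorem isOrdinal_empty : IsOrdinal (empty : M) :=
  ⟨fun y hy => (not_mem_empty hy).elim, fun y z hy => (not_mem_empty hy).elim⟩

theorem ordinal_induction {P : M → Prop}
    (h : ∀ a : M, IsOrdinal a → (∀ b : M, b ∈ a → P b) → P a) {a : M} (ha : IsOrdinal a)
    (hP : Def M P := by fun_prop (disch := assumption)) : P a := by
  by_contra hn
  obtain ⟨y, hy, hPy, hm⟩ := exists_minimal (P := fun x : M => ¬ P x) (mem_succ_self a) hn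
  have hys := ha.succ
  exact hPy (h y (hys.mem hy) fun b hb => not_not.1 (hm b hb (hys.1 y hy b hb)))

theorem isOrdinal_of_mem_omega {n : M} (hn : n ∈ (omega : M)) : IsOrdinal n :=
  omega_induction (P := fun n : M => IsOrdinal n) isOrdinal_empty
    (fun _ _ ih => ih.succ) hn

theorem empty_mem_or_eq {n : M} (hn : n ∈ (omega : M)) : n = empty ∨ empty ∈ n :=
  omega_induction (P := fun n : M => n = empty ∨ empty ∈ n) (Or.inl rfl)
    (fun n _ ih => Or.inr (mem_succ.2 (ih.elim (fun h => Or.inr h.symm) Or.inl))) hn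

theorem succ_mem_succ {m n : M} (hn : n ∈ (omega : M)) : m ∈ n → succ m ∈ succ n := by
  refine omega_induction (P := fun n : M => m ∈ n → succ m ∈ succ n) (by simp) ?_ hn
  intro n _ ih h
  rcases mem_succ.1 h with h | rfl
  · exact mem_succ.2 (Or.inl (ih h))
  · exact mem_succ_self _

theorem omega_trichotomy {m n : M} (hm : m ∈ (omega : M)) (hn : n ∈ (omega : M)) :
    m ∈ n ∨ m = n ∨ n ∈ m := by
  refine omega_induction (P := fun n : M => m ∈ n ∨ m = n ∨ n ∈ m) ?_ ?_ hn
  · exact Or.inr (empty_mem_or_eq hm)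
  · rintro n hn (h | rfl | h)
    · exact Or.inl (mem_succ.2 (Or.inl h))
    · exact Or.inl (mem_succ_self m)
    · rcases mem_succ.1 (succ_mem_succ hm h) with h | h
      · exact Or.inr (Or.inr h)
      · exact Or.inr (Or.inl h.symm)

theorem isOrdinal_omega : IsOrdinal (omega : M) :=
  ⟨omega_transitive, fun y z hy hz => omega_trichotomy hy hz⟩

theorem IsLimit.empty_mem {a : M} (ha : IsLimit a) : empty ∈ a := by
  obtain ⟨y, hy, hm⟩ := ModelsZF.foundation a (ne_empty_iff.1 ha.2.1)
  have : y = empty := eq_empty_iff.2 fun z hz => hm z (ha.1.1 y hy z hz) hz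
  exact this ▸ hy

theorem IsLimit.omega_sub {a : M} (ha : IsLimit a) : Sub omega a :=
  ZFModel.omega_sub ⟨ha.empty_mem, ha.2.2⟩

/-- Definition by recursion on the natural numbers of the model. -/
theorem exists_omega_recursion (a : M) {G : M → M} (hG : DefF M G := by fun_prop (disch := assumption)) :
    ∃ f : M, IsFunOn f omega ∧ app f empty = a ∧
      ∀ n : M, n ∈ (omega : M) → app f (succ n) = G (app f n) := by
  let A : M → M → Prop := fun n f => IsFunOn f (succ n) ∧ ap f empty = a ∧
    ∀ m : M, m ∈ n → ap f (succ m) = G (ap f m)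
  have hA : Def M fun p : M × M => A p.1 p.2 := by simp only [A]; fun_prop
  have agree : ∀ n f n' f', n' ∈ (omega : M) → A n f → A n' f' → ∀ m, m ∈ (omega : M) →
      m ∈ succ n → m ∈ succ n' → n ∈ (omega : M) → ap f m = ap f' m := by
    intro n f n' f' hn' h h' m hm
    refine omega_induction (P := fun m : M => m ∈ succ n → m ∈ succ n' → n ∈ (omega : M) →
      ap f m = ap f' m) ?_ ?_ hm
    · intros; rw [h.2.1, h'.2.1]
    · intro m hm ih h1 h2 h3
      have k1 : m ∈ n := by
        rcases mem_succ.1 h1 with h | h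
        · exact mem_trans_omega h3 (mem_succ_self m) h
        · exact h ▸ mem_succ_self m
      have k2 : m ∈ n' := by
        rcases mem_succ.1 h2 with h | h
        · exact mem_trans_omega hn' (mem_succ_self m) h
        · exact h ▸ mem_succ_self m
      rw [h.2.2 m k1, h'.2.2 m k2, ih (mem_succ.2 (Or.inl k1)) (mem_succ.2 (Or.inl k2)) h3]
  have ex : ∀ n : M, n ∈ (omega : M) → ∃ f : M, A n f := by
    intro n hn
    refine omega_induction (P := fun n : M => ∃ f : M, A n f) ?_ ?_ hn
    · refine ⟨lam (succ empty) fun _ => a, isFunOn_lam, ?_, by simp⟩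
      rw [← app_eq_ap (isFunOn_lam).functional, app_lam (mem_succ_self _)]
    · rintro n hn ⟨f, hf⟩
      have hfun : IsFunOn (lam (succ (succ n)) fun m => open Classical in
        if m = succ n then G (ap f n) else ap f m) (succ (succ n)) := isFunOn_lam
      refine ⟨_, hfun, ?_, ?_⟩
      · rw [← app_eq_ap hfun.functional, app_lam, if_neg (succ_ne_empty n).symm, hf.2.1]
        rcases empty_mem_or_eq hn with rfl | h <;> simp [*]
      · intro m hm
        have h1 : ¬ m = succ n := by rintro rfl; exact mem_irrefl _ hm
        rw [← app_eq_ap hfun.functional, ← app_eq_ap hfun.functional,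
          app_lam (succ_mem_succ (succ_mem_omega hn) hm), app_lam (mem_succ.2 (Or.inl hm)),
          if_neg h1]
        rcases mem_succ.1 hm with h | rfl
        · have h2 : ¬ succ m = succ n := fun h' => mem_irrefl n (succ_inj h' ▸ h)
          rw [if_neg h2, hf.2.2 m h]
        · rw [if_pos rfl]
  -- No approximation is chosen for each `n`: the common value of all of them is recovered by
  -- comprehension.
  have hval : ∀ n : M, n ∈ (omega : M) → ∀ f, A n f →
      compr (fun z : M => ∃ f, A n f ∧ z ∈ ap f n) = ap f n := by
    intro n hn f hf
    apply ext'; intro z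
    rw [mem_compr_of_sub (ap f n) _ (by fun_prop)]
    · exact ⟨fun ⟨f', hf', hz⟩ => agree n f' n f hn hf' hf n hn (by simp) (by simp) hn ▸ hz,
        fun h => ⟨f, hf, h⟩⟩
    · exact fun z ⟨f', hf', hz⟩ => agree n f' n f hn hf' hf n hn (by simp) (by simp) hn ▸ hz
  refine ⟨lam omega fun n => compr (fun z : M => ∃ f, A n f ∧ z ∈ ap f n), isFunOn_lam, ?_, ?_⟩
  · obtain ⟨f, hf⟩ := ex _ empty_mem_omega
    rw [app_lam empty_mem_omega, hval _ empty_mem_omega f hf, hf.2.1]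
  · intro n hn
    obtain ⟨f, hf⟩ := ex _ (succ_mem_omega hn)
    obtain ⟨g, hg⟩ := ex _ hn
    rw [app_lam (succ_mem_omega hn), app_lam hn, hval _ (succ_mem_omega hn) f hf,
      hval _ hn g hg, hf.2.2 n (mem_succ_self n),
      agree _ f n g hn hf hg n hn (by simp) (by simp) (succ_mem_omega hn)]

/-! ## The cumulative hierarchy -/

theorem isCumulative_iff {F d : M} : IsCumulative F d ↔ IsFunOn F d ∧
    ∀ β : M, β ∈ d → ∀ x : M, x ∈ ap F β ↔ ∃ γ : M, γ ∈ β ∧ Sub x (ap F γ) :=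
  and_congr_right fun h => by simp only [app_eq_ap h.functional]

theorem V_eq (a : M) :
    V a = compr fun x : M => ∃ F : M, IsCumulative F (succ a) ∧ x ∈ ap F a := by
  unfold V
  congr 1; funext x
  exact propext (exists_congr fun F => and_congr_right fun h => by
    rw [app_eq_ap h.1.functional])

@[fun_prop] theorem DefF.V {f : α → M} (hf : DefF M f) : DefF M fun x => V (f x) := by
  simp only [V_eq, isCumulative_iff]; fun_prop

theorem IsCumulative.eq {F G d : M} (hd : IsOrdinal d) (hF : IsCumulative F d)
    (hG : IsCumulative G d) {a : M} (ha : a ∈ d) : app F a = app G a := by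
  have f1 := hF.1.functional
  have f2 := hG.1.functional
  refine ordinal_induction (P := fun a : M => a ∈ d → app F a = app G a) ?_ (hd.mem ha) ?_ ha
  · intro a _ ih had
    apply ext'; intro x
    rw [hF.2 a had, hG.2 a had]
    exact exists_congr fun γ => and_congr_right fun hγ => by rw [ih γ hγ (hd.1 a had γ hγ)]
  · fun_prop (disch := assumption)

theorem mem_V {a x : M} (ha : IsOrdinal a) : x ∈ V a ↔ ∃ γ : M, γ ∈ a ∧ Sub x (V γ) := by
  refine ordinal_induction
    (P := fun a : M => ∀ x, x ∈ V a ↔ ∃ γ : M, γ ∈ a ∧ Sub x (V γ)) ?_ ha (by fun_prop) x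
  intro a ha ih
  -- One more step of the hierarchy, built from the values below; it yields the cumulative function
  -- on `succ a` whose existence is needed.
  let Φ : M → M := fun β => sUnion (compr fun y : M => ∃ γ : M, γ ∈ β ∧ y = pow (V γ))
  have hΦ : ∀ β x : M, x ∈ Φ β ↔ ∃ γ : M, γ ∈ β ∧ Sub x (V γ) := by
    intro β x
    simp only [Φ, mem_sUnion]
    constructor
    · rintro ⟨y, hy, hx⟩
      obtain ⟨γ, hγ, rfl⟩ := (mem_replace).1 hy
      exact ⟨γ, hγ, mem_pow.1 hx⟩
    · rintro ⟨γ, hγ, hx⟩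
      exact ⟨_, (mem_replace).2 ⟨γ, hγ, rfl⟩, mem_pow.2 hx⟩
  have dΦ : DefF M Φ := by simp only [Φ]; fun_prop
  have hG : IsCumulative (lam (succ a) Φ) (succ a) := by
    refine ⟨isFunOn_lam, fun β hβ x => ?_⟩
    rw [app_lam hβ, hΦ]
    refine exists_congr fun γ => and_congr_right fun hγ => ?_
    have hγa : γ ∈ a := by
      rcases mem_succ.1 hβ with h | rfl
      · exact ha.1 β h γ hγ
      · exact hγ
    rw [app_lam (mem_succ.2 (Or.inl hγa))]
    have : V γ = Φ γ := ext' fun z => by rw [hΦ, ih γ hγa]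
    rw [this]
  have : V a = Φ a := by
    apply ext'; intro z
    have key : ∀ F, IsCumulative F (succ a) → app F a = Φ a := fun F hF => by
      rw [hF.eq ha.succ hG (mem_succ_self a), app_lam (mem_succ_self a)]
    unfold V
    rw [mem_compr ⟨Φ a, fun x => ⟨fun h => ⟨_, hG, key _ hG ▸ h⟩,
      fun ⟨F, hF, h⟩ => key F hF ▸ h⟩⟩]
    exact ⟨fun ⟨F, hF, h⟩ => key F hF ▸ h, fun h => ⟨_, hG, key _ hG ▸ h⟩⟩
  intro x
  rw [this, hΦ]

theorem V_mono {a b : M} (ha : IsOrdinal a) (hb : b ∈ a) : Sub (V b) (V a) := by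
  intro x hx
  obtain ⟨γ, hγ, h⟩ := (mem_V (ha.mem hb)).1 hx
  exact (mem_V ha).2 ⟨γ, ha.1 b hb γ hγ, h⟩

theorem V_transitive {a : M} (ha : IsOrdinal a) : IsTransitive (V a) := by
  intro x hx
  obtain ⟨γ, hγ, h⟩ := (mem_V ha).1 hx
  exact h.trans (V_mono ha hγ)

theorem V_succ {a : M} (ha : IsOrdinal a) : V (succ a) = pow (V a) := by
  apply ext'; intro x
  rw [mem_V ha.succ, mem_pow]
  constructor
  · rintro ⟨γ, hγ, h⟩
    rcases mem_succ.1 hγ with h' | rfl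
    · exact h.trans (V_mono ha h')
    · exact h
  · exact fun h => ⟨a, mem_succ_self a, h⟩

theorem V_empty : V (empty : M) = empty := by
  rw [eq_empty_iff]
  intro x hx
  obtain ⟨γ, hγ, _⟩ := (mem_V isOrdinal_empty).1 hx
  exact not_mem_empty hγ

/-! ## Sets closed under pairs -/

/-- Transitive sets that contain all hereditarily finite sets and are closed under pairs. -/
structure IsBase (N : M) : Prop where
  transitive : IsTransitive N
  omega_sub : Sub omega N
  V_mem : ∀ n : M, n ∈ (omega : M) → V n ∈ N
  tagZero_mem : ∀ x : M, x ∈ N → tagZero x ∈ N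
  tagOne_mem : ∀ x : M, x ∈ N → tagOne x ∈ N
  pair_mem : ∀ x y : M, x ∈ N → y ∈ N → pair x y ∈ N
  sub_mem : ∀ x y : M, x ∈ N → Sub y x → y ∈ N
  of_tagZero : ∀ x : M, tagZero x ∈ N → x ∈ N
  of_tagOne : ∀ x : M, tagOne x ∈ N → x ∈ N
  of_pair : ∀ x y : M, pair x y ∈ N → x ∈ N ∧ y ∈ N

theorem IsTransitive.of_shift {N v : M} (h : IsTransitive N) (hv : shift v ∈ N) : v ∈ N := by
  by_cases hn : v ∈ (omega : M)
  · rw [shift_of_mem hn] at hv; exact h _ hv v (mem_succ_self v)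
  · rwa [shift_of_not_mem hn] at hv

theorem sub_of_tagZero {N x : M} (h : IsTransitive N) (hx : Sub (tagZero x) N) : Sub x N :=
  fun v hv => h.of_shift (hx _ (shift_mem_tagZero.2 hv))

theorem sub_of_tagOne {N x : M} (h : IsTransitive N) (hx : Sub (tagOne x) N) : Sub x N :=
  fun v hv => h.of_shift (hx _ (shift_mem_tagOne.2 hv))

theorem IsTransitive.pow {N : M} (h : IsTransitive N) : IsTransitive (pow N) := by
  intro y hy z hz
  exact mem_pow.2 (h z (mem_pow.1 hy z hz))

theorem IsBase.empty_mem {N : M} (h : IsBase N) : empty ∈ N := h.omega_sub _ empty_mem_omega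

theorem IsBase.shift_mem {N : M} (h : IsBase N) {v : M} (hv : v ∈ N) : shift v ∈ N := by
  by_cases hn : v ∈ (omega : M)
  · rw [shift_of_mem hn]; exact h.omega_sub _ (succ_mem_omega hn)
  · rwa [shift_of_not_mem hn]

/-- Quine–Rosser pairs are flat: the elements of `pair x y` are tags of elements of `x` and of `y`.
A pair of subsets of `N` is therefore again a subset of `N`, provided that `N` contains the tags of
its elements. -/
theorem IsBase.pow {N : M} (h : IsBase N) : IsBase (pow N) where
  transitive := h.transitive.pow
  omega_sub := fun n hn => mem_pow.2 (h.transitive n (h.omega_sub n hn))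
  V_mem := fun n hn => mem_pow.2 (h.transitive _ (h.V_mem n hn))
  tagZero_mem := fun x hx => mem_pow.2 fun z hz => by
    obtain ⟨v, hv, rfl⟩ := mem_tagZero.1 hz
    exact h.shift_mem (mem_pow.1 hx v hv)
  tagOne_mem := fun x hx => mem_pow.2 fun z hz => by
    rcases mem_tagOne.1 hz with rfl | ⟨v, hv, rfl⟩
    · exact h.empty_mem
    · exact h.shift_mem (mem_pow.1 hx v hv)
  pair_mem := fun x y hx hy => mem_pow.2 fun z hz => by
    rcases mem_pair.1 hz with ⟨v, hv, rfl⟩ | ⟨v, hv, rfl⟩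
    · exact h.tagZero_mem v (mem_pow.1 hx v hv)
    · exact h.tagOne_mem v (mem_pow.1 hy v hv)
  sub_mem := fun x y hx hy => mem_pow.2 (hy.trans (mem_pow.1 hx))
  of_tagZero := fun x hx => mem_pow.2 (sub_of_tagZero h.transitive (mem_pow.1 hx))
  of_tagOne := fun x hx => mem_pow.2 (sub_of_tagOne h.transitive (mem_pow.1 hx))
  of_pair := fun x y hx =>
    ⟨mem_pow.2 fun v hv => h.of_tagZero v (mem_pow.1 hx _ (tagZero_mem_pair.2 hv)),
      mem_pow.2 fun v hv => h.of_tagOne v (mem_pow.1 hx _ (tagOne_mem_pair.2 hv))⟩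

theorem sub_V {n : M} (hn : IsOrdinal n) : Sub n (V n) :=
  ordinal_induction (P := fun n : M => Sub n (V n))
    (fun a ha ih b hb => (mem_V ha).2 ⟨b, hb, ih b hb⟩) hn

theorem IsLimit.mem_V {a x : M} (ha : IsLimit a) : x ∈ V a ↔ ∃ γ : M, γ ∈ a ∧ x ∈ V γ := by
  constructor
  · intro h
    obtain ⟨γ, hγ, hx⟩ := (ZFModel.mem_V ha.1).1 h
    exact ⟨succ γ, ha.2.2 γ hγ, by rw [V_succ (ha.1.mem hγ), mem_pow]; exact hx⟩
  · rintro ⟨γ, hγ, hx⟩; exact V_mono ha.1 hγ x hx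

theorem IsLimit.pow_mem {a x γ : M} (ha : IsLimit a) (hγ : γ ∈ a) (hx : Sub x (V γ)) :
    x ∈ V a :=
  (ZFModel.mem_V ha.1).2 ⟨γ, hγ, hx⟩

theorem shift_mem_V {a v : M} (ha : IsOrdinal a) (hv : v ∈ V a) : shift v ∈ V (succ a) := by
  rw [V_succ ha, mem_pow]
  have h1 := V_transitive ha v hv
  by_cases hn : v ∈ (omega : M)
  · rw [shift_of_mem hn]
    intro z hz
    rcases mem_succ.1 hz with h | rfl
    · exact h1 z h
    · exact hv
  · rwa [shift_of_not_mem hn]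

theorem tagZero_mem_V {a v : M} (ha : IsOrdinal a) (hv : v ∈ V a) :
    tagZero v ∈ V (succ (succ a)) := by
  rw [V_succ ha.succ, mem_pow]
  intro z hz
  obtain ⟨w, hw, rfl⟩ := mem_tagZero.1 hz
  exact shift_mem_V ha (V_transitive ha v hv w hw)

theorem tagOne_mem_V {a v : M} (ha : IsOrdinal a) (hv : v ∈ V a) :
    tagOne v ∈ V (succ (succ a)) := by
  rw [V_succ ha.succ, mem_pow]
  intro z hz
  rcases mem_tagOne.1 hz with rfl | ⟨w, hw, rfl⟩
  · rw [V_succ ha, mem_pow]; exact empty_sub _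
  · exact shift_mem_V ha (V_transitive ha v hv w hw)

theorem IsLimit.exists_common {a x y : M} (ha : IsLimit a) (hx : x ∈ V a) (hy : y ∈ V a) :
    ∃ γ : M, γ ∈ a ∧ x ∈ V γ ∧ y ∈ V γ := by
  obtain ⟨γ, hγ, h⟩ := ha.mem_V.1 hx
  obtain ⟨δ, hδ, h'⟩ := ha.mem_V.1 hy
  rcases ha.1.2 γ δ hγ hδ with k | rfl | k
  · exact ⟨δ, hδ, V_mono (ha.1.mem hδ) k x h, h'⟩
  · exact ⟨γ, hγ, h, h'⟩
  · exact ⟨γ, hγ, h, V_mono (ha.1.mem hγ) k y h'⟩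

theorem V_sub_mem {a x y : M} (ha : IsOrdinal a) (hx : x ∈ V a) (hy : Sub y x) : y ∈ V a := by
  obtain ⟨γ, hγ, h⟩ := (mem_V ha).1 hx
  exact (mem_V ha).2 ⟨γ, hγ, hy.trans h⟩

theorem V_of_tagZero {a x : M} (ha : IsOrdinal a) (hx : tagZero x ∈ V a) : x ∈ V a := by
  obtain ⟨γ, hγ, h⟩ := (mem_V ha).1 hx
  exact (mem_V ha).2 ⟨γ, hγ, sub_of_tagZero (V_transitive (ha.mem hγ)) h⟩

theorem V_of_tagOne {a x : M} (ha : IsOrdinal a) (hx : tagOne x ∈ V a) : x ∈ V a := by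
  obtain ⟨γ, hγ, h⟩ := (mem_V ha).1 hx
  exact (mem_V ha).2 ⟨γ, hγ, sub_of_tagOne (V_transitive (ha.mem hγ)) h⟩

theorem IsLimit.isBase {a : M} (ha : IsLimit a) : IsBase (V a) where
  transitive := V_transitive ha.1
  omega_sub := fun n hn => V_mono ha.1 (ha.omega_sub _ (succ_mem_omega hn)) n (by
    rw [V_succ (isOrdinal_of_mem_omega hn), mem_pow]; exact sub_V (isOrdinal_of_mem_omega hn))
  V_mem := fun n hn => ha.pow_mem (ha.omega_sub n hn) (Sub.refl _)
  tagZero_mem := fun x hx => by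
    obtain ⟨γ, hγ, h⟩ := ha.mem_V.1 hx
    exact V_mono ha.1 (ha.2.2 _ (ha.2.2 _ hγ)) _ (tagZero_mem_V (ha.1.mem hγ) h)
  tagOne_mem := fun x hx => by
    obtain ⟨γ, hγ, h⟩ := ha.mem_V.1 hx
    exact V_mono ha.1 (ha.2.2 _ (ha.2.2 _ hγ)) _ (tagOne_mem_V (ha.1.mem hγ) h)
  pair_mem := fun x y hx hy => by
    obtain ⟨γ, hγ, h, h'⟩ := ha.exists_common hx hy
    have hγo := ha.1.mem hγ
    refine ha.pow_mem (ha.2.2 _ (ha.2.2 _ hγ)) fun z hz => ?_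
    rcases mem_pair.1 hz with ⟨v, hv, rfl⟩ | ⟨v, hv, rfl⟩
    · exact tagZero_mem_V hγo (V_transitive hγo x h v hv)
    · exact tagOne_mem_V hγo (V_transitive hγo y h' v hv)
  sub_mem := fun x y hx hy => V_sub_mem ha.1 hx hy
  of_tagZero := fun x => V_of_tagZero ha.1
  of_tagOne := fun x => V_of_tagOne ha.1
  of_pair := fun x y hx => by
    obtain ⟨γ, hγ, h⟩ := (ZFModel.mem_V ha.1).1 hx
    exact ⟨ha.pow_mem hγ fun v hv => V_of_tagZero (ha.1.mem hγ) (h _ (tagZero_mem_pair.2 hv)),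
      ha.pow_mem hγ fun v hv => V_of_tagOne (ha.1.mem hγ) (h _ (tagOne_mem_pair.2 hv))⟩

theorem isLimit_omega : IsLimit (omega : M) :=
  ⟨isOrdinal_omega, ne_empty_iff.2 ⟨_, empty_mem_omega⟩, fun _ h => succ_mem_omega h⟩

end ZFModel

end

noncomputable section

namespace ZFModel

variable {M : Type u} [Membership M M] [Nonempty M] [ModelsZF M] {α : Type u} [Ctx M α]

/-! ## Products -/

def prod (a b : M) : M := compr fun z => ∃ x y : M, x ∈ a ∧ y ∈ b ∧ z = pair x y

theorem mem_prod {a b z : M} : z ∈ prod a b ↔ ∃ x y : M, x ∈ a ∧ y ∈ b ∧ z = pair x y := by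
  refine mem_compr_of_sub (sUnion (compr fun c : M => ∃ x : M, x ∈ a ∧
    c = compr fun z : M => ∃ y : M, y ∈ b ∧ z = pair x y)) ?_ (by fun_prop) z
  rintro z ⟨x, y, hx, hy, rfl⟩
  exact mem_sUnion.2 ⟨_, (mem_replace).2 ⟨x, hx, rfl⟩, (mem_replace).2 ⟨y, hy, rfl⟩⟩

@[simp] theorem pair_mem_prod {a b x y : M} : pair x y ∈ prod a b ↔ x ∈ a ∧ y ∈ b := by
  rw [mem_prod]
  constructor
  · rintro ⟨x', y', hx, hy, h⟩
    rw [pair_inj] at h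
    exact ⟨h.1 ▸ hx, h.2 ▸ hy⟩
  · rintro ⟨hx, hy⟩; exact ⟨x, y, hx, hy, rfl⟩

theorem IsFun.sub_prod {f a b : M} (h : IsFun f a b) : Sub f (prod a b) := by
  intro z hz
  obtain ⟨x, hx, rfl⟩ := h.1.mem_iff.1 hz
  exact pair_mem_prod.2 ⟨hx, h.2 x hx⟩

/-! ## Formulas -/

@[fun_prop] theorem DefF.fMem {f g : α → M} (hf : DefF M f) (hg : DefF M g) :
    DefF M fun x => fMem (f x) (g x) := by unfold ZFModel.fMem; fun_prop
@[fun_prop] theorem DefF.fEq {f g : α → M} (hf : DefF M f) (hg : DefF M g) :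
    DefF M fun x => fEq (f x) (g x) := by unfold ZFModel.fEq; fun_prop
@[fun_prop] theorem DefF.fNot {f : α → M} (hf : DefF M f) :
    DefF M fun x => fNot (f x) := by unfold ZFModel.fNot; fun_prop
@[fun_prop] theorem DefF.fAnd {f g : α → M} (hf : DefF M f) (hg : DefF M g) :
    DefF M fun x => fAnd (f x) (g x) := by unfold ZFModel.fAnd; fun_prop
@[fun_prop] theorem DefF.fEx {f g : α → M} (hf : DefF M f) (hg : DefF M g) :
    DefF M fun x => fEx (f x) (g x) := by unfold ZFModel.fEx; fun_prop
@[fun_prop] theorem DefF.fBddEx {f g h : α → M} (hf : DefF M f) (hg : DefF M g) (hh : DefF M h) :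
    DefF M fun x => fBddEx (f x) (g x) (h x) := by unfold ZFModel.fBddEx; fun_prop
@[fun_prop] theorem Def.isFormula {f : α → M} (hf : DefF M f) :
    Def M fun x => IsFormula (f x) := by
  unfold IsFormula ContainsAtomic ClosedBoolean; fun_prop
@[fun_prop] theorem Def.isSigmaZero {f : α → M} (hf : DefF M f) :
    Def M fun x => IsSigmaZero (f x) := by
  unfold IsSigmaZero ContainsAtomic ClosedBoolean; fun_prop
@[fun_prop] theorem Def.isSigma {f g : α → M} (hf : DefF M f) (hg : DefF M g) :
    Def M fun x => IsSigma (f x) (g x) := by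
  unfold IsSigma; fun_prop
@[fun_prop] theorem Def.isPi {f g : α → M} (hf : DefF M f) (hg : DefF M g) :
    Def M fun x => IsPi (f x) (g x) := by
  unfold IsPi; fun_prop

theorem isBase_V_omega : IsBase (V (omega : M)) := isLimit_omega.isBase

theorem num_mem_V_omega (n : ℕ) : (num n : M) ∈ V (omega : M) :=
  isBase_V_omega.omega_sub _ (num_mem_omega n)

@[simp] theorem num_inj {m n : ℕ} : (num m : M) = num n ↔ m = n := num_injective.eq_iff

theorem IsFormula.mem' {i j : M} (hi : i ∈ (omega : M)) (hj : j ∈ (omega : M)) :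
    IsFormula (fMem i j) := fun X h _ _ => (h i j hi hj).1
theorem IsFormula.eq' {i j : M} (hi : i ∈ (omega : M)) (hj : j ∈ (omega : M)) :
    IsFormula (fEq i j) := fun X h _ _ => (h i j hi hj).2
theorem IsFormula.not' {φ : M} (h : IsFormula φ) : IsFormula (fNot φ) :=
  fun X h1 h2 h3 => h2.1 _ (h X h1 h2 h3)
theorem IsFormula.and' {φ ψ : M} (h : IsFormula φ) (h' : IsFormula ψ) : IsFormula (fAnd φ ψ) :=
  fun X h1 h2 h3 => h2.2 _ _ (h X h1 h2 h3) (h' X h1 h2 h3)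
theorem IsFormula.ex' {i φ : M} (hi : i ∈ (omega : M)) (h : IsFormula φ) :
    IsFormula (fEx i φ) := fun X h1 h2 h3 => h3 _ _ hi (h X h1 h2 h3)

theorem IsSigmaZero.mem' {i j : M} (hi : i ∈ (omega : M)) (hj : j ∈ (omega : M)) :
    IsSigmaZero (fMem i j) := fun X h _ _ => (h i j hi hj).1
theorem IsSigmaZero.eq' {i j : M} (hi : i ∈ (omega : M)) (hj : j ∈ (omega : M)) :
    IsSigmaZero (fEq i j) := fun X h _ _ => (h i j hi hj).2
theorem IsSigmaZero.not' {φ : M} (h : IsSigmaZero φ) : IsSigmaZero (fNot φ) :=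
  fun X h1 h2 h3 => h2.1 _ (h X h1 h2 h3)
theorem IsSigmaZero.and' {φ ψ : M} (h : IsSigmaZero φ) (h' : IsSigmaZero ψ) :
    IsSigmaZero (fAnd φ ψ) :=
  fun X h1 h2 h3 => h2.2 _ _ (h X h1 h2 h3) (h' X h1 h2 h3)
theorem IsSigmaZero.bex' {i j φ : M} (hi : i ∈ (omega : M)) (hj : j ∈ (omega : M)) (hij : i ≠ j)
    (h : IsSigmaZero φ) : IsSigmaZero (fBddEx i j φ) :=
  fun X h1 h2 h3 => h3 _ _ _ hi hj hij (h X h1 h2 h3)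

theorem fMem_mem_V {i j : M} (hi : i ∈ V (omega : M)) (hj : j ∈ V (omega : M)) :
    fMem i j ∈ V (omega : M) :=
  isBase_V_omega.pair_mem _ _ (num_mem_V_omega 0) (isBase_V_omega.pair_mem _ _ hi hj)
theorem fEq_mem_V {i j : M} (hi : i ∈ V (omega : M)) (hj : j ∈ V (omega : M)) :
    fEq i j ∈ V (omega : M) :=
  isBase_V_omega.pair_mem _ _ (num_mem_V_omega 1) (isBase_V_omega.pair_mem _ _ hi hj)
theorem fNot_mem_V {φ : M} (h : φ ∈ V (omega : M)) : fNot φ ∈ V (omega : M) :=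
  isBase_V_omega.pair_mem _ _ (num_mem_V_omega 2) h
theorem fAnd_mem_V {i j : M} (hi : i ∈ V (omega : M)) (hj : j ∈ V (omega : M)) :
    fAnd i j ∈ V (omega : M) :=
  isBase_V_omega.pair_mem _ _ (num_mem_V_omega 3) (isBase_V_omega.pair_mem _ _ hi hj)
theorem fEx_mem_V {i j : M} (hi : i ∈ V (omega : M)) (hj : j ∈ V (omega : M)) :
    fEx i j ∈ V (omega : M) :=
  isBase_V_omega.pair_mem _ _ (num_mem_V_omega 4) (isBase_V_omega.pair_mem _ _ hi hj)

theorem omega_sub_V : Sub (omega : M) (V omega) := isBase_V_omega.omega_sub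

/-- The definition of a formula quantifies over sets, so the class of formulas with `P` is first cut
down to a set; `V ω` serves, being closed under the constructors. -/
theorem formula_induction {P : M → Prop}
    (hmem : ∀ i j : M, i ∈ (omega : M) → j ∈ (omega : M) → P (fMem i j))
    (heq : ∀ i j : M, i ∈ (omega : M) → j ∈ (omega : M) → P (fEq i j))
    (hnot : ∀ φ : M, IsFormula φ → P φ → P (fNot φ))
    (hand : ∀ φ ψ : M, IsFormula φ → IsFormula ψ → P φ → P ψ → P (fAnd φ ψ))
    (hex : ∀ i φ : M, i ∈ (omega : M) → IsFormula φ → P φ → P (fEx i φ))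
    {φ : M} (hφ : IsFormula φ) (hP : Def M P := by fun_prop (disch := assumption)) : P φ := by
  have key := hφ (compr fun φ : M => φ ∈ V (omega : M) ∧ (IsFormula φ ∧ P φ)) ?_ ?_ ?_
  · exact ((mem_sep).1 key).2.2
  · intro i j hi hj
    rw [mem_sep, mem_sep]
    exact ⟨⟨fMem_mem_V (omega_sub_V _ hi) (omega_sub_V _ hj), .mem' hi hj, hmem i j hi hj⟩,
      fEq_mem_V (omega_sub_V _ hi) (omega_sub_V _ hj), .eq' hi hj, heq i j hi hj⟩
  · constructor
    · intro φ h
      rw [mem_sep] at h ⊢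
      exact ⟨fNot_mem_V h.1, h.2.1.not', hnot _ h.2.1 h.2.2⟩
    · intro φ ψ h h'
      rw [mem_sep] at h h' ⊢
      exact ⟨fAnd_mem_V h.1 h'.1, h.2.1.and' h'.2.1, hand _ _ h.2.1 h'.2.1 h.2.2 h'.2.2⟩
  · intro i φ hi h
    rw [mem_sep] at h ⊢
    exact ⟨fEx_mem_V (omega_sub_V _ hi) h.1, h.2.1.ex' hi, hex _ _ hi h.2.1 h.2.2⟩

theorem sigmaZero_induction {P : M → Prop}
    (hmem : ∀ i j : M, i ∈ (omega : M) → j ∈ (omega : M) → P (fMem i j))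
    (heq : ∀ i j : M, i ∈ (omega : M) → j ∈ (omega : M) → P (fEq i j))
    (hnot : ∀ φ : M, IsSigmaZero φ → P φ → P (fNot φ))
    (hand : ∀ φ ψ : M, IsSigmaZero φ → IsSigmaZero ψ → P φ → P ψ → P (fAnd φ ψ))
    (hex : ∀ i j φ : M, i ∈ (omega : M) → j ∈ (omega : M) → i ≠ j → IsSigmaZero φ → P φ →
      P (fBddEx i j φ))
    {φ : M} (hφ : IsSigmaZero φ) (hP : Def M P := by fun_prop (disch := assumption)) : P φ := by
  have key := hφ (compr fun φ : M => φ ∈ V (omega : M) ∧ (IsSigmaZero φ ∧ P φ)) ?_ ?_ ?_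
  · exact ((mem_sep).1 key).2.2
  · intro i j hi hj
    rw [mem_sep, mem_sep]
    exact ⟨⟨fMem_mem_V (omega_sub_V _ hi) (omega_sub_V _ hj), .mem' hi hj, hmem i j hi hj⟩,
      fEq_mem_V (omega_sub_V _ hi) (omega_sub_V _ hj), .eq' hi hj, heq i j hi hj⟩
  · constructor
    · intro φ h
      rw [mem_sep] at h ⊢
      exact ⟨fNot_mem_V h.1, h.2.1.not', hnot _ h.2.1 h.2.2⟩
    · intro φ ψ h h'
      rw [mem_sep] at h h' ⊢
      exact ⟨fAnd_mem_V h.1 h'.1, h.2.1.and' h'.2.1, hand _ _ h.2.1 h'.2.1 h.2.2 h'.2.2⟩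
  · intro i j φ hi hj hij h
    rw [mem_sep] at h ⊢
    have hi' := omega_sub_V _ hi
    exact ⟨fEx_mem_V hi' (fAnd_mem_V (fMem_mem_V hi' (omega_sub_V _ hj)) h.1),
      h.2.1.bex' hi hj hij, hex _ _ _ hi hj hij h.2.1 h.2.2⟩

theorem IsSigmaZero.isFormula {φ : M} (h : IsSigmaZero φ) : IsFormula φ :=
  sigmaZero_induction (P := fun φ : M => IsFormula φ) (fun _ _ hi hj => .mem' hi hj)
    (fun _ _ hi hj => .eq' hi hj) (fun _ _ h => h.not') (fun _ _ _ _ h h' => h.and' h')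
    (fun _ _ _ hi hj _ _ h => ((IsFormula.mem' hi hj).and' h).ex' hi) h

theorem IsFormula.mem_V {φ : M} (h : IsFormula φ) : φ ∈ V (omega : M) :=
  formula_induction (P := fun φ : M => φ ∈ V (omega : M))
    (fun _ _ hi hj => fMem_mem_V (omega_sub_V _ hi) (omega_sub_V _ hj))
    (fun _ _ hi hj => fEq_mem_V (omega_sub_V _ hi) (omega_sub_V _ hj))
    (fun _ _ h => fNot_mem_V h) (fun _ _ _ _ h h' => fAnd_mem_V h h')
    (fun _ _ hi _ h => fEx_mem_V (omega_sub_V _ hi) h) h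

theorem IsSigma.zero {φ : M} (h : IsSigmaZero φ) : IsSigma (num 0) φ := fun X h0 _ _ => (h0 φ h).1
theorem IsSigma.one {φ : M} (h : IsSigmaZero φ) : IsSigma (num 1) φ := fun X h0 _ _ => (h0 φ h).2
theorem IsSigma.not' {m φ : M} (hm : m ∈ (omega : M)) (h : IsSigma (succ m) φ) :
    IsSigma (succ (succ m)) (fNot φ) := fun X h0 h1 h2 => h1 m φ hm (h X h0 h1 h2)
theorem IsSigma.ex' {m i φ : M} (hm : m ∈ (omega : M)) (hi : i ∈ (omega : M))
    (h : IsSigma (succ m) φ) : IsSigma (succ m) (fEx i φ) :=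
  fun X h0 h1 h2 => h2 m i φ hm hi (h X h0 h1 h2)

theorem sigma_induction {P : M → M → Prop}
    (h0 : ∀ ψ : M, IsSigmaZero ψ → P (num 0) ψ ∧ P (num 1) ψ)
    (hnot : ∀ m ψ : M, m ∈ (omega : M) → IsSigma (succ m) ψ → P (succ m) ψ →
      P (succ (succ m)) (fNot ψ))
    (hex : ∀ m i ψ : M, m ∈ (omega : M) → i ∈ (omega : M) → IsSigma (succ m) ψ → P (succ m) ψ →
      P (succ m) (fEx i ψ))
    {n φ : M} (h : IsSigma n φ) (hP : Def M (fun p : M × M => P p.1 p.2) := by fun_prop (disch := assumption)) :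
    P n φ := by
  obtain ⟨X, key⟩ : ∃ X : M, ∀ m ψ : M, pair m ψ ∈ X ↔
      (m ∈ (omega : M) ∧ ψ ∈ V (omega : M)) ∧ IsSigma m ψ ∧ P m ψ := by
    refine ⟨compr (fun z : M => z ∈ prod (omega : M) (V (omega : M)) ∧
      ∃ m ψ : M, z = pair m ψ ∧ IsSigma m ψ ∧ P m ψ), fun m ψ => ?_⟩
    rw [mem_sep, pair_mem_prod]
    refine and_congr_right fun _ => ⟨?_, fun h => ⟨m, ψ, rfl, h⟩⟩
    rintro ⟨m', ψ', he, h⟩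
    rw [pair_inj] at he
    obtain ⟨rfl, rfl⟩ := he
    exact h
  have := h X ?_ ?_ ?_
  · exact ((key _ _).1 this).2.2
  · intro ψ hψ
    rw [key, key]
    exact ⟨⟨⟨num_mem_omega 0, hψ.isFormula.mem_V⟩, .zero hψ, (h0 ψ hψ).1⟩,
      ⟨num_mem_omega 1, hψ.isFormula.mem_V⟩, .one hψ, (h0 ψ hψ).2⟩
  · intro m ψ hm hψ
    rw [key] at hψ ⊢
    exact ⟨⟨succ_mem_omega hψ.1.1, fNot_mem_V hψ.1.2⟩, hψ.2.1.not' hm, hnot _ _ hm hψ.2.1 hψ.2.2⟩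
  · intro m i ψ hm hi hψ
    rw [key] at hψ ⊢
    exact ⟨⟨hψ.1.1, fEx_mem_V (omega_sub_V _ hi) hψ.1.2⟩, hψ.2.1.ex' hm hi,
      hex _ _ _ hm hi hψ.2.1 hψ.2.2⟩

theorem IsSigma.isFormula {n φ : M} (h : IsSigma n φ) : IsFormula φ :=
  sigma_induction (P := fun _ φ : M => IsFormula φ) (fun _ h => ⟨h.isFormula, h.isFormula⟩)
    (fun _ _ _ _ h => h.not') (fun _ _ _ _ hi _ h => h.ex' hi) h

theorem IsSigma.isSigmaZero {φ : M} (h : IsSigma empty φ) : IsSigmaZero φ :=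
  sigma_induction (P := fun n φ : M => n = empty → IsSigmaZero φ) (fun _ h => ⟨fun _ => h, fun _ => h⟩)
    (fun _ _ _ _ h h' => (succ_ne_empty _ h').elim)
    (fun _ _ _ _ hi _ h h' => (succ_ne_empty _ h').elim) h (by fun_prop) rfl

theorem IsPi.isFormula {n φ : M} (h : IsPi n φ) : IsFormula φ := by
  rcases h with h | ⟨_, ψ, h, rfl⟩
  · exact h.2.isFormula
  · exact h.isFormula.not'

/-! ## Assignments -/

/-- A definable version of `update`. -/
def upd (s i a : M) : M := lam omega fun m => open Classical in if m = i then a else ap s m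

@[fun_prop] theorem DefF.upd {f g h : α → M} (hf : DefF M f) (hg : DefF M g) (hh : DefF M h) :
    DefF M fun x => upd (f x) (g x) (h x) := by unfold ZFModel.upd; fun_prop

theorem update_eq_upd {s : M} (hs : Functional s) (i a : M) : update s i a = upd s i a := by
  unfold update upd; simp only [app_eq_ap hs]

@[fun_prop] theorem Def.isAssignment {f g : α → M} (hf : DefF M f) (hg : DefF M g) :
    Def M fun x => IsAssignment (f x) (g x) := by
  unfold IsAssignment; fun_prop

theorem isFunOn_update {s : M} (hs : Functional s) (i a : M) : IsFunOn (update s i a) omega := by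
  rw [update_eq_upd hs]; exact isFunOn_lam

open Classical in
theorem app_update {s i a m : M} (hs : Functional s) (hm : m ∈ (omega : M)) :
    app (update s i a) m = if m = i then a else app s m := by
  rw [update_eq_upd hs, app_eq_ap hs]; exact app_lam hm

theorem app_update_self {s i a : M} (hs : Functional s) (hi : i ∈ (omega : M)) :
    app (update s i a) i = a := by
  rw [app_update hs hi, if_pos rfl]

theorem app_update_ne {s i a m : M} (hs : Functional s) (hm : m ∈ (omega : M)) (h : m ≠ i) :
    app (update s i a) m = app s m := by
  rw [app_update hs hm, if_neg h]

theorem IsAssignment.functional {A s : M} (h : IsAssignment A s) : Functional s := h.1.functional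

theorem IsAssignment.update {A s i a : M} (h : IsAssignment A s) (ha : a ∈ A) :
    IsAssignment A (update s i a) := by
  refine ⟨isFunOn_update h.functional i a, fun m hm => ?_⟩
  rw [app_update h.functional hm]
  split_ifs
  · exact ha
  · exact h.2 m hm

theorem IsAssignment.ext {A B s t : M} (hs : IsAssignment A s) (ht : IsAssignment B t)
    (h : ∀ m : M, m ∈ (omega : M) → app s m = app t m) : s = t := hs.1.ext ht.1 h

theorem IsAssignment.mono {A B s : M} (hs : IsAssignment A s) (h : Sub A B) : IsAssignment B s :=
  ⟨hs.1, fun m hm => h _ (hs.2 m hm)⟩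

theorem IsAssignment.lam {A : M} {F : M → M} (h : ∀ m : M, m ∈ (omega : M) → F m ∈ A)
    (hF : DefF M F := by fun_prop (disch := assumption)) : IsAssignment A (lam omega F) := isFun_lam h

/-! ## Satisfaction -/

theorem isSatRelation_iff {A S : M} : IsSatRelation A S ↔ ∀ s : M, IsAssignment A s →
    (∀ i j : M, i ∈ (omega : M) → j ∈ (omega : M) →
      ((pair (fMem i j) s ∈ S ↔ ap s i ∈ ap s j) ∧
        (pair (fEq i j) s ∈ S ↔ ap s i = ap s j))) ∧
    (∀ φ : M, IsFormula φ → (pair (fNot φ) s ∈ S ↔ ¬ pair φ s ∈ S)) ∧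
    (∀ φ ψ : M, IsFormula φ → IsFormula ψ →
      (pair (fAnd φ ψ) s ∈ S ↔ pair φ s ∈ S ∧ pair ψ s ∈ S)) ∧
    (∀ i φ : M, i ∈ (omega : M) → IsFormula φ →
      (pair (fEx i φ) s ∈ S ↔ ∃ a : M, a ∈ A ∧ pair φ (upd s i a) ∈ S)) :=
  forall_congr' fun s => forall_congr' fun hs => by
    simp only [app_eq_ap hs.functional, update_eq_upd hs.functional]

@[fun_prop] theorem Def.isSatRelation {f g : α → M} (hf : DefF M f) (hg : DefF M g) :
    Def M fun x => IsSatRelation (f x) (g x) := by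
  simp only [isSatRelation_iff]; fun_prop

@[fun_prop] theorem Def.sat {f g h : α → M} (hf : DefF M f) (hg : DefF M g) (hh : DefF M h) :
    Def M fun x => Sat (f x) (g x) (h x) := by
  unfold Sat; fun_prop

theorem IsSatRelation.unique {A S S' φ : M} (h : IsSatRelation A S) (h' : IsSatRelation A S')
    (hφ : IsFormula φ) : ∀ s : M, IsAssignment A s → (pair φ s ∈ S ↔ pair φ s ∈ S') := by
  refine formula_induction
    (P := fun φ : M => ∀ s : M, IsAssignment A s → (pair φ s ∈ S ↔ pair φ s ∈ S')) ?_ ?_ ?_ ?_ ?_ hφ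
  · intro i j hi hj s hs
    rw [((h s hs).1 i j hi hj).1, ((h' s hs).1 i j hi hj).1]
  · intro i j hi hj s hs
    rw [((h s hs).1 i j hi hj).2, ((h' s hs).1 i j hi hj).2]
  · intro φ hφ ih s hs
    rw [(h s hs).2.1 φ hφ, (h' s hs).2.1 φ hφ, ih s hs]
  · intro φ ψ hφ hψ ih ih' s hs
    rw [(h s hs).2.2.1 φ ψ hφ hψ, (h' s hs).2.2.1 φ ψ hφ hψ, ih s hs, ih' s hs]
  · intro i φ hi hφ ih s hs
    rw [(h s hs).2.2.2 i φ hi hφ, (h' s hs).2.2.2 i φ hi hφ]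
    exact exists_congr fun a => and_congr_right fun ha => ih _ (hs.update ha)

/-- The inductive clauses for the signed truth relation of `(A, ∈)`: the sign `1` stands for truth
and the sign `0` for falsity. -/
def SignedStep (A L e : M) : Prop := ∃ s : M, IsAssignment A s ∧
  ((∃ i j : M, i ∈ (omega : M) ∧ j ∈ (omega : M) ∧
    ((e = pair (num 1) (pair (fMem i j) s) ∧ ap s i ∈ ap s j) ∨
     (e = pair (num 0) (pair (fMem i j) s) ∧ ¬ ap s i ∈ ap s j) ∨
     (e = pair (num 1) (pair (fEq i j) s) ∧ ap s i = ap s j) ∨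
     (e = pair (num 0) (pair (fEq i j) s) ∧ ¬ ap s i = ap s j))) ∨
  (∃ φ : M, IsFormula φ ∧
    ((e = pair (num 1) (pair (fNot φ) s) ∧ pair (num 0) (pair φ s) ∈ L) ∨
     (e = pair (num 0) (pair (fNot φ) s) ∧ pair (num 1) (pair φ s) ∈ L))) ∨
  (∃ φ ψ : M, IsFormula φ ∧ IsFormula ψ ∧
    ((e = pair (num 1) (pair (fAnd φ ψ) s) ∧ pair (num 1) (pair φ s) ∈ L ∧
        pair (num 1) (pair ψ s) ∈ L) ∨
     (e = pair (num 0) (pair (fAnd φ ψ) s) ∧ (pair (num 0) (pair φ s) ∈ L ∨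
        pair (num 0) (pair ψ s) ∈ L)))) ∨
  (∃ i φ : M, i ∈ (omega : M) ∧ IsFormula φ ∧
    ((e = pair (num 1) (pair (fEx i φ) s) ∧
        ∃ a : M, a ∈ A ∧ pair (num 1) (pair φ (upd s i a)) ∈ L) ∨
     (e = pair (num 0) (pair (fEx i φ) s) ∧
        ∀ a : M, a ∈ A → pair (num 0) (pair φ (upd s i a)) ∈ L))))

@[fun_prop] theorem Def.signedStep {f g h : α → M} (hf : DefF M f) (hg : DefF M g)
    (hh : DefF M h) : Def M fun x => SignedStep (f x) (g x) (h x) := by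
  unfold SignedStep; fun_prop

theorem SignedStep.mono {A L L' e : M} (h : Sub L L') (he : SignedStep A L e) :
    SignedStep A L' e := by
  obtain ⟨s, hs, he⟩ := he
  refine ⟨s, hs, ?_⟩
  rcases he with he | ⟨φ, hφ, he⟩ | ⟨φ, ψ, hφ, hψ, he⟩ | ⟨i, φ, hi, hφ, he⟩
  · exact Or.inl he
  · exact Or.inr (Or.inl ⟨φ, hφ, he.imp (fun k => ⟨k.1, h _ k.2⟩) fun k => ⟨k.1, h _ k.2⟩⟩)
  · exact Or.inr (Or.inr (Or.inl ⟨φ, ψ, hφ, hψ, he.imp (fun k => ⟨k.1, h _ k.2.1, h _ k.2.2⟩)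
      fun k => ⟨k.1, k.2.imp (h _) (h _)⟩⟩))
  · exact Or.inr (Or.inr (Or.inr ⟨i, φ, hi, hφ, he.imp
      (fun ⟨k, a, ha, k'⟩ => ⟨k, a, ha, h _ k'⟩) fun k => ⟨k.1, fun a ha => h _ (k.2 a ha)⟩⟩))

/-- Truth and falsity are defined together as the least fixed point of `SignedStep`; for truth alone
the clause for negation would not be monotone. Induction on formulas then shows that falsity is the
complement of truth. -/
theorem exists_isSatRelation (A : M) : ∃ S : M, IsSatRelation A S := by
  let U : M := prod omega (prod (V omega) (pow (prod omega A)))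
  have hU : ∀ k φ s : M, k ∈ (omega : M) → IsFormula φ → IsAssignment A s →
      pair k (pair φ s) ∈ U := fun k φ s hk hφ hs =>
    pair_mem_prod.2 ⟨hk, pair_mem_prod.2 ⟨hφ.mem_V, mem_pow.2 (IsFun.sub_prod hs)⟩⟩
  let T : M := compr fun e : M => e ∈ U ∧
    ∀ L : M, (∀ e : M, e ∈ U → SignedStep A L e → e ∈ L) → e ∈ L
  have hT : ∀ e : M, e ∈ T ↔ e ∈ U ∧
      ∀ L : M, (∀ e : M, e ∈ U → SignedStep A L e → e ∈ L) → e ∈ L := fun e => mem_sep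
  have closed : ∀ e : M, e ∈ U → SignedStep A T e → e ∈ T := fun e he hs =>
    (hT e).2 ⟨he, fun L hL => hL e he (hs.mono fun z hz => ((hT z).1 hz).2 L hL)⟩
  -- The one-step consequences of `T` form a closed set, so `T` is contained in them.
  have inv : ∀ e : M, e ∈ U → (e ∈ T ↔ SignedStep A T e) := by
    refine fun e he => ⟨fun h => ?_, closed e he⟩
    have := ((hT e).1 h).2 (compr fun e : M => e ∈ U ∧ SignedStep A T e) fun e he hs =>
      (mem_sep).2 ⟨he, hs.mono fun z hz => ?_⟩
    · exact ((mem_sep).1 this).2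
    · rw [mem_sep] at hz
      exact closed z hz.1 hz.2
  have n0 := num_mem_omega (M := M) 0
  have n1 := num_mem_omega (M := M) 1
  -- The signs and the leading numerals of the codes are distinct, so only one clause of
  -- `SignedStep` can produce a given entry.
  have tmem : ∀ i j s : M, i ∈ (omega : M) → j ∈ (omega : M) → IsAssignment A s →
      ((pair (num 1) (pair (fMem i j) s) ∈ T ↔ ap s i ∈ ap s j) ∧
       (pair (num 0) (pair (fMem i j) s) ∈ T ↔ ¬ ap s i ∈ ap s j)) ∧
      ((pair (num 1) (pair (fEq i j) s) ∈ T ↔ ap s i = ap s j) ∧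
       (pair (num 0) (pair (fEq i j) s) ∈ T ↔ ¬ ap s i = ap s j)) := by
    intro i j s hi hj hs
    rw [inv _ (hU _ _ _ n0 (.mem' hi hj) hs), inv _ (hU _ _ _ n1 (.mem' hi hj) hs),
      inv _ (hU _ _ _ n0 (.eq' hi hj) hs), inv _ (hU _ _ _ n1 (.eq' hi hj) hs)]
    simp +contextual [SignedStep, fMem, fEq, fNot, fAnd, fEx, hi, hj, hs]
  have tnot : ∀ φ s : M, IsFormula φ → IsAssignment A s →
      ((pair (num 1) (pair (fNot φ) s) ∈ T ↔ pair (num 0) (pair φ s) ∈ T) ∧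
       (pair (num 0) (pair (fNot φ) s) ∈ T ↔ pair (num 1) (pair φ s) ∈ T)) := by
    intro φ s hφ hs
    rw [inv _ (hU _ _ _ n0 hφ.not' hs), inv _ (hU _ _ _ n1 hφ.not' hs)]
    simp [SignedStep, fMem, fEq, fNot, fAnd, fEx, hφ, hs]
  have tand : ∀ φ ψ s : M, IsFormula φ → IsFormula ψ → IsAssignment A s →
      ((pair (num 1) (pair (fAnd φ ψ) s) ∈ T ↔
        pair (num 1) (pair φ s) ∈ T ∧ pair (num 1) (pair ψ s) ∈ T) ∧
       (pair (num 0) (pair (fAnd φ ψ) s) ∈ T ↔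
        pair (num 0) (pair φ s) ∈ T ∨ pair (num 0) (pair ψ s) ∈ T)) := by
    intro φ ψ s hφ hψ hs
    rw [inv _ (hU _ _ _ n0 (hφ.and' hψ) hs), inv _ (hU _ _ _ n1 (hφ.and' hψ) hs)]
    simp [SignedStep, fMem, fEq, fNot, fAnd, fEx, hφ, hψ, hs]
  have tex : ∀ i φ s : M, i ∈ (omega : M) → IsFormula φ → IsAssignment A s →
      ((pair (num 1) (pair (fEx i φ) s) ∈ T ↔
        ∃ a : M, a ∈ A ∧ pair (num 1) (pair φ (upd s i a)) ∈ T) ∧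
       (pair (num 0) (pair (fEx i φ) s) ∈ T ↔
        ∀ a : M, a ∈ A → pair (num 0) (pair φ (upd s i a)) ∈ T)) := by
    intro i φ s hi hφ hs
    rw [inv _ (hU _ _ _ n0 (hφ.ex' hi) hs), inv _ (hU _ _ _ n1 (hφ.ex' hi) hs)]
    simp [SignedStep, fMem, fEq, fNot, fAnd, fEx, hφ, hi, hs]
  have dich : ∀ φ : M, IsFormula φ → ∀ s : M, IsAssignment A s →
      (pair (num 0) (pair φ s) ∈ T ↔ ¬ pair (num 1) (pair φ s) ∈ T) := by
    intro φ hφ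
    refine formula_induction (P := fun φ : M => ∀ s : M, IsAssignment A s →
      (pair (num 0) (pair φ s) ∈ T ↔ ¬ pair (num 1) (pair φ s) ∈ T)) ?_ ?_ ?_ ?_ ?_ hφ
    · intro i j hi hj s hs
      rw [(tmem i j s hi hj hs).1.1, (tmem i j s hi hj hs).1.2]
    · intro i j hi hj s hs
      rw [(tmem i j s hi hj hs).2.1, (tmem i j s hi hj hs).2.2]
    · intro φ hφ ih s hs
      rw [(tnot φ s hφ hs).1, (tnot φ s hφ hs).2, ih s hs, not_not]
    · intro φ ψ hφ hψ ih ih' s hs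
      rw [(tand φ ψ s hφ hψ hs).1, (tand φ ψ s hφ hψ hs).2, ih s hs, ih' s hs]
      tauto
    · intro i φ hi hφ ih s hs
      rw [(tex i φ s hi hφ hs).1, (tex i φ s hi hφ hs).2]
      have : ∀ a : M, a ∈ A → (pair (num 0) (pair φ (upd s i a)) ∈ T ↔
          ¬ pair (num 1) (pair φ (upd s i a)) ∈ T) := fun a ha =>
        ih _ (update_eq_upd hs.functional i a ▸ hs.update ha)
      simp +contextual [this]
  refine ⟨compr fun z : M => z ∈ prod (V (omega : M)) (pow (prod omega A)) ∧ pair (num 1) z ∈ T, ?_⟩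
  have hS : ∀ φ s : M, IsFormula φ → IsAssignment A s →
      (pair φ s ∈ compr (fun z : M => z ∈ prod (V (omega : M)) (pow (prod omega A)) ∧
        pair (num 1) z ∈ T) ↔ pair (num 1) (pair φ s) ∈ T) := fun φ s hφ hs => by
    rw [mem_sep, pair_mem_prod, mem_pow]
    exact ⟨fun h => h.2, fun h => ⟨⟨hφ.mem_V, IsFun.sub_prod hs⟩, h⟩⟩
  rw [isSatRelation_iff]
  intro s hs
  refine ⟨fun i j hi hj => ?_, fun φ hφ => ?_, fun φ ψ hφ hψ => ?_, fun i φ hi hφ => ?_⟩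
  · rw [hS _ _ (.mem' hi hj) hs, hS _ _ (.eq' hi hj) hs]
    exact ⟨(tmem i j s hi hj hs).1.1, (tmem i j s hi hj hs).2.1⟩
  · rw [hS _ _ hφ.not' hs, hS _ _ hφ hs, (tnot φ s hφ hs).1, dich φ hφ s hs]
  · rw [hS _ _ (hφ.and' hψ) hs, hS _ _ hφ hs, hS _ _ hψ hs, (tand φ ψ s hφ hψ hs).1]
  · rw [hS _ _ (hφ.ex' hi) hs, (tex i φ s hi hφ hs).1]
    refine exists_congr fun a => and_congr_right fun ha => ?_
    rw [hS _ _ hφ (update_eq_upd hs.functional i a ▸ hs.update ha)]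

theorem sat_iff {A S φ s : M} (hS : IsSatRelation A S) (hφ : IsFormula φ)
    (hs : IsAssignment A s) : Sat A φ s ↔ pair φ s ∈ S :=
  ⟨fun ⟨_, h', h⟩ => (hS.unique h' hφ s hs).2 h, fun h => ⟨S, hS, h⟩⟩

section clauses
variable {A s i j φ ψ : M} (hs : IsAssignment A s)
include hs

theorem sat_mem (hi : i ∈ (omega : M)) (hj : j ∈ (omega : M)) :
    Sat A (fMem i j) s ↔ app s i ∈ app s j := by
  obtain ⟨S, hS⟩ := exists_isSatRelation A
  rw [sat_iff hS (.mem' hi hj) hs, ((hS s hs).1 i j hi hj).1]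

theorem sat_eq (hi : i ∈ (omega : M)) (hj : j ∈ (omega : M)) :
    Sat A (fEq i j) s ↔ app s i = app s j := by
  obtain ⟨S, hS⟩ := exists_isSatRelation A
  rw [sat_iff hS (.eq' hi hj) hs, ((hS s hs).1 i j hi hj).2]

theorem sat_not (hφ : IsFormula φ) : Sat A (fNot φ) s ↔ ¬ Sat A φ s := by
  obtain ⟨S, hS⟩ := exists_isSatRelation A
  rw [sat_iff hS hφ.not' hs, sat_iff hS hφ hs, (hS s hs).2.1 φ hφ]

theorem sat_and (hφ : IsFormula φ) (hψ : IsFormula ψ) :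
    Sat A (fAnd φ ψ) s ↔ Sat A φ s ∧ Sat A ψ s := by
  obtain ⟨S, hS⟩ := exists_isSatRelation A
  rw [sat_iff hS (hφ.and' hψ) hs, sat_iff hS hφ hs, sat_iff hS hψ hs, (hS s hs).2.2.1 φ ψ hφ hψ]

theorem sat_ex (hi : i ∈ (omega : M)) (hφ : IsFormula φ) :
    Sat A (fEx i φ) s ↔ ∃ a : M, a ∈ A ∧ Sat A φ (update s i a) := by
  obtain ⟨S, hS⟩ := exists_isSatRelation A
  rw [sat_iff hS (hφ.ex' hi) hs, (hS s hs).2.2.2 i φ hi hφ]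
  exact exists_congr fun a => and_congr_right fun ha => (sat_iff hS hφ (hs.update ha)).symm

theorem sat_bex (hA : IsTransitive A) (hi : i ∈ (omega : M)) (hj : j ∈ (omega : M)) (hij : i ≠ j)
    (hφ : IsFormula φ) :
    Sat A (fBddEx i j φ) s ↔ ∃ a : M, a ∈ app s j ∧ Sat A φ (update s i a) := by
  unfold fBddEx
  rw [sat_ex hs hi ((IsFormula.mem' hi hj).and' hφ)]
  have key : ∀ a : M, a ∈ A → (Sat A (fAnd (fMem i j) φ) (update s i a) ↔
      a ∈ app s j ∧ Sat A φ (update s i a)) := fun a ha => by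
    rw [sat_and (hs.update ha) (.mem' hi hj) hφ, sat_mem (hs.update ha) hi hj,
      app_update_self hs.functional hi, app_update_ne hs.functional hj hij.symm]
  constructor
  · rintro ⟨a, ha, h⟩; exact ⟨a, (key a ha).1 h⟩
  · rintro ⟨a, ha, h⟩
    have ha' := hA _ (hs.2 j hj) a ha
    exact ⟨a, ha', (key a ha').2 ⟨ha, h⟩⟩

end clauses

end ZFModel

end

noncomputable section

namespace ZFModel

variable {M : Type u} [Membership M M] [Nonempty M] [ModelsZF M]

/-! ## Absolute relations

A relation between finitely many sets is `D0` if it is expressed by `Σ_0` formulas, with arbitrary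
variables, in all transitive sets. -/

/-- Types of tuples of elements of `M`. -/
class Tup (M : Type u) (α : Type u) [Membership M M] [Nonempty M] where
  map : (M → M) → α → α
  All : (M → Prop) → α → Prop
  map_congr : ∀ {σ τ : M → M} {x : α}, All (fun y => σ y = τ y) x → map σ x = map τ x
  map_map : ∀ (σ τ : M → M) (x : α), map σ (map τ x) = map (fun y => σ (τ y)) x
  all_mono : ∀ {p q : M → Prop} {x : α}, (∀ y, p y → q y) → All p x → All q x
  all_and : ∀ {p q : M → Prop} {x : α}, All p x → All q x → All (fun y => p y ∧ q y) x
  fresh : ∀ x : α, ∃ F : Finset M, ∀ p : M → Prop, (∀ y ∈ F, p y) → All p x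
  exists_idx : [ModelsZF M] → ∀ (k : ℕ) (x : α), ∃ (k' : ℕ) (i : α), k ≤ k' ∧
    All (fun y => ∃ n : ℕ, k ≤ n ∧ n < k' ∧ y = num n) i ∧ ∀ A s : M, IsAssignment A s →
      All (fun y => y ∈ A) x → ∃ s' : M, IsAssignment A s' ∧ map (app s') i = x ∧
        ∀ m < k, app s' (num m) = app s (num m)

instance : Tup M M where
  map σ := σ
  All p := p
  map_congr h := h
  map_map _ _ _ := rfl
  all_mono h := h _
  all_and h h' := ⟨h, h'⟩
  fresh x := ⟨{x}, fun p h => h x (by simp)⟩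
  exists_idx k x := ⟨k + 1, num k, Nat.le_succ k, ⟨k, le_rfl, Nat.lt_succ_self k, rfl⟩,
    fun A s hs hx => ⟨update s (num k) x, hs.update hx,
      app_update_self hs.functional (num_mem_omega k), fun m hm =>
        app_update_ne hs.functional (num_mem_omega m) (num_ne hm.ne)⟩⟩

instance {α β : Type u} [Tup M α] [Tup M β] : Tup M (α × β) where
  map σ x := (Tup.map σ x.1, Tup.map σ x.2)
  All p x := Tup.All p x.1 ∧ Tup.All p x.2
  map_congr h := Prod.ext (Tup.map_congr h.1) (Tup.map_congr h.2)
  map_map σ τ x := Prod.ext (Tup.map_map σ τ x.1) (Tup.map_map σ τ x.2)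
  all_mono h h' := ⟨Tup.all_mono h h'.1, Tup.all_mono h h'.2⟩
  all_and h h' := ⟨Tup.all_and h.1 h'.1, Tup.all_and h.2 h'.2⟩
  fresh x := by
    classical
    obtain ⟨F, hF⟩ := Tup.fresh (M := M) x.1
    obtain ⟨G, hG⟩ := Tup.fresh (M := M) x.2
    exact ⟨F ∪ G, fun p h => ⟨hF p fun y hy => h y (by simp [hy]),
      hG p fun y hy => h y (by simp [hy])⟩⟩
  exists_idx k x := by
    obtain ⟨k1, i1, hk1, hi1, h1⟩ := Tup.exists_idx (M := M) k x.1
    obtain ⟨k2, i2, hk2, hi2, h2⟩ := Tup.exists_idx (M := M) k1 x.2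
    refine ⟨k2, (i1, i2), hk1.trans hk2,
      ⟨Tup.all_mono (fun y ⟨n, a, b, c⟩ => ⟨n, a, b.trans_le hk2, c⟩) hi1,
        Tup.all_mono (fun y ⟨n, a, b, c⟩ => ⟨n, hk1.trans a, b, c⟩) hi2⟩, ?_⟩
    intro A s hs hx
    obtain ⟨s1, hs1, e1, a1⟩ := h1 A s hs hx.1
    obtain ⟨s2, hs2, e2, a2⟩ := h2 A s1 hs1 hx.2
    refine ⟨s2, hs2, Prod.ext ?_ e2, fun m hm => (a2 m (hm.trans_le hk1)).trans (a1 m hm)⟩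
    rw [← e1]
    refine Tup.map_congr (Tup.all_mono ?_ hi1)
    rintro y ⟨n, _, hn, rfl⟩
    exact a2 n hn

/-- Functions that select components of tuples. -/
@[fun_prop]
def DV (M : Type u) [Membership M M] [Nonempty M] {α β : Type u} [Tup M α] [Tup M β]
    (f : α → β) : Prop :=
  (∀ (σ : M → M) (x : α), f (Tup.map σ x) = Tup.map σ (f x)) ∧
    ∀ (p : M → Prop) (x : α), Tup.All p x → Tup.All p (f x)

/-- Absolute relations. -/
@[fun_prop]
def D0 (M : Type u) [Membership M M] [Nonempty M] {α : Type u} [Tup M α] (P : α → Prop) : Prop :=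
  ∀ i : α, Tup.All (fun y : M => y ∈ (omega : M)) i → ∃ φ : M, IsSigmaZero φ ∧
    ∀ A s : M, IsTransitive A → IsAssignment A s → (Sat A φ s ↔ P (Tup.map (app s) i))

section closure
variable {α β γ : Type u} [Tup M α] [Tup M β] [Tup M γ]

@[fun_prop] theorem DV.id : DV M fun x : α => x := ⟨fun _ _ => rfl, fun _ _ h => h⟩
@[fun_prop] theorem DV.comp {f : β → γ} {g : α → β} (hf : DV M f) (hg : DV M g) :
    DV M fun x => f (g x) :=
  ⟨fun σ x => by beta_reduce; rw [hg.1, hf.1], fun p x h => hf.2 p _ (hg.2 p x h)⟩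
@[fun_prop] theorem DV.fst {f : α → β × γ} (hf : DV M f) : DV M fun x => (f x).1 :=
  ⟨fun σ x => by beta_reduce; rw [hf.1]; rfl, fun p x h => (hf.2 p x h).1⟩
@[fun_prop] theorem DV.snd {f : α → β × γ} (hf : DV M f) : DV M fun x => (f x).2 :=
  ⟨fun σ x => by beta_reduce; rw [hf.1]; rfl, fun p x h => (hf.2 p x h).2⟩
@[fun_prop] theorem DV.prodMk {f : α → β} {g : α → γ} (hf : DV M f) (hg : DV M g) :
    DV M fun x => (f x, g x) :=
  ⟨fun σ x => by beta_reduce; rw [hf.1, hg.1]; rfl, fun p x h => ⟨hf.2 p x h, hg.2 p x h⟩⟩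

@[fun_prop] theorem D0.comp {P : β → Prop} {g : α → β} (hP : D0 M P) (hg : DV M g) :
    D0 M fun x => P (g x) := fun i hi => by
  obtain ⟨φ, h1, h2⟩ := hP (g i) (hg.2 _ _ hi)
  exact ⟨φ, h1, fun A s hA hs => by beta_reduce; rw [h2 A s hA hs, hg.1]⟩

@[fun_prop] theorem D0.not {P : α → Prop} (hP : D0 M P) : D0 M fun x => ¬ P x := fun i hi => by
  obtain ⟨φ, h1, h2⟩ := hP i hi
  exact ⟨fNot φ, h1.not', fun A s hA hs => by rw [sat_not hs h1.isFormula, h2 A s hA hs]⟩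

@[fun_prop] theorem D0.and {P Q : α → Prop} (hP : D0 M P) (hQ : D0 M Q) :
    D0 M fun x => P x ∧ Q x := fun i hi => by
  obtain ⟨φ, h1, h2⟩ := hP i hi
  obtain ⟨ψ, h3, h4⟩ := hQ i hi
  exact ⟨fAnd φ ψ, h1.and' h3, fun A s hA hs => by
    rw [sat_and hs h1.isFormula h3.isFormula, h2 A s hA hs, h4 A s hA hs]⟩

@[fun_prop] theorem D0.or {P Q : α → Prop} (hP : D0 M P) (hQ : D0 M Q) :
    D0 M fun x => P x ∨ Q x := by
  have : (fun x => P x ∨ Q x) = fun x => ¬ (¬ P x ∧ ¬ Q x) := by funext x; simp [or_iff_not_and_not]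
  rw [this]; fun_prop

@[fun_prop] theorem D0.imp {P Q : α → Prop} (hP : D0 M P) (hQ : D0 M Q) :
    D0 M fun x => P x → Q x := by
  simp only [imp_iff_not_or]; fun_prop

@[fun_prop] theorem D0.iff {P Q : α → Prop} (hP : D0 M P) (hQ : D0 M Q) :
    D0 M fun x => P x ↔ Q x := by
  simp only [iff_def]; fun_prop

@[fun_prop] theorem D0.mem {f g : α → M} (hf : DV M f) (hg : DV M g) :
    D0 M fun x => f x ∈ g x := fun i hi =>
  ⟨fMem (f i) (g i), .mem' (hf.2 _ _ hi) (hg.2 _ _ hi), fun A s hA hs => by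
    rw [sat_mem hs (hf.2 _ _ hi) (hg.2 _ _ hi)]; beta_reduce; rw [hf.1, hg.1]; rfl⟩

@[fun_prop] theorem D0.eq {f g : α → M} (hf : DV M f) (hg : DV M g) :
    D0 M fun x => f x = g x := fun i hi =>
  ⟨fEq (f i) (g i), .eq' (hf.2 _ _ hi) (hg.2 _ _ hi), fun A s hA hs => by
    rw [sat_eq hs (hf.2 _ _ hi) (hg.2 _ _ hi)]; beta_reduce; rw [hf.1, hg.1]; rfl⟩

/-- Only finitely many elements of `M` occur in a tuple, so some standard numeral avoids them. It
serves as the bound variable in `D0.bex`. -/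
theorem exists_fresh (x : α) : ∃ m : M, m ∈ (omega : M) ∧ Tup.All (fun y : M => y ≠ m) x := by
  obtain ⟨F, hF⟩ := Tup.fresh (M := M) x
  obtain ⟨n, hn⟩ := Infinite.exists_notMem_finset (F.preimage (num : ℕ → M)
    num_injective.injOn)
  exact ⟨num n, num_mem_omega n, hF _ fun y hy h => hn (by simpa [← h] using hy)⟩

@[fun_prop] theorem D0.bex {f : α → M} {P : α → M → Prop} (hf : DV M f)
    (hP : D0 M fun p : α × M => P p.1 p.2) : D0 M fun x => ∃ y : M, y ∈ f x ∧ P x y := by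
  intro i hi
  obtain ⟨m, hm, hfr⟩ := exists_fresh (M := M) i
  obtain ⟨φ, h1, h2⟩ := hP (i, m) ⟨hi, hm⟩
  have hne : f i ≠ m := hf.2 _ _ hfr
  refine ⟨fBddEx m (f i) φ, h1.bex' hm (hf.2 _ _ hi) hne.symm, fun A s hA hs => ?_⟩
  beta_reduce
  rw [sat_bex hs hA hm (hf.2 _ _ hi) hne.symm h1.isFormula, hf.1]
  refine exists_congr fun a => and_congr_right fun ha => ?_
  have ha' : a ∈ A := hA _ (hs.2 _ (hf.2 _ _ hi)) a ha
  rw [h2 A _ hA (hs.update ha')]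
  have e1 : Tup.map (app (update s m a)) i = Tup.map (app s) i :=
    Tup.map_congr (Tup.all_mono (fun y hy => app_update_ne hs.functional hy.1 hy.2)
      (Tup.all_and hi hfr))
  have e2 : app (update s m a) m = a := app_update_self hs.functional hm
  change P (Tup.map (app (update s m a)) i) (app (update s m a) m) ↔ _
  rw [e1, e2]

@[fun_prop] theorem D0.ball {f : α → M} {P : α → M → Prop} (hf : DV M f)
    (hP : D0 M fun p : α × M => P p.1 p.2) : D0 M fun x => ∀ y : M, y ∈ f x → P x y := by
  have : (fun x => ∀ y : M, y ∈ f x → P x y) = fun x => ¬ ∃ y : M, y ∈ f x ∧ ¬ P x y := by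
    funext x; simp
  rw [this]; fun_prop

end closure

/-- `j` preserves `Σ_0` formulas. -/
abbrev IsSigmaZeroElementary (A B j : M) : Prop := IsElementaryFor IsSigmaZero A B j

theorem isAssignment_comp {A B j s : M} (hj : IsFun j A B) (hs : IsAssignment A s) :
    IsAssignment B (lam omega fun m => app j (app s m)) := by
  have h1 := hj.functional
  have h2 := hs.functional
  exact .lam (fun m hm => hj.2 _ (hs.2 m hm)) (by fun_prop (disch := assumption))

theorem app_comp {A B j s m : M} (hj : IsFun j A B) (hs : IsAssignment A s)
    (hm : m ∈ (omega : M)) : app (lam omega fun m => app j (app s m)) m = app j (app s m) := by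
  have h1 := hj.functional
  have h2 := hs.functional
  exact app_lam hm (by fun_prop (disch := assumption))

theorem isAssignment_const {A a : M} (ha : a ∈ A) : IsAssignment A (lam omega fun _ => a) :=
  .lam fun _ _ => ha

/-- The tuple is realized by an assignment at standard variables, and elementarity applies to the
formula that `D0` provides for these variables. -/
theorem D0.preserved {α : Type u} [Tup M α] {P : α → Prop} (hP : D0 M P) {A B j : M}
    (hA : IsTransitive A) (hB : IsTransitive B) (hj : IsSigmaZeroElementary A B j)
    (hne : ∃ a : M, a ∈ A) (x : α) (hx : Tup.All (fun y : M => y ∈ A) x) :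
    P x ↔ P (Tup.map (app j) x) := by
  obtain ⟨a, ha⟩ := hne
  obtain ⟨k, i, _, hi, h⟩ := Tup.exists_idx (M := M) 0 x
  obtain ⟨s, hs, e, _⟩ := h A _ (isAssignment_const ha) hx
  have hi' : Tup.All (fun y : M => y ∈ (omega : M)) i :=
    Tup.all_mono (fun y ⟨n, _, _, hn⟩ => hn ▸ num_mem_omega n) hi
  obtain ⟨φ, h1, h2⟩ := hP i hi'
  have := hj.2 φ s h1 hs
  rw [h2 A s hA hs, h2 B _ hB (isAssignment_comp hj.1 hs), e] at this
  rw [this, ← e, Tup.map_map, Tup.map_congr (τ := fun y => app j (app s y))]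
  exact Tup.all_mono (fun y hy => app_comp hj.1 hs hy) hi'

/-! ### Absolute definitions -/

section defs
variable {α : Type u} [Tup M α]

@[fun_prop] theorem D0.sub {f g : α → M} (hf : DV M f) (hg : DV M g) :
    D0 M fun x => Sub (f x) (g x) := by unfold Sub; fun_prop

def EqEmpty (a : M) : Prop := ∀ y : M, y ∈ a → y ≠ y
def EqSucc (t q : M) : Prop :=
  q ∈ t ∧ (∀ r : M, r ∈ q → r ∈ t) ∧ ∀ r : M, r ∈ t → r ∈ q ∨ r = q
def EqShift (w t q : M) : Prop := (q ∈ w ∧ EqSucc t q) ∨ (¬ q ∈ w ∧ t = q)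
def EqTagZero (w u v : M) : Prop :=
  (∀ t : M, t ∈ u → ∃ q : M, q ∈ v ∧ EqShift w t q) ∧
    ∀ q : M, q ∈ v → ∃ t : M, t ∈ u ∧ EqShift w t q
def EqTagOne (w u v : M) : Prop :=
  (∃ e : M, e ∈ u ∧ EqEmpty e) ∧
  (∀ t : M, t ∈ u → (EqEmpty t ∨ ∃ q : M, q ∈ v ∧ EqShift w t q)) ∧
    ∀ q : M, q ∈ v → ∃ t : M, t ∈ u ∧ EqShift w t q
/-- `z = ⌜x, y⌝`, where `w` stands for `ω`. -/
def EqPair (w z x y : M) : Prop :=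
  (∀ u : M, u ∈ z → ((∃ v : M, v ∈ x ∧ EqTagZero w u v) ∨ ∃ v : M, v ∈ y ∧ EqTagOne w u v)) ∧
  (∀ v : M, v ∈ x → ∃ u : M, u ∈ z ∧ EqTagZero w u v) ∧
  ∀ v : M, v ∈ y → ∃ u : M, u ∈ z ∧ EqTagOne w u v
/-- `⌜x, y⌝ ∈ R`, where `w` stands for `ω`. -/
def PairMem (w x y R : M) : Prop := ∃ z : M, z ∈ R ∧ EqPair w z x y
/-- `w = ω`. -/
def EqOmega (w : M) : Prop := (∃ e : M, e ∈ w ∧ EqEmpty e) ∧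
  (∀ n : M, n ∈ w → ∃ m : M, m ∈ w ∧ EqSucc m n) ∧
  (∀ n : M, n ∈ w → ∀ m : M, m ∈ n → m ∈ w) ∧
  ∀ n : M, n ∈ w → (EqEmpty n ∨ ∃ m : M, m ∈ w ∧ EqSucc n m)

@[fun_prop] theorem D0.eqEmpty {f : α → M} (hf : DV M f) : D0 M fun x => EqEmpty (f x) := by
  unfold EqEmpty; fun_prop
@[fun_prop] theorem D0.eqSucc {f g : α → M} (hf : DV M f) (hg : DV M g) :
    D0 M fun x => EqSucc (f x) (g x) := by unfold EqSucc; fun_prop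
@[fun_prop] theorem D0.eqShift {f g h : α → M} (hf : DV M f) (hg : DV M g) (hh : DV M h) :
    D0 M fun x => EqShift (f x) (g x) (h x) := by unfold EqShift; fun_prop
@[fun_prop] theorem D0.eqTagZero {f g h : α → M} (hf : DV M f) (hg : DV M g) (hh : DV M h) :
    D0 M fun x => EqTagZero (f x) (g x) (h x) := by unfold EqTagZero; fun_prop
@[fun_prop] theorem D0.eqTagOne {f g h : α → M} (hf : DV M f) (hg : DV M g) (hh : DV M h) :
    D0 M fun x => EqTagOne (f x) (g x) (h x) := by unfold EqTagOne; fun_prop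
@[fun_prop] theorem D0.eqPair {f g h k : α → M} (hf : DV M f) (hg : DV M g) (hh : DV M h)
    (hk : DV M k) : D0 M fun x => EqPair (f x) (g x) (h x) (k x) := by unfold EqPair; fun_prop
@[fun_prop] theorem D0.pairMem {f g h k : α → M} (hf : DV M f) (hg : DV M g) (hh : DV M h)
    (hk : DV M k) : D0 M fun x => PairMem (f x) (g x) (h x) (k x) := by unfold PairMem; fun_prop
@[fun_prop] theorem D0.eqOmega {f : α → M} (hf : DV M f) : D0 M fun x => EqOmega (f x) := by
  unfold EqOmega; fun_prop

theorem eqEmpty_iff {a : M} : EqEmpty a ↔ a = empty := by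
  rw [eq_empty_iff]; simp [EqEmpty]
theorem eqSucc_iff {t q : M} : EqSucc t q ↔ t = succ q := by
  constructor
  · rintro ⟨h1, h2, h3⟩
    exact ext' fun z => by
      rw [mem_succ]; exact ⟨h3 z, fun h => h.elim (h2 z) fun h => h ▸ h1⟩
  · rintro rfl
    exact ⟨by simp, fun r h => by simp [h], fun r h => mem_succ.1 h⟩
theorem eqShift_omega {t q : M} : EqShift omega t q ↔ t = shift q := by
  rw [eq_shift_iff]; simp [EqShift, eqSucc_iff]
theorem eqTagZero_omega {u v : M} : EqTagZero omega u v ↔ u = tagZero v := by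
  simp only [EqTagZero, eqShift_omega, ext_iff' (a := u), mem_tagZero]
  constructor
  · rintro ⟨h1, h2⟩ z
    exact ⟨h1 z, fun ⟨q, hq, h⟩ => by obtain ⟨t, ht, h'⟩ := h2 q hq; rwa [h, ← h']⟩
  · exact fun h => ⟨fun t ht => (h t).1 ht, fun q hq => ⟨_, (h _).2 ⟨q, hq, rfl⟩, rfl⟩⟩
theorem eqTagOne_omega {u v : M} : EqTagOne omega u v ↔ u = tagOne v := by
  simp only [EqTagOne, eqShift_omega, ext_iff' (a := u), mem_tagOne, eqEmpty_iff]
  constructor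
  · rintro ⟨⟨e, he, rfl⟩, h1, h2⟩ z
    refine ⟨h1 z, ?_⟩
    rintro (rfl | ⟨q, hq, h⟩)
    · exact he
    · obtain ⟨t, ht, h'⟩ := h2 q hq
      rwa [h, ← h']
  · exact fun h => ⟨⟨empty, (h _).2 (Or.inl rfl), rfl⟩, fun t ht => (h t).1 ht,
      fun q hq => ⟨_, (h _).2 (Or.inr ⟨q, hq, rfl⟩), rfl⟩⟩
theorem eqPair_omega {z x y : M} : EqPair omega z x y ↔ z = pair x y := by
  simp only [EqPair, eqTagZero_omega, eqTagOne_omega, ext_iff' (a := z), mem_pair]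
  constructor
  · rintro ⟨h1, h2, h3⟩ u
    refine ⟨h1 u, ?_⟩
    rintro (⟨v, hv, rfl⟩ | ⟨v, hv, rfl⟩)
    · obtain ⟨t, ht, h'⟩ := h2 v hv; rwa [← h']
    · obtain ⟨t, ht, h'⟩ := h3 v hv; rwa [← h']
  · exact fun h => ⟨fun u hu => (h u).1 hu, fun v hv => ⟨_, (h _).2 (Or.inl ⟨v, hv, rfl⟩), rfl⟩,
      fun v hv => ⟨_, (h _).2 (Or.inr ⟨v, hv, rfl⟩), rfl⟩⟩
theorem pairMem_omega {x y R : M} : PairMem omega x y R ↔ pair x y ∈ R := by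
  simp only [PairMem, eqPair_omega]
  exact ⟨fun ⟨z, hz, h⟩ => h ▸ hz, fun h => ⟨_, h, rfl⟩⟩

/-- Foundation bounds the set from above: a minimal element outside `ω` would be zero or the
successor of an element of `ω`. -/
theorem eqOmega_iff {w : M} : EqOmega w ↔ w = omega := by
  simp only [EqOmega, eqEmpty_iff, eqSucc_iff]
  constructor
  · rintro ⟨⟨e, he, rfl⟩, h1, h2, h3⟩
    have hsub : Sub omega w := omega_sub ⟨he, fun n hn => by
      obtain ⟨m, hm, rfl⟩ := h1 n hn; exact hm⟩
    refine Sub.antisymm ?_ hsub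
    intro n hn
    by_contra hno
    obtain ⟨m, hm, hmo, hmin⟩ := exists_minimal (P := fun n : M => ¬ n ∈ (omega : M)) hn hno
    rcases h3 m hm with rfl | ⟨k, hk, rfl⟩
    · exact hmo empty_mem_omega
    · exact hmo (succ_mem_omega (not_not.1 (hmin k (mem_succ_self k) hk)))
  · rintro rfl
    exact ⟨⟨_, empty_mem_omega, rfl⟩, fun n hn => ⟨_, succ_mem_omega hn, rfl⟩,
      fun n hn m hm => omega_transitive n hn m hm, fun n hn => omega_cases hn⟩

end defs

end ZFModel

end

noncomputable section

namespace ZFModel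

variable {M : Type u} [Membership M M] [Nonempty M] [ModelsZF M]

/-! ## The Levy hierarchy is increasing -/

/-- The classes are taken literally, so a `Σ_n` formula need not be `Σ_(n+1)`. A double negation of
the `Σ_0` matrix inserts the missing empty block of quantifiers. -/
theorem IsSigma.raise {n φ : M} (h : IsSigma n φ) : ∃ φ' : M, IsSigma (succ n) φ' ∧
    ∀ A s : M, IsAssignment A s → (Sat A φ s ↔ Sat A φ' s) := by
  refine sigma_induction (P := fun n φ : M => ∃ φ' : M, IsSigma (succ n) φ' ∧
    ∀ A s : M, IsAssignment A s → (Sat A φ s ↔ Sat A φ' s)) ?_ ?_ ?_ h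
  · intro ψ hψ
    refine ⟨⟨ψ, .one hψ, fun _ _ _ => Iff.rfl⟩, fNot (fNot ψ),
      (IsSigma.one hψ.not').not' empty_mem_omega, fun A s hs => ?_⟩
    rw [sat_not hs hψ.isFormula.not', sat_not hs hψ.isFormula, not_not]
  · rintro m ψ hm h ⟨ψ', h', e⟩
    refine ⟨fNot ψ', h'.not' (succ_mem_omega hm), fun A s hs => ?_⟩
    rw [sat_not hs h.isFormula, sat_not hs h'.isFormula, e A s hs]
  · rintro m i ψ hm hi h ⟨ψ', h', e⟩
    refine ⟨fEx i ψ', h'.ex' (succ_mem_omega hm) hi, fun A s hs => ?_⟩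
    rw [sat_ex hs hi h.isFormula, sat_ex hs hi h'.isFormula]
    exact exists_congr fun a => and_congr_right fun ha => e A _ (hs.update ha)

theorem IsSigmaElementarySelf.pred {n A j : M} (h : IsSigmaElementarySelf (succ n) A j) :
    IsSigmaElementarySelf n A j := by
  refine ⟨h.1, fun φ s hφ hs => ?_⟩
  obtain ⟨φ', h', e⟩ := hφ.raise
  rw [e A s hs, e A _ (isAssignment_comp h.1 hs), h.2 φ' s h' hs]

theorem isElementaryFor_iff {Γ : M → Prop} {A B j : M} : IsElementaryFor Γ A B j ↔ IsFun j A B ∧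
    ∀ φ s : M, Γ φ → IsAssignment A s →
      (Sat A φ s ↔ Sat B φ (lam omega fun m => ap j (ap s m))) := by
  refine and_congr_right fun h => forall₄_congr fun φ s _ hs => ?_
  simp only [app_eq_ap h.functional, app_eq_ap hs.functional]

@[fun_prop] theorem Def.isElementarySelf {α : Type u} [Ctx M α] {f g : α → M} (hf : DefF M f)
    (hg : DefF M g) : Def M fun x => IsElementarySelf (f x) (g x) := by
  simp only [IsElementarySelf, isElementaryFor_iff]; fun_prop

@[fun_prop] theorem Def.isSigmaElementarySelf {α : Type u} [Ctx M α] {f g h : α → M}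
    (hf : DefF M f) (hg : DefF M g) (hh : DefF M h) :
    Def M fun x => IsSigmaElementarySelf (f x) (g x) (h x) := by
  simp only [IsSigmaElementarySelf, isElementaryFor_iff]; fun_prop

theorem IsSigmaElementarySelf.to_one {n A j : M} (hn : n ∈ (omega : M)) :
    IsSigmaElementarySelf (succ n) A j → IsSigmaElementarySelf (num 1) A j :=
  omega_induction (P := fun n : M => IsSigmaElementarySelf (succ n) A j →
    IsSigmaElementarySelf (num 1) A j) (fun h => h) (fun n _ ih h => ih h.pred) hn

theorem IsElementarySelf.sigma {n A j : M} (h : IsElementarySelf A j) :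
    IsSigmaElementarySelf n A j := ⟨h.1, fun φ s hφ hs => h.2 φ s hφ.isFormula hs⟩

theorem IsSigmaElementarySelf.sigmaZero {A j : M} (h : IsSigmaElementarySelf (num 1) A j) :
    IsSigmaZeroElementary A A j := ⟨h.1, fun φ s hφ hs => h.2 φ s (.one hφ) hs⟩

theorem IsElementarySelf.sigmaZero {A j : M} (h : IsElementarySelf A j) :
    IsSigmaZeroElementary A A j := ⟨h.1, fun φ s hφ hs => h.2 φ s hφ.isFormula hs⟩

/-! ## Finite sets -/

/-- Tarski's notion of a finite set. -/
def IsFin (x : M) : Prop := ∀ F : M, empty ∈ F →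
  (∀ a b : M, a ∈ F → b ∈ x → union a (dbl b b) ∈ F) → x ∈ F

@[fun_prop] theorem Def.isFin {α : Type u} [Ctx M α] {f : α → M} (hf : DefF M f) :
    Def M fun x => IsFin (f x) := by unfold IsFin; fun_prop

theorem IsFin.induction {P : M → Prop} {x : M} (hx : IsFin x) (h0 : P empty)
    (hs : ∀ a b : M, Sub a x → b ∈ x → P a → P (union a (dbl b b)))
    (hP : Def M P := by fun_prop (disch := assumption)) : P x := by
  refine ((mem_sep).1 (hx (compr fun a : M => a ∈ pow x ∧ P a) ?_ ?_)).2
  · exact (mem_sep).2 ⟨mem_pow.2 (empty_sub x), h0⟩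
  · intro a b ha hb
    rw [mem_sep, mem_pow] at ha ⊢
    refine ⟨fun z hz => ?_, hs a b ha.1 hb ha.2⟩
    simp only [mem_union, mem_dbl, or_self] at hz
    rcases hz with h | rfl
    · exact ha.1 z h
    · exact hb

theorem isFin_empty : IsFin (empty : M) := fun _ h _ => h

theorem IsFin.insert {x b : M} (hx : IsFin x) : IsFin (union x (dbl b b)) := fun F h0 h =>
  h x b (hx F h0 fun a c ha hc => h a c ha (mem_union.2 (Or.inl hc))) (by simp)

theorem IsFin.sub {x y : M} (hx : IsFin x) (hy : Sub y x) : IsFin y := by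
  have e : inter x y = y := ext' fun z => by
    rw [mem_inter]; exact ⟨fun h => h.2, fun h => ⟨hy z h, h⟩⟩
  rw [← e]
  refine hx.induction (P := fun a : M => IsFin (inter a y)) ?_ ?_
  · have : inter empty y = empty := ext' fun z => by simp
    rw [this]; exact isFin_empty
  · intro a b _ _ ha
    by_cases hb : b ∈ y
    · have : inter (union a (dbl b b)) y = union (inter a y) (dbl b b) := ext' fun z => by
        simp only [mem_inter, mem_union, mem_dbl, or_self, or_and_right]
        exact or_congr_right ⟨fun h => h.1, fun h => ⟨h, h ▸ hb⟩⟩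
      rw [this]; exact ha.insert
    · have : inter (union a (dbl b b)) y = inter a y := ext' fun z => by
        simp only [mem_inter, mem_union, mem_dbl, or_self, or_and_right]
        exact or_iff_left fun h => hb (h.1 ▸ h.2)
      rw [this]; exact ha

theorem IsFin.union {x y : M} (hx : IsFin x) (hy : IsFin y) : IsFin (union x y) := by
  refine hy.induction (P := fun a : M => IsFin (ZFModel.union x a)) ?_ ?_
  · have : ZFModel.union x empty = x := ext' fun z => by simp
    rw [this]; exact hx
  · intro a b _ _ ha
    have : ZFModel.union x (ZFModel.union a (dbl b b)) = ZFModel.union (ZFModel.union x a) (dbl b b) :=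
      ext' fun z => by simp [or_assoc]
    rw [this]; exact ha.insert

theorem IsFin.replace {x : M} {F : M → M} (hx : IsFin x) (hF : DefF M F := by fun_prop (disch := assumption)) :
    IsFin (compr fun y : M => ∃ z : M, z ∈ x ∧ y = F z) := by
  refine hx.induction (P := fun x : M => IsFin (compr fun y : M => ∃ z : M, z ∈ x ∧ y = F z)) ?_ ?_
  · have : (compr fun y : M => ∃ z : M, z ∈ (empty : M) ∧ y = F z) = empty := ext' fun z => by
      rw [mem_replace]; simp
    rw [this]; exact isFin_empty
  · intro a b _ _ ha
    have : (compr fun y : M => ∃ z : M, z ∈ ZFModel.union a (dbl b b) ∧ y = F z) =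
        ZFModel.union (compr fun y : M => ∃ z : M, z ∈ a ∧ y = F z) (dbl (F b) (F b)) :=
      ext' fun z => by
        rw [mem_replace, mem_union, mem_replace]
        simp [or_and_right, exists_or]
    rw [this]; exact ha.insert

theorem IsFin.pow {x : M} (hx : IsFin x) : IsFin (pow x) := by
  refine hx.induction (P := fun x : M => IsFin (ZFModel.pow x)) ?_ ?_
  · have : ZFModel.pow (empty : M) = ZFModel.union empty (dbl empty empty) := ext' fun z => by
      simp only [mem_pow, mem_union, mem_dbl, not_mem_empty, false_or, or_self]
      exact ⟨fun h => eq_empty_iff.2 fun y hy => not_mem_empty (h y hy), fun h => h ▸ Sub.refl _⟩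
    rw [this]; exact isFin_empty.insert
  · intro a b _ _ ha
    refine (ha.union (ha.replace (F := fun c : M => ZFModel.union c (dbl b b)))).sub ?_
    intro z hz
    rw [mem_pow] at hz
    rw [mem_union, mem_replace, mem_pow]
    by_cases hb : b ∈ z
    · refine Or.inr ⟨diff z (dbl b b), mem_pow.2 fun y hy => ?_, ext' fun y => ?_⟩
      · simp only [mem_diff, mem_dbl, or_self] at hy
        have := hz y hy.1
        simp only [mem_union, mem_dbl, or_self] at this
        exact this.resolve_right hy.2
      · simp only [mem_union, mem_diff, mem_dbl, or_self]
        by_cases h : y = b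
        · simp [h, hb]
        · simp [h]
    · refine Or.inl fun y hy => ?_
      have := hz y hy
      simp only [mem_union, mem_dbl, or_self] at this
      exact this.resolve_right fun h => hb (h ▸ hy)

theorem isFin_V {n : M} (hn : n ∈ (omega : M)) : IsFin (V n) :=
  omega_induction (P := fun n : M => IsFin (V n)) (by rw [V_empty]; exact isFin_empty)
    (fun n hn ih => by rw [V_succ (isOrdinal_of_mem_omega hn)]; exact ih.pow) hn

/-! ## Elementary embeddings fix hereditarily finite sets -/

section elementary
variable {A B j : M}

theorem IsSigmaZeroElementary.mem_iff (hj : IsSigmaZeroElementary A B j) (hA : IsTransitive A)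
    (hB : IsTransitive B) {x y : M} (hx : x ∈ A) (hy : y ∈ A) :
    x ∈ y ↔ app j x ∈ app j y :=
  D0.preserved (P := fun p : M × M => p.1 ∈ p.2) (by fun_prop) hA hB hj ⟨x, hx⟩ (x, y) ⟨hx, hy⟩

/-- Inserting an element is described by a `Σ_0` formula, so it preserves fixed points. Tarski's
notion of finiteness is tailored to this operation. -/
theorem IsSigmaZeroElementary.fix_insert (hj : IsSigmaZeroElementary A B j) (hA : IsTransitive A)
    (hB : IsTransitive B) {a b : M} (ha : a ∈ A) (hb : b ∈ A) (hu : union a (dbl b b) ∈ A)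
    (ja : app j a = a) (jb : app j b = b) :
    app j (union a (dbl b b)) = union a (dbl b b) := by
  have h := D0.preserved (P := fun p : M × M × M => (∀ z : M, z ∈ p.1 → (z ∈ p.2.1 ∨ z = p.2.2)) ∧
    (∀ z : M, z ∈ p.2.1 → z ∈ p.1) ∧ p.2.2 ∈ p.1) (by fun_prop) hA hB hj ⟨a, ha⟩
    (union a (dbl b b), a, b) ⟨hu, ha, hb⟩
  obtain ⟨h1, h2, h3⟩ := h.1 ⟨by simp, by simp +contextual, by simp⟩
  change ∀ z : M, z ∈ app j (union a (dbl b b)) → (z ∈ app j a ∨ z = app j b) at h1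
  change ∀ z : M, z ∈ app j a → z ∈ app j (union a (dbl b b)) at h2
  change app j b ∈ app j (union a (dbl b b)) at h3
  rw [ja, jb] at h1
  rw [ja] at h2
  rw [jb] at h3
  apply ext'
  intro z
  simp only [mem_union, mem_dbl, or_self]
  exact ⟨h1 z, fun h => h.elim (h2 z) fun h => h ▸ h3⟩

/-- An element of `V (n + 1)` is a finite subset of `V n`, built from `∅` by inserting elements that
are fixed by the induction hypothesis. -/
theorem IsSigmaZeroElementary.fix (hj : IsSigmaZeroElementary A B j) (hA : IsTransitive A)
    (hB : IsTransitive B) (hsub : ∀ x y : M, x ∈ A → Sub y x → y ∈ A) {n : M}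
    (hn : n ∈ (omega : M)) : ∀ x : M, x ∈ A → x ∈ V n → app j x = x := by
  have fj := hj.1.functional
  refine omega_induction (P := fun n : M => ∀ x : M, x ∈ A → x ∈ V n → app j x = x) ?_ ?_ hn
   
  · intro x _ h
    rw [V_empty] at h
    exact (not_mem_empty h).elim
  · intro n hn ih x hx hxV
    rw [V_succ (isOrdinal_of_mem_omega hn), mem_pow] at hxV
    refine ((isFin_V hn).sub hxV).induction (P := fun a : M => Sub a x → app j a = a) ?_ ?_
      (by fun_prop (disch := assumption)) (Sub.refl x)
    · intro _
      have he := hsub x empty hx (empty_sub x)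
      have h := D0.preserved (P := fun p : M => EqEmpty p) (by fun_prop) hA hB hj ⟨x, hx⟩ empty he
      exact eqEmpty_iff.1 (h.1 (eqEmpty_iff.2 rfl))
    · intro a b hax hb iha hu
      exact hj.fix_insert hA hB (hsub _ _ hx hax) (hA x hx b hb) (hsub _ _ hx hu) (iha hax)
        (ih b (hA x hx b hb) (hxV b hb))

end elementary

/-! ## Even ordinals -/

/-- Above `ω` the base of `η + 2n` is a limit, so limits and double successors suffice. A double
successor is the passage from `N` to `P(P(N))`. -/
theorem IsEven.induction {P : M → Prop} {l : M} (hl : IsEven l) (hlo : ¬ l ∈ (omega : M))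
    (hlim : ∀ a : M, IsLimit a → P a)
    (hs : ∀ a : M, IsOrdinal a → P a → P (succ (succ a))) (hP : Def M P := by fun_prop (disch := assumption)) :
    P l := by
  obtain ⟨η, f, n, hη, hf, h0, hsucc, hn, rfl⟩ := hl
  have ff := hf.functional
  rcases hη with rfl | hη
  · refine (hlo ?_).elim
    refine omega_induction (P := fun n : M => app f n ∈ (omega : M)) ?_ ?_ hn
     
    · rw [h0]; exact empty_mem_omega
    · intro m hm ih
      rw [hsucc m hm]; exact succ_mem_omega (succ_mem_omega ih)
  · refine And.right (omega_induction (P := fun n : M => IsOrdinal (app f n) ∧ P (app f n))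
      ?_ ?_ hn)
    · rw [h0]; exact ⟨hη.1, hlim _ hη⟩
    · intro m hm ih
      rw [hsucc m hm]; exact ⟨ih.1.succ.succ, hs _ ih.1 ih.2⟩

theorem IsEven.isOrdinal {l : M} (hl : IsEven l) : IsOrdinal l := by
  by_cases h : l ∈ (omega : M)
  · exact isOrdinal_of_mem_omega h
  · exact hl.induction h (P := fun a : M => IsOrdinal a) (fun _ h => h.1) fun _ _ h => h.succ.succ

@[fun_prop] theorem Def.isBase {α : Type u} [Ctx M α] {f : α → M} (hf : DefF M f) :
    Def M fun x => IsBase (f x) := by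
  have : (fun x => IsBase (f x)) = fun x => (IsTransitive (f x) ∧ Sub omega (f x) ∧
    (∀ n : M, n ∈ (omega : M) → V n ∈ f x) ∧ (∀ y : M, y ∈ f x → tagZero y ∈ f x) ∧
    (∀ y : M, y ∈ f x → tagOne y ∈ f x) ∧ (∀ y z : M, y ∈ f x → z ∈ f x → pair y z ∈ f x) ∧
    (∀ y z : M, y ∈ f x → Sub z y → z ∈ f x) ∧ (∀ y : M, tagZero y ∈ f x → y ∈ f x) ∧
    (∀ y : M, tagOne y ∈ f x → y ∈ f x) ∧ ∀ y z : M, pair y z ∈ f x → y ∈ f x ∧ z ∈ f x) := by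
    funext x
    exact propext ⟨fun h => ⟨h.1, h.2, h.3, h.4, h.5, h.6, h.7, h.8, h.9, h.10⟩,
      fun ⟨h1, h2, h3, h4, h5, h6, h7, h8, h9, h10⟩ => ⟨h1, h2, h3, h4, h5, h6, h7, h8, h9, h10⟩⟩
  rw [this]; fun_prop

/-! ## Isomorphisms onto sets of a transitive set -/

structure IsIso (N A k : M) : Prop where
  isFunOn : IsFunOn k N
  mem_range : ∀ y : M, y ∈ A ↔ ∃ x : M, x ∈ N ∧ y = app k x
  mem_iff : ∀ x x' : M, x ∈ N → x' ∈ N → (x ∈ x' ↔ app k x ∈ app k x')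

theorem IsIso.functional {N A k : M} (h : IsIso N A k) : Functional k := h.isFunOn.functional

theorem isIso_iff {N A k : M} : IsIso N A k ↔ IsFunOn k N ∧
    (∀ y : M, y ∈ A ↔ ∃ x : M, x ∈ N ∧ y = ap k x) ∧
    ∀ x x' : M, x ∈ N → x' ∈ N → (x ∈ x' ↔ ap k x ∈ ap k x') := by
  constructor
  · intro h
    have hf := h.functional
    refine ⟨h.isFunOn, ?_, ?_⟩
    · simpa only [app_eq_ap hf] using h.mem_range
    · simpa only [app_eq_ap hf] using h.mem_iff
  · rintro ⟨h1, h2, h3⟩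
    have hf := h1.functional
    simp only [← app_eq_ap hf] at h2 h3
    exact ⟨h1, h2, h3⟩

@[fun_prop] theorem Def.isIso {α : Type u} [Ctx M α] {f g h : α → M} (hf : DefF M f)
    (hg : DefF M g) (hh : DefF M h) : Def M fun x => IsIso (f x) (g x) (h x) := by
  simp only [isIso_iff]; fun_prop

section iso
variable {N A k : M}

theorem IsIso.inj (hN : IsTransitive N) (h : IsIso N A k) {x y : M} (hx : x ∈ N) (hy : y ∈ N)
    (e : app k x = app k y) : x = y := by
  apply ext'
  intro z
  constructor
  · intro hz
    have hzN := hN x hx z hz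
    rwa [h.mem_iff z y hzN hy, ← e, ← h.mem_iff z x hzN hx]
  · intro hz
    have hzN := hN y hy z hz
    rwa [h.mem_iff z x hzN hx, e, ← h.mem_iff z y hzN hy]

theorem IsIso.app_mem (h : IsIso N A k) {x : M} (hx : x ∈ N) : app k x ∈ A :=
  (h.mem_range _).2 ⟨x, hx, rfl⟩

/-- Rigidity of transitive sets: at a minimal disagreement `y`, the preimage under `k` of `k' y` has
the same elements as `y`. -/
theorem IsIso.unique (hN : IsTransitive N) {k' : M} (h : IsIso N A k) (h' : IsIso N A k') :
    k = k' := by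
  have f1 := h.functional
  have f2 := h'.functional
  refine h.isFunOn.ext h'.isFunOn fun x hx => ?_
  by_contra hne
  obtain ⟨y, hy, hney, hmin⟩ := exists_minimal (P := fun x : M => ¬ app k x = app k' x) hx hne
   
  apply hney
  obtain ⟨w, hw, ew⟩ := (h.mem_range _).1 (h'.app_mem hy)
  have hmin' : ∀ z : M, z ∈ y → app k z = app k' z := fun z hz =>
    not_not.1 (hmin z hz (hN y hy z hz))
  have : w = y := by
    apply ext'
    intro u
    constructor
    · intro hu
      have huN := hN w hw u hu
      have h1 : app k u ∈ app k' y := by rw [ew, ← h.mem_iff u w huN hw]; exact hu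
      obtain ⟨v, hv, ev⟩ := (h'.mem_range _).1 (h.app_mem huN)
      rw [ev, ← h'.mem_iff v y hv hy] at h1
      have := hmin' v h1
      rw [← ev] at this
      rwa [← h.inj hN hv huN this]
    · intro hu
      have huN := hN y hy u hu
      rw [h.mem_iff u w huN hw, ← ew, hmin' u hu, ← h'.mem_iff u y huN hy]
      exact hu
  rw [ew, this]

/-- The relation `IsIso N A k` as an absolute relation; `w` stands for `ω`. -/
def EqIso (w N A k : M) : Prop :=
  (∀ p : M, p ∈ k → ∃ x : M, x ∈ N ∧ ∃ y : M, y ∈ A ∧ EqPair w p x y) ∧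
  (∀ x : M, x ∈ N → ∃ y : M, y ∈ A ∧ PairMem w x y k) ∧
  (∀ y : M, y ∈ A → ∃ x : M, x ∈ N ∧ PairMem w x y k) ∧
  ∀ x : M, x ∈ N → ∀ x' : M, x' ∈ N → ∀ y : M, y ∈ A → ∀ y' : M, y' ∈ A →
    PairMem w x y k → PairMem w x' y' k → ((x = x' → y = y') ∧ (x ∈ x' ↔ y ∈ y'))

@[fun_prop] theorem D0.eqIso {α : Type u} [Tup M α] {f g h i : α → M} (hf : DV M f) (hg : DV M g)
    (hh : DV M h) (hi : DV M i) : D0 M fun x => EqIso (f x) (g x) (h x) (i x) := by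
  unfold EqIso; fun_prop

theorem eqIso_omega : EqIso omega N A k ↔ IsIso N A k := by
  simp only [EqIso, eqPair_omega, pairMem_omega]
  constructor
  · rintro ⟨h1, h2, h3, h4⟩
    have hf : IsFunOn k N := by
      refine ⟨fun z hz => ?_, fun x hx => ?_⟩
      · obtain ⟨x, hx, y, _, e⟩ := h1 z hz
        exact ⟨x, y, hx, e⟩
      · obtain ⟨y, hy, e⟩ := h2 x hx
        refine ⟨y, e, fun y' e' => ?_⟩
        obtain ⟨x'', _, y'', hy'', e''⟩ := h1 _ e'
        rw [pair_inj] at e''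
        rw [e''.2]
        rw [e''.2] at e'
        exact (h4 x hx x hx y'' hy'' y hy e' e).1 rfl
    refine ⟨hf, fun y => ⟨fun hy => ?_, ?_⟩, fun x x' hx hx' => ?_⟩
    · obtain ⟨x, hx, e⟩ := h3 y hy
      exact ⟨x, hx, (app_eq hf.functional e).symm⟩
    · rintro ⟨x, hx, rfl⟩
      obtain ⟨y, hy, e⟩ := h2 x hx
      rwa [app_eq hf.functional e]
    · obtain ⟨y, hy, e⟩ := h2 x hx
      obtain ⟨y', hy', e'⟩ := h2 x' hx'
      rw [app_eq hf.functional e, app_eq hf.functional e']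
      exact (h4 x hx x' hx' y hy y' hy' e e').2
  · intro h
    refine ⟨fun p hp => ?_, fun x hx => ⟨_, h.app_mem hx, h.isFunOn.pair_app_mem hx⟩,
      fun y hy => ?_, ?_⟩
    · obtain ⟨x, hx, e⟩ := h.isFunOn.mem_iff.1 hp
      exact ⟨x, hx, _, h.app_mem hx, e⟩
    · obtain ⟨x, hx, rfl⟩ := (h.mem_range y).1 hy
      exact ⟨x, hx, h.isFunOn.pair_app_mem hx⟩
    · intro x hx x' hx' y _ y' _ e e'
      rw [← app_eq h.functional e, ← app_eq h.functional e']
      exact ⟨fun h => h ▸ rfl, h.mem_iff x x' hx hx'⟩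

end iso

end ZFModel

end

noncomputable section

namespace ZFModel

variable {M : Type u} [Membership M M] [Nonempty M] [ModelsZF M] {α : Type u} [Ctx M α]

/-! ## Ultrafilters -/

@[fun_prop] theorem Def.almostAll {X μ : α → M} {P : α → M → Prop} (hX : DefF M X)
    (hμ : DefF M μ) (hP : Def M fun p : α × M => P p.1 p.2) :
    Def M fun x => AlmostAll (X x) (μ x) (fun y => P x y) := by
  unfold AlmostAll; fun_prop

section ultrafilter
variable {X μ : M} {P Q : M → Prop}

theorem IsUltrafilter.sub (hU : IsUltrafilter X μ) {σ : M} (h : σ ∈ μ) : Sub σ X := hU.1 σ h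

theorem AlmostAll.congr (h : AlmostAll X μ P) (hPQ : ∀ x : M, x ∈ X → (P x ↔ Q x)) :
    AlmostAll X μ Q := by
  unfold AlmostAll at *
  have : (fun x : M => x ∈ X ∧ P x) = fun x => x ∈ X ∧ Q x := by
    funext x; exact propext (and_congr_right fun hx => hPQ x hx)
  rwa [← this]

theorem almostAll_congr (hPQ : ∀ x : M, x ∈ X → (P x ↔ Q x)) :
    AlmostAll X μ P ↔ AlmostAll X μ Q :=
  ⟨fun h => h.congr hPQ, fun h => h.congr fun x hx => (hPQ x hx).symm⟩

variable (hU : IsUltrafilter X μ)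
include hU

theorem IsUltrafilter.upward {σ τ : M} (h : σ ∈ μ) (hs : Sub σ τ) (ht : Sub τ X) : τ ∈ μ :=
  hU.2.2.2.2.1 σ τ h hs ht

theorem IsUltrafilter.of_mem {σ : M} (h : σ ∈ μ) (hs : ∀ x : M, x ∈ σ → P x)
    (hP : Def M P := by fun_prop (disch := assumption)) : AlmostAll X μ P :=
  hU.upward h (fun x hx => (mem_sep).2 ⟨hU.sub h x hx, hs x hx⟩) fun x hx => ((mem_sep).1 hx).1

theorem IsUltrafilter.mono (h : AlmostAll X μ P) (hPQ : ∀ x : M, x ∈ X → P x → Q x)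
    (hP : Def M P := by fun_prop (disch := assumption))
    (hQ : Def M Q := by fun_prop (disch := assumption)) : AlmostAll X μ Q :=
  hU.of_mem h fun x hx => by
    rw [mem_sep] at hx
    exact hPQ x hx.1 hx.2

theorem IsUltrafilter.all (h : ∀ x : M, x ∈ X → P x)
    (hP : Def M P := by fun_prop (disch := assumption)) : AlmostAll X μ P :=
  hU.of_mem hU.2.1 h

theorem IsUltrafilter.and (h : AlmostAll X μ P) (h' : AlmostAll X μ Q)
    (hP : Def M P := by fun_prop (disch := assumption))
    (hQ : Def M Q := by fun_prop (disch := assumption)) : AlmostAll X μ fun x => P x ∧ Q x :=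
  hU.of_mem (hU.2.2.2.1 _ _ h h') fun x hx => by
    rw [mem_inter, mem_sep, mem_sep] at hx
    exact ⟨hx.1.2, hx.2.2⟩

theorem IsUltrafilter.mono₂ {R : M → Prop} (h : AlmostAll X μ P) (h' : AlmostAll X μ Q)
    (hPQ : ∀ x : M, x ∈ X → P x → Q x → R x)
    (hP : Def M P := by fun_prop (disch := assumption))
    (hQ : Def M Q := by fun_prop (disch := assumption))
    (hR : Def M R := by fun_prop (disch := assumption)) : AlmostAll X μ R :=
  hU.mono (hU.and h h') fun x hx hh => hPQ x hx hh.1 hh.2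

theorem IsUltrafilter.exists (h : AlmostAll X μ P)
    (hP : Def M P := by fun_prop (disch := assumption)) : ∃ x : M, x ∈ X ∧ P x := by
  by_contra hn
  apply hU.2.2.1
  have : compr (fun x : M => x ∈ X ∧ P x) = empty := eq_empty_iff.2 fun x hx => by
    rw [mem_sep] at hx
    exact hn ⟨x, hx⟩
  rw [← this]
  exact h

theorem IsUltrafilter.not (hP : Def M P := by fun_prop (disch := assumption)) :
    AlmostAll X μ (fun x => ¬ P x) ↔ ¬ AlmostAll X μ P := by
  constructor
  · intro h h'
    obtain ⟨x, _, hx⟩ := hU.exists (hU.and h h')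
    exact hx.1 hx.2
  · intro h
    have h1 : Sub (compr fun x : M => x ∈ X ∧ P x) X := fun x hx => ((mem_sep).1 hx).1
    rcases hU.2.2.2.2.2 _ h1 with h2 | h2
    · exact (h h2).elim
    · refine hU.of_mem h2 fun x hx hPx => ?_
      rw [mem_diff, mem_sep] at hx
      exact hx.2 ⟨hx.1, hPx⟩

theorem IsUltrafilter.const {p : Prop} : AlmostAll X μ (fun _ => p) ↔ p := by
  constructor
  · intro h
    obtain ⟨_, _, h⟩ := hU.exists h
    exact h
  · exact fun h => hU.all fun _ _ => h

theorem IsUltrafilter.iff (h : AlmostAll X μ fun x => (P x ↔ Q x))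
    (hP : Def M P := by fun_prop (disch := assumption))
    (hQ : Def M Q := by fun_prop (disch := assumption)) : AlmostAll X μ P ↔ AlmostAll X μ Q :=
  ⟨fun h' => hU.mono (hU.and h h') fun x _ hx => hx.1.1 hx.2,
    fun h' => hU.mono (hU.and h h') fun x _ hx => hx.1.2 hx.2⟩

theorem IsUltrafilter.and_iff (hP : Def M P := by fun_prop (disch := assumption))
    (hQ : Def M Q := by fun_prop (disch := assumption)) :
    (AlmostAll X μ fun x => P x ∧ Q x) ↔ AlmostAll X μ P ∧ AlmostAll X μ Q :=
  ⟨fun h => ⟨hU.mono h fun _ _ h => h.1, hU.mono h fun _ _ h => h.2⟩, fun h => hU.and h.1 h.2⟩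

end ultrafilter

/-! ## Embeddings of `W = P(P(N))` into itself -/

/-- The function `f : d → b`, as an absolute relation; `w` stands for `ω`. -/
def EqFun (w f d b : M) : Prop :=
  (∀ p : M, p ∈ f → ∃ x : M, x ∈ d ∧ ∃ y : M, y ∈ b ∧ EqPair w p x y) ∧
  (∀ x : M, x ∈ d → ∃ y : M, y ∈ b ∧ PairMem w x y f) ∧
  ∀ x : M, x ∈ d → ∀ y : M, y ∈ b → ∀ y' : M, y' ∈ b → PairMem w x y f → PairMem w x y' f → y = y'

@[fun_prop] theorem D0.eqFun {β : Type u} [Tup M β] {f g h i : β → M} (hf : DV M f) (hg : DV M g)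
    (hh : DV M h) (hi : DV M i) : D0 M fun x => EqFun (f x) (g x) (h x) (i x) := by
  unfold EqFun; fun_prop

theorem eqFun_omega {f d b : M} : EqFun omega f d b ↔ IsFun f d b := by
  simp only [EqFun, eqPair_omega, pairMem_omega]
  constructor
  · rintro ⟨h1, h2, h3⟩
    have hf : IsFunOn f d := by
      refine ⟨fun z hz => ?_, fun x hx => ?_⟩
      · obtain ⟨x, hx, y, _, e⟩ := h1 z hz
        exact ⟨x, y, hx, e⟩
      · obtain ⟨y, hy, e⟩ := h2 x hx
        refine ⟨y, e, fun y' e' => ?_⟩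
        obtain ⟨x'', _, y'', hy'', e''⟩ := h1 _ e'
        rw [pair_inj] at e''
        rw [e''.2] at e' ⊢
        exact h3 x hx y'' hy'' y hy e' e
    refine ⟨hf, fun x hx => ?_⟩
    obtain ⟨y, hy, e⟩ := h2 x hx
    rwa [app_eq hf.functional e]
  · intro h
    refine ⟨fun p hp => ?_, fun x hx => ⟨_, h.2 x hx, h.1.pair_app_mem hx⟩, ?_⟩
    · obtain ⟨x, hx, e⟩ := h.1.mem_iff.1 hp
      exact ⟨x, hx, _, h.2 x hx, e⟩
    · intro x hx y _ y' _ e e'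
      exact h.functional _ _ _ e e'

section embedding
variable {N j : M} (hN : IsBase N) (hj : IsSigmaElementarySelf (num 1) (pow (pow N)) j)

theorem sub_X {N x : M} (hN : IsBase N) (h : x ∈ N) : x ∈ pow N := mem_pow.2 (hN.transitive x h)
theorem sub_W {N x : M} (hN : IsBase N) (h : x ∈ pow N) : x ∈ pow (pow N) := sub_X hN.pow h
theorem N_mem_X (N : M) : N ∈ pow N := mem_pow.2 (Sub.refl N)
theorem X_mem_W (N : M) : pow N ∈ pow (pow N) := N_mem_X _
theorem N_mem_W {N : M} (hN : IsBase N) : N ∈ pow (pow N) := sub_W hN (N_mem_X N)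
theorem omega_mem_X {N : M} (hN : IsBase N) : (omega : M) ∈ pow N := mem_pow.2 hN.omega_sub
theorem omega_mem_W {N : M} (hN : IsBase N) : (omega : M) ∈ pow (pow N) :=
  sub_W hN (omega_mem_X hN)

include hN hj

theorem emb_preserved {β : Type u} [Tup M β] {P : β → Prop} (x : β)
    (hx : Tup.All (fun y : M => y ∈ pow (pow N)) x) (hP : D0 M P := by fun_prop) :
    P x ↔ P (Tup.map (app j) x) :=
  hP.preserved hN.transitive.pow.pow hN.transitive.pow.pow hj.sigmaZero ⟨_, X_mem_W N⟩ x hx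

theorem emb_mem_W {x : M} (hx : x ∈ pow (pow N)) : app j x ∈ pow (pow N) := hj.1.2 x hx

theorem emb_mem {x y : M} (hx : x ∈ pow (pow N)) (hy : y ∈ pow (pow N)) :
    x ∈ y ↔ app j x ∈ app j y :=
  emb_preserved hN hj (P := fun p : M × M => p.1 ∈ p.2) (x, y) ⟨hx, hy⟩

theorem emb_inj {x y : M} (hx : x ∈ pow (pow N)) (hy : y ∈ pow (pow N)) :
    x = y ↔ app j x = app j y :=
  emb_preserved hN hj (P := fun p : M × M => p.1 = p.2) (x, y) ⟨hx, hy⟩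

theorem emb_sub {x y : M} (hx : x ∈ pow (pow N)) (hy : y ∈ pow (pow N)) :
    Sub x y ↔ Sub (app j x) (app j y) :=
  emb_preserved hN hj (P := fun p : M × M => Sub p.1 p.2) (x, y) ⟨hx, hy⟩

theorem emb_omega : app j omega = omega :=
  eqOmega_iff.1 ((emb_preserved hN hj (P := fun p : M => EqOmega p) omega (omega_mem_W hN)).1
    (eqOmega_iff.2 rfl))

theorem emb_fix {n x : M} (hn : n ∈ (omega : M)) (hx : x ∈ V n) (hxW : x ∈ pow (pow N)) :
    app j x = x :=
  hj.sigmaZero.fix hN.transitive.pow.pow hN.transitive.pow.pow hN.pow.pow.sub_mem hn x hxW hx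

/-- Here `Σ_1`-elementarity is used. As `X` is the union of `W`, it is false that some element of an
element of `W` is missing from `X`; hence none is missing from `j(X)`. The other inclusion is `j(X)
∈ W`. -/
theorem emb_X : app j (pow N) = pow N := by
  have hD : D0 M fun p : M × M × M => p.1 ∈ p.2.1 ∧ ¬ p.1 ∈ p.2.2 := by fun_prop
  obtain ⟨φ, h1, h2⟩ := hD (num 0, num 1, num 2)
    ⟨num_mem_omega 0, num_mem_omega 1, num_mem_omega 2⟩
  have hW := hN.transitive.pow.pow
  have n0 := num_mem_omega (M := M) 0
  have n1 := num_mem_omega (M := M) 1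
  have n2 := num_mem_omega (M := M) 2
  have hSig : IsSigma (num 1) (fEx (num 0) (fEx (num 1) φ)) :=
    ((IsSigma.one h1).ex' empty_mem_omega n1).ex' empty_mem_omega n0
  have key : ∀ s : M, IsAssignment (pow (pow N)) s →
      (Sat (pow (pow N)) (fEx (num 0) (fEx (num 1) φ)) s ↔
        ∃ x : M, x ∈ pow (pow N) ∧ ∃ y : M, y ∈ pow (pow N) ∧ x ∈ y ∧ ¬ x ∈ app s (num 2)) := by
    intro s hs
    rw [sat_ex hs n0 (h1.isFormula.ex' n1)]
    refine exists_congr fun x => and_congr_right fun hx => ?_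
    have hs' := hs.update (i := num 0) hx
    rw [sat_ex hs' n1 h1.isFormula]
    refine exists_congr fun y => and_congr_right fun hy => ?_
    have hs'' := hs'.update (i := num 1) hy
    rw [h2 _ _ hW hs'']
    change (app _ (num 0) ∈ app _ (num 1) ∧ ¬ app _ (num 0) ∈ app _ (num 2)) ↔ _
    rw [app_update_self hs'.functional n1,
      app_update_ne hs'.functional n0 (num_ne (by decide)),
      app_update_ne hs'.functional n2 (num_ne (by decide)),
      app_update_self hs.functional n0, app_update_ne hs.functional n2 (num_ne (by decide))]
  have hs := isAssignment_const (X_mem_W N)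
  have h3 := hj.2 _ _ hSig hs
  rw [key _ hs, key _ (isAssignment_comp hj.1 hs), app_comp hj.1 hs n2, app_lam n2] at h3
  refine Sub.antisymm (mem_pow.1 (emb_mem_W hN hj (X_mem_W N))) fun x hx => ?_
  by_contra hn
  obtain ⟨y, _, z, hz, hyz, hy⟩ := h3.2 ⟨x, sub_W hN hx, _, X_mem_W N, hx, hn⟩
  exact hy (mem_pow.1 hz y hyz)

/-- `N` is the union of `X`; this is a `Σ_0` statement about the two, and `X` is fixed. -/
theorem emb_N : app j N = N := by
  have h := (emb_preserved hN hj (β := M × M) (P := fun p => (∀ y : M, y ∈ p.2 → Sub y p.1) ∧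
    ∀ x : M, x ∈ p.1 → ∃ y : M, y ∈ p.2 ∧ x ∈ y) (N, pow N) (by exact ⟨N_mem_W hN, X_mem_W N⟩)).1
    ⟨fun y hy => mem_pow.1 hy, fun x hx => ⟨N, N_mem_X N, hx⟩⟩
  obtain ⟨h1, h2⟩ := h
  change ∀ y : M, y ∈ app j (pow N) → Sub y (app j N) at h1
  change ∀ x : M, x ∈ app j N → ∃ y : M, y ∈ app j (pow N) ∧ x ∈ y at h2
  rw [emb_X hN hj] at h1 h2
  refine Sub.antisymm (fun x hx => ?_) (h1 N (N_mem_X N))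
  obtain ⟨y, hy, hxy⟩ := h2 x hx
  exact mem_pow.1 hy x hxy

theorem emb_mem_N {x : M} (hx : x ∈ N) : app j x ∈ N := by
  have h := (emb_mem hN hj (sub_W hN (sub_X hN hx)) (N_mem_W hN)).1 hx
  rwa [emb_N hN hj] at h

theorem emb_pair {x y : M} (hx : x ∈ pow (pow N)) (hy : y ∈ pow (pow N)) :
    app j (pair x y) = pair (app j x) (app j y) := by
  have h : EqPair omega (pair x y) x y ↔
      EqPair (app j omega) (app j (pair x y)) (app j x) (app j y) :=
    emb_preserved hN hj (P := fun p : M × M × M × M => EqPair p.1 p.2.1 p.2.2.1 p.2.2.2)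
      (omega, pair x y, x, y) ⟨omega_mem_W hN, hN.pow.pow.pair_mem _ _ hx hy, hx, hy⟩
  rw [emb_omega hN hj, eqPair_omega, eqPair_omega] at h
  exact h.1 rfl

theorem emb_pair_mem {x y R : M} (hx : x ∈ pow (pow N)) (hy : y ∈ pow (pow N))
    (hR : R ∈ pow (pow N)) : pair x y ∈ R ↔ pair (app j x) (app j y) ∈ app j R := by
  rw [emb_mem hN hj (hN.pow.pow.pair_mem _ _ hx hy) hR, emb_pair hN hj hx hy]

/-- The image of a set `σ ⊆ X` that has an absolute definition. -/
theorem emb_mem_of_def {β : Type u} [Tup M β] {P : M × β → Prop} {σ : M} (p : β)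
    (hσ : σ ∈ pow (pow N)) (hp : Tup.All (fun y : M => y ∈ pow (pow N)) p)
    (h : ∀ A : M, A ∈ pow N → (A ∈ σ ↔ P (A, p))) {A : M} (hA : A ∈ pow N)
    (hP : D0 M P := by fun_prop) : A ∈ app j σ ↔ P (A, Tup.map (app j) p) := by
  have := (emb_preserved hN hj (β := M × M × β) (P := fun q => ∀ A : M, A ∈ q.1 →
    (A ∈ q.2.1 ↔ P (A, q.2.2))) (pow N, σ, p) (by exact ⟨X_mem_W N, hσ, hp⟩)).1 h
  change ∀ A : M, A ∈ app j (pow N) → (A ∈ app j σ ↔ P (A, Tup.map (app j) p)) at this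
  rw [emb_X hN hj] at this
  exact this A hA

theorem emb_fun {f d b : M} (hf : IsFun f d b) (hfW : f ∈ pow (pow N)) (hd : d ∈ pow (pow N))
    (hb : b ∈ pow (pow N)) : IsFun (app j f) (app j d) (app j b) := by
  have h : EqFun omega f d b ↔ EqFun (app j omega) (app j f) (app j d) (app j b) :=
    emb_preserved hN hj (P := fun p : M × M × M × M => EqFun p.1 p.2.1 p.2.2.1 p.2.2.2)
      (omega, f, d, b) ⟨omega_mem_W hN, hfW, hd, hb⟩
  rw [emb_omega hN hj, eqFun_omega, eqFun_omega] at h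
  exact h.1 hf

theorem mem_range_emb {y : M} : y ∈ image j N ↔ ∃ x : M, x ∈ N ∧ y = app j x :=
  mem_image hj.1.functional

theorem range_sub : Sub (image j N) N := by
  intro y hy
  obtain ⟨x, hx, rfl⟩ := (mem_range_emb hN hj).1 hy
  exact emb_mem_N hN hj hx

theorem range_mem_X : image j N ∈ pow N := mem_pow.2 (range_sub hN hj)

theorem isIso_emb : IsIso N (image j N) (lam N fun x => app j x) := by
  have fj := hj.1.functional
  refine ⟨isFunOn_lam, fun y => ?_, fun x x' hx hx' => ?_⟩
  · rw [mem_range_emb hN hj]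
    exact exists_congr fun x => and_congr_right fun hx => by rw [app_lam hx]
  · rw [app_lam hx, app_lam hx']
    exact emb_mem hN hj (sub_W hN (sub_X hN hx)) (sub_W hN (sub_X hN hx'))

end embedding

theorem IsIso.mem_X {N A k : M} (hN : IsBase N) (hA : Sub A N) (h : IsIso N A k) : k ∈ pow N := by
  rw [mem_pow]
  intro z hz
  obtain ⟨x, hx, rfl⟩ := h.isFunOn.mem_iff.1 hz
  exact hN.pair_mem _ _ hx (hA _ (h.app_mem hx))

end ZFModel

end

noncomputable section

namespace ZFModel


variable {M : Type u} [Membership M M] [Nonempty M] [ModelsZF M] {α : Type u} [Ctx M α]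

/-! ## Elementary submodels and collapses -/

/-- A unique value is extracted without choice, as the union of the singleton of solutions. -/
theorem exists_fun_of_unique {d : M} {P : M → M → Prop}
    (h : ∀ x : M, x ∈ d → ∃ y : M, P x y ∧ ∀ y' : M, P x y' → y' = y)
    (hP : Def M (fun p : M × M => P p.1 p.2) := by fun_prop (disch := assumption)) :
    ∃ f : M, IsFunOn f d ∧ ∀ x : M, x ∈ d → P x (app f x) := by
  refine ⟨lam d fun x => sUnion (compr fun y => P x y), isFunOn_lam, fun x hx => ?_⟩
  rw [app_lam hx]
  obtain ⟨y, hy, hu⟩ := h x hx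
  have h1 : ∀ z : M, z ∈ compr (fun y => P x y) ↔ P x z := fun z =>
    mem_compr_of_sub (dbl y y) (fun z hz => by simp [hu z hz]) (by fun_prop) z
  have h2 : sUnion (compr fun y => P x y) = y := by
    apply ext'
    intro z
    rw [mem_sUnion]
    constructor
    · rintro ⟨w, hw, hz⟩
      rw [h1] at hw
      rwa [← hu w hw]
    · exact fun hz => ⟨y, (h1 y).2 hy, hz⟩
  rwa [h2]

@[fun_prop] theorem Def.isElementarySub {f g : α → M} (hf : DefF M f) (hg : DefF M g) :
    Def M fun x => IsElementarySub (f x) (g x) := by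
  unfold IsElementarySub; fun_prop

/-- The Tarski–Vaught test; only the quantifier step uses it. -/
theorem elementarySub_of_test {A N : M} (hA : Sub A N)
    (h : ∀ i φ s b : M, i ∈ (omega : M) → IsFormula φ → IsAssignment A s → b ∈ N →
      Sat N φ (update s i b) → ∃ c : M, c ∈ A ∧ Sat N φ (update s i c)) : IsElementarySub A N := by
  refine ⟨hA, fun φ s hφ => ?_⟩
  revert s
  refine formula_induction (P := fun φ : M => ∀ s : M, IsAssignment A s →
    (Sat A φ s ↔ Sat N φ s)) ?_ ?_ ?_ ?_ ?_ hφ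
  · intro i j hi hj s hs
    rw [sat_mem hs hi hj, sat_mem (hs.mono hA) hi hj]
  · intro i j hi hj s hs
    rw [sat_eq hs hi hj, sat_eq (hs.mono hA) hi hj]
  · intro φ hφ ih s hs
    rw [sat_not hs hφ, sat_not (hs.mono hA) hφ, ih s hs]
  · intro φ ψ hφ hψ ih ih' s hs
    rw [sat_and hs hφ hψ, sat_and (hs.mono hA) hφ hψ, ih s hs, ih' s hs]
  · intro i φ hi hφ ih s hs
    rw [sat_ex hs hi hφ, sat_ex (hs.mono hA) hi hφ]
    constructor
    · rintro ⟨a, ha, hs'⟩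
      exact ⟨a, hA a ha, (ih _ (hs.update ha)).1 hs'⟩
    · rintro ⟨b, hb, hs'⟩
      obtain ⟨c, hc, hs''⟩ := h i φ s b hi hφ hs hb hs'
      exact ⟨c, hc, (ih _ (hs.update hc)).2 hs''⟩

/-- The inverse of the collapse is the useful map: `k : N → A` will be an elementary map of `N` into
itself, to which canonical extensions apply. -/
theorem hasTransitiveCollapse_iff {A N : M} (hN : IsTransitive N) :
    HasTransitiveCollapse A N ↔ ∃ k : M, IsIso N A k := by
  constructor
  · rintro ⟨π, hπ, h1, h2⟩
    have fπ := hπ.functional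
    obtain ⟨k, hk, h⟩ := exists_fun_of_unique (d := N) (P := fun x y => y ∈ A ∧ app π y = x)
      fun x hx => by
        obtain ⟨y, hy, e⟩ := h1 x hx
        exact ⟨y, ⟨hy, e⟩, fun y' hy' => (h2 y' y hy'.1 hy).1 (hy'.2.trans e.symm)⟩
    refine ⟨k, hk, fun y => ⟨fun hy => ⟨app π y, hπ.2 y hy, ?_⟩, ?_⟩, fun x x' hx hx' => ?_⟩
    · have := h _ (hπ.2 y hy)
      exact ((h2 _ _ this.1 hy).1 this.2).symm
    · rintro ⟨x, hx, rfl⟩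
      exact (h x hx).1
    · rw [(h2 _ _ (h x hx).1 (h x' hx').1).2, (h x hx).2, (h x' hx').2]
  · rintro ⟨k, hk⟩
    have fk := hk.functional
    obtain ⟨π, hπ, h⟩ := exists_fun_of_unique (d := A) (P := fun y x => x ∈ N ∧ app k x = y)
      fun y hy => by
        obtain ⟨x, hx, e⟩ := (hk.mem_range y).1 hy
        exact ⟨x, ⟨hx, e.symm⟩, fun x' hx' => hk.inj hN hx'.1 hx (hx'.2.trans e)⟩
    refine ⟨π, ⟨hπ, fun x hx => (h x hx).1⟩, fun x hx => ⟨app k x, hk.app_mem hx, ?_⟩,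
      fun y y' hy hy' => ⟨fun e => ?_, ?_⟩⟩
    · have := h _ (hk.app_mem hx)
      exact hk.inj hN this.1 hx this.2
    · rw [← (h y hy).2, e, (h y' hy').2]
    · rw [hk.mem_iff _ _ (h y hy).1 (h y' hy').1, (h y hy).2, (h y' hy').2]

/-- The preimage of `z` under the isomorphism of `N` with `A`, if there is one. -/
def pre (N z A : M) : M := compr fun y => y ∈ N ∧ ∃ k : M, IsIso N A k ∧ ap k y ∈ z

@[fun_prop] theorem DefF.pre {f g h : α → M} (hf : DefF M f) (hg : DefF M g) (hh : DefF M h) :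
    DefF M fun x => pre (f x) (g x) (h x) := by
  unfold ZFModel.pre; fun_prop

theorem pre_mem (N z A : M) : pre N z A ∈ pow N := mem_pow.2 fun y hy => by
  unfold pre at hy; exact ((mem_sep).1 hy).1

theorem mem_pre {N z A k y : M} (hN : IsTransitive N) (h : IsIso N A k) :
    y ∈ pre N z A ↔ y ∈ N ∧ app k y ∈ z := by
  unfold pre
  rw [mem_sep]
  refine and_congr_right fun _ => ⟨?_, fun hz => ⟨k, h, by rwa [← app_eq_ap h.functional]⟩⟩
  rintro ⟨k', h', hz⟩
  rw [h.unique hN h', app_eq_ap h'.functional]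
  exact hz

/-- The part of the definition of a `Σ_1`-Reinhardt ultrafilter over `P(N)`, for any base `N`. -/
structure IsRein (N μ : M) : Prop where
  ultra : IsUltrafilter (pow N) μ
  elem : AlmostAll (pow N) μ fun A => IsElementarySub A N ∧ ∃ k : M, IsIso N A k
  fine : ∀ x : M, x ∈ N → AlmostAll (pow N) μ fun A => x ∈ A
  normal : ∀ σ : M, IsFun σ N μ → AlmostAll (pow N) μ fun A => ∀ x : M, x ∈ A → A ∈ app σ x
  unif : ∀ R : M, IsRelation R (pow N) (pow N) → HasUniformization (pow N) μ R

theorem isPreReinhardt_iff {l μ : M} (hl : IsOrdinal l) : IsPreReinhardt l μ ↔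
    IsUltrafilter (pow (V l)) μ ∧
    (AlmostAll (pow (V l)) μ fun A => IsElementarySub A (V l) ∧ ∃ k : M, IsIso (V l) A k) ∧
    (∀ x : M, x ∈ V l → AlmostAll (pow (V l)) μ fun A => x ∈ A) ∧
    ∀ σ : M, IsFun σ (V l) μ →
      AlmostAll (pow (V l)) μ fun A => ∀ x : M, x ∈ A → A ∈ app σ x := by
  unfold IsPreReinhardt IsRankJonsson IsFine IsNormal AlmostAll
  rw [V_succ hl]
  have e1 : (fun A : M => IsElementarySub A (V l) ∧ HasTransitiveCollapse A (V l)) =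
      fun A : M => A ∈ pow (V l) ∧ IsElementarySub A (V l) ∧ ∃ k : M, IsIso (V l) A k := by
    funext A
    rw [hasTransitiveCollapse_iff (V_transitive hl), mem_pow]
    exact propext ⟨fun h => ⟨h.1.1, h⟩, fun h => h.2⟩
  have e2 : ∀ x : M, (fun A : M => x ∈ A ∧ Sub A (V l)) = fun A : M => A ∈ pow (V l) ∧ x ∈ A := by
    intro x
    funext A
    rw [mem_pow, and_comm]
  simp only [e1, e2, mem_pow]

theorem isPreReinhardt_unif_iff {l μ : M} (hl : IsOrdinal l) : IsRein (V l) μ ↔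
    IsPreReinhardt l μ ∧ ∀ R : M, IsRelation R (V (succ l)) (V (succ l)) →
      HasUniformization (V (succ l)) μ R := by
  rw [isPreReinhardt_iff hl, V_succ hl]
  exact ⟨fun h => ⟨⟨h.1, h.2, h.3, h.4⟩, h.5⟩, fun h => ⟨h.1.1, h.1.2.1, h.1.2.2.1, h.1.2.2.2, h.2⟩⟩

end ZFModel

end

noncomputable section

namespace ZFModel


variable {M : Type u} [Membership M M] [Nonempty M] [ModelsZF M]

/-! ## The derived ultrafilter -/

/-- The ultrafilter over `P(N)` derived from `j` with seed the range of `j ↾ N`. -/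
def der (N j : M) : M := compr fun σ => Sub σ (pow N) ∧ image j N ∈ app j σ

theorem derived_eq {l j : M} (hl : IsOrdinal l) : derived l j = der (V l) j := by
  unfold derived der; rw [V_succ hl]

theorem mem_der {N j σ : M} (fj : Functional j) :
    σ ∈ der N j ↔ σ ∈ pow (pow N) ∧ image j N ∈ app j σ := by
  rw [mem_pow]
  unfold der
  exact mem_compr_of_sub (pow (pow N)) (fun z hz => mem_pow.2 hz.1) (by fun_prop) σ

theorem isFunOn_range_mem_X {N s d : M} (hN : IsBase N) (hs : IsFun s d N) (hd : Sub d N) :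
    s ∈ pow N := mem_pow.2 fun z hz => by
  obtain ⟨x, hx, rfl⟩ := hs.1.mem_iff.1 hz
  exact hN.pair_mem _ _ (hd x hx) (hs.2 x hx)

/-- The relation with code `F` is `n ↦ V n` on `ω`. -/
def hierarchy : M := compr fun z => ∃ n : M, n ∈ (omega : M) ∧ ∃ c : M, c ∈ V n ∧ z = pair n c

theorem mem_hierarchy {N z : M} (hN : IsBase N) : z ∈ (hierarchy : M) ↔
    ∃ n : M, n ∈ (omega : M) ∧ ∃ c : M, c ∈ V n ∧ z = pair n c := by
  unfold hierarchy
  refine mem_compr_of_sub N ?_ (by fun_prop) z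
  rintro z ⟨n, hn, c, hc, rfl⟩
  exact hN.pair_mem _ _ (hN.omega_sub n hn) (hN.transitive _ (hN.V_mem n hn) c hc)

theorem pair_mem_hierarchy {N n c : M} (hN : IsBase N) : pair n c ∈ (hierarchy : M) ↔
    n ∈ (omega : M) ∧ c ∈ V n := by
  rw [mem_hierarchy hN]
  constructor
  · rintro ⟨n', hn, c', hc, e⟩
    rw [pair_inj] at e
    rw [e.1, e.2]
    exact ⟨hn, hc⟩
  · exact fun h => ⟨n, h.1, c, h.2, rfl⟩

/-- A form of the Tarski-Vaught test for `A ⊆ N`; `w` stands for `ω`, `F` for the hierarchy, and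
`S` for the satisfaction relation of `N`. -/
def SelTest (w F S X N A : M) : Prop :=
  ∀ n : M, n ∈ w → ∀ c : M, c ∈ X → PairMem w n c F → ∀ s : M, s ∈ X → EqFun w s w A →
    ∀ p : M, p ∈ X → EqPair w p c s → (∃ b : M, b ∈ N ∧ PairMem w p b S) →
      ∃ b : M, b ∈ A ∧ PairMem w p b S

@[fun_prop] theorem D0.selTest {β : Type u} [Tup M β] {f g h i k l : β → M} (hf : DV M f)
    (hg : DV M g) (hh : DV M h) (hi : DV M i) (hk : DV M k) (hl : DV M l) :
    D0 M fun x => SelTest (f x) (g x) (h x) (i x) (k x) (l x) := by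
  unfold SelTest; fun_prop

/-- The satisfaction relation of `N` used in `SelTest`. -/
def selRel (N : M) : M := compr fun z => z ∈ pow N ∧ ∃ i φ s b : M, i ∈ (omega : M) ∧
  IsFormula φ ∧ IsAssignment N s ∧ b ∈ N ∧ Sat N φ (upd s i b) ∧
    z = pair (pair (pair i φ) s) b

theorem selRel_mem_W (N : M) : selRel N ∈ pow (pow N) := mem_pow.2 fun z hz => by
  unfold selRel at hz
  exact ((mem_sep).1 hz).1

theorem pair_mem_selRel {N i φ s b : M} (hN : IsBase N) (hi : i ∈ (omega : M)) (hφ : IsFormula φ)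
    (hs : IsAssignment N s) (hb : b ∈ N) :
    pair (pair (pair i φ) s) b ∈ selRel N ↔ Sat N φ (update s i b) := by
  unfold selRel
  rw [mem_sep, update_eq_upd hs.functional]
  constructor
  · rintro ⟨_, i', φ', s', b', _, _, hs', _, h, e⟩
    simp only [pair_inj] at e
    obtain ⟨⟨⟨rfl, rfl⟩, rfl⟩, rfl⟩ := e
    exact h
  · intro h
    refine ⟨hN.pow.pair_mem _ _ (hN.pow.pair_mem _ _ (hN.pow.pair_mem _ _ ?_ ?_) ?_) (sub_X hN hb),
      i, φ, s, b, hi, hφ, hs, hb, h, rfl⟩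
    · exact hN.pow.omega_sub i hi
    · obtain ⟨n, hn, hφ'⟩ := isLimit_omega.mem_V.1 hφ.mem_V
      exact hN.pow.transitive _ (hN.pow.V_mem n hn) _ hφ'
    · exact isFunOn_range_mem_X hN hs hN.omega_sub

/-- Formula codes lie in some `V n`, assignments are subsets of `N`, and satisfaction over `N` is
the single parameter `selRel N`. The Tarski–Vaught test thereby becomes a `Σ_0` statement about
elements of `W`. -/
theorem SelTest.isElementarySub {N A : M} (hN : IsBase N) (hA : Sub A N)
    (h : SelTest omega hierarchy (selRel N) (pow N) N A) : IsElementarySub A N := by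
  refine elementarySub_of_test hA fun i φ s b hi hφ hs hb hsat => ?_
  have hs' := hs.mono hA
  have hc : pair i φ ∈ V (omega : M) :=
    isBase_V_omega.pair_mem _ _ (omega_sub_V i hi) hφ.mem_V
  obtain ⟨n, hn, hcn⟩ := isLimit_omega.mem_V.1 hc
  have hcX : pair i φ ∈ pow N := hN.pow.transitive _ (hN.pow.V_mem n hn) _ hcn
  have hsX : s ∈ pow N := isFunOn_range_mem_X hN hs' hN.omega_sub
  obtain ⟨c, hcA, hcS⟩ := h n hn _ hcX (pairMem_omega.2 ((pair_mem_hierarchy hN).2 ⟨hn, hcn⟩)) s hsX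
    (eqFun_omega.2 hs) _ (hN.pow.pair_mem _ _ hcX hsX) (eqPair_omega.2 rfl)
    ⟨b, hb, pairMem_omega.2 ((pair_mem_selRel hN hi hφ hs' hb).2 hsat)⟩
  exact ⟨c, hcA, (pair_mem_selRel hN hi hφ hs' (hA c hcA)).1 (pairMem_omega.1 hcS)⟩

section derived
variable {N j : M} (hN : IsBase N) (hj : IsSigmaElementarySelf (num 1) (pow (pow N)) j)
include hN hj

/-- Absolute properties of almost all `A`. -/
theorem der_almostAll {β : Type u} [Tup M β] {P : M × β → Prop} {Q : M → Prop} (p : β)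
    (hp : Tup.All (fun y : M => y ∈ pow (pow N)) p) (h : ∀ A : M, A ∈ pow N → (Q A ↔ P (A, p)))
    (hP : D0 M P := by fun_prop) (hQ : Def M Q := by fun_prop (disch := assumption)) :
    AlmostAll (pow N) (der N j) Q ↔ P (image j N, Tup.map (app j) p) := by
  have hσ : compr (fun x : M => x ∈ pow N ∧ Q x) ∈ pow (pow N) :=
    mem_pow.2 fun x hx => ((mem_sep).1 hx).1
  rw [← emb_mem_of_def hN hj p hσ hp (fun A hA => ?_) (range_mem_X hN hj) hP]
  · unfold AlmostAll
    rw [mem_der hj.1.functional]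
    exact and_iff_right hσ
  · rw [mem_sep, h A hA]
    exact and_iff_right hA

/-- Each clause is a `Σ_0` fact about membership in the sets concerned, transferred by `j` and
evaluated at the seed `j``N`. -/
theorem isUltrafilter_der : IsUltrafilter (pow N) (der N j) := by
  have fj := hj.1.functional
  have hX := range_mem_X hN hj
  refine ⟨fun σ hσ => mem_pow.1 ((mem_der fj).1 hσ).1, ?_, ?_, ?_, ?_, ?_⟩
  · rw [mem_der fj, emb_X hN hj]
    exact ⟨X_mem_W N, hX⟩
  · rw [mem_der fj]
    rintro ⟨h1, h2⟩
    rw [emb_mem_of_def hN hj (β := M) (P := fun p => p.1 ≠ p.1) empty h1 h1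
      (fun A _ => by simp) hX] at h2
    exact h2 rfl
  · intro σ τ hσ hτ
    rw [mem_der fj] at hσ hτ ⊢
    have h : inter σ τ ∈ pow (pow N) := mem_pow.2 fun x hx => mem_pow.1 hσ.1 x (mem_inter.1 hx).1
    refine ⟨h, ?_⟩
    rw [emb_mem_of_def hN hj (β := M × M) (P := fun p => p.1 ∈ p.2.1 ∧ p.1 ∈ p.2.2) (σ, τ) h
      (by exact ⟨hσ.1, hτ.1⟩) (fun A _ => mem_inter) hX]
    exact ⟨hσ.2, hτ.2⟩
  · intro σ τ hσ hs hτ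
    rw [mem_der fj] at hσ ⊢
    exact ⟨mem_pow.2 hτ, (emb_sub hN hj hσ.1 (mem_pow.2 hτ)).1 hs _ hσ.2⟩
  · intro σ hσ
    rw [mem_der fj, mem_der fj]
    have h : diff (pow N) σ ∈ pow (pow N) := mem_pow.2 fun x hx => (mem_diff.1 hx).1
    by_cases h1 : image j N ∈ app j σ
    · exact Or.inl ⟨mem_pow.2 hσ, h1⟩
    · refine Or.inr ⟨h, ?_⟩
      rw [emb_mem_of_def hN hj (β := M) (P := fun p => ¬ p.1 ∈ p.2) σ h
        (mem_pow.2 hσ) (fun A hA => by rw [mem_diff]; exact and_iff_right hA) hX]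
      exact h1

theorem der_fine {x : M} (hx : x ∈ N) : AlmostAll (pow N) (der N j) fun A => x ∈ A := by
  rw [der_almostAll hN hj (P := fun p : M × M => p.2 ∈ p.1) x (sub_W hN (sub_X hN hx))
    fun _ _ => Iff.rfl]
  exact (mem_range_emb hN hj).2 ⟨x, hx, rfl⟩

/-- Every element of `j``N` is some `j(x)`, and `j``N ∈ j(σ_x)` by assumption. The sequence is coded
as one set `S ⊆ X` of pairs so that `j` can be applied to it. -/
theorem der_normal {σ : M} (hσ : IsFun σ N (der N j)) :
    AlmostAll (pow N) (der N j) fun A => ∀ x : M, x ∈ A → A ∈ app σ x := by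
  have fj := hj.1.functional
  have fσ := hσ.functional
  have hU := isUltrafilter_der hN hj
  obtain ⟨S, hS⟩ : ∃ S : M, ∀ z : M, z ∈ S ↔ z ∈ pow N ∧ ∃ x A : M, x ∈ N ∧ A ∈ app σ x ∧
    z = pair x A := ⟨_, fun z => mem_sep⟩
  have hSW : S ∈ pow (pow N) := mem_pow.2 fun z hz => ((hS z).1 hz).1
  have hSp : ∀ x A : M, x ∈ N → A ∈ pow N → (pair x A ∈ S ↔ A ∈ app σ x) := by
    intro x A hx hA
    rw [hS]
    constructor
    · rintro ⟨_, x', A', _, h, e⟩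
      rw [pair_inj] at e
      rwa [e.1, e.2]
    · exact fun h => ⟨hN.pow.pair_mem _ _ (sub_X hN hx) hA, x, A, hx, h, rfl⟩
  have hoW := omega_mem_W hN
  refine hU.mono ((der_almostAll hN hj (β := M × M × M) (Q := fun A => ∀ x : M, x ∈ A → x ∈ N →
      pair x A ∈ S) (P := fun p => ∀ x : M, x ∈ p.1 → x ∈ p.2.2.2 → PairMem p.2.1 x p.1 p.2.2.1)
      (omega, S, N) (by exact ⟨hoW, hSW, N_mem_W hN⟩) fun A _ => ?_).2 ?_)
    fun A hA h x hx => ?_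
  · simp only [pairMem_omega]
  · change ∀ x : M, x ∈ image j N → x ∈ app j N → PairMem (app j omega) x (image j N) (app j S)
    rw [emb_omega hN hj]
    intro y hy _
    rw [pairMem_omega]
    obtain ⟨x, hx, rfl⟩ := (mem_range_emb hN hj).1 hy
    have h1 := (mem_der fj).1 (hσ.2 x hx)
    have h2 := (emb_mem_of_def hN hj (β := M × M × M) (P := fun p =>
      PairMem p.2.1 p.2.2.1 p.1 p.2.2.2) (omega, x, S) h1.1
      (by exact ⟨hoW, sub_W hN (sub_X hN hx), hSW⟩)
      (fun A hA => by simp only [pairMem_omega]; exact (hSp x A hx hA).symm) (range_mem_X hN hj)).1 h1.2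
    change PairMem (app j omega) (app j x) _ (app j S) at h2
    rwa [emb_omega hN hj, pairMem_omega] at h2
  · have hxN := mem_pow.1 hA x hx
    exact (hSp x A hxN hA).1 (h x hx hxN)

/-- The Tarski–Vaught test at the seed. The formula code `c` is hereditarily finite and hence fixed;
the hierarchy `F` is carried along to show that `c` lies in a finite level. The assignment `s` is
`j(t)` for its pointwise preimage `t`, as `j` fixes natural numbers. So the existence of a witness
for `j(⌜c, t⌝)` pulls back to a witness `b'` for `⌜c, t⌝`, and `j(b')` lies in `j``N`. -/
theorem selTest_range (F S : M) (hF : F = hierarchy) (hS : S ∈ pow (pow N)) :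
    SelTest omega (app j F) (app j S) (pow N) N (image j N) := by
  have hoW := omega_mem_W hN
  have hFW : F ∈ pow (pow N) := mem_pow.2 fun z hz => by
    rw [hF, mem_hierarchy hN] at hz
    obtain ⟨n, hn, c, hc, rfl⟩ := hz
    exact hN.pow.pair_mem _ _ (hN.pow.omega_sub n hn) (hN.pow.transitive _ (hN.pow.V_mem n hn) c hc)
  intro n hn c hc hnc s hs hsf p hp hps ⟨b, hb, hpb⟩
  rw [pairMem_omega] at hnc hpb
  rw [eqPair_omega] at hps
  rw [eqFun_omega] at hsf
  have fs := hsf.functional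
  have fj := hj.1.functional
  have fix : ∀ m : M, m ∈ (omega : M) → app j m = m := fun m hm =>
    emb_fix hN hj (succ_mem_omega hm) ((V_succ (isOrdinal_of_mem_omega hm)).symm ▸
      mem_pow.2 (sub_V (isOrdinal_of_mem_omega hm))) (hN.pow.pow.omega_sub m hm)
  have hVW : V n ∈ pow (pow N) := hN.pow.pow.V_mem n hn
  have hjV : app j (V n) = V n := emb_fix hN hj (succ_mem_omega hn)
    (by rw [V_succ (isOrdinal_of_mem_omega hn)]; exact N_mem_X _) hVW
  -- the element `c` is fixed by `j`
  have hcV : c ∈ V n := by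
    have := (emb_preserved hN hj (β := M × M × M × M × M) (P := fun q => ∀ c : M, c ∈ q.2.2.2.2 →
      PairMem q.1 q.2.1 c q.2.2.1 → c ∈ q.2.2.2.1) (omega, n, F, V n, pow N)
      (by exact ⟨hoW, hN.pow.pow.omega_sub n hn, hFW, hVW, X_mem_W N⟩)).1
      (by
        intro c _ h
        change PairMem omega n c F at h
        rw [pairMem_omega, hF, pair_mem_hierarchy hN] at h
        exact h.2)
    change ∀ c : M, c ∈ app j (pow N) → PairMem (app j omega) (app j n) c (app j F) →
      c ∈ app j (V n) at this
    rw [emb_omega hN hj, fix n hn, hjV, emb_X hN hj] at this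
    exact this c hc (pairMem_omega.2 hnc)
  have hjc : app j c = c := emb_fix hN hj hn hcV (sub_W hN hc)
  -- the assignment `s` is in the range of `j`
  obtain ⟨t, ht, hts⟩ := exists_fun_of_unique (d := omega) (P := fun m x => x ∈ N ∧
      app j x = app s m) fun m hm => by
    obtain ⟨x, hx, e⟩ := (mem_range_emb hN hj).1 (hsf.2 m hm)
    exact ⟨x, ⟨hx, e.symm⟩, fun x' hx' => (emb_inj hN hj (sub_W hN (sub_X hN hx'.1))
      (sub_W hN (sub_X hN hx))).2 (hx'.2.trans e)⟩
  have htf : IsFun t omega N := ⟨ht, fun m hm => (hts m hm).1⟩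
  have htX : t ∈ pow N := isFunOn_range_mem_X hN htf hN.omega_sub
  have htW := sub_W hN htX
  have hjt : IsFun (app j t) omega N := by
    have := emb_fun hN hj htf htW hoW (N_mem_W hN)
    rwa [emb_omega hN hj, emb_N hN hj] at this
  have e : app j t = s := by
    refine hjt.1.ext hsf.1 fun m hm => app_eq hjt.functional ?_
    have h1 := (emb_pair_mem hN hj (hN.pow.pow.omega_sub m hm)
      (sub_W hN (sub_X hN (htf.2 m hm))) htW).1 (ht.pair_app_mem hm)
    rwa [fix m hm, (hts m hm).2] at h1
  have hcW := sub_W hN hc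
  have hpW : pair c t ∈ pow (pow N) := hN.pow.pow.pair_mem _ _ hcW htW
  have ep : app j (pair c t) = p := by rw [emb_pair hN hj hcW htW, hjc, e, hps]
  have h3 := (emb_preserved hN hj (β := M × M × M × M) (P := fun q => ∃ b : M, b ∈ q.1 ∧
    PairMem q.2.1 q.2.2.1 b q.2.2.2) (N, omega, pair c t, S)
    (by exact ⟨N_mem_W hN, hoW, hpW, hS⟩)).2 (by
      change ∃ b : M, b ∈ app j N ∧ PairMem (app j omega) (app j (pair c t)) b (app j S)
      rw [emb_N hN hj, emb_omega hN hj, ep]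
      exact ⟨b, hb, pairMem_omega.2 hpb⟩)
  obtain ⟨b', hb', h4⟩ := h3
  change PairMem omega (pair c t) b' S at h4
  rw [pairMem_omega] at h4
  have hb'W := sub_W hN (sub_X hN hb')
  refine ⟨app j b', (mem_range_emb hN hj).2 ⟨b', hb', rfl⟩, pairMem_omega.2 ?_⟩
  rw [← ep]
  exact (emb_pair_mem hN hj hpW hb'W hS).1 h4

/-- An isomorphism of `N` with a subset of `N` is itself a subset of `N`, so its existence is a
quantifier bounded by `X`, and the seed has the isomorphism `j ↾ N`. -/
theorem der_elem : AlmostAll (pow N) (der N j) fun A =>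
    IsElementarySub A N ∧ ∃ k : M, IsIso N A k := by
  have hU := isUltrafilter_der hN hj
  have hoW := omega_mem_W hN
  have hFW : (hierarchy : M) ∈ pow (pow N) := mem_pow.2 fun z hz => by
    rw [mem_hierarchy hN] at hz
    obtain ⟨n, hn, c, hc, rfl⟩ := hz
    exact hN.pow.pair_mem _ _ (hN.pow.omega_sub n hn) (hN.pow.transitive _ (hN.pow.V_mem n hn) c hc)
  refine hU.mono ((der_almostAll hN hj (β := M × M × M × M × M) (Q := fun A =>
    SelTest omega hierarchy (selRel N) (pow N) N A ∧ ∃ k : M, k ∈ pow N ∧ EqIso omega N A k)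
    (P := fun p => SelTest p.2.1 p.2.2.1 p.2.2.2.1 p.2.2.2.2.1 p.2.2.2.2.2 p.1 ∧
      ∃ k : M, k ∈ p.2.2.2.2.1 ∧ EqIso p.2.1 p.2.2.2.2.2 p.1 k)
    (omega, hierarchy, selRel N, pow N, N)
    (by exact ⟨hoW, hFW, selRel_mem_W N, X_mem_W N, N_mem_W hN⟩) (fun A _ => Iff.rfl)
    (hQ := ?_)).2 ?_) (fun A hA h => ?_) ?_
  · simp only [SelTest, eqFun_omega, pairMem_omega, eqPair_omega, eqIso_omega]; fun_prop
  · change SelTest (app j omega) (app j hierarchy) (app j (selRel N)) (app j (pow N)) (app j N)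
      (image j N) ∧ ∃ k : M, k ∈ app j (pow N) ∧ EqIso (app j omega) (app j N) (image j N) k
    rw [emb_omega hN hj, emb_X hN hj, emb_N hN hj]
    refine ⟨selTest_range hN hj _ _ rfl (selRel_mem_W N), _, ?_, eqIso_omega.2 (isIso_emb hN hj)⟩
    exact (isIso_emb hN hj).mem_X hN (range_sub hN hj)
  · obtain ⟨h1, k, _, hk⟩ := h
    exact ⟨h1.isElementarySub hN (mem_pow.1 hA), k, eqIso_omega.1 hk⟩
  · simp only [SelTest, eqFun_omega, pairMem_omega, eqPair_omega, eqIso_omega]; fun_prop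

/-- Absolute properties of `A` and of the preimage of `z` under the isomorphism of `N` with `A`,
for almost all `A`. -/
theorem der_almostAll_pre {β : Type u} [Tup M β] {P : M × M × β → Prop} {Q : M → M → Prop} {z : M}
    (p : β) (hz : z ∈ pow N) (hp : Tup.All (fun y : M => y ∈ pow (pow N)) p)
    (h : ∀ A u : M, A ∈ pow N → u ∈ pow N → (Q A u ↔ P (A, u, p)))
    (hP : D0 M P := by fun_prop)
    (hQ : Def M (fun q : M × M => Q q.1 q.2) := by fun_prop (disch := assumption)) :
    AlmostAll (pow N) (der N j) (fun A => Q A (pre N z A)) ↔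
      P (image j N, z, Tup.map (app j) p) := by
  have hU := isUltrafilter_der hN hj
  have fj := hj.1.functional
  have hiso : AlmostAll (pow N) (der N j) fun A => ∃ k : M, IsIso N A k :=
    hU.mono (der_elem hN hj) fun _ _ h => h.2
  -- the absolute relation `u = pre N z A`
  have key : ∀ A u : M, A ∈ pow N → ((∃ k : M, IsIso N A k) ∧ u = pre N z A ↔
      ∃ k : M, k ∈ pow N ∧ EqIso omega N A k ∧ (∀ y : M, y ∈ u → y ∈ N) ∧
        ∀ y : M, y ∈ N → (y ∈ u ↔ ∃ v : M, v ∈ z ∧ PairMem omega y v k)) := by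
    intro A u hA
    have h1 : ∀ k : M, IsIso N A k → ((∀ y : M, y ∈ u → y ∈ N) ∧
        (∀ y : M, y ∈ N → (y ∈ u ↔ ∃ v : M, v ∈ z ∧ PairMem omega y v k)) ↔ u = pre N z A) := by
      intro k hk
      have h2 : ∀ y : M, y ∈ N → ((∃ v : M, v ∈ z ∧ PairMem omega y v k) ↔ app k y ∈ z) := by
        intro y hy
        simp only [pairMem_omega]
        constructor
        · rintro ⟨v, hv, e⟩; rwa [app_eq hk.functional e]
        · exact fun hv => ⟨_, hv, hk.isFunOn.pair_app_mem hy⟩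
      constructor
      · rintro ⟨a, b⟩
        apply ext'
        intro y
        rw [mem_pre hN.transitive hk]
        exact ⟨fun hy => ⟨a y hy, (h2 y (a y hy)).1 ((b y (a y hy)).1 hy)⟩,
          fun hy => (b y hy.1).2 ((h2 y hy.1).2 hy.2)⟩
      · rintro rfl
        refine ⟨fun y hy => ((mem_pre hN.transitive hk).1 hy).1, fun y hy => ?_⟩
        rw [h2 y hy, mem_pre hN.transitive hk]
        exact and_iff_right hy
    constructor
    · rintro ⟨⟨k, hk⟩, e⟩
      have := (h1 k hk).2 e
      exact ⟨k, hk.mem_X hN (mem_pow.1 hA), eqIso_omega.2 hk, this.1, this.2⟩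
    · rintro ⟨k, _, hk, a, b⟩
      rw [eqIso_omega] at hk
      exact ⟨⟨k, hk⟩, (h1 k hk).1 ⟨a, b⟩⟩
  -- The term `pre N z A` is replaced by a variable bounded by `X`, which makes the statement
  -- absolute.
  have step : AlmostAll (pow N) (der N j) (fun A => Q A (pre N z A)) ↔
      AlmostAll (pow N) (der N j) (fun A => ∃ u : M, u ∈ pow N ∧
        ((∃ k : M, IsIso N A k) ∧ u = pre N z A) ∧ Q A u) :=
    hU.iff (hU.mono hiso fun A _ h => ⟨fun hQ => ⟨_, pre_mem N z A, ⟨h, rfl⟩, hQ⟩, fun ⟨u, _, e, hQ⟩ =>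
      e.2 ▸ hQ⟩)
  rw [step, der_almostAll hN hj (β := M × M × M × M × β) (P := fun q => ∃ u : M, u ∈ q.2.2.2.1 ∧
    (∃ k : M, k ∈ q.2.2.2.1 ∧ EqIso q.2.1 q.2.2.1 q.1 k ∧ (∀ y : M, y ∈ u → y ∈ q.2.2.1) ∧
        ∀ y : M, y ∈ q.2.2.1 → (y ∈ u ↔ ∃ v : M, v ∈ q.2.2.2.2.1 ∧ PairMem q.2.1 y v k)) ∧
        P (q.1, u, q.2.2.2.2.2)) (omega, N, pow N, z, p)
    (by exact ⟨omega_mem_W hN, N_mem_W hN, X_mem_W N, sub_W hN hz, hp⟩)]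
  · change (∃ u : M, u ∈ app j (pow N) ∧ (∃ k : M, k ∈ app j (pow N) ∧
      EqIso (app j omega) (app j N) (image j N) k ∧ (∀ y : M, y ∈ u → y ∈ app j N) ∧
        ∀ y : M, y ∈ app j N → (y ∈ u ↔ ∃ v : M, v ∈ app j z ∧ PairMem (app j omega) y v k)) ∧
        P (image j N, u, Tup.map (app j) p)) ↔ _
    rw [emb_omega hN hj, emb_X hN hj, emb_N hN hj]
    -- At the seed the isomorphism is `j ↾ N`, and the preimage of `j(z)` under it is `z`.
    have h1 : ∀ k : M, IsIso N (image j N) k → ∀ y : M, y ∈ N →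
        ((∃ v : M, v ∈ app j z ∧ PairMem omega y v k) ↔ y ∈ z) := by
      intro k hk y hy
      have e : app k y = app j y := by
        rw [hk.unique hN.transitive (isIso_emb hN hj), app_lam hy]
      rw [emb_mem hN hj (sub_W hN (sub_X hN hy)) (sub_W hN hz), ← e]
      simp only [pairMem_omega]
      constructor
      · rintro ⟨v, hv, e⟩; rwa [app_eq hk.functional e]
      · exact fun hv => ⟨_, hv, hk.isFunOn.pair_app_mem hy⟩
    constructor
    · rintro ⟨u, _, ⟨k, _, hk, a, b⟩, hPu⟩
      rw [eqIso_omega] at hk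
      have : u = z := by
        apply ext'
        intro y
        exact ⟨fun hy => (h1 k hk y (a y hy)).1 ((b y (a y hy)).1 hy),
          fun hy => (b y (mem_pow.1 hz y hy)).2 ((h1 k hk y (mem_pow.1 hz y hy)).2 hy)⟩
      rwa [← this]
    · intro hPz
      have hk := isIso_emb hN hj
      refine ⟨z, hz, ⟨_, hk.mem_X hN (range_sub hN hj), eqIso_omega.2 hk, mem_pow.1 hz, fun y hy => ?_⟩,
        hPz⟩
      exact (h1 _ hk y hy).symm
  · intro A hA
    refine exists_congr fun u => and_congr_right fun hu => ?_
    rw [key A u hA, h A u hA hu]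

theorem der_pair_pre_mem {z Y : M} (hz : z ∈ pow N) (hY : Y ∈ pow (pow N)) :
    AlmostAll (pow N) (der N j) (fun A => pair A (pre N z A) ∈ Y) ↔
      pair (image j N) z ∈ app j Y := by
  rw [der_almostAll_pre hN hj (β := M × M) (P := fun q => PairMem q.2.2.1 q.1 q.2.1 q.2.2.2)
    (Q := fun A u => pair A u ∈ Y) (omega, Y) hz (by exact ⟨omega_mem_W hN, hY⟩)
    fun A u _ _ => by rw [pairMem_omega]]
  change PairMem (app j omega) _ _ (app j Y) ↔ _
  rw [emb_omega hN hj, pairMem_omega]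

/-- If `j(R)` relates `j``N` to `x`, then `A ↦ pre N x A` uniformizes `R`, since it represents `x`.
Otherwise almost no `A` has a partner, and any function will do. -/
theorem der_unif {R : M} (hR : IsRelation R (pow N) (pow N)) :
    HasUniformization (pow N) (der N j) R := by
  have hU := isUltrafilter_der hN hj
  have hRW : R ∈ pow (pow N) := mem_pow.2 fun z hz => by
    obtain ⟨x, y, hx, hy, rfl⟩ := hR z hz
    exact hN.pow.pair_mem _ _ hx hy
  by_cases h : ∃ x : M, x ∈ pow N ∧ pair (image j N) x ∈ app j R
  · obtain ⟨x, hx, hxR⟩ := h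
    refine ⟨lam (pow N) fun A => pre N x A, isFunOn_lam, ?_⟩
    rw [← der_pair_pre_mem hN hj hx hRW] at hxR
    exact AlmostAll.congr (hU.mono (Q := fun A => (∃ x : M, pair A x ∈ R) → pair A (pre N x A) ∈ R)
      hxR fun A hA h _ => h) fun A hA => by rw [app_lam hA]
  · refine ⟨lam (pow N) fun A => empty, isFunOn_lam, ?_⟩
    have h1 : ¬ AlmostAll (pow N) (der N j) fun A => ∃ x : M, x ∈ pow N ∧ pair A x ∈ R := by
      rw [der_almostAll hN hj (β := M × M × M) (P := fun q => ∃ x : M, x ∈ q.2.1 ∧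
        PairMem q.2.2.1 q.1 x q.2.2.2) (pow N, omega, R)
        (by exact ⟨X_mem_W N, omega_mem_W hN, hRW⟩) fun A _ => by simp only [pairMem_omega]]
      change ¬ ∃ x : M, x ∈ app j (pow N) ∧ PairMem (app j omega) _ x (app j R)
      rw [emb_omega hN hj, emb_X hN hj]
      simpa only [pairMem_omega] using h
    rw [← hU.not] at h1
    exact AlmostAll.congr (hU.mono (Q := fun A => (∃ x : M, pair A x ∈ R) → pair A empty ∈ R)
      h1 fun A hA h h' => by
        obtain ⟨x, hx⟩ := h'
        obtain ⟨A', x', hA', hx', e⟩ := hR _ hx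
        rw [pair_inj] at e
        exact (h ⟨x, e.2 ▸ hx', hx⟩).elim) fun A hA => by rw [app_lam hA]

theorem isRein_der : IsRein N (der N j) where
  ultra := isUltrafilter_der hN hj
  elem := der_elem hN hj
  fine := fun _ => der_fine hN hj
  normal := fun _ => der_normal hN hj
  unif := fun _ => der_unif hN hj

end derived

end ZFModel

end

noncomputable section

namespace ZFModel


variable {M : Type u} [Membership M M] [Nonempty M] [ModelsZF M] {α : Type u} [Ctx M α]

/-! ## The ultrapower by a normal ultrafilter -/

/-- The value of the class of `F` in the transitive collapse of the ultrapower. -/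
def val (N μ : M) (F : M → M) : M :=
  compr fun z => z ∈ pow N ∧ AlmostAll (pow N) μ fun A => pre N z A ∈ F A

@[fun_prop] theorem DefF.val {N μ : α → M} {F : α → M → M} (hN : DefF M N) (hμ : DefF M μ)
    (hF : DefF M fun p : α × M => F p.1 p.2) : DefF M fun x => val (N x) (μ x) (F x) := by
  unfold ZFModel.val; fun_prop

theorem mem_val {N μ z : M} {F : M → M} (hF : DefF M F := by fun_prop (disch := assumption)) :
    z ∈ val N μ F ↔ z ∈ pow N ∧ AlmostAll (pow N) μ fun A => pre N z A ∈ F A := by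
  unfold val; exact mem_sep

theorem val_mem_W {N μ : M} {F : M → M} (hF : DefF M F := by fun_prop (disch := assumption)) :
    val N μ F ∈ pow (pow N) := mem_pow.2 fun _ hz => ((mem_val hF).1 hz).1

theorem val_congr {N μ : M} {F G : M → M} (h : ∀ A : M, A ∈ pow N → F A = G A) :
    val N μ F = val N μ G := by
  unfold val
  congr 1
  funext z
  refine propext (and_congr_right fun _ => almostAll_congr fun A hA => ?_)
  rw [h A hA]

section rein
variable {N μ : M} (hN : IsBase N) (hμ : IsRein N μ)
include hN hμ

omit hN in
theorem IsRein.iso : AlmostAll (pow N) μ fun A => ∃ k : M, IsIso N A k :=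
  hμ.ultra.mono hμ.elem fun _ _ h => h.2

-- Normality for a definable family instead of a sequence in `μ`. Applied to negations it is the
-- pressing-down principle: a function that picks an element of `A` is constant almost everywhere.
omit hN in
theorem IsRein.regressive {P : M → M → Prop}
    (h : ∀ x : M, x ∈ N → AlmostAll (pow N) μ fun A => P x A)
    (hP : Def M (fun p : M × M => P p.1 p.2) := by fun_prop (disch := assumption)) :
    AlmostAll (pow N) μ fun A => ∀ x : M, x ∈ A → P x A := by
  have h1 : IsFun (lam N fun x => compr fun A => A ∈ pow N ∧ P x A) N μ := isFun_lam h
  have f1 := h1.functional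
  refine hμ.ultra.mono (hμ.normal _ h1) fun A hA h2 x hx => ?_
  have := h2 x hx
  rw [app_lam (mem_pow.1 hA x hx)] at this
  exact ((mem_sep).1 this).2

/-- Let `z` collect the `x ∈ N` whose preimage under `k` lies in `G A` for almost all `A`. By
normality, membership in `z` gives the right answer for all `x ∈ A` simultaneously, for almost all
`A`; this says `G A = k⁻¹[z]`. -/
theorem IsRein.exists_eq_pre {G : M → M} (h : AlmostAll (pow N) μ fun A => G A ∈ pow N)
    (hG : DefF M G := by fun_prop (disch := assumption)) :
    ∃ z : M, z ∈ pow N ∧ AlmostAll (pow N) μ fun A => G A = pre N z A := by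
  have hU := hμ.ultra
  refine ⟨compr fun x => x ∈ N ∧ AlmostAll (pow N) μ fun A => ∃ k y : M, IsIso N A k ∧ y ∈ N ∧
    ap k y = x ∧ y ∈ G A, mem_pow.2 fun x hx => ((mem_sep).1 hx).1, ?_⟩
  set z : M := compr fun x => x ∈ N ∧ AlmostAll (pow N) μ fun A => ∃ k y : M, IsIso N A k ∧ y ∈ N ∧
    ap k y = x ∧ y ∈ G A with hz
  have h1 := hμ.regressive (P := fun x A => ((∃ k y : M, IsIso N A k ∧ y ∈ N ∧
    ap k y = x ∧ y ∈ G A) ↔ x ∈ z)) fun x hx => by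
      by_cases hxz : x ∈ z
      · have := hxz
        rw [hz, mem_sep] at this
        exact hU.mono this.2 fun A _ h => iff_of_true h hxz
      · have : ¬ AlmostAll (pow N) μ fun A => ∃ k y : M, IsIso N A k ∧ y ∈ N ∧
            ap k y = x ∧ y ∈ G A := fun hh => hxz (by rw [hz, mem_sep]; exact ⟨hx, hh⟩)
        rw [← hU.not] at this
        exact hU.mono this fun A _ h => iff_of_false h hxz
  refine hU.mono₂ (hU.and h h1) hμ.iso fun A hA hh hk => ?_
  obtain ⟨k, hk⟩ := hk
  apply ext'
  intro y
  rw [mem_pre hN.transitive hk]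
  have key : ∀ y : M, y ∈ N → (y ∈ G A ↔ app k y ∈ z) := by
    intro y hy
    rw [← hh.2 _ (hk.app_mem hy)]
    constructor
    · exact fun hyG => ⟨k, y, hk, hy, by rw [app_eq_ap hk.functional], hyG⟩
    · rintro ⟨k', y', hk', hy', e, hyG⟩
      rw [hk'.unique hN.transitive hk, ← app_eq_ap hk.functional] at e
      rwa [← hk.inj hN.transitive hy' hy e]
  constructor
  · intro hy
    have hyN := mem_pow.1 hh.1 y hy
    exact ⟨hyN, (key y hyN).1 hy⟩
  · rintro ⟨hyN, hy⟩
    exact (key y hyN).2 hy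

/-- By fineness an element `x` of `z` is of the form `k y` for almost all `A`, and `y` then belongs
to both preimages. -/
theorem IsRein.pre_inj {z z' : M} (hz : z ∈ pow N) (hz' : z' ∈ pow N)
    (h : AlmostAll (pow N) μ fun A => pre N z A = pre N z' A) : z = z' := by
  have key : ∀ z z' : M, z ∈ pow N → (AlmostAll (pow N) μ fun A => pre N z A = pre N z' A) →
      Sub z z' := by
    intro z z' hz h x hx
    obtain ⟨A, hA, ⟨h1, k, hk⟩, hxA⟩ := hμ.ultra.exists (hμ.ultra.and (hμ.ultra.and h hμ.iso)
      (hμ.fine x (mem_pow.1 hz x hx)))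
    obtain ⟨y, hy, rfl⟩ := (hk.mem_range x).1 hxA
    have : y ∈ pre N z A := (mem_pre hN.transitive hk).2 ⟨hy, hx⟩
    rw [h1] at this
    exact ((mem_pre hN.transitive hk).1 this).2
  exact Sub.antisymm (key z z' hz h)
    (key z' z hz' (hμ.ultra.mono h fun _ _ h => h.symm))

/-- For `w ∈ A` the preimage of `w` as a set is the point `k⁻¹(w)`, because `k` preserves membership
and `N` is transitive. -/
theorem IsRein.pre_of_mem {w : M} (hw : w ∈ N) : AlmostAll (pow N) μ fun A =>
    ∃ k : M, IsIso N A k ∧ pre N w A ∈ N ∧ ap k (pre N w A) = w := by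
  refine hμ.ultra.mono₂ hμ.iso (hμ.fine w hw) fun A hA hk hwA => ?_
  obtain ⟨k, hk⟩ := hk
  obtain ⟨y, hy, rfl⟩ := (hk.mem_range w).1 hwA
  have : pre N (app k y) A = y := by
    apply ext'
    intro x
    rw [mem_pre hN.transitive hk]
    constructor
    · rintro ⟨hx, h⟩
      rwa [hk.mem_iff x y hx hy]
    · intro hx
      have hxN := hN.transitive y hy x hx
      exact ⟨hxN, by rwa [← hk.mem_iff x y hxN hy]⟩
  exact ⟨k, hk, by rwa [this], by rw [this, app_eq_ap hk.functional]⟩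

theorem IsRein.pre_mem_pre {w z : M} (hw : w ∈ N) :
    AlmostAll (pow N) μ fun A => (pre N w A ∈ pre N z A ↔ w ∈ z) := by
  refine hμ.ultra.mono (hμ.pre_of_mem hN hw) fun A hA h => ?_
  obtain ⟨k, hk, h1, h2⟩ := h
  rw [mem_pre hN.transitive hk, app_eq_ap hk.functional, h2]
  exact and_iff_right h1

/-- A function whose values are in `A` is almost constant, up to the isomorphism of `N`
with `A`. -/
theorem IsRein.exists_of_mem {G : M → M} {z : M} (hz : z ∈ pow N)
    (h : AlmostAll (pow N) μ fun A => ∃ k : M, IsIso N A k ∧ G A ∈ N ∧ ap k (G A) ∈ z)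
    (hG : DefF M G := by fun_prop (disch := assumption)) :
    ∃ x : M, x ∈ z ∧ AlmostAll (pow N) μ fun A => G A = pre N x A := by
  have hU := hμ.ultra
  by_contra hn
  have h1 := hμ.regressive (P := fun x A => x ∈ z → ¬ G A = pre N x A) fun x hx => by
    by_cases hxz : x ∈ z
    · have : ¬ AlmostAll (pow N) μ fun A => G A = pre N x A := fun hh => hn ⟨x, hxz, hh⟩
      rw [← hU.not] at this
      exact hU.mono this fun A _ h _ => h
    · exact hU.all fun A _ h => (hxz h).elim
  obtain ⟨A, hA, h2, k, hk, hGN, hkz⟩ := hU.exists (hU.and h1 h)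
  rw [← app_eq_ap hk.functional] at hkz
  refine h2 _ (hk.app_mem hGN) hkz ?_
  apply ext'
  intro y
  rw [mem_pre hN.transitive hk]
  constructor
  · intro hy
    have hyN := hN.transitive _ hGN y hy
    exact ⟨hyN, (hk.mem_iff y _ hyN hGN).1 hy⟩
  · rintro ⟨hyN, hy⟩
    exact (hk.mem_iff y _ hyN hGN).2 hy

/-- If `pre N w A ∈ pre N z A`, then `k` sends `pre N w A` to an element of `z ∩ A`. Normality makes
this element a constant `x`, and then `w = x` by `IsRein.pre_inj`. -/
theorem IsRein.val_pre {z : M} (hz : z ∈ pow N) : val N μ (fun A => pre N z A) = z := by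
  have hU := hμ.ultra
  apply ext'
  intro w
  rw [mem_val]
  constructor
  · rintro ⟨hw, h⟩
    obtain ⟨x, hx, h1⟩ := hμ.exists_of_mem hN (G := fun A => pre N w A) hz
      (hU.mono₂ h hμ.iso fun A hA h hk => by
        obtain ⟨k, hk⟩ := hk
        rw [mem_pre hN.transitive hk, app_eq_ap hk.functional] at h
        exact ⟨k, hk, h⟩)
    rwa [hμ.pre_inj hN hw (sub_X hN (mem_pow.1 hz x hx)) h1]
  · intro hw
    have hwN := mem_pow.1 hz w hw
    exact ⟨sub_X hN hwN, hU.mono (hμ.pre_mem_pre hN (z := z) hwN) fun A _ h => h.2 hw⟩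

/-- Extensionality of the ultrapower. Where `F` and `G` differ, a uniformizing function picks a
point of the symmetric difference. It agrees almost everywhere with some `pre N z`, and this `z`
separates the two values. -/
theorem IsRein.val_inj {F G : M → M} (hFW : AlmostAll (pow N) μ fun A => F A ∈ pow (pow N))
    (hGW : AlmostAll (pow N) μ fun A => G A ∈ pow (pow N))
    (hF : DefF M F := by fun_prop (disch := assumption))
    (hG : DefF M G := by fun_prop (disch := assumption)) :
    val N μ F = val N μ G ↔ AlmostAll (pow N) μ fun A => F A = G A := by
  have hU := hμ.ultra
  constructor
  · intro h
    by_contra hn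
    rw [← hU.not] at hn
    obtain ⟨R, hR⟩ : ∃ R : M, ∀ z : M, z ∈ R ↔ z ∈ pow N ∧ ∃ A u : M, A ∈ pow N ∧ u ∈ pow N ∧
      ¬ (u ∈ F A ↔ u ∈ G A) ∧ z = pair A u := ⟨_, fun z => mem_sep⟩
    have hRp : ∀ A u : M, pair A u ∈ R ↔ A ∈ pow N ∧ u ∈ pow N ∧ ¬ (u ∈ F A ↔ u ∈ G A) := by
      intro A u
      rw [hR]
      constructor
      · rintro ⟨_, A', u', h1, h2, h3, e⟩
        rw [pair_inj] at e
        rw [e.1, e.2]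
        exact ⟨h1, h2, h3⟩
      · rintro ⟨h1, h2, h3⟩
        exact ⟨hN.pow.pair_mem _ _ h1 h2, A, u, h1, h2, h3, rfl⟩
    obtain ⟨f, hf, hu⟩ := hμ.unif R fun z hz => by
      obtain ⟨_, A, u, h1, h2, _, e⟩ := (hR z).1 hz
      exact ⟨A, u, h1, h2, e⟩
    have ff := hf.functional
    have h1 : AlmostAll (pow N) μ fun A => app f A ∈ pow N ∧ ¬ (app f A ∈ F A ↔ app f A ∈ G A) := by
      refine hU.mono (hU.and (hU.and hu hn) (hU.and hFW hGW)) fun A hA hh => ?_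
      obtain ⟨⟨h1, h2⟩, h3, h4⟩ := hh
      have h5 : ∃ u : M, pair A u ∈ R := by
        by_contra h6
        apply h2
        apply ext'
        intro u
        by_contra h7
        refine h6 ⟨u, (hRp A u).2 ⟨hA, ?_, h7⟩⟩
        by_contra h8
        exact h7 (iff_of_false (fun h => h8 (mem_pow.1 h3 u h)) fun h => h8 (mem_pow.1 h4 u h))
      exact ((hRp _ _).1 (h1 h5)).2
    obtain ⟨z, hz, h2⟩ := hμ.exists_eq_pre hN (G := fun A => app f A)
      (hU.mono h1 fun _ _ h => h.1)
    have h3 : AlmostAll (pow N) μ fun A => ¬ (pre N z A ∈ F A ↔ pre N z A ∈ G A) :=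
      hU.mono₂ h1 h2 fun A _ h h' => by rw [← h']; exact h.2
    have h4 : z ∈ val N μ F ↔ z ∈ val N μ G := by rw [h]
    rw [mem_val, mem_val, and_iff_right hz, and_iff_right hz] at h4
    by_cases h5 : AlmostAll (pow N) μ fun A => pre N z A ∈ F A
    · obtain ⟨A, _, h6, h7, h8⟩ := hU.exists (hU.and h3 (hU.and h5 (h4.1 h5)))
      exact h6 (iff_of_true h7 h8)
    · have h5' : ¬ AlmostAll (pow N) μ fun A => pre N z A ∈ G A := fun h => h5 (h4.2 h)
      rw [← hU.not] at h5 h5'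
      obtain ⟨A, _, h6, h7, h8⟩ := hU.exists (hU.and h3 (hU.and h5 h5'))
      exact h6 (iff_of_false h7 h8)
  · intro h
    apply ext'
    intro z
    rw [mem_val, mem_val]
    refine and_congr_right fun _ => hU.iff (hU.mono h fun A _ h => by rw [h])

/-- Both directions pass through a `z ∈ X` with `F A = pre N z A` almost everywhere. It exists
because an element of an element of `W` lies in `X`. -/
theorem IsRein.val_mem {F G : M → M} (hFW : AlmostAll (pow N) μ fun A => F A ∈ pow (pow N))
    (hGW : AlmostAll (pow N) μ fun A => G A ∈ pow (pow N))
    (hF : DefF M F := by fun_prop (disch := assumption))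
    (hG : DefF M G := by fun_prop (disch := assumption)) :
    val N μ F ∈ val N μ G ↔ AlmostAll (pow N) μ fun A => F A ∈ G A := by
  have hU := hμ.ultra
  constructor
  · intro h
    have h' := (mem_val).1 h
    have h1 := hμ.val_pre hN h'.1
    rw [hμ.val_inj hN (hU.all fun A _ => sub_W hN (pre_mem N _ A)) hFW] at h1
    exact hU.mono₂ h1 h'.2 fun A _ h h' => by rwa [← h]
  · intro h
    obtain ⟨z, hz, h1⟩ := hμ.exists_eq_pre hN (G := F)
      (hU.mono₂ h hGW fun A _ h h' => mem_pow.1 h' _ h)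
    have h2 : val N μ F = z := by
      rw [← hμ.val_pre hN hz]
      exact (hμ.val_inj hN hFW (hU.all fun A _ => sub_W hN (pre_mem N _ A))).2 h1
    rw [h2, mem_val]
    exact ⟨hz, hU.mono₂ h h1 fun A _ h h' => by rwa [← h']⟩

/-- The ultrapower map. -/
def ultMap (N μ : M) : M := lam (pow (pow N)) fun x => val N μ fun _ => x

omit hN hμ in
theorem isFun_ultMap : IsFun (ultMap N μ) (pow (pow N)) (pow (pow N)) :=
  isFun_lam fun _ _ => val_mem_W

omit hN hμ in
theorem app_ultMap {x : M} (hx : x ∈ pow (pow N)) :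
    app (ultMap N μ) x = val N μ fun _ => x := app_lam hx

/-- If `pre N z A ∈ A` almost everywhere, pressing down makes `pre N z A` equal to a constant `x`,
so that `z = [c_x] = j(x)`. The converse is fineness. -/
theorem IsRein.val_id : val N μ (fun A => A) = image (ultMap N μ) N := by
  have hU := hμ.ultra
  apply ext'
  intro z
  rw [mem_image isFun_ultMap.functional]
  have hid : AlmostAll (pow N) μ fun A => A ∈ pow (pow N) := hU.all fun A hA => sub_W hN hA
  have hc : ∀ y : M, y ∈ N → AlmostAll (pow N) μ fun A => y ∈ pow (pow N) :=
    fun y hy => hU.const.2 (sub_W hN (sub_X hN hy))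
  constructor
  · intro h
    obtain ⟨hz, h⟩ := (mem_val).1 h
    by_contra hn
    have h1 := hμ.regressive (P := fun x A => ¬ pre N z A = x) fun x hx => by
      rw [hU.not]
      intro hh
      refine hn ⟨x, hx, ?_⟩
      rw [app_ultMap (sub_W hN (sub_X hN hx)), ← hμ.val_pre hN hz]
      exact (hμ.val_inj hN (hU.all fun A _ => sub_W hN (pre_mem N _ A)) (hc x hx)).2 hh
    obtain ⟨A, _, h2, h3⟩ := hU.exists (hU.and h1 h)
    exact h2 _ h3 rfl
  · rintro ⟨y, hy, rfl⟩
    rw [app_ultMap (sub_W hN (sub_X hN hy)), hμ.val_mem hN (hc y hy) hid]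
    exact hμ.fine y hy

/-- As `j``N = [id]`, the statement `j``N ∈ j(σ)` says that `A ∈ σ` for almost all `A`. -/
theorem IsRein.eq_der : μ = der N (ultMap N μ) := by
  have hU := hμ.ultra
  have hid : AlmostAll (pow N) μ fun A => A ∈ pow (pow N) := hU.all fun A hA => sub_W hN hA
  apply ext'
  intro σ
  rw [mem_der isFun_ultMap.functional, ← hμ.val_id hN]
  have key : ∀ σ : M, σ ∈ pow (pow N) → (val N μ (fun A => A) ∈ app (ultMap N μ) σ ↔ σ ∈ μ) := by
    intro σ hσ
    rw [app_ultMap hσ, hμ.val_mem hN hid (hU.const.2 hσ)]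
    exact ⟨fun h => hU.upward h (fun x hx => ((mem_sep).1 hx).2) (mem_pow.1 hσ),
      fun h => hU.of_mem h fun x hx => hx⟩
  constructor
  · intro h
    have h1 : σ ∈ pow (pow N) := mem_pow.2 (hU.sub h)
    exact ⟨h1, (key σ h1).2 h⟩
  · rintro ⟨h1, h2⟩
    exact (key σ h1).1 h2

end rein

end ZFModel

end

noncomputable section

namespace ZFModel


variable {M : Type u} [Membership M M] [Nonempty M] [ModelsZF M] {α : Type u} [Ctx M α]

/-! ## The collapse of an ultrapower -/

section ultrapower
variable {X W μ : M}

theorem ultClass_eq {f : M} (hf : Functional f) : ultClass X W μ f =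
    compr fun g => IsFun g X W ∧ AlmostAll X μ fun x => ap f x = ap g x := by
  unfold ultClass
  congr 1
  funext g
  refine propext (and_congr_right fun hg => almostAll_congr fun x _ => ?_)
  rw [app_eq_ap hf, app_eq_ap hg.functional]

theorem mem_ultClass {f g : M} (hf : Functional f) : g ∈ ultClass X W μ f ↔
    IsFun g X W ∧ AlmostAll X μ fun x => app f x = app g x := by
  rw [ultClass_eq hf, mem_compr_of_sub (pow (prod X W)) (fun g hg => mem_pow.2 hg.1.sub_prod)]
  · refine and_congr_right fun hg => almostAll_congr fun x _ => ?_
    rw [app_eq_ap hf, app_eq_ap hg.functional]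

theorem mem_ult {c : M} : c ∈ ult X W μ ↔ ∃ f : M, IsFun f X W ∧ c = ultClass X W μ f := by
  have h : (fun c : M => ∃ f : M, IsFun f X W ∧ c = ultClass X W μ f) = fun c : M =>
      ∃ f : M, IsFun f X W ∧
        c = compr fun g => IsFun g X W ∧ AlmostAll X μ fun x => ap f x = ap g x := by
    funext c
    refine propext (exists_congr fun f => and_congr_right fun hf => ?_)
    rw [ultClass_eq hf.functional]
  unfold ult
  rw [h, mem_compr_of_sub (pow (pow (prod X W)))]
  · exact Iff.of_eq (congrFun h c).symm
  · rintro c ⟨f, hf, rfl⟩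
    rw [← ultClass_eq hf.functional]
    exact mem_pow.2 fun g hg => mem_pow.2 ((mem_ultClass hf.functional).1 hg).1.sub_prod

theorem ultClass_eq_iff (hU : IsUltrafilter X μ) {f g : M} (hf : IsFun f X W) (hg : IsFun g X W) :
    ultClass X W μ f = ultClass X W μ g ↔ AlmostAll X μ fun x => app f x = app g x := by
  have ff := hf.functional
  have fg := hg.functional
  constructor
  · intro h
    have : g ∈ ultClass X W μ g := (mem_ultClass fg).2 ⟨hg, hU.all fun _ _ => rfl⟩
    rw [← h] at this
    exact ((mem_ultClass ff).1 this).2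
  · intro h
    apply ext'
    intro k
    rw [mem_ultClass ff, mem_ultClass fg]
    refine and_congr_right fun hk => ?_
    have fk := hk.functional
    exact hU.iff (hU.mono h fun x _ h => by rw [h])

/-- A collapse of the ultrapower from a valuation of functions. -/
theorem exists_ultCollapse (hU : IsUltrafilter X μ) (hW : IsTransitive W) {E : M → M}
    (hE : DefF M E) (hEW : ∀ f : M, IsFun f X W → E f ∈ W)
    (hsurj : ∀ y : M, y ∈ W → ∃ f : M, IsFun f X W ∧ E f = y)
    (hinj : ∀ f g : M, IsFun f X W → IsFun g X W →
      (E f = E g ↔ AlmostAll X μ fun x => app f x = app g x))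
    (hmem : ∀ f g : M, IsFun f X W → IsFun g X W →
      (E f ∈ E g ↔ AlmostAll X μ fun x => app f x ∈ app g x)) :
    ∃ π : M, IsUltCollapse X W μ π W ∧
      ∀ f : M, IsFun f X W → app π (ultClass X W μ f) = E f := by
  obtain ⟨π, hπ, h⟩ := exists_fun_of_unique (d := ult X W μ) (P := fun c y => ∃ f : M,
    IsFun f X W ∧ (c = compr fun g => IsFun g X W ∧ AlmostAll X μ fun x => ap f x = ap g x) ∧
      y = E f) fun c hc => by
    obtain ⟨f, hf, e⟩ := mem_ult.1 hc
    refine ⟨E f, ⟨f, hf, by rwa [← ultClass_eq hf.functional], rfl⟩, ?_⟩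
    rintro y ⟨g, hg, e', rfl⟩
    rw [← ultClass_eq hg.functional, e, ultClass_eq_iff hU hf hg] at e'
    exact ((hinj f g hf hg).2 e').symm
  have hv : ∀ f : M, IsFun f X W → app π (ultClass X W μ f) = E f := by
    intro f hf
    obtain ⟨g, hg, e, e'⟩ := h _ (mem_ult.2 ⟨f, hf, rfl⟩)
    rw [e', hinj g f hg hf, ← ultClass_eq_iff hU hg hf, ultClass_eq hg.functional, e]
  refine ⟨π, ⟨hW, ⟨hπ, fun c hc => ?_⟩, fun y hy => ?_, fun c d hc hd => ?_⟩, hv⟩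
  · obtain ⟨f, hf, rfl⟩ := mem_ult.1 hc
    rw [hv f hf]
    exact hEW f hf
  · obtain ⟨f, hf, rfl⟩ := hsurj y hy
    exact ⟨_, mem_ult.2 ⟨f, hf, rfl⟩, hv f hf⟩
  · obtain ⟨f, hf, rfl⟩ := mem_ult.1 hc
    obtain ⟨g, hg, rfl⟩ := mem_ult.1 hd
    rw [hv f hf, hv g hg, hinj f g hf hg, hmem f g hf hg, ultClass_eq_iff hU hf hg]
    refine ⟨id, ?_, fun h => ⟨f, g, hf, hg, rfl, rfl, h⟩⟩
    rintro ⟨f', g', hf', hg', e, e', h'⟩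
    rw [ultClass_eq_iff hU hf hf'] at e
    rw [ultClass_eq_iff hU hg hg'] at e'
    have f1 := hf.functional
    have f2 := hg.functional
    have f3 := hf'.functional
    have f4 := hg'.functional
    exact hU.mono₂ (hU.and e e') h' fun x _ h h' => by rw [h.1, h.2]; exact h'

variable {π N : M} (hπ : IsUltCollapse X W μ π N)
include hπ

theorem IsUltCollapse.wellfounded : UltWellfounded X W μ := by
  intro S hS hne
  have fπ := hπ.2.1.functional
  obtain ⟨c0, hc0⟩ := ne_empty_iff.1 hne
  obtain ⟨y, hy, ⟨c, hc, rfl⟩, hmin⟩ := exists_minimal (a := N) (P := fun y => ∃ c : M, c ∈ S ∧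
    app π c = y) (hπ.2.1.2 _ (hS _ hc0)) ⟨c0, hc0, rfl⟩
  refine ⟨c, hc, fun d hd h => ?_⟩
  rw [(hπ.2.2.2 d c (hS d hd) (hS c hc)).2] at h
  exact hmin _ h (hπ.2.1.2 _ (hS d hd)) ⟨d, hd, rfl⟩

theorem IsUltCollapse.extensional : UltExtensional X W μ := by
  intro c d hc hd hne
  by_contra hn
  refine hne ((hπ.2.2.2 c d hc hd).1 (ext' fun y => ?_))
  by_contra hy
  have hyN : y ∈ N := by
    by_contra hyN
    exact hy (iff_of_false (fun h => hyN (hπ.1 _ (hπ.2.1.2 c hc) y h))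
      fun h => hyN (hπ.1 _ (hπ.2.1.2 d hd) y h))
  obtain ⟨e, he, rfl⟩ := hπ.2.2.1 y hyN
  refine hn ⟨e, he, ?_⟩
  rw [(hπ.2.2.2 e c he hc).2, (hπ.2.2.2 e d he hd).2]
  tauto

end ultrapower

/-- The collapse is `val`; it respects equality and membership by `IsRein.val_inj` and
`IsRein.val_mem`. Surjectivity is left as a hypothesis, to be supplied by the functions `seed`. -/
theorem IsRein.exists_collapse {N μ : M} (hN : IsBase N) (hμ : IsRein N μ)
    (hs : ∀ y : M, y ∈ pow (pow N) → ∃ f : M, IsFun f (pow N) (pow (pow N)) ∧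
      val N μ (fun A => app f A) = y) :
    ∃ π : M, IsUltCollapse (pow N) (pow (pow N)) μ π (pow (pow N)) ∧
      IsUltMap (pow N) (pow (pow N)) μ π (pow (pow N)) (ultMap N μ) ∧
      ∀ f : M, IsFun f (pow N) (pow (pow N)) →
        app π (ultClass (pow N) (pow (pow N)) μ f) = val N μ (fun A => app f A) := by
  have hU := hμ.ultra
  have e : ∀ f : M, IsFun f (pow N) (pow (pow N)) →
      val N μ (fun A => app f A) = val N μ (fun A => ap f A) := fun f hf =>
    val_congr fun A _ => app_eq_ap hf.functional A
  have hs' : ∀ y : M, y ∈ pow (pow N) → ∃ f : M, IsFun f (pow N) (pow (pow N)) ∧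
      val N μ (fun A => ap f A) = y := fun y hy => by
    obtain ⟨f, hf, hfy⟩ := hs y hy
    exact ⟨f, hf, by rw [← e f hf, hfy]⟩
  obtain ⟨π, hπ, h⟩ := exists_ultCollapse (E := fun f => val N μ (fun A => ap f A)) hU
    hN.transitive.pow.pow (by fun_prop) (fun f _ => val_mem_W (by fun_prop)) hs'
    (fun f g hf hg => by
      have ff := hf.functional
      have fg := hg.functional
      rw [← e f hf, ← e g hg]
      exact hμ.val_inj hN (hU.all fun A hA => hf.2 A hA) (hU.all fun A hA => hg.2 A hA))
    (fun f g hf hg => by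
      have ff := hf.functional
      have fg := hg.functional
      rw [← e f hf, ← e g hg]
      exact hμ.val_mem hN (hU.all fun A hA => hf.2 A hA) (hU.all fun A hA => hg.2 A hA))
  refine ⟨π, hπ, ⟨isFun_ultMap, fun x hx => ?_⟩, fun f hf => by rw [h f hf, e f hf]⟩
  have hf : IsFun (lam (pow N) fun _ => x) (pow N) (pow (pow N)) := isFun_lam fun _ _ => hx
  rw [h _ hf, ← e _ hf, app_ultMap hx]
  exact val_congr fun A hA => (app_lam (F := fun _ => x) hA).symm

end ZFModel

end

noncomputable section

namespace ZFModel


variable {M : Type u} [Membership M M] [Nonempty M] [ModelsZF M] {α : Type u} [Ctx M α]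

/-! ## Isomorphisms and elementary embeddings -/

theorem sat_iso {N A k : M} (hN : IsTransitive N) (hk : IsIso N A k) {φ s : M} (hφ : IsFormula φ)
    (hs : IsAssignment N s) : Sat N φ s ↔ Sat A φ (lam omega fun m => app k (app s m)) := by
  have fk := hk.functional
  have hkf : IsFun k N A := ⟨hk.isFunOn, fun x hx => hk.app_mem hx⟩
  -- The image assignment is generalized to any `t` that matches `s` pointwise, which lets the
  -- induction pass through quantifiers.
  suffices h : ∀ s t : M, IsAssignment N s → IsAssignment A t →
      (∀ m : M, m ∈ (omega : M) → ap t m = app k (ap s m)) → (Sat N φ s ↔ Sat A φ t) by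
    have ht := isAssignment_comp hkf hs
    refine h s _ hs ht fun m hm => ?_
    rw [← app_eq_ap ht.functional, app_comp hkf hs hm, app_eq_ap hs.functional]
  clear hs s
  refine formula_induction (P := fun φ : M => ∀ s t : M, IsAssignment N s → IsAssignment A t →
      (∀ m : M, m ∈ (omega : M) → ap t m = app k (ap s m)) → (Sat N φ s ↔ Sat A φ t))
    ?_ ?_ ?_ ?_ ?_ hφ
  · intro i j hi hj s t hs ht h
    rw [sat_mem hs hi hj, sat_mem ht hi hj, hk.mem_iff _ _ (hs.2 i hi) (hs.2 j hj),
      app_eq_ap ht.functional, app_eq_ap ht.functional, h i hi, h j hj, app_eq_ap hs.functional,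
      app_eq_ap hs.functional]
  · intro i j hi hj s t hs ht h
    rw [sat_eq hs hi hj, sat_eq ht hi hj, app_eq_ap ht.functional, app_eq_ap ht.functional, h i hi,
      h j hj, ← app_eq_ap hs.functional, ← app_eq_ap hs.functional]
    exact ⟨fun e => by rw [e], fun e => hk.inj hN (hs.2 i hi) (hs.2 j hj) e⟩
  · intro φ hφ ih s t hs ht h
    rw [sat_not hs hφ, sat_not ht hφ, ih s t hs ht h]
  · intro φ ψ hφ hψ ih ih' s t hs ht h
    rw [sat_and hs hφ hψ, sat_and ht hφ hψ, ih s t hs ht h, ih' s t hs ht h]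
  · intro i φ hi hφ ih s t hs ht h
    have key : ∀ x : M, x ∈ N → (Sat N φ (update s i x) ↔ Sat A φ (update t i (app k x))) := by
      intro x hx
      have hs' := hs.update (i := i) hx
      have ht' := ht.update (i := i) (hk.app_mem hx)
      refine ih _ _ hs' ht' fun m hm => ?_
      rw [← app_eq_ap ht'.functional, ← app_eq_ap hs'.functional]
      by_cases e : m = i
      · subst e
        rw [app_update_self ht.functional hm, app_update_self hs.functional hm]
      · rw [app_update_ne ht.functional hm e, app_update_ne hs.functional hm e,
          app_eq_ap ht.functional, app_eq_ap hs.functional, h m hm]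
    rw [sat_ex hs hi hφ, sat_ex ht hi hφ]
    constructor
    · rintro ⟨x, hx, h1⟩
      exact ⟨_, hk.app_mem hx, (key x hx).1 h1⟩
    · rintro ⟨y, hy, h1⟩
      obtain ⟨x, hx, rfl⟩ := (hk.mem_range y).1 hy
      exact ⟨x, hx, (key x hx).2 h1⟩

/-- The isomorphism of `N` with `A` is composed with `A ≼ N`. -/
theorem IsIso.isElementarySelf {N A k : M} (hN : IsTransitive N) (hk : IsIso N A k)
    (hA : IsElementarySub A N) : IsElementarySelf N k := by
  have hkf : IsFun k N A := ⟨hk.isFunOn, fun x hx => hk.app_mem hx⟩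
  refine ⟨⟨hk.isFunOn, fun x hx => hA.1 _ (hk.app_mem hx)⟩, fun φ s hφ hs => ?_⟩
  rw [sat_iso hN hk hφ hs]
  exact hA.2 φ _ hφ (isAssignment_comp hkf hs)

theorem IsElementarySelf.isIso {N k : M} (hN : IsTransitive N) (hk : IsElementarySelf N k) :
    IsIso N (image k N) k :=
  ⟨hk.1.1, fun y => mem_image hk.1.functional, fun x x' hx hx' =>
    hk.sigmaZero.mem_iff hN hN hx hx'⟩

/-- Needed where one quantifier ranges over all of `N` and preservation of `Σ_0` relations is not
enough. The parameters are placed at variables from `v_1` on, which keeps `v_0` free for the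
quantifier. -/
theorem IsElementarySelf.exists_iff {N k : M} (hN : IsTransitive N) (hk : IsElementarySelf N k)
    {β : Type u} [Tup M β] {P : M × β → Prop} (p : β) (hne : ∃ a : M, a ∈ N)
    (hp : Tup.All (fun y : M => y ∈ N) p) (hP : D0 M P := by fun_prop) :
    (∃ x : M, x ∈ N ∧ P (x, p)) ↔ ∃ x : M, x ∈ N ∧ P (x, Tup.map (app k) p) := by
  obtain ⟨a, ha⟩ := hne
  have n0 := num_mem_omega (M := M) 0
  obtain ⟨m, i, _, hi, h⟩ := Tup.exists_idx (M := M) 1 p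
  obtain ⟨s, hs, e, _⟩ := h N _ (isAssignment_const ha) hp
  have hi' : Tup.All (fun y : M => y ∈ (omega : M)) i :=
    Tup.all_mono (fun y ⟨n, _, _, hn⟩ => hn ▸ num_mem_omega n) hi
  obtain ⟨φ, h1, h2⟩ := hP (num 0, i) ⟨n0, hi'⟩
  have key : ∀ t q, IsAssignment N t → Tup.map (app t) i = q →
      (Sat N (fEx (num 0) φ) t ↔ ∃ x : M, x ∈ N ∧ P (x, q)) := by
    intro t q ht hq
    rw [sat_ex ht n0 h1.isFormula]
    refine exists_congr fun x => and_congr_right fun hx => ?_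
    rw [h2 N _ hN (ht.update hx), ← hq]
    change P (app _ (num 0), Tup.map (app (update t (num 0) x)) i) ↔ _
    rw [app_update_self ht.functional n0, Tup.map_congr (τ := app t)]
    refine Tup.all_mono ?_ hi
    rintro y ⟨n, hn, _, rfl⟩
    exact app_update_ne ht.functional (num_mem_omega n) (num_ne (by omega))
  have h3 := hk.2 _ _ (h1.isFormula.ex' n0) hs
  rw [key _ _ hs e, key _ _ (isAssignment_comp hk.1 hs) rfl] at h3
  rw [h3, ← e, Tup.map_map, Tup.map_congr (τ := fun y => app k (app s y))]
  exact Tup.all_mono (fun y hy => app_comp hk.1 hs hy) hi'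

/-! ## Levels of the hierarchy of infinite even rank -/

/-- The field `omega_or` serves the treatment of pairs: either `ω` is an admissible parameter, or `N
= V ω` and every elementary map of `N` is the identity. -/
structure IsLevel (N : M) : Prop extends IsBase N where
  sect_mem : ∀ a x : M, a ∈ N → sect a x ∈ N
  omega_or : omega ∈ N ∨ N = V omega

@[fun_prop] theorem DefF.sect {f g : α → M} (hf : DefF M f) (hg : DefF M g) :
    DefF M fun x => sect (f x) (g x) := by unfold ZFModel.sect; fun_prop

@[fun_prop] theorem DefF.coded {f g : α → M} (hf : DefF M f) (hg : DefF M g) :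
    DefF M fun x => coded (f x) (g x) := by unfold ZFModel.coded; fun_prop

theorem mem_sect {N a x y : M} (hN : IsBase N) (ha : a ∈ pow N) : y ∈ sect a x ↔ pair x y ∈ a := by
  unfold sect
  exact mem_compr_of_sub N (fun y hy => (hN.of_pair _ _ (mem_pow.1 ha _ hy)).2) (by fun_prop) y

theorem mem_coded {a b c : M} : c ∈ coded a b ↔ ∃ x : M, x ∈ b ∧ c = sect a x := mem_replace

theorem sect_sub {N a x : M} (hN : IsBase N) (ha : a ∈ pow N) : sect a x ∈ pow N :=
  mem_pow.2 fun y hy => (hN.of_pair _ _ (mem_pow.1 ha _ ((mem_sect hN ha).1 hy))).2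

theorem IsLevel.pow {N : M} (h : IsLevel N) : IsLevel (pow (pow N)) where
  toIsBase := h.toIsBase.pow.pow
  sect_mem := fun a x ha => sect_sub h.toIsBase.pow ha
  omega_or := Or.inl (omega_mem_W h.toIsBase)

theorem IsLimit.omega_mem_or {a : M} (ha : IsLimit a) : omega ∈ a ∨ a = omega := by
  by_cases h : Sub a omega
  · exact Or.inr (Sub.antisymm h ha.omega_sub)
  · left
    have : ∃ y : M, y ∈ a ∧ ¬ y ∈ (omega : M) := by
      by_contra hn
      exact h fun y hy => by
        by_contra hyo
        exact hn ⟨y, hy, hyo⟩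
    obtain ⟨y0, hy0, hyo0⟩ := this
    obtain ⟨y, hy, hyo, hmin⟩ := exists_minimal (P := fun y : M => ¬ y ∈ (omega : M)) hy0 hyo0
    have : y = omega := by
      apply Sub.antisymm
      · intro z hz
        exact not_not.1 (hmin z hz (ha.1.1 y hy z hz))
      · intro n hn
        rcases ha.1.2 n y (ha.omega_sub n hn) hy with h1 | h1 | h1
        · exact h1
        · exact (hyo (h1 ▸ hn)).elim
        · exact (hyo (omega_transitive n hn y h1)).elim
    rwa [← this]

theorem IsLimit.isLevel {a : M} (ha : IsLimit a) : IsLevel (V a) where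
  toIsBase := ha.isBase
  sect_mem := fun b x hb => by
    obtain ⟨γ, hγ, hb'⟩ := ha.mem_V.1 hb
    have hγo := ha.1.mem hγ
    refine ha.mem_V.2 ⟨succ γ, ha.2.2 γ hγ, ?_⟩
    rw [V_succ hγo, mem_pow]
    intro y hy
    rw [mem_sect ha.isBase (mem_pow.2 (V_transitive ha.1 b hb))] at hy
    obtain ⟨δ, hδ, hp⟩ := (ZFModel.mem_V hγo).1 (V_transitive hγo b hb' _ hy)
    refine (ZFModel.mem_V hγo).2 ⟨δ, hδ, fun v hv => ?_⟩
    exact V_of_tagOne (hγo.mem hδ) (hp _ (tagOne_mem_pair.2 hv))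
  omega_or := by
    rcases ha.omega_mem_or with h | h
    · left
      exact ha.mem_V.2 ⟨succ omega, ha.2.2 _ h, by
        rw [V_succ isOrdinal_omega]; exact mem_pow.2 (sub_V isOrdinal_omega)⟩
    · right; rw [h]

section level
variable {N k : M} (hN : IsLevel N) (hk : IsElementarySelf N k)
include hN hk

theorem elem_mem {x : M} (hx : x ∈ N) : app k x ∈ N := hk.1.2 x hx

theorem elem_preserved {β : Type u} [Tup M β] {P : β → Prop} (x : β)
    (hx : Tup.All (fun y : M => y ∈ N) x) (hP : D0 M P := by fun_prop) :
    P x ↔ P (Tup.map (app k) x) :=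
  hP.preserved hN.transitive hN.transitive hk.sigmaZero ⟨_, hN.empty_mem⟩ x hx

theorem elem_cases : (omega ∈ N ∧ app k omega = omega) ∨ ∀ x : M, x ∈ N → app k x = x := by
  rcases hN.omega_or with h | h
  · refine Or.inl ⟨h, eqOmega_iff.1 ?_⟩
    exact (elem_preserved hN hk (P := fun p : M => EqOmega p) omega h).1 (eqOmega_iff.2 rfl)
  · right
    intro x hx
    rw [h] at hx
    obtain ⟨n, hn, hxn⟩ := isLimit_omega.mem_V.1 hx
    exact hk.sigmaZero.fix hN.transitive hN.transitive hN.sub_mem hn x (h ▸ hx) hxn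

theorem elem_pair {x y : M} (hx : x ∈ N) (hy : y ∈ N) :
    app k (pair x y) = pair (app k x) (app k y) := by
  rcases elem_cases hN hk with ⟨h, e⟩ | h
  · have h1 : EqPair omega (pair x y) x y ↔
        EqPair (app k omega) (app k (pair x y)) (app k x) (app k y) :=
      elem_preserved hN hk (P := fun p : M × M × M × M => EqPair p.1 p.2.1 p.2.2.1 p.2.2.2)
        (omega, pair x y, x, y) ⟨h, hN.pair_mem _ _ hx hy, hx, hy⟩
    rw [e, eqPair_omega, eqPair_omega] at h1
    exact h1.1 rfl
  · rw [h x hx, h y hy, h _ (hN.pair_mem _ _ hx hy)]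

/-- No `y ∈ N` violates the definition of the section; this has one unbounded quantifier and is
transferred by `IsElementarySelf.exists_iff`. -/
theorem elem_sect {a x : M} (ha : a ∈ N) (hx : x ∈ N) :
    app k (sect a x) = sect (app k a) (app k x) := by
  rcases elem_cases hN hk with ⟨h, e⟩ | h
  · have h1 := (hk.exists_iff hN.transitive (β := M × M × M × M) (P := fun p =>
      ¬ (p.1 ∈ p.2.2.2.2 ↔ PairMem p.2.1 p.2.2.2.1 p.1 p.2.2.1)) (omega, a, x, sect a x)
      ⟨_, h⟩ (by exact ⟨h, ha, hx, hN.sect_mem _ _ ha⟩)).not.1 (by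
        rintro ⟨y, hy, h1⟩
        apply h1
        change y ∈ sect a x ↔ PairMem omega x y a
        rw [pairMem_omega, mem_sect hN.toIsBase (sub_X hN.toIsBase ha)])
    have ha' := elem_mem hN hk ha
    apply ext'
    intro y
    rw [mem_sect hN.toIsBase (sub_X hN.toIsBase ha')]
    have key : ∀ y : M, y ∈ N → (y ∈ app k (sect a x) ↔ pair (app k x) y ∈ app k a) := by
      intro y hy
      by_contra h2
      refine h1 ⟨y, hy, ?_⟩
      change ¬ (y ∈ app k (sect a x) ↔ PairMem (app k omega) (app k x) y (app k a))
      rwa [e, pairMem_omega]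
    constructor
    · intro hy
      exact (key y (hN.transitive _ (elem_mem hN hk (hN.sect_mem _ _ ha)) y hy)).1 hy
    · intro hy
      exact (key y (hN.of_pair _ _ (hN.transitive _ ha' _ hy)).2).2 hy
  · rw [h a ha, h x hx, h _ (hN.sect_mem _ _ ha)]

end level

end ZFModel

end

noncomputable section

namespace ZFModel


variable {M : Type u} [Membership M M] [Nonempty M] [ModelsZF M] {α : Type u} [Ctx M α]

/-! ## Canonical extensions and seeds -/

/-- `canonExt` for a base `N`. -/
def cext (N k X : M) : M :=
  compr fun c => ∃ a b : M, a ∈ N ∧ b ∈ N ∧ Sub (coded a b) X ∧ c ∈ coded (ap k a) (ap k b)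

@[fun_prop] theorem DefF.cext {f g h : α → M} (hf : DefF M f) (hg : DefF M g) (hh : DefF M h) :
    DefF M fun x => cext (f x) (g x) (h x) := by unfold ZFModel.cext; fun_prop

theorem canonExt_eq {l k X : M} (hk : Functional k) : canonExt l k X = cext (V l) k X := by
  unfold canonExt cext; simp only [app_eq_ap hk]

/-- The value of `seedFun` at `A`, for a base `N`. -/
def seed (N x A : M) : M := compr fun y => y ∈ pow N ∧
    ∃ k : M, IsElementarySelf N k ∧ IsIso N A k ∧ cext N k y ∈ x

@[fun_prop] theorem DefF.seed {f g h : α → M} (hf : DefF M f) (hg : DefF M g) (hh : DefF M h) :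
    DefF M fun x => seed (f x) (g x) (h x) := by unfold ZFModel.seed; fun_prop

theorem mem_seed {N x A y : M} : y ∈ seed N x A ↔ y ∈ pow N ∧
    ∃ k : M, IsElementarySelf N k ∧ IsIso N A k ∧ cext N k y ∈ x := by unfold seed; exact mem_sep

theorem seed_mem_W (N x A : M) : seed N x A ∈ pow (pow N) := mem_pow.2 fun _ hy => (mem_seed.1 hy).1

theorem seedFun_eq {l x : M} (hl : IsOrdinal l) :
    seedFun l x = lam (pow (V l)) fun A => seed (V l) x A := by
  unfold seedFun seed
  rw [V_succ hl]
  congr 1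
  funext A
  congr 1
  funext y
  refine propext (and_congr_right fun _ => exists_congr fun k => and_congr_right fun hk => ?_)
  rw [canonExt_eq hk.1.functional]
  refine and_congr_left fun _ => ⟨fun h => h ▸ hk.isIso (V_transitive hl), fun h => ?_⟩
  apply ext'
  intro y
  rw [mem_image hk.1.functional, h.mem_range]

/-- Every element of `N` lies in the canonical extension of every elementary `k`. -/
def Covers (N : M) : Prop := ∀ k c : M, IsElementarySelf N k → c ∈ N →
  ∃ a b : M, a ∈ N ∧ b ∈ N ∧ c ∈ coded (ap k a) (ap k b)

@[fun_prop] theorem Def.covers {f : α → M} (hf : DefF M f) : Def M fun x => Covers (f x) := by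
  unfold Covers; fun_prop

section rein
variable {N μ : M} (hN : IsLevel N) (hμ : IsRein N μ)
include hN hμ

theorem IsRein.elementary : AlmostAll (pow N) μ fun A =>
    ∃ k : M, IsElementarySelf N k ∧ IsIso N A k :=
  hμ.ultra.mono hμ.elem fun A _ ⟨h, k, hk⟩ => ⟨k, hk.isElementarySelf hN.transitive h, hk⟩

end rein

/-- The part of `b` coded by `a` in `z`. -/
def restr (a b z : M) : M := compr fun x => x ∈ b ∧ sect a x ∈ z

@[fun_prop] theorem DefF.restr {f g h : α → M} (hf : DefF M f) (hg : DefF M g) (hh : DefF M h) :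
    DefF M fun x => restr (f x) (g x) (h x) := by unfold ZFModel.restr; fun_prop

theorem mem_restr {a b z x : M} : x ∈ restr a b z ↔ x ∈ b ∧ sect a x ∈ z := mem_sep

section rein
variable {N μ : M} (hN : IsLevel N) (hμ : IsRein N μ)
include hN hμ

/-- Normality is applied at the element `q = pair (k a) (k b)` of `A`. For a fixed `q = pair a' b'`,
the set `restr a' b' z` belongs to `N`, and its preimage is `restr a b (pre N z A)` whenever `k a =
a'` and `k b = b'`. -/
theorem IsRein.restr {z : M} : AlmostAll (pow N) μ fun A =>
    ∀ k a b : M, IsElementarySelf N k → IsIso N A k → a ∈ N → b ∈ N →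
      ap k (restr a b (pre N z A)) = restr (ap k a) (ap k b) z := by
  have hU := hμ.ultra
  have hNb := hN.toIsBase
  have h := hμ.regressive (P := fun q A => ∀ k a b : M, IsElementarySelf N k → IsIso N A k →
    a ∈ N → b ∈ N → q = pair (ap k a) (ap k b) →
      ap k (ZFModel.restr a b (pre N z A)) = ZFModel.restr (ap k a) (ap k b) z) fun q hq => by
    by_cases h0 : ∃ a b : M, a ∈ N ∧ b ∈ N ∧ q = pair a b
    · obtain ⟨a', b', ha', hb', rfl⟩ := h0
      have hr : ZFModel.restr a' b' z ∈ N := hN.sub_mem _ _ hb' fun x hx => (mem_restr.1 hx).1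
      refine hU.mono (hμ.pre_of_mem hNb hr) fun A hA h1 => ?_
      intro k a b hke hk ha hb e
      obtain ⟨k', hk', h2, h3⟩ := h1
      have hkk : k' = k := hk'.unique hN.transitive hk
      subst hkk
      rw [pair_inj] at e
      have fk := hke.1.functional
      have : ZFModel.restr a b (pre N z A) = pre N (ZFModel.restr a' b' z) A := by
        apply ext'
        intro x
        rw [mem_restr, mem_pre hN.transitive hk, mem_pre hN.transitive hk, mem_restr]
        rw [← app_eq_ap fk, ← app_eq_ap fk] at e
        have h4 : ∀ x : M, x ∈ N → (x ∈ b ↔ app k' x ∈ b') := fun x hx => by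
          rw [e.2]
          exact hke.sigmaZero.mem_iff hN.transitive hN.transitive hx hb
        constructor
        · rintro ⟨hx, h5, h6⟩
          have hxN := hN.transitive b hb x hx
          refine ⟨hxN, (h4 x hxN).1 hx, ?_⟩
          rwa [e.1, ← elem_sect hN hke ha hxN]
        · rintro ⟨hxN, h5, h6⟩
          refine ⟨(h4 x hxN).2 h5, hN.sect_mem _ _ ha, ?_⟩
          rwa [elem_sect hN hke ha hxN, ← e.1]
      rw [this, h3, e.1, e.2]
    · refine hU.all fun A hA => ?_
      intro k a b hke hk ha hb e
      have fk := hke.1.functional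
      rw [← app_eq_ap fk, ← app_eq_ap fk] at e
      exact (h0 ⟨_, _, elem_mem hN hke ha, elem_mem hN hke hb, e⟩).elim
  refine hU.mono h fun A hA h1 k a b hke hk ha hb => ?_
  have fk := hke.1.functional
  refine h1 (pair (ap k a) (ap k b)) ?_ k a b hke hk ha hb rfl
  rw [← app_eq_ap fk, ← app_eq_ap fk, ← elem_pair hN hke ha hb]
  exact hk.app_mem (hN.pair_mem _ _ ha hb)

/-- If `(a ∣ b) ⊆ k⁻¹[z]`, then cutting `b` down to the indices coding elements of `k⁻¹[z]` changes
nothing, and `IsRein.restr` gives `(k(a) ∣ k(b)) ⊆ z`. Conversely `Covers` puts each `c ∈ z` into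
some `(k(a) ∣ k(b))`; after cutting `b` down, `c` is still covered, again by `IsRein.restr`. -/
theorem IsRein.cext_pre (hc : Covers N) {z : M} (hz : z ∈ pow N) : AlmostAll (pow N) μ fun A =>
    ∃ k : M, IsElementarySelf N k ∧ IsIso N A k ∧ cext N k (pre N z A) = z := by
  have hNb := hN.toIsBase
  refine hμ.ultra.mono₂ (hμ.restr hN (z := z)) (hμ.elementary hN) fun A hA h1 h2 => ?_
  obtain ⟨k, hke, hk⟩ := h2
  refine ⟨k, hke, hk, ?_⟩
  have fk := hke.1.functional
  have mem : ∀ c : M, c ∈ cext N k (pre N z A) ↔ ∃ a b : M, a ∈ N ∧ b ∈ N ∧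
      Sub (coded a b) (pre N z A) ∧ c ∈ coded (ap k a) (ap k b) := by
    intro c
    unfold cext
    refine mem_compr_of_sub N ?_ (by fun_prop) c
    rintro c ⟨a, b, ha, hb, _, h⟩
    obtain ⟨x, hx, rfl⟩ := mem_coded.1 h
    rw [← app_eq_ap fk]
    exact hN.sect_mem _ _ (elem_mem hN hke ha)
  apply ext'
  intro c
  rw [mem]
  constructor
  · rintro ⟨a, b, ha, hb, hs, h⟩
    obtain ⟨x, hx, rfl⟩ := mem_coded.1 h
    have h3 := h1 k a b hke hk ha hb
    have : ZFModel.restr a b (pre N z A) = b := ext' fun y => by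
      rw [mem_restr]
      exact ⟨fun h => h.1, fun h => ⟨h, hs _ (mem_coded.2 ⟨y, h, rfl⟩)⟩⟩
    rw [this] at h3
    rw [h3] at hx
    exact (mem_restr.1 hx).2
  · intro hcz
    obtain ⟨a, b, ha, hb, h⟩ := hc k c hke (mem_pow.1 hz c hcz)
    obtain ⟨x, hx, rfl⟩ := mem_coded.1 h
    refine ⟨a, ZFModel.restr a b (pre N z A), ha,
      hN.sub_mem _ _ hb fun x hx => (mem_restr.1 hx).1, ?_, ?_⟩
    · intro y hy
      obtain ⟨v, hv, rfl⟩ := mem_coded.1 hy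
      exact (mem_restr.1 hv).2
    · rw [h1 k a b hke hk ha hb]
      exact mem_coded.2 ⟨x, mem_restr.2 ⟨hx, hcz⟩, rfl⟩

/-- For almost all `A`, `pre N z A ∈ f_x(A)` means `k⁺(pre N z A) ∈ x`, which is `z ∈ x`. -/
theorem IsRein.val_seed (hc : Covers N) {x : M} (hx : x ∈ pow (pow N)) :
    val N μ (fun A => seed N x A) = x := by
  have hU := hμ.ultra
  have key : ∀ z : M, z ∈ pow N → AlmostAll (pow N) μ fun A => (pre N z A ∈ seed N x A ↔ z ∈ x) := by
    intro z hz
    refine hU.mono (hμ.cext_pre hN hc hz) fun A hA h => ?_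
    obtain ⟨k, hke, hk, e⟩ := h
    rw [mem_seed]
    constructor
    · rintro ⟨_, k', _, hk', h'⟩
      rwa [hk'.unique hN.transitive hk, e] at h'
    · exact fun h' => ⟨pre_mem N z A, k, hke, hk, by rwa [e]⟩
  apply ext'
  intro z
  rw [mem_val]
  constructor
  · rintro ⟨hz, h⟩
    exact hU.const.1 ((hU.iff (key z hz)).1 h)
  · intro hz
    have hzX := mem_pow.1 hx z hz
    exact ⟨hzX, (hU.iff (key z hzX)).2 (hU.const.2 hz)⟩

theorem IsRein.exists_val_eq (hc : Covers N) {x : M} (hx : x ∈ pow (pow N)) :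
    ∃ f : M, IsFun f (pow N) (pow (pow N)) ∧ val N μ (fun A => app f A) = x := by
  refine ⟨lam (pow N) fun A => seed N x A, isFun_lam fun A _ => seed_mem_W N x A, ?_⟩
  rw [val_congr (G := fun A => seed N x A) fun A hA => app_lam hA]
  exact hμ.val_seed hN hc hx

end rein

/-! ## Values of functions under the derived ultrafilter -/

/-- The code of the function `F` on `P(N)`. -/
def codeOf (N : M) (F : M → M) : M := compr fun z => ∃ A y : M, A ∈ pow N ∧ y ∈ F A ∧ z = pair A y

theorem mem_codeOf {N z : M} {F : M → M} (hN : IsBase N)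
    (hFW : ∀ A : M, A ∈ pow N → F A ∈ pow (pow N))
    (hF : DefF M F := by fun_prop (disch := assumption)) :
    z ∈ codeOf N F ↔ ∃ A y : M, A ∈ pow N ∧ y ∈ F A ∧ z = pair A y := by
  unfold codeOf
  refine mem_compr_of_sub (pow N) ?_ (by fun_prop) z
  rintro z ⟨A, y, hA, hy, rfl⟩
  exact hN.pow.pair_mem _ _ hA (mem_pow.1 (hFW A hA) y hy)

theorem pair_mem_codeOf {N A y : M} {F : M → M} (hN : IsBase N)
    (hFW : ∀ A : M, A ∈ pow N → F A ∈ pow (pow N))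
    (hF : DefF M F := by fun_prop (disch := assumption)) :
    pair A y ∈ codeOf N F ↔ A ∈ pow N ∧ y ∈ F A := by
  rw [mem_codeOf hN hFW hF]
  constructor
  · rintro ⟨A', y', h1, h2, e⟩
    rw [pair_inj] at e
    rw [e.1, e.2]
    exact ⟨h1, h2⟩
  · exact fun h => ⟨A, y, h.1, h.2, rfl⟩

theorem codeOf_mem_W {N : M} {F : M → M} (hN : IsBase N)
    (hFW : ∀ A : M, A ∈ pow N → F A ∈ pow (pow N))
    (hF : DefF M F := by fun_prop (disch := assumption)) : codeOf N F ∈ pow (pow N) :=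
  mem_pow.2 fun z hz => by
    obtain ⟨A, y, h1, h2, rfl⟩ := (mem_codeOf hN hFW hF).1 hz
    exact hN.pow.pair_mem _ _ h1 (mem_pow.1 (hFW A h1) y h2)

section derived
variable {N j : M} (hN : IsBase N) (hj : IsSigmaElementarySelf (num 1) (pow (pow N)) j)
include hN hj

/-- This is `[F] = j(F)(j``N)`, read through the code of `F`. -/
theorem val_der {F : M → M} (hFW : ∀ A : M, A ∈ pow N → F A ∈ pow (pow N))
    (hF : DefF M F := by fun_prop (disch := assumption)) :
    val N (der N j) F = sect (app j (codeOf N F)) (image j N) := by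
  have hY := codeOf_mem_W hN hFW hF
  have hU := isUltrafilter_der hN hj
  have hjY := emb_mem_W hN hj hY
  apply ext'
  intro z
  rw [mem_val, mem_sect hN.pow hjY]
  have key : ∀ z : M, z ∈ pow N → (AlmostAll (pow N) (der N j) (fun A => pre N z A ∈ F A) ↔
      pair (image j N) z ∈ app j (codeOf N F)) := by
    intro z hz
    rw [← der_pair_pre_mem hN hj hz hY]
    refine almostAll_congr fun A hA => ?_
    rw [pair_mem_codeOf hN hFW hF]
    exact (and_iff_right hA).symm
  constructor
  · rintro ⟨hz, h⟩
    exact (key z hz).1 h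
  · intro h
    have hz := (hN.pow.of_pair _ _ (mem_pow.1 hjY _ h)).2
    exact ⟨hz, (key z hz).2 h⟩

/-- The statement `pre N z A ∈ x` becomes `z ∈ j(x)` at the seed, where the preimage of `j(z)` is
`z`. -/
theorem ultMap_der : ultMap N (der N j) = j := by
  refine isFun_ultMap.1.ext hj.1.1 fun x hx => ?_
  rw [app_ultMap hx]
  have hxW := emb_mem_W hN hj hx
  apply ext'
  intro z
  rw [mem_val]
  have key : ∀ z : M, z ∈ pow N → (AlmostAll (pow N) (der N j) (fun A => pre N z A ∈ x) ↔
      z ∈ app j x) := fun z hz =>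
    der_almostAll_pre hN hj (P := fun p : M × M × M => p.2.1 ∈ p.2.2) (Q := fun A u => u ∈ x) x hz
      hx fun _ _ _ _ => Iff.rfl
  constructor
  · rintro ⟨hz, h⟩
    exact (key z hz).1 h
  · intro h
    have hz := mem_pow.1 hxW z h
    exact ⟨hz, (key z hz).2 h⟩

end derived

/-- The results on derived ultrafilters apply to `k` itself. The seed function of `c` represents `c`
in the ultrapower by the ultrafilter derived from `k`, so `c` is the section of `k(a)` at `k``N`,
where `a` codes that function. As `k``N ∈ X = k(X)`, one may take `b = X`. -/
theorem Covers.pow {N : M} (hN : IsLevel N) (hc : Covers N) : Covers (pow (pow N)) := by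
  intro k c hk hcW
  have hj : IsSigmaElementarySelf (num 1) (ZFModel.pow (ZFModel.pow N)) k := hk.sigma
  have hNb := hN.toIsBase
  have h1 := (isRein_der hNb hj).val_seed hN hc hcW
  rw [val_der hNb hj fun A _ => seed_mem_W N c A] at h1
  refine ⟨codeOf N fun A => seed N c A, ZFModel.pow N, codeOf_mem_W hNb fun A _ => seed_mem_W N c A,
    X_mem_W N, mem_coded.2 ⟨image k N, ?_, ?_⟩⟩
  · rw [← app_eq_ap hk.1.functional, emb_X hNb hj]
    exact range_mem_X hNb hj
  · rw [← app_eq_ap hk.1.functional]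
    exact h1.symm

/-- Since ranks do not drop, `c ∈ V γ ⊆ k(V γ)` for some `γ`. If `a` codes the identity on `V γ`,
then `k(a)` codes the identity on `k(V γ)`, and its section at `c` is `c`. -/
theorem IsLimit.covers {a : M} (ha : IsLimit a) : Covers (V a) := by
  have hN := ha.isLevel
  intro k c hk hc
  have fk := hk.1.functional
  have hVm : ∀ γ : M, γ ∈ a → V γ ∈ V a := fun γ hγ => ha.mem_V.2 ⟨succ γ, ha.2.2 γ hγ, by
    rw [V_succ (ha.1.mem hγ)]; exact N_mem_X _⟩
  -- the ranks do not decrease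
  have hrank : ∀ γ : M, IsOrdinal γ → γ ∈ a → Sub (V γ) (app k (V γ)) := fun γ hγ =>
    ordinal_induction (P := fun γ : M => γ ∈ a → Sub (V γ) (app k (V γ))) (fun γ hγo ih hγ x hx => by
      obtain ⟨δ, hδ, hxδ⟩ := (ZFModel.mem_V hγo).1 hx
      have hδa := ha.1.1 γ hγ δ hδ
      have h1 := ih δ hδ hδa
      -- No subset of `V δ` is missing from `V γ`; this has one unbounded quantifier and is moved to
      -- the images under `k`.
      have h2 := (hk.exists_iff hN.transitive (β := M × M) (P := fun p => Sub p.1 p.2.1 ∧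
        ¬ p.1 ∈ p.2.2) (V δ, V γ) ⟨_, hVm δ hδa⟩ (by exact ⟨hVm δ hδa, hVm γ hγ⟩)).not.1 (by
          rintro ⟨x, hx, h3, h4⟩
          exact h4 ((ZFModel.mem_V hγo).2 ⟨δ, hδ, h3⟩))
      by_contra h3
      refine h2 ⟨x, V_transitive ha.1 _ (hVm γ hγ) x hx, hxδ.trans h1, h3⟩) hγ
  obtain ⟨γ, hγ, hcγ⟩ := ha.mem_V.1 hc
  have hcb := hrank γ (ha.1.mem hγ) hγ c hcγ
  have hb := hVm γ hγ
  -- a code of the identity on `V γ`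
  obtain ⟨e, he⟩ : ∃ e : M, ∀ z : M, z ∈ e ↔ ∃ x y : M, x ∈ V γ ∧ y ∈ x ∧ z = pair x y := by
    refine ⟨_, mem_compr_of_sub (prod (V γ) (V γ)) ?_ (by fun_prop)⟩
    rintro z ⟨x, y, hx, hy, rfl⟩
    exact pair_mem_prod.2 ⟨hx, V_transitive (ha.1.mem hγ) x hx y hy⟩
  have hea : e ∈ V a := by
    have hγo := ha.1.mem hγ
    have h1 := ha.2.2 _ (ha.2.2 _ (ha.2.2 _ hγ))
    refine (ZFModel.mem_V ha.1).2 ⟨_, h1, fun z hz => ?_⟩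
    obtain ⟨x, y, hx, hy, rfl⟩ := (he z).1 hz
    have hyV := V_transitive hγo x hx y hy
    rw [V_succ hγo.succ.succ, mem_pow]
    intro z hz
    rcases mem_pair.1 hz with ⟨v, hv, rfl⟩ | ⟨v, hv, rfl⟩
    · exact tagZero_mem_V hγo (V_transitive hγo x hx v hv)
    · exact tagOne_mem_V hγo (V_transitive hγo y hyV v hv)
  have h1 : (∀ x : M, x ∈ app k (V γ) → ∀ y : M, y ∈ x → pair x y ∈ app k e) ∧
      ∀ p : M, p ∈ app k e → ∃ x : M, x ∈ app k (V γ) ∧ ∃ y : M, y ∈ x ∧ p = pair x y := by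
    have h0 : (∀ x : M, x ∈ V γ → ∀ y : M, y ∈ x → pair x y ∈ e) ∧
        ∀ p : M, p ∈ e → ∃ x : M, x ∈ V γ ∧ ∃ y : M, y ∈ x ∧ p = pair x y :=
      ⟨fun x hx y hy => (he _).2 ⟨x, y, hx, hy, rfl⟩, fun p hp => by
        obtain ⟨x, y, hx, hy, e⟩ := (he p).1 hp
        exact ⟨x, hx, y, hy, e⟩⟩
    rcases elem_cases hN hk with ⟨ho, e'⟩ | h
    · have h2 := elem_preserved hN hk (β := M × M × M) (P := fun q =>
        (∀ x : M, x ∈ q.2.1 → ∀ y : M, y ∈ x → PairMem q.1 x y q.2.2) ∧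
          ∀ p : M, p ∈ q.2.2 → ∃ x : M, x ∈ q.2.1 ∧ ∃ y : M, y ∈ x ∧ EqPair q.1 p x y)
        (omega, V γ, e) (by exact ⟨ho, hb, hea⟩)
      change ((∀ x : M, x ∈ V γ → ∀ y : M, y ∈ x → PairMem omega x y e) ∧
        ∀ p : M, p ∈ e → ∃ x : M, x ∈ V γ ∧ ∃ y : M, y ∈ x ∧ EqPair omega p x y) ↔
        (∀ x : M, x ∈ app k (V γ) → ∀ y : M, y ∈ x → PairMem (app k omega) x y (app k e)) ∧
        ∀ p : M, p ∈ app k e → ∃ x : M, x ∈ app k (V γ) ∧ ∃ y : M, y ∈ x ∧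
          EqPair (app k omega) p x y at h2
      simp only [e', pairMem_omega, eqPair_omega] at h2
      exact h2.1 h0
    · rwa [h _ hb, h _ hea]
  refine ⟨e, V γ, hea, hb, mem_coded.2 ⟨c, ?_, ?_⟩⟩
  · rwa [← app_eq_ap fk]
  · rw [← app_eq_ap fk]
    apply ext'
    intro y
    rw [mem_sect hN.toIsBase (sub_X hN.toIsBase (elem_mem hN hk hea))]
    constructor
    · exact fun hy => h1.1 c hcb y hy
    · intro h
      obtain ⟨x, _, y', hy', e'⟩ := h1.2 _ h
      rw [pair_inj] at e'
      rw [e'.1, e'.2]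
      exact hy'

theorem IsEven.level_covers {l : M} (hl : IsEven l) (hlo : ¬ l ∈ (omega : M)) :
    IsLevel (V l) ∧ Covers (V l) := by
  -- The fields of `IsLevel` are spelled out so that the predicate of the induction is visibly
  -- definable.
  refine hl.induction hlo (P := fun a : M => (IsBase (V a) ∧ (∀ b x : M, b ∈ V a → sect b x ∈ V a) ∧
    (omega ∈ V a ∨ V a = V omega)) ∧ Covers (V a)) (fun a ha => ⟨⟨ha.isLevel.toIsBase,
      ha.isLevel.sect_mem, ha.isLevel.omega_or⟩, ha.covers⟩) (fun a ha h => ?_) |>.imp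
    (fun h => ⟨h.1, h.2.1, h.2.2⟩) id
  rw [V_succ ha.succ, V_succ ha]
  have hN : IsLevel (V a) := ⟨h.1.1, h.1.2.1, h.1.2.2⟩
  exact ⟨⟨hN.pow.toIsBase, hN.pow.sect_mem, hN.pow.omega_or⟩, h.2.pow hN⟩

end ZFModel

end

noncomputable section

namespace ZFModel


variable {M : Type u} [Membership M M] [Nonempty M] [ModelsZF M] {α : Type u} [Ctx M α]

/-! ## Two families of new variables -/

/-- Two functions from variables to variables with disjoint ranges, that omit `v_0, …, v_7`. -/
structure IsSplit (d e : M) : Prop where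
  left : IsFun d omega omega
  right : IsFun e omega omega
  left_inj : ∀ m n : M, m ∈ (omega : M) → n ∈ (omega : M) → app d m = app d n → m = n
  right_inj : ∀ m n : M, m ∈ (omega : M) → n ∈ (omega : M) → app e m = app e n → m = n
  disj : ∀ m n : M, m ∈ (omega : M) → n ∈ (omega : M) → app d m ≠ app e n
  left_ne : ∀ m : M, ∀ c : ℕ, c < 8 → m ∈ (omega : M) → app d m ≠ num c
  right_ne : ∀ m : M, ∀ c : ℕ, c < 8 → m ∈ (omega : M) → app e m ≠ num c

theorem num_mem_num {a b : ℕ} (h : a < b) : (num a : M) ∈ (num b : M) := by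
  induction b with
  | zero => omega
  | succ b ih =>
    rcases Nat.lt_succ_iff_lt_or_eq.1 h with h | rfl
    · exact mem_succ.2 (Or.inl (ih h))
    · exact mem_succ_self _

/-- An old variable `v_m` will be simulated by two new ones. The choice is `d m = 8 + 2m` and `e m =
9 + 2m`, which leaves `v_0, …, v_7` for parameters. -/
theorem exists_isSplit : ∃ d e : M, IsSplit d e := by
  obtain ⟨d, hd, h0, hs⟩ := exists_omega_recursion (M := M) (num 8) (G := fun x => succ (succ x))
  have fd := hd.functional
  have hω : ∀ m : M, m ∈ (omega : M) → app d m ∈ (omega : M) := fun m hm =>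
    omega_induction (P := fun m : M => app d m ∈ (omega : M)) (h0 ▸ num_mem_omega 8)
      (fun m hm ih => by rw [hs m hm]; exact succ_mem_omega (succ_mem_omega ih)) hm
  have hlow : ∀ m : M, m ∈ (omega : M) → ∀ c : ℕ, c < 8 → num c ∈ app d m := fun m hm c hc =>
    omega_induction (P := fun m : M => num c ∈ app d m) (h0 ▸ num_mem_num hc)
      (fun m hm ih => by rw [hs m hm]; simp [ih]) hm
  have hlt : ∀ n : M, n ∈ (omega : M) → ∀ m : M, m ∈ n → app d m ∈ app d n ∧
      succ (app d m) ∈ app d n := fun n hn =>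
    omega_induction (P := fun n : M => ∀ m : M, m ∈ n → app d m ∈ app d n ∧
      succ (app d m) ∈ app d n) (fun m hm => (not_mem_empty hm).elim) (fun n hn ih m hm => by
        rw [hs n hn]
        rcases mem_succ.1 hm with h | rfl
        · simp [ih m h]
        · simp) hn
  have he : ∀ m : M, m ∈ (omega : M) → app (lam omega fun m => succ (app d m)) m = succ (app d m) :=
    fun m hm => app_lam hm
  refine ⟨d, lam omega fun m => succ (app d m), ⟨hd, hω⟩,
    isFun_lam fun m hm => succ_mem_omega (hω m hm), ?_, ?_, ?_, ?_, ?_⟩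
  · intro m n hm hn e
    rcases omega_trichotomy hm hn with h | h | h
    · exact (mem_irrefl _ (e ▸ (hlt n hn m h).1)).elim
    · exact h
    · exact (mem_irrefl _ (e ▸ (hlt m hm n h).1)).elim
  · intro m n hm hn e
    rw [he m hm, he n hn] at e
    have e := succ_inj e
    rcases omega_trichotomy hm hn with h | h | h
    · exact (mem_irrefl _ (e ▸ (hlt n hn m h).1)).elim
    · exact h
    · exact (mem_irrefl _ (e ▸ (hlt m hm n h).1)).elim
  · intro m n hm hn e
    rw [he n hn] at e
    rcases omega_trichotomy hm hn with h | h | h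
    · have h1 := (hlt n hn m h).1
      rw [e] at h1
      exact mem_asymm h1 (mem_succ_self _)
    · subst h
      have h1 := mem_succ_self (app d m)
      rw [← e] at h1
      exact mem_irrefl _ h1
    · have h1 := (hlt m hm n h).2
      rw [e] at h1
      exact mem_irrefl _ h1
  · intro m c hc hm e
    exact mem_irrefl _ (e ▸ hlow m hm c hc)
  · intro m c hc hm e
    rw [he m hm] at e
    have h1 := mem_succ.2 (Or.inl (hlow m hm c hc) : (num c : M) ∈ app d m ∨ num c = app d m)
    rw [e] at h1
    exact mem_irrefl _ h1

/-! ## Substitution of coded assignments -/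

/-- The value at `b` of the assignment coded by `u`. -/
def dsec (N u b : M) : M := compr fun y => y ∈ pow N ∧ (b ∈ (omega : M) ∧ pair b y ∈ u)

@[fun_prop] theorem DefF.dsec {f g h : α → M} (hf : DefF M f) (hg : DefF M g) (hh : DefF M h) :
    DefF M fun x => dsec (f x) (g x) (h x) := by unfold ZFModel.dsec; fun_prop

theorem mem_dsec {N u b y : M} : y ∈ dsec N u b ↔ y ∈ pow N ∧ b ∈ (omega : M) ∧ pair b y ∈ u :=
  mem_sep

theorem dsec_mem_W (N u b : M) : dsec N u b ∈ pow (pow N) := mem_pow.2 fun _ h => (mem_dsec.1 h).1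

theorem union_mem_W {N a b : M} (ha : a ∈ pow (pow N)) (hb : b ∈ pow (pow N)) :
    union a b ∈ pow (pow N) := mem_pow.2 fun y hy => by
  rcases mem_union.1 hy with h | h
  · exact mem_pow.1 ha y h
  · exact mem_pow.1 hb y h

/-- Assignments for which `v_2` is `P(N)` and `v_3` is `ω`. -/
def Good (N s : M) : Prop :=
  IsAssignment (pow (pow N)) s ∧ ap s (num 2) = pow N ∧ ap s (num 3) = omega

@[fun_prop] theorem Def.good {f g : α → M} (hf : DefF M f) (hg : DefF M g) :
    Def M fun x => Good (f x) (g x) := by unfold Good; fun_prop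

/-- The translation of assignments: the value at `v_m` is computed from the values at the two new
variables of `m`. -/
def tr (N d e s : M) : M := lam omega fun m =>
  union (ap s (ap d m)) (dsec N (ap s (num 1)) (ap s (ap e m)))

@[fun_prop] theorem DefF.tr {f g h i : α → M} (hf : DefF M f) (hg : DefF M g) (hh : DefF M h)
    (hi : DefF M i) : DefF M fun x => tr (f x) (g x) (h x) (i x) := by
  unfold ZFModel.tr; fun_prop

/-- `y ∈ a ∪ dsec N u b`, as an absolute relation. -/
def InT (w u a b y : M) : Prop := y ∈ a ∨ (b ∈ w ∧ PairMem w b y u)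

@[fun_prop] theorem D0.inT {β : Type u} [Tup M β] {f g h i k : β → M} (hf : DV M f)
    (hg : DV M g) (hh : DV M h) (hi : DV M i) (hk : DV M k) :
    D0 M fun x => InT (f x) (g x) (h x) (i x) (k x) := by
  unfold InT; fun_prop

theorem inT_omega {N u a b y : M} (hy : y ∈ pow N) :
    InT omega u a b y ↔ y ∈ union a (dsec N u b) := by
  unfold InT
  rw [mem_union, mem_dsec, pairMem_omega]
  simp [hy]

section split
variable {N d e s : M} (hN : IsBase N) (hde : IsSplit d e)
include hN hde

theorem Good.tr_app (hs : Good N s) {m : M} (hm : m ∈ (omega : M)) :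
    app (tr N d e s) m =
      union (app s (app d m)) (dsec N (app s (num 1)) (app s (app e m))) := by
  unfold tr
  rw [app_lam hm, app_eq_ap hde.left.functional, app_eq_ap hde.right.functional]
  simp only [app_eq_ap hs.1.functional]

theorem Good.isAssignment_tr (hs : Good N s) : IsAssignment (pow (pow N)) (tr N d e s) := by
  refine IsAssignment.lam fun m hm => union_mem_W ?_ (dsec_mem_W _ _ _)
  rw [← app_eq_ap hde.left.functional, ← app_eq_ap hs.1.functional]
  exact hs.1.2 _ (hde.left.2 m hm)

theorem Good.update_left (hs : Good N s) {i a : M} (hi : i ∈ (omega : M))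
    (ha : a ∈ pow (pow N)) : Good N (update s (app d i) a) := by
  have h := hs.1.update (i := app d i) ha
  refine ⟨h, ?_, ?_⟩
  · rw [← app_eq_ap h.functional, app_update_ne hs.1.functional (num_mem_omega 2)
      (hde.left_ne i 2 (by omega) hi).symm, app_eq_ap hs.1.functional, hs.2.1]
  · rw [← app_eq_ap h.functional, app_update_ne hs.1.functional (num_mem_omega 3)
      (hde.left_ne i 3 (by omega) hi).symm, app_eq_ap hs.1.functional, hs.2.2]

theorem Good.update_right (hs : Good N s) {i a : M} (hi : i ∈ (omega : M))
    (ha : a ∈ pow (pow N)) : Good N (update s (app e i) a) := by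
  have h := hs.1.update (i := app e i) ha
  refine ⟨h, ?_, ?_⟩
  · rw [← app_eq_ap h.functional, app_update_ne hs.1.functional (num_mem_omega 2)
      (hde.right_ne i 2 (by omega) hi).symm, app_eq_ap hs.1.functional, hs.2.1]
  · rw [← app_eq_ap h.functional, app_update_ne hs.1.functional (num_mem_omega 3)
      (hde.right_ne i 3 (by omega) hi).symm, app_eq_ap hs.1.functional, hs.2.2]

theorem Good.tr_update (hs : Good N s) {i a b : M} (hi : i ∈ (omega : M))
    (ha : a ∈ pow (pow N)) (hb : b ∈ pow (pow N)) :
    tr N d e (update (update s (app d i) a) (app e i) b) =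
      update (tr N d e s) i (union a (dsec N (app s (num 1)) b)) := by
  have h1 := hs.update_left hN hde hi ha
  have h2 := h1.update_right hN hde hi hb
  have ht := hs.isAssignment_tr hN hde
  have f0 := hs.1.functional
  have f1 := h1.1.functional
  have n1 := num_mem_omega (M := M) 1
  refine (h2.isAssignment_tr hN hde).ext (ht.update (union_mem_W ha (dsec_mem_W _ _ _)))
    fun m hm => ?_
  have hdm := hde.left.2 m hm
  have hem := hde.right.2 m hm
  rw [h2.tr_app hN hde hm, app_update_ne f1 hdm (hde.disj m i hm hi),
    app_update_ne f1 n1 (hde.right_ne i 1 (by omega) hi).symm,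
    app_update_ne f0 n1 (hde.left_ne i 1 (by omega) hi).symm]
  by_cases h : m = i
  · subst h
    rw [app_update_self f0 hdm, app_update_self f1 hem, app_update_self ht.functional hm]
  · rw [app_update_ne f0 hdm fun e => h (hde.left_inj m i hm hi e),
      app_update_ne f1 hem fun e => h (hde.right_inj m i hm hi e),
      app_update_ne f0 hem (hde.disj i m hi hm).symm, app_update_ne ht.functional hm h,
      hs.tr_app hN hde hm]

-- A second new variable with value `ω` switches the coded part off, and the first one alone can
-- take any value. This lets a quantified variable detach itself from the code.
omit hde in
theorem dsec_omega (N u : M) : dsec N u omega = empty := eq_empty_iff.2 fun y hy =>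
  mem_irrefl _ (mem_dsec.1 hy).2.1

/-- The translation of `Σ_0` formulas. -/
theorem IsSigmaZero.translate {φ : M} (hφ : IsSigmaZero φ) : ∃ φ' : M, IsSigmaZero φ' ∧
    ∀ s : M, Good N s → (Sat (pow (pow N)) φ' s ↔ Sat (pow (pow N)) φ (tr N d e s)) := by
  have hW := hN.transitive.pow.pow
  have n1 := num_mem_omega (M := M) 1
  have n2 := num_mem_omega (M := M) 2
  have n3 := num_mem_omega (M := M) 3
  -- The translated value of `v_i` is not the value of a variable, so membership is expressed
  -- through some `z ∈ X` with the same elements.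
  have hmem : ∀ i j : M, i ∈ (omega : M) → j ∈ (omega : M) → ∃ φ' : M, IsSigmaZero φ' ∧
      ∀ s : M, Good N s → (Sat (pow (pow N)) φ' s ↔
        app (tr N d e s) i ∈ app (tr N d e s) j) := by
    intro i j hi hj
    have hD : D0 M fun p : M × M × M × M × M × M × M => ∃ z : M, z ∈ p.1 ∧
        InT p.2.1 p.2.2.1 p.2.2.2.2.2.1 p.2.2.2.2.2.2 z ∧
        ∀ y : M, y ∈ p.1 → (y ∈ z ↔ InT p.2.1 p.2.2.1 p.2.2.2.1 p.2.2.2.2.1 y) := by fun_prop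
    obtain ⟨φ', h1, h2⟩ := hD (num 2, num 3, num 1, app d i, app e i, app d j, app e j)
      ⟨n2, n3, n1, hde.left.2 i hi, hde.right.2 i hi, hde.left.2 j hj, hde.right.2 j hj⟩
    refine ⟨φ', h1, fun s hs => ?_⟩
    rw [h2 _ s hW hs.1]
    change (∃ z : M, z ∈ app s (num 2) ∧ InT (app s (num 3)) (app s (num 1)) (app s (app d j))
      (app s (app e j)) z ∧ ∀ y : M, y ∈ app s (num 2) → (y ∈ z ↔ InT (app s (num 3))
        (app s (num 1)) (app s (app d i)) (app s (app e i)) y)) ↔ _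
    rw [app_eq_ap hs.1.functional (num 2), hs.2.1, app_eq_ap hs.1.functional (num 3), hs.2.2,
      hs.tr_app hN hde hi, hs.tr_app hN hde hj]
    have hti := mem_pow.1 (union_mem_W (hs.1.2 _ (hde.left.2 i hi))
      (dsec_mem_W N (app s (num 1)) (app s (app e i))))
    have htj := mem_pow.1 (union_mem_W (hs.1.2 _ (hde.left.2 j hj))
      (dsec_mem_W N (app s (num 1)) (app s (app e j))))
    constructor
    · rintro ⟨z, hz, h3, h4⟩
      rw [inT_omega hz] at h3
      have : z = union (app s (app d i)) (dsec N (app s (num 1)) (app s (app e i))) := by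
        apply ext'
        intro y
        constructor
        · intro hy
          have hyX := hN.pow.transitive z hz y hy
          rw [← inT_omega hyX]
          exact (h4 y hyX).1 hy
        · intro hy
          have hyX := hti y hy
          rw [← inT_omega hyX] at hy
          exact (h4 y hyX).2 hy
      rwa [← this]
    · intro h
      refine ⟨_, htj _ h, (inT_omega (htj _ h)).2 h, fun y hy => ?_⟩
      rw [inT_omega hy]
  refine sigmaZero_induction (P := fun φ : M => ∃ φ' : M, IsSigmaZero φ' ∧
    ∀ s : M, Good N s → (Sat (pow (pow N)) φ' s ↔ Sat (pow (pow N)) φ (tr N d e s)))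
    ?_ ?_ ?_ ?_ ?_ hφ
  · intro i j hi hj
    obtain ⟨φ', h1, h2⟩ := hmem i j hi hj
    refine ⟨φ', h1, fun s hs => ?_⟩
    rw [h2 s hs, sat_mem (hs.isAssignment_tr hN hde) hi hj]
  · intro i j hi hj
    have hD : D0 M fun p : M × M × M × M × M × M × M =>
        ∀ y : M, y ∈ p.1 → (InT p.2.1 p.2.2.1 p.2.2.2.1 p.2.2.2.2.1 y ↔
          InT p.2.1 p.2.2.1 p.2.2.2.2.2.1 p.2.2.2.2.2.2 y) := by fun_prop
    obtain ⟨φ', h1, h2⟩ := hD (num 2, num 3, num 1, app d i, app e i, app d j, app e j)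
      ⟨n2, n3, n1, hde.left.2 i hi, hde.right.2 i hi, hde.left.2 j hj, hde.right.2 j hj⟩
    refine ⟨φ', h1, fun s hs => ?_⟩
    rw [h2 _ s hW hs.1, sat_eq (hs.isAssignment_tr hN hde) hi hj]
    change (∀ y : M, y ∈ app s (num 2) → (InT (app s (num 3)) (app s (num 1)) (app s (app d i))
      (app s (app e i)) y ↔ InT (app s (num 3))
        (app s (num 1)) (app s (app d j)) (app s (app e j)) y)) ↔ _
    rw [app_eq_ap hs.1.functional (num 2), hs.2.1, app_eq_ap hs.1.functional (num 3), hs.2.2,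
      hs.tr_app hN hde hi, hs.tr_app hN hde hj]
    have hti := mem_pow.1 (union_mem_W (hs.1.2 _ (hde.left.2 i hi))
      (dsec_mem_W N (app s (num 1)) (app s (app e i))))
    have htj := mem_pow.1 (union_mem_W (hs.1.2 _ (hde.left.2 j hj))
      (dsec_mem_W N (app s (num 1)) (app s (app e j))))
    constructor
    · intro h
      apply ext'
      intro y
      constructor
      · intro hy
        have hyX := hti y hy
        rw [← inT_omega hyX] at hy ⊢
        exact (h y hyX).1 hy
      · intro hy
        have hyX := htj y hy
        rw [← inT_omega hyX] at hy ⊢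
        exact (h y hyX).2 hy
    · intro h y hy
      rw [inT_omega hy, inT_omega hy, h]
  · rintro φ hφ ⟨φ', h1, h2⟩
    refine ⟨fNot φ', h1.not', fun s hs => ?_⟩
    rw [sat_not hs.1 h1.isFormula, sat_not (hs.isAssignment_tr hN hde) hφ.isFormula, h2 s hs]
  · rintro φ ψ hφ hψ ⟨φ', h1, h2⟩ ⟨ψ', h3, h4⟩
    refine ⟨fAnd φ' ψ', h1.and' h3, fun s hs => ?_⟩
    rw [sat_and hs.1 h1.isFormula h3.isFormula,
      sat_and (hs.isAssignment_tr hN hde) hφ.isFormula hψ.isFormula, h2 s hs, h4 s hs]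
  · rintro i j φ hi hj hij hφ ⟨φ', h1, h2⟩
    obtain ⟨χ, h3, h4⟩ := hmem i j hi hj
    have hdi := hde.left.2 i hi
    have hei := hde.right.2 i hi
    -- The bound on `v_i` turns into the bound `X` on both new variables, with the original bound
    -- kept as the conjunct `χ`. Nothing is lost, as elements of elements of `W` lie in `X`.
    refine ⟨fBddEx (app d i) (num 2) (fBddEx (app e i) (num 2) (fAnd χ φ')),
      ((h3.and' h1).bex' hei n2 (hde.right_ne i 2 (by omega) hi)).bex' hdi n2
        (hde.left_ne i 2 (by omega) hi), fun s hs => ?_⟩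
    have ht := hs.isAssignment_tr hN hde
    rw [sat_bex hs.1 hW hdi n2 (hde.left_ne i 2 (by omega) hi)
      ((h3.and' h1).bex' hei n2 (hde.right_ne i 2 (by omega) hi)).isFormula,
      sat_bex ht hW hi hj hij hφ.isFormula, app_eq_ap hs.1.functional, hs.2.1]
    have key : ∀ a : M, a ∈ pow N → (Sat (pow (pow N)) (fBddEx (app e i) (num 2) (fAnd χ φ'))
        (update s (app d i) a) ↔ ∃ b : M, b ∈ pow N ∧
          union a (dsec N (app s (num 1)) b) ∈ app (tr N d e s) j ∧
          Sat (pow (pow N)) φ (update (tr N d e s) i (union a (dsec N (app s (num 1)) b)))) := by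
      intro a ha
      have haW := sub_W hN ha
      have hs1 := hs.update_left hN hde hi haW
      rw [sat_bex hs1.1 hW hei n2 (hde.right_ne i 2 (by omega) hi) (h3.and' h1).isFormula,
        app_eq_ap hs1.1.functional, hs1.2.1]
      refine exists_congr fun b => and_congr_right fun hb => ?_
      have hbW := sub_W hN hb
      have hs2 := hs1.update_right hN hde hi hbW
      rw [sat_and hs2.1 h3.isFormula h1.isFormula, h4 _ hs2, h2 _ hs2,
        hs.tr_update hN hde hi haW hbW, app_update_self ht.functional hi,
        app_update_ne ht.functional hj hij.symm]
    constructor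
    · rintro ⟨a, ha, h⟩
      obtain ⟨b, hb, h5, h6⟩ := (key a ha).1 h
      exact ⟨_, h5, h6⟩
    · rintro ⟨x, hx, h⟩
      have hxX := mem_pow.1 (ht.2 j hj) x hx
      refine ⟨x, hxX, (key x hxX).2 ⟨omega, omega_mem_X hN, ?_⟩⟩
      have : union x (dsec N (app s (num 1)) omega) = x := by
        rw [dsec_omega hN]
        apply ext'
        intro y
        simp
      rw [this]
      exact ⟨hx, h⟩

/-- `χ` is a `Σ_0` formula whose truth does not depend on the new variables. -/
def IsSide (N d e χ : M) : Prop := IsSigmaZero χ ∧ ∀ s i a : M, Good N s → i ∈ (omega : M) →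
  a ∈ pow (pow N) → (Sat (pow (pow N)) χ s ↔ Sat (pow (pow N)) χ (upd s (ap d i) a)) ∧
    (Sat (pow (pow N)) χ s ↔ Sat (pow (pow N)) χ (upd s (ap e i) a))

end split

@[fun_prop] theorem Def.isSide {f g h i : α → M} (hf : DefF M f) (hg : DefF M g) (hh : DefF M h)
    (hi : DefF M i) : Def M fun x => IsSide (f x) (g x) (h x) (i x) := by
  unfold IsSide; fun_prop

section split
variable {N d e s : M} (hN : IsBase N) (hde : IsSplit d e)
include hN hde

theorem IsSide.not' {χ : M} (h : IsSide N d e χ) : IsSide N d e (fNot χ) := by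
  refine ⟨h.1.not', fun s i a hs hi ha => ?_⟩
  have h1 := (hs.update_left hN hde hi ha).1
  have h2 := (hs.update_right hN hde hi ha).1
  have h3 := h.2 s i a hs hi ha
  rw [update_eq_upd hs.1.functional, app_eq_ap hde.left.functional] at h1
  rw [update_eq_upd hs.1.functional, app_eq_ap hde.right.functional] at h2
  rw [sat_not hs.1 h.1.isFormula, sat_not h1 h.1.isFormula, sat_not h2 h.1.isFormula]
  exact ⟨not_congr h3.1, not_congr h3.2⟩

theorem IsSide.and' {χ χ' : M} (h : IsSide N d e χ) (h' : IsSide N d e χ') :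
    IsSide N d e (fAnd χ χ') := by
  refine ⟨h.1.and' h'.1, fun s i a hs hi ha => ?_⟩
  have h1 := (hs.update_left hN hde hi ha).1
  have h2 := (hs.update_right hN hde hi ha).1
  have h3 := h.2 s i a hs hi ha
  have h4 := h'.2 s i a hs hi ha
  rw [update_eq_upd hs.1.functional, app_eq_ap hde.left.functional] at h1
  rw [update_eq_upd hs.1.functional, app_eq_ap hde.right.functional] at h2
  rw [sat_and hs.1 h.1.isFormula h'.1.isFormula, sat_and h1 h.1.isFormula h'.1.isFormula,
    sat_and h2 h.1.isFormula h'.1.isFormula]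
  exact ⟨and_congr h3.1 h4.1, and_congr h3.2 h4.2⟩

theorem IsSide.update2 {χ : M} (h : IsSide N d e χ) (hs : Good N s) {i a b : M}
    (hi : i ∈ (omega : M)) (ha : a ∈ pow (pow N)) (hb : b ∈ pow (pow N)) :
    Sat (pow (pow N)) χ s ↔
      Sat (pow (pow N)) χ (update (update s (app d i) a) (app e i) b) := by
  have h1 := hs.update_left hN hde hi ha
  rw [(h.2 s i a hs hi ha).1, ← app_eq_ap hde.left.functional, ← update_eq_upd hs.1.functional,
    (h.2 _ i b h1 hi hb).2, ← app_eq_ap hde.right.functional, ← update_eq_upd h1.1.functional]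

/-- The translation of `Σ_n` formulas, with side conditions. -/
theorem IsSigma.translate {n φ : M} (hφ : IsSigma n φ) : ∀ χ θ : M, IsSide N d e χ →
    IsSide N d e θ → ∃ φ' : M, IsSigma n φ' ∧ ∀ s : M, Good N s →
      (Sat (pow (pow N)) φ' s ↔ (Sat (pow (pow N)) φ (tr N d e s) ∧ Sat (pow (pow N)) χ s) ∨
        Sat (pow (pow N)) θ s) := by
  refine sigma_induction (P := fun n φ => ∀ χ θ : M, IsSide N d e χ →
    IsSide N d e θ → ∃ φ' : M, IsSigma n φ' ∧ ∀ s : M, Good N s →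
      (Sat (pow (pow N)) φ' s ↔ (Sat (pow (pow N)) φ (tr N d e s) ∧ Sat (pow (pow N)) χ s) ∨
        Sat (pow (pow N)) θ s)) ?_ ?_ ?_ hφ
  · intro ψ hψ
    have key : ∀ χ θ : M, IsSide N d e χ →
      IsSide N d e θ → ∃ φ' : M, IsSigmaZero φ' ∧ ∀ s : M, Good N s →
      (Sat (pow (pow N)) φ' s ↔ (Sat (pow (pow N)) ψ (tr N d e s) ∧ Sat (pow (pow N)) χ s) ∨
        Sat (pow (pow N)) θ s) := by
      intro χ θ hχ hθ
      obtain ⟨φ', h1, h2⟩ := hψ.translate hN hde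
      have h3 := (h1.and' hχ.1).not'.and' hθ.1.not'
      refine ⟨fNot (fAnd (fNot (fAnd φ' χ)) (fNot θ)), h3.not', fun s hs => ?_⟩
      rw [sat_not hs.1 h3.isFormula, sat_and hs.1 (h1.and' hχ.1).not'.isFormula hθ.1.not'.isFormula,
        sat_not hs.1 (h1.and' hχ.1).isFormula, sat_and hs.1 h1.isFormula hχ.1.isFormula,
        sat_not hs.1 hθ.1.isFormula, h2 s hs]
      tauto
    constructor
    · intro χ θ hχ hθ
      obtain ⟨φ', h1, h2⟩ := key χ θ hχ hθ
      exact ⟨φ', .zero h1, h2⟩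
    · intro χ θ hχ hθ
      obtain ⟨φ', h1, h2⟩ := key χ θ hχ hθ
      exact ⟨φ', .one h1, h2⟩
  · intro m ψ hm hψ ih χ θ hχ hθ
    -- Side conditions are pushed into the matrix so that the level does not rise. The shape `(φ ∧
    -- χ) ∨ θ` survives negation: `¬((ψ ∧ ¬θ) ∨ (¬χ ∧ ¬θ))` is equivalent to `(¬ψ ∧ χ) ∨ θ`.
    obtain ⟨φ', h1, h2⟩ := ih (fNot θ) (fAnd (fNot χ) (fNot θ)) (hθ.not' hN hde)
      ((hχ.not' hN hde).and' hN hde (hθ.not' hN hde))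
    refine ⟨fNot φ', h1.not' hm, fun s hs => ?_⟩
    rw [sat_not hs.1 h1.isFormula, h2 s hs, sat_not (hs.isAssignment_tr hN hde) hψ.isFormula,
      sat_and hs.1 hχ.1.not'.isFormula hθ.1.not'.isFormula, sat_not hs.1 hχ.1.isFormula,
      sat_not hs.1 hθ.1.isFormula]
    tauto
  · intro m i ψ hm hi hψ ih χ θ hχ hθ
    obtain ⟨φ', h1, h2⟩ := ih χ θ hχ hθ
    have hdi := hde.left.2 i hi
    have hei := hde.right.2 i hi
    refine ⟨fEx (app d i) (fEx (app e i) φ'), (h1.ex' hm hei).ex' hm hdi, fun s hs => ?_⟩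
    have ht := hs.isAssignment_tr hN hde
    rw [sat_ex hs.1 hdi (h1.ex' hm hei).isFormula, sat_ex ht hi hψ.isFormula]
    have key : ∀ a : M, a ∈ pow (pow N) → (Sat (pow (pow N)) (fEx (app e i) φ')
        (update s (app d i) a) ↔ ∃ b : M, b ∈ pow (pow N) ∧
          ((Sat (pow (pow N)) ψ (update (tr N d e s) i (union a (dsec N (app s (num 1)) b))) ∧
            Sat (pow (pow N)) χ s) ∨ Sat (pow (pow N)) θ s)) := by
      intro a ha
      have hs1 := hs.update_left hN hde hi ha
      rw [sat_ex hs1.1 hei h1.isFormula]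
      refine exists_congr fun b => and_congr_right fun hb => ?_
      rw [h2 _ (hs1.update_right hN hde hi hb), hs.tr_update hN hde hi ha hb,
        ← hχ.update2 hN hde hs hi ha hb, ← hθ.update2 hN hde hs hi ha hb]
    constructor
    · rintro ⟨a, ha, h⟩
      obtain ⟨b, hb, h | h⟩ := (key a ha).1 h
      · exact Or.inl ⟨⟨_, union_mem_W ha (dsec_mem_W _ _ _), h.1⟩, h.2⟩
      · exact Or.inr h
    · rintro (⟨⟨x, hx, h⟩, h'⟩ | h)
      · refine ⟨x, hx, (key x hx).2 ⟨omega, omega_mem_W hN, Or.inl ⟨?_, h'⟩⟩⟩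
        have : union x (dsec N (app s (num 1)) omega) = x := by
          rw [dsec_omega hN]
          apply ext'
          intro y
          simp
        rwa [this]
      · exact ⟨omega, omega_mem_W hN, (key _ (omega_mem_W hN)).2 ⟨omega, omega_mem_W hN, Or.inr h⟩⟩

end split

end ZFModel

end

noncomputable section

namespace ZFModel


variable {M : Type u} [Membership M M] [Nonempty M] [ModelsZF M] {α : Type u} [Ctx M α]

/-! ## Blocks of existential quantifiers -/

theorem IsPi.of_zero {φ : M} (h : IsSigmaZero φ) : IsPi empty φ := Or.inl ⟨rfl, h⟩

theorem IsPi.of_succ {n φ : M} (h : IsSigma (succ n) φ) : IsPi (succ n) (fNot φ) :=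
  Or.inr ⟨succ_ne_empty n, φ, h, rfl⟩

/-- A `Σ_(k+1)` formula says that a `Π_k` formula holds for some values of finitely many
variables. -/
theorem IsSigma.contract {k φ : M} (h : IsSigma (succ k) φ) : ∃ I ψ : M, Sub I omega ∧ IsPi k ψ ∧
    ∀ A s : M, IsAssignment A s → (Sat A φ s ↔ ∃ t : M, IsAssignment A t ∧
      (∀ m : M, m ∈ (omega : M) → ¬ m ∈ I → ap t m = ap s m) ∧ Sat A ψ t) := by
  refine sigma_induction (P := fun n φ : M => ∀ k : M, n = succ k → ∃ I ψ : M, Sub I omega ∧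
    IsPi k ψ ∧ ∀ A s : M, IsAssignment A s → (Sat A φ s ↔ ∃ t : M, IsAssignment A t ∧
      (∀ m : M, m ∈ (omega : M) → ¬ m ∈ I → ap t m = ap s m) ∧ Sat A ψ t))
    ?_ ?_ ?_ h (by fun_prop) k rfl
  · have triv : ∀ ψ A s : M, IsAssignment A s → (Sat A ψ s ↔ ∃ t : M, IsAssignment A t ∧
        (∀ m : M, m ∈ (omega : M) → ¬ m ∈ (empty : M) → ap t m = ap s m) ∧ Sat A ψ t) := by
      intro ψ A s hs
      constructor
      · exact fun h => ⟨s, hs, fun _ _ _ => rfl, h⟩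
      · rintro ⟨t, ht, h, h'⟩
        have : t = s := ht.ext hs fun m hm => by
          rw [app_eq_ap ht.functional, app_eq_ap hs.functional]
          exact h m hm not_mem_empty
        rwa [← this]
    intro ψ hψ
    refine ⟨fun k e => (succ_ne_empty k e.symm).elim, fun k e => ?_⟩
    have hk : k = empty := (succ_inj e).symm
    subst hk
    exact ⟨empty, ψ, empty_sub _, .of_zero hψ, triv ψ⟩
  · intro m ψ hm hψ _ k e
    rw [← succ_inj e]
    refine ⟨empty, fNot ψ, empty_sub _, .of_succ hψ, fun A s hs => ?_⟩
    constructor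
    · exact fun h => ⟨s, hs, fun _ _ _ => rfl, h⟩
    · rintro ⟨t, ht, h, h'⟩
      have : t = s := ht.ext hs fun m hm => by
        rw [app_eq_ap ht.functional, app_eq_ap hs.functional]
        exact h m hm not_mem_empty
      rwa [← this]
  · intro m i ψ hm hi hψ ih k e
    obtain ⟨I, θ, hI, hθ, h⟩ := ih k e
    refine ⟨union I (dbl i i), θ, fun z hz => ?_, hθ, fun A s hs => ?_⟩
    · rcases mem_union.1 hz with h | h
      · exact hI z h
      · rw [mem_dbl, or_self] at h
        rwa [h]
    · have key : ∀ a t : M, a ∈ A → IsAssignment A t → ∀ m : M, m ∈ (omega : M) →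
          (ap (update s i a) m = open Classical in if m = i then a else ap s m) := by
        intro a t ha ht m hm
        rw [← app_eq_ap (hs.update ha).functional, app_update hs.functional hm,
          app_eq_ap hs.functional]
      rw [sat_ex hs hi hψ.isFormula]
      constructor
      · rintro ⟨a, ha, h1⟩
        obtain ⟨t, ht, h2, h3⟩ := (h A _ (hs.update ha)).1 h1
        refine ⟨t, ht, fun m hm hmI => ?_, h3⟩
        rw [mem_union, mem_dbl, or_self, not_or] at hmI
        rw [h2 m hm hmI.1, key a t ha ht m hm, if_neg hmI.2]
      · rintro ⟨t, ht, h2, h3⟩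
        have ha := ht.2 i hi
        refine ⟨app t i, ha, (h A _ (hs.update ha)).2 ⟨t, ht, fun m hm hmI => ?_, h3⟩⟩
        rw [key _ t ha ht m hm]
        split_ifs with hmi
        · rw [hmi, app_eq_ap ht.functional]
        · exact h2 m hm (by rw [mem_union, mem_dbl, or_self, not_or]; exact ⟨hmI, hmi⟩)

/-! ## Side conditions -/

section split
variable {N d e s : M} (hN : IsBase N) (hde : IsSplit d e)
include hN hde

/-- The condition involves only `v_0, …, v_5`, and the new variables avoid `v_0, …, v_7`. -/
theorem exists_isSide {P : M × M × M × M × M × M → Prop} (hP : D0 M P := by fun_prop) :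
    ∃ χ : M, IsSide N d e χ ∧ ∀ s : M, Good N s → (Sat (pow (pow N)) χ s ↔
      P (app s (num 0), app s (num 1), pow N, omega, app s (num 4), app s (num 5))) := by
  have hW := hN.transitive.pow.pow
  obtain ⟨χ, h1, h2⟩ := hP (num 0, num 1, num 2, num 3, num 4, num 5)
    ⟨num_mem_omega 0, num_mem_omega 1, num_mem_omega 2, num_mem_omega 3, num_mem_omega 4,
      num_mem_omega 5⟩
  have h3 : ∀ s : M, Good N s → (Sat (pow (pow N)) χ s ↔
      P (app s (num 0), app s (num 1), pow N, omega, app s (num 4), app s (num 5))) := by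
    intro s hs
    rw [h2 _ s hW hs.1]
    change P (app s (num 0), app s (num 1), app s (num 2), app s (num 3), app s (num 4),
      app s (num 5)) ↔ _
    rw [app_eq_ap hs.1.functional (num 2), hs.2.1, app_eq_ap hs.1.functional (num 3), hs.2.2]
  refine ⟨χ, ⟨h1, fun s i a hs hi ha => ?_⟩, h3⟩
  have h4 := hs.update_left hN hde hi ha
  have h5 := hs.update_right hN hde hi ha
  have h6 : ∀ c : ℕ, c < 8 → app (update s (app d i) a) (num c) = app s (num c) := fun c hc =>
    app_update_ne hs.1.functional (num_mem_omega c) (hde.left_ne i c hc hi).symm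
  have h7 : ∀ c : ℕ, c < 8 → app (update s (app e i) a) (num c) = app s (num c) := fun c hc =>
    app_update_ne hs.1.functional (num_mem_omega c) (hde.right_ne i c hc hi).symm
  rw [← app_eq_ap hde.left.functional, ← app_eq_ap hde.right.functional,
    ← update_eq_upd hs.1.functional, ← update_eq_upd hs.1.functional, h3 s hs, h3 _ h4, h3 _ h5,
    h6 0 (by omega), h6 1 (by omega), h6 4 (by omega), h6 5 (by omega),
    h7 0 (by omega), h7 1 (by omega), h7 4 (by omega), h7 5 (by omega)]
  exact ⟨Iff.rfl, Iff.rfl⟩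

theorem exists_isSide_true : ∃ χ : M, IsSide N d e χ ∧
    ∀ s : M, Good N s → Sat (pow (pow N)) χ s := by
  obtain ⟨χ, h1, h2⟩ := exists_isSide hN hde (P := fun p => p.1 = p.1)
  exact ⟨χ, h1, fun s hs => (h2 s hs).2 rfl⟩

/-- The translation of `Π_k` formulas, with a side condition. -/
theorem IsPi.translate {k ψ χ : M} (hψ : IsPi k ψ) (hχ : IsSide N d e χ) :
    ∃ ψ' : M, IsPi k ψ' ∧ ∀ s : M, Good N s → (Sat (pow (pow N)) ψ' s ↔
      Sat (pow (pow N)) ψ (tr N d e s) ∧ Sat (pow (pow N)) χ s) := by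
  obtain ⟨τ, hτ, hτ'⟩ := exists_isSide_true hN hde
  rcases hψ with ⟨rfl, hψ⟩ | ⟨hk, σ, hσ, rfl⟩
  · obtain ⟨φ', h1, h2⟩ := IsSigma.translate hN hde (.zero hψ) χ (fNot τ) hχ (hτ.not' hN hde)
    refine ⟨φ', .of_zero h1.isSigmaZero, fun s hs => ?_⟩
    rw [h2 s hs, sat_not hs.1 hτ.1.isFormula]
    have := hτ' s hs
    tauto
  · obtain ⟨φ', h1, h2⟩ := IsSigma.translate hN hde hσ τ (fNot χ) hτ (hχ.not' hN hde)
    refine ⟨fNot φ', Or.inr ⟨hk, φ', h1, rfl⟩, fun s hs => ?_⟩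
    rw [sat_not hs.1 h1.isFormula, h2 s hs, sat_not hs.1 hχ.1.isFormula,
      sat_not (hs.isAssignment_tr hN hde) hσ.isFormula]
    have := hτ' s hs
    tauto

end split

/-! ### An assignment with the parameters of side conditions -/

open Classical in
/-- The assignment with values `P(N)`, `ω`, `p`, `q` at `v_2`, …, `v_5`, with value `m` at the
second new variable of `m`, and with value `∅` elsewhere. -/
def paramAsg (N e p q : M) : M := lam omega fun v =>
  if v = num 2 then pow N else if v = num 3 then omega else if v = num 4 then p
    else if v = num 5 then q else sUnion (compr fun m => m ∈ (omega : M) ∧ ap e m = v)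

/-- For these values the translated assignment is `m ↦ ∅ ∪ dsec N u m`, where `u` is the value at
`v_1`. It is thus the assignment coded by `u`. -/
structure IsParamAsg (N d e p q s : M) : Prop where
  good : Good N s
  val_p : app s (num 4) = p
  val_q : app s (num 5) = q
  left : ∀ m : M, m ∈ (omega : M) → app s (app d m) = empty
  right : ∀ m : M, m ∈ (omega : M) → app s (app e m) = m

section split
variable {N d e p q s : M} (hN : IsBase N) (hde : IsSplit d e)
include hN hde

theorem IsParamAsg.update {a b : M} (hs : IsParamAsg N d e p q s) (ha : a ∈ pow (pow N))
    (hb : b ∈ pow (pow N)) :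
    IsParamAsg N d e p q (update (update s (num 0) a) (num 1) b) ∧
      app (ZFModel.update (ZFModel.update s (num 0) a) (num 1) b) (num 0) = a ∧
      app (ZFModel.update (ZFModel.update s (num 0) a) (num 1) b) (num 1) = b := by
  have n0 := num_mem_omega (M := M) 0
  have n1 := num_mem_omega (M := M) 1
  have h0 := hs.good.1.functional
  have h1 := (hs.good.1.update (i := num 0) ha)
  have h2 := (h1.update (i := num 1) hb)
  have key : ∀ v : M, v ∈ (omega : M) → v ≠ num 0 → v ≠ num 1 →
      app (ZFModel.update (ZFModel.update s (num 0) a) (num 1) b) v = app s v := by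
    intro v hv e0 e1
    rw [app_update_ne h1.functional hv e1, app_update_ne h0 hv e0]
  refine ⟨⟨⟨h2, ?_, ?_⟩, ?_, ?_, fun m hm => ?_, fun m hm => ?_⟩, ?_, ?_⟩
  · rw [← app_eq_ap h2.functional, key _ (num_mem_omega 2) (num_ne (by omega)) (num_ne (by omega)),
      app_eq_ap h0, hs.good.2.1]
  · rw [← app_eq_ap h2.functional, key _ (num_mem_omega 3) (num_ne (by omega)) (num_ne (by omega)),
      app_eq_ap h0, hs.good.2.2]
  · rw [key _ (num_mem_omega 4) (num_ne (by omega)) (num_ne (by omega)), hs.val_p]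
  · rw [key _ (num_mem_omega 5) (num_ne (by omega)) (num_ne (by omega)), hs.val_q]
  · rw [key _ (hde.left.2 m hm) (hde.left_ne m 0 (by omega) hm) (hde.left_ne m 1 (by omega) hm),
      hs.left m hm]
  · rw [key _ (hde.right.2 m hm) (hde.right_ne m 0 (by omega) hm)
      (hde.right_ne m 1 (by omega) hm), hs.right m hm]
  · rw [app_update_ne h1.functional n0 (num_ne (by omega)), app_update_self h0 n0]
  · rw [app_update_self h1.functional n1]

theorem IsParamAsg.tr_eq (hs : IsParamAsg N d e p q s) :
    tr N d e s = lam omega fun m => dsec N (app s (num 1)) m := by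
  have ht := hs.good.isAssignment_tr hN hde
  refine ht.1.ext isFunOn_lam fun m hm => ?_
  rw [hs.good.tr_app hN hde hm, app_lam hm, hs.left m hm, hs.right m hm]
  apply ext'
  intro y
  simp

theorem isParamAsg_paramAsg (hp : p ∈ pow (pow N)) (hq : q ∈ pow (pow N)) :
    IsParamAsg N d e p q (paramAsg N e p q) := by
  have fe := hde.right.functional
  have hr : ∀ m : M, m ∈ (omega : M) →
      sUnion (compr fun m' => m' ∈ (omega : M) ∧ ap e m' = app e m) = m := by
    intro m hm
    have h1 : ∀ m' : M, m' ∈ compr (fun m' => m' ∈ (omega : M) ∧ ap e m' = app e m) ↔ m' = m := by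
      intro m'
      rw [mem_sep, ← app_eq_ap fe]
      exact ⟨fun h => hde.right_inj _ _ h.1 hm h.2, fun h => by rw [h]; exact ⟨hm, rfl⟩⟩
    apply ext'
    intro y
    rw [mem_sUnion]
    simp only [h1, exists_eq_left]
  have hl : ∀ v : M, (∀ m : M, m ∈ (omega : M) → app e m ≠ v) →
      sUnion (compr fun m' => m' ∈ (omega : M) ∧ ap e m' = v) = empty := by
    intro v hv
    refine eq_empty_iff.2 fun y hy => ?_
    obtain ⟨m, hm, _⟩ := mem_sUnion.1 hy
    rw [mem_sep, ← app_eq_ap fe] at hm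
    exact hv m hm.1 hm.2
  have hasg : IsAssignment (pow (pow N)) (paramAsg N e p q) := by
    refine isFun_lam fun v hv => ?_
    split_ifs
    · exact X_mem_W N
    · exact omega_mem_W hN
    · exact hp
    · exact hq
    · by_cases h : ∃ m : M, m ∈ (omega : M) ∧ app e m = v
      · obtain ⟨m, hm, rfl⟩ := h
        rw [hr m hm]
        exact hN.pow.pow.omega_sub m hm
      · rw [hl v fun m hm e => h ⟨m, hm, e⟩]
        exact hN.pow.pow.empty_mem
  have n2 := num_mem_omega (M := M) 2
  have n3 := num_mem_omega (M := M) 3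
  have n4 := num_mem_omega (M := M) 4
  have n5 := num_mem_omega (M := M) 5
  refine ⟨⟨hasg, ?_, ?_⟩, ?_, ?_, fun m hm => ?_, fun m hm => ?_⟩
  · rw [← app_eq_ap hasg.functional]
    unfold paramAsg
    rw [app_lam n2, if_pos rfl]
  · rw [← app_eq_ap hasg.functional]
    unfold paramAsg
    rw [app_lam n3, if_neg (num_ne (by omega)), if_pos rfl]
  · unfold paramAsg
    rw [app_lam n4, if_neg (num_ne (by omega)), if_neg (num_ne (by omega)), if_pos rfl]
  · unfold paramAsg
    rw [app_lam n5, if_neg (num_ne (by omega)), if_neg (num_ne (by omega)),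
      if_neg (num_ne (by omega)), if_pos rfl]
  · unfold paramAsg
    rw [app_lam (hde.left.2 m hm), if_neg (hde.left_ne m 2 (by omega) hm),
      if_neg (hde.left_ne m 3 (by omega) hm), if_neg (hde.left_ne m 4 (by omega) hm),
      if_neg (hde.left_ne m 5 (by omega) hm)]
    exact hl _ fun m' hm' h => hde.disj m m' hm hm' h.symm
  · unfold paramAsg
    rw [app_lam (hde.right.2 m hm), if_neg (hde.right_ne m 2 (by omega) hm),
      if_neg (hde.right_ne m 3 (by omega) hm), if_neg (hde.right_ne m 4 (by omega) hm),
      if_neg (hde.right_ne m 5 (by omega) hm)]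
    exact hr m hm

end split

/-- Flatness of pairs makes an `ω`-sequence of elements of `W` a single element of `W`, so one
variable can stand for all variables of a formula. -/
theorem exists_assignment_code {N s : M} (hN : IsBase N) (hs : IsAssignment (pow (pow N)) s) :
    ∃ u : M, u ∈ pow (pow N) ∧ ∀ m : M, m ∈ (omega : M) → dsec N u m = app s m := by
  have fs := hs.functional
  refine ⟨compr fun z => z ∈ pow N ∧ ∃ m y : M, m ∈ (omega : M) ∧ y ∈ app s m ∧ z = pair m y,
    mem_pow.2 fun z hz => ((mem_sep).1 hz).1, fun m hm => ?_⟩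
  apply ext'
  intro y
  rw [mem_dsec, mem_sep]
  constructor
  · rintro ⟨_, _, _, m', y', _, h, e⟩
    rw [pair_inj] at e
    rw [e.1, e.2]
    exact h
  · intro h
    have hy := mem_pow.1 (hs.2 m hm) y h
    exact ⟨hy, hm, hN.pow.pair_mem _ _ (hN.pow.omega_sub m hm) hy, m, y, hm, h, rfl⟩

end ZFModel

end

noncomputable section

namespace ZFModel


variable {M : Type u} [Membership M M] [Nonempty M] [ModelsZF M] {α : Type u} [Ctx M α]

/-! ## The theorem of Łoś -/

theorem ap_lam {d x : M} {F : M → M} (hx : x ∈ d) (hF : DefF M F := by fun_prop) :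
    ap (lam d F) x = F x := by rw [← app_eq_ap (isFunOn_lam hF).functional, app_lam hx hF]

/-- `g` is a family of assignments into `P(P(N))`, indexed by `P(N)`. -/
def IsSeq (N g : M) : Prop := ∀ A : M, A ∈ pow N → IsAssignment (pow (pow N)) (ap g A)

@[fun_prop] theorem Def.isSeq {f g : α → M} (hf : DefF M f) (hg : DefF M g) :
    Def M fun x => IsSeq (f x) (g x) := by unfold IsSeq; fun_prop

/-- The assignment into the ultrapower given by a family of assignments. -/
def tseq (N μ g : M) : M := lam omega fun m => val N μ fun A => ap (ap g A) m

@[fun_prop] theorem DefF.tseq {f g h : α → M} (hf : DefF M f) (hg : DefF M g) (hh : DefF M h) :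
    DefF M fun x => tseq (f x) (g x) (h x) := by unfold ZFModel.tseq; fun_prop

theorem isAssignment_tseq {N μ g : M} : IsAssignment (pow (pow N)) (tseq N μ g) :=
  .lam fun m _ => val_mem_W

theorem app_tseq {N μ g m : M} (hm : m ∈ (omega : M)) :
    app (tseq N μ g) m = val N μ fun A => ap (ap g A) m := app_lam hm

/-- The theorem of Łoś for the formula `φ`. -/
def Los (N μ φ : M) : Prop := ∀ g : M, IsSeq N g →
  (Sat (pow (pow N)) φ (tseq N μ g) ↔ AlmostAll (pow N) μ fun A => Sat (pow (pow N)) φ (ap g A))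

@[fun_prop] theorem Def.los {f g h : α → M} (hf : DefF M f) (hg : DefF M g) (hh : DefF M h) :
    Def M fun x => Los (f x) (g x) (h x) := by unfold Los; fun_prop

/-- Every relation between `P(N)` and `P(P(N))` that is `Π_k`-definable over `P(P(N))` can be
uniformized. -/
def Unif (N μ k : M) : Prop := ∀ R : M, IsRelation R (pow N) (pow (pow N)) →
  IsPiDefinable k (pow (pow N)) R → HasUniformization (pow N) μ R

section rein
variable {N μ : M} (hN : IsBase N) (hμ : IsRein N μ)
include hN hμ

omit hN in
theorem Los.not' {φ : M} (hφ : IsFormula φ) (h : Los N μ φ) : Los N μ (fNot φ) := by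
  intro g hg
  rw [sat_not isAssignment_tseq hφ, h g hg, ← hμ.ultra.not]
  exact almostAll_congr fun A hA => (sat_not (hg A hA) hφ).symm

theorem IsSeq.val_mem_W {g m : M} (hg : IsSeq N g) (hm : m ∈ (omega : M)) :
    AlmostAll (pow N) μ fun A => ap (ap g A) m ∈ pow (pow N) :=
  hμ.ultra.all fun A hA => by rw [← app_eq_ap (hg A hA).functional]; exact (hg A hA).2 m hm

/-- Atomic formulas are `IsRein.val_mem` and `IsRein.val_inj`. The witnesses of a bounded quantifier
lie in `X`, so uniformizing a relation on `X` is enough; the resulting function agrees almost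
everywhere with some `pre N z`, and `z` is the witness in the ultrapower. -/
theorem IsSigmaZero.los {φ : M} (hφ : IsSigmaZero φ) : Los N μ φ := by
  have hU := hμ.ultra
  have hW := hN.transitive.pow.pow
  refine sigmaZero_induction (P := fun φ : M => Los N μ φ) ?_ ?_ ?_ ?_ ?_ hφ
  · intro i j hi hj g hg
    rw [sat_mem isAssignment_tseq hi hj, app_tseq hi, app_tseq hj,
      hμ.val_mem hN (hg.val_mem_W hN hμ hi) (hg.val_mem_W hN hμ hj)]
    refine almostAll_congr fun A hA => ?_
    rw [sat_mem (hg A hA) hi hj, app_eq_ap (hg A hA).functional, app_eq_ap (hg A hA).functional]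
  · intro i j hi hj g hg
    rw [sat_eq isAssignment_tseq hi hj, app_tseq hi, app_tseq hj,
      hμ.val_inj hN (hg.val_mem_W hN hμ hi) (hg.val_mem_W hN hμ hj)]
    refine almostAll_congr fun A hA => ?_
    rw [sat_eq (hg A hA) hi hj, app_eq_ap (hg A hA).functional, app_eq_ap (hg A hA).functional]
  · exact fun φ hφ h => h.not' hμ hφ.isFormula
  · intro φ ψ hφ hψ h h' g hg
    rw [sat_and isAssignment_tseq hφ.isFormula hψ.isFormula, h g hg, h' g hg, ← hU.and_iff]
    exact almostAll_congr fun A hA => (sat_and (hg A hA) hφ.isFormula hψ.isFormula).symm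
  · intro i j φ hi hj hij hφ ih g hg
    -- the effect of changing the value at `v_i` to the class of `pre N z`
    have key : ∀ z : M, z ∈ pow N → (Sat (pow (pow N)) φ (update (tseq N μ g) i z) ↔
        AlmostAll (pow N) μ fun A => Sat (pow (pow N)) φ (upd (ap g A) i (pre N z A))) := by
      intro z hz
      obtain ⟨g', hg'⟩ : ∃ g' : M, ∀ A : M, A ∈ pow N → ap g' A = upd (ap g A) i (pre N z A) := by
        refine ⟨lam (pow N) fun A => upd (ap g A) i (pre N z A), fun A hA => ?_⟩
        rw [ap_lam hA]
      have hup : ∀ A : M, A ∈ pow N → IsAssignment (pow (pow N)) (upd (ap g A) i (pre N z A)) :=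
        fun A hA => by
          rw [← update_eq_upd (hg A hA).functional]
          exact (hg A hA).update (sub_W hN (pre_mem N z A))
      have hs : IsSeq N g' := fun A hA => by rw [hg' A hA]; exact hup A hA
      have e : tseq N μ g' = update (tseq N μ g) i z := by
        have ht := isAssignment_tseq (N := N) (μ := μ) (g := g)
        refine isAssignment_tseq.ext (ht.update (sub_W hN hz)) fun m hm => ?_
        rw [app_tseq hm]
        by_cases h : m = i
        · rw [h, app_update_self ht.functional hi, ← hμ.val_pre hN hz]
          refine val_congr fun A hA => ?_
          rw [hg' A hA, ← update_eq_upd (hg A hA).functional,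
            ← app_eq_ap ((hg A hA).update (sub_W hN (pre_mem N z A))).functional,
            app_update_self (hg A hA).functional hi]
        · rw [app_update_ne ht.functional hm h, app_tseq hm]
          refine val_congr fun A hA => ?_
          rw [hg' A hA, ← update_eq_upd (hg A hA).functional,
            ← app_eq_ap ((hg A hA).update (sub_W hN (pre_mem N z A))).functional,
            app_update_ne (hg A hA).functional hm h, app_eq_ap (hg A hA).functional]
      rw [← e, ih g' hs]
      exact almostAll_congr fun A hA => by rw [hg' A hA]
    have hbex : ∀ A : M, A ∈ pow N → (Sat (pow (pow N)) (fBddEx i j φ) (ap g A) ↔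
        ∃ u : M, u ∈ ap (ap g A) j ∧ Sat (pow (pow N)) φ (upd (ap g A) i u)) := by
      intro A hA
      rw [sat_bex (hg A hA) hW hi hj hij hφ.isFormula, app_eq_ap (hg A hA).functional]
      simp only [update_eq_upd (hg A hA).functional]
    rw [sat_bex isAssignment_tseq hW hi hj hij hφ.isFormula, app_tseq hj,
      almostAll_congr hbex]
    constructor
    · rintro ⟨z, hz, h⟩
      rw [mem_val] at hz
      exact hU.mono₂ hz.2 ((key z hz.1).1 h) fun A _ h h' => ⟨_, h, h'⟩
    · intro h
      obtain ⟨R, hR⟩ : ∃ R : M, ∀ z : M, z ∈ R ↔ z ∈ prod (pow N) (pow N) ∧ ∃ A u : M,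
          u ∈ ap (ap g A) j ∧ Sat (pow (pow N)) φ (upd (ap g A) i u) ∧ z = pair A u :=
        ⟨_, fun z => mem_sep⟩
      have hRp : ∀ A u : M, pair A u ∈ R ↔ (A ∈ pow N ∧ u ∈ pow N) ∧ u ∈ ap (ap g A) j ∧
          Sat (pow (pow N)) φ (upd (ap g A) i u) := by
        intro A u
        rw [hR, pair_mem_prod]
        refine and_congr_right fun _ => ⟨?_, fun h => ⟨A, u, h.1, h.2, rfl⟩⟩
        rintro ⟨A', u', h1, h2, e⟩
        rw [pair_inj] at e
        rw [e.1, e.2]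
        exact ⟨h1, h2⟩
      obtain ⟨f, hf, hu⟩ := hμ.unif R fun z hz => by
        obtain ⟨h1, _⟩ := (hR z).1 hz
        obtain ⟨x, y, hx, hy, e⟩ := mem_prod.1 h1
        exact ⟨x, y, hx, hy, e⟩
      have ff := hf.functional
      have h1 : AlmostAll (pow N) μ fun A => app f A ∈ pow N ∧ app f A ∈ ap (ap g A) j ∧
          Sat (pow (pow N)) φ (upd (ap g A) i (app f A)) := by
        refine hU.mono₂ hu h fun A hA h1 h2 => ?_
        obtain ⟨u, hu1, hu2⟩ := h2
        have h3 := (hRp A (app f A)).1 (h1 ⟨u, (hRp A u).2 ⟨⟨hA, ?_⟩, hu1, hu2⟩⟩)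
        · exact ⟨h3.1.2, h3.2⟩
        · have := (hg A hA).2 j hj
          rw [app_eq_ap (hg A hA).functional] at this
          exact mem_pow.1 this u hu1
      obtain ⟨z, hz, h2⟩ := hμ.exists_eq_pre hN (G := fun A => app f A)
        (hU.mono h1 fun _ _ h => h.1)
      refine ⟨z, (mem_val).2 ⟨hz, hU.mono₂ h1 h2 fun A _ h h' => ?_⟩,
        (key z hz).2 (hU.mono₂ h1 h2 fun A _ h h' => ?_)⟩
      · rw [← h']; exact h.2.1
      · rw [← h']; exact h.2.2

omit hN in
theorem IsPi.los {k ψ : M} (hψ : IsPi k ψ) (h : ∀ φ : M, IsSigma k φ → Los N μ φ) :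
    Los N μ ψ := by
  rcases hψ with ⟨rfl, hψ⟩ | ⟨_, σ, hσ, rfl⟩
  · exact h ψ (.zero hψ)
  · exact (h σ hσ).not' hμ hσ.isFormula

end rein

section rein
variable {N μ : M} (hN : IsLevel N) (hμ : IsRein N μ) (hc : Covers N)
include hN hμ hc

/-- Truth in the ultrapower of a formula `∃…∃ ψ` is inherited by almost all factors, if the
theorem of Łoś holds for `ψ`. -/
theorem IsSigma.los_factors {k φ : M} (hφ : IsSigma (succ k) φ)
    (h : ∀ ψ : M, IsSigma k ψ → Los N μ ψ) {g : M} (hg : IsSeq N g)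
    (hs : Sat (pow (pow N)) φ (tseq N μ g)) :
    AlmostAll (pow N) μ fun A => Sat (pow (pow N)) φ (ap g A) := by
  have hNb := hN.toIsBase
  obtain ⟨I, ψ, hI, hψ, hc'⟩ := hφ.contract
  obtain ⟨t, ht, h1, h2⟩ := (hc' _ _ isAssignment_tseq).1 hs
  have ft := ht.functional
  -- The witness at each `m ∈ I` gets the definable representative `seed N (t m)`, so no choice of
  -- representatives is involved.
  obtain ⟨g', hg'⟩ : ∃ g' : M, ∀ A : M, A ∈ pow N → ap g' A = lam omega fun m =>
      open Classical in if m ∈ I then seed N (ap t m) A else ap (ap g A) m := by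
    refine ⟨lam (pow N) fun A => lam omega fun m =>
      open Classical in if m ∈ I then seed N (ap t m) A else ap (ap g A) m, fun A hA => ?_⟩
    rw [ap_lam hA]
  have hs' : IsSeq N g' := fun A hA => by
    rw [hg' A hA]
    refine isFun_lam fun m hm => ?_
    split_ifs
    · exact seed_mem_W _ _ _
    · rw [← app_eq_ap (hg A hA).functional]
      exact (hg A hA).2 m hm
  have hap : ∀ A : M, A ∈ pow N → ∀ m : M, m ∈ (omega : M) → ap (ap g' A) m =
      open Classical in if m ∈ I then seed N (ap t m) A else ap (ap g A) m := by
    intro A hA m hm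
    rw [hg' A hA, ap_lam hm]
  have e : tseq N μ g' = t := by
    refine isAssignment_tseq.ext ht fun m hm => ?_
    rw [app_tseq hm]
    by_cases hmI : m ∈ I
    · rw [val_congr (G := fun A => seed N (ap t m) A) fun A hA => by rw [hap A hA m hm, if_pos hmI],
        ← app_eq_ap ft, hμ.val_seed hN hc (ht.2 m hm)]
    · rw [val_congr (G := fun A => ap (ap g A) m) fun A hA => by rw [hap A hA m hm, if_neg hmI],
        app_eq_ap ft, h1 m hm hmI, ← app_eq_ap isAssignment_tseq.functional, app_tseq hm]
  have h3 := (hψ.los hμ h) g' hs'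
  rw [e] at h3
  refine hμ.ultra.mono (h3.1 h2) fun A hA h4 => (hc' _ _ (hg A hA)).2 ⟨_, hs' A hA, ?_, h4⟩
  intro m hm hmI
  rw [hap A hA m hm, if_neg hmI]

omit hc in
/-- Truth of a formula `∃…∃ ψ` in almost all factors is inherited by the ultrapower, if the
theorem of Łoś holds for `ψ` and the relations defined by formulas such as `ψ` can be
uniformized. -/
theorem IsSigma.los_ultrapower {k φ : M} (hφ : IsSigma (succ k) φ)
    (h : ∀ ψ : M, IsSigma k ψ → Los N μ ψ) (hu : Unif N μ k) {g : M} (hg : IsSeq N g)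
    (hs : AlmostAll (pow N) μ fun A => Sat (pow (pow N)) φ (ap g A)) :
    Sat (pow (pow N)) φ (tseq N μ g) := by
  have hNb := hN.toIsBase
  have hU := hμ.ultra
  obtain ⟨I, ψ, hI, hψ, hc'⟩ := hφ.contract
  have hIW : I ∈ pow (pow N) := sub_W hNb (mem_pow.2 (hI.trans hN.omega_sub))
  -- the relation to be uniformized
  let T : M → M → Prop := fun A u =>
    (∀ m : M, m ∈ (omega : M) → ¬ m ∈ I → dsec N u m = ap (ap g A) m) ∧
      Sat (pow (pow N)) ψ (lam omega fun m => dsec N u m)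
  have hT : Def M fun p : M × M => T p.1 p.2 := by
    show Def M fun p : M × M =>
      (∀ m : M, m ∈ (omega : M) → ¬ m ∈ I → dsec N p.2 m = ap (ap g p.1) m) ∧
      Sat (pow (pow N)) ψ (lam omega fun m => dsec N p.2 m)
    fun_prop
  obtain ⟨R, hR⟩ : ∃ R : M, ∀ z : M, z ∈ R ↔ z ∈ prod (pow N) (pow (pow N)) ∧ ∃ A u : M,
      T A u ∧ z = pair A u := ⟨_, fun z => mem_sep (by
        show Def M fun z : M => ∃ A u : M, T A u ∧ z = pair A u
        fun_prop)⟩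
  have hRp : ∀ A u : M, pair A u ∈ R ↔ (A ∈ pow N ∧ u ∈ pow (pow N)) ∧ T A u := by
    intro A u
    rw [hR, pair_mem_prod]
    refine and_congr_right fun _ => ⟨?_, fun h => ⟨A, u, h, rfl⟩⟩
    rintro ⟨A', u', h1, e⟩
    rw [pair_inj] at e
    rwa [e.1, e.2]
  have hRrel : IsRelation R (pow N) (pow (pow N)) := fun z hz => by
    obtain ⟨x, y, hx, hy, e⟩ := mem_prod.1 ((hR z).1 hz).1
    exact ⟨x, y, hx, hy, e⟩
  -- its definition
  have hRdef : IsPiDefinable k (pow (pow N)) R := by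
    obtain ⟨d, e, hde⟩ := exists_isSplit (M := M)
    -- The family `g` is coded by one element of `W`, the parameter at `v_4`; the parameter at `v_5`
    -- is `I`.
    obtain ⟨G, hG⟩ : ∃ G : M, ∀ z : M, z ∈ G ↔ z ∈ pow N ∧ ∃ A m y : M, y ∈ ap (ap g A) m ∧
        z = pair (pair A m) y := ⟨_, fun z => mem_sep⟩
    have hGW : G ∈ pow (pow N) := mem_pow.2 fun z hz => ((hG z).1 hz).1
    have hGp : ∀ A m y : M, A ∈ pow N → m ∈ (omega : M) → y ∈ pow N →
        (pair (pair A m) y ∈ G ↔ y ∈ ap (ap g A) m) := by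
      intro A m y hA hm hy
      rw [hG]
      constructor
      · rintro ⟨_, A', m', y', h, e⟩
        rw [pair_inj, pair_inj] at e
        rw [e.1.1, e.1.2, e.2]
        exact h
      · exact fun h => ⟨hN.toIsBase.pow.pair_mem _ _ (hN.toIsBase.pow.pair_mem _ _ hA
          (hN.toIsBase.pow.omega_sub m hm)) hy, A, m, y, h, rfl⟩
    obtain ⟨χ, hχ, hχ'⟩ := exists_isSide hNb hde (P := fun p : M × M × M × M × M × M =>
      p.1 ∈ p.2.2.1 ∧ ∀ m : M, m ∈ p.2.2.2.1 → ¬ m ∈ p.2.2.2.2.2 → ∀ y : M, y ∈ p.2.2.1 →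
        (PairMem p.2.2.2.1 m y p.2.1 ↔ ∃ q : M, q ∈ p.2.2.1 ∧ EqPair p.2.2.2.1 q p.1 m ∧
          PairMem p.2.2.2.1 q y p.2.2.2.2.1))
    obtain ⟨ψ', hψ', h1⟩ := hψ.translate hNb hde hχ
    have hpa := isParamAsg_paramAsg hNb hde hGW hIW
    refine ⟨ψ', paramAsg N e G I, hψ', hpa.good.1, fun A u hA hu => ?_⟩
    obtain ⟨h2, h3, h4⟩ := hpa.update hNb hde hA hu
    rw [hRp, h1 _ h2.good, hχ' _ h2.good, h2.tr_eq hNb hde, h3, h4, h2.val_p, h2.val_q]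
    change _ ↔ _ ∧ (A ∈ pow N ∧ ∀ m : M, m ∈ (omega : M) → ¬ m ∈ I → ∀ y : M, y ∈ pow N →
        (PairMem omega m y u ↔ ∃ q : M, q ∈ pow N ∧ EqPair omega q A m ∧
          PairMem omega q y G))
    simp only [pairMem_omega, eqPair_omega]
    have h5 : A ∈ pow N → ((∀ m : M, m ∈ (omega : M) → ¬ m ∈ I → dsec N u m = ap (ap g A) m) ↔
        ∀ m : M, m ∈ (omega : M) → ¬ m ∈ I → ∀ y : M, y ∈ pow N →
        (pair m y ∈ u ↔ ∃ q : M, q ∈ pow N ∧ q = pair A m ∧ pair q y ∈ G)) := by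
      intro hA
      refine forall_congr' fun m => forall_congr' fun hm => forall_congr' fun hmI => ?_
      have h6 : ∀ y : M, y ∈ pow N → ((∃ q : M, q ∈ pow N ∧ q = pair A m ∧ pair q y ∈ G) ↔
          y ∈ ap (ap g A) m) := by
        intro y hy
        rw [← hGp A m y hA hm hy]
        constructor
        · rintro ⟨q, _, rfl, h⟩; exact h
        · exact fun h => ⟨_, hN.toIsBase.pow.pair_mem _ _ hA (hN.toIsBase.pow.omega_sub m hm), rfl, h⟩
      have h7 := (hg A hA).2 m hm
      rw [app_eq_ap (hg A hA).functional] at h7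
      constructor
      · intro e y hy
        rw [h6 y hy, ← e, mem_dsec]
        simp [hy, hm]
      · intro h8
        apply ext'
        intro y
        rw [mem_dsec]
        constructor
        · rintro ⟨hy, _, h9⟩
          exact (h6 y hy).1 ((h8 y hy).1 h9)
        · intro h9
          have hy := mem_pow.1 h7 y h9
          exact ⟨hy, hm, (h8 y hy).2 ((h6 y hy).2 h9)⟩
    constructor
    · rintro ⟨⟨hA, _⟩, h6, h7⟩
      exact ⟨h7, hA, (h5 hA).1 h6⟩
    · rintro ⟨h7, hA, h6⟩
      exact ⟨⟨hA, hu⟩, (h5 hA).2 h6, h7⟩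
  obtain ⟨f, hf, hfu⟩ := hu R hRrel hRdef
  have ff := hf.functional
  -- A factor in which `φ` holds has a witnessing assignment; its code is a partner of `A`, so the
  -- uniformizing function takes a correct value there.
  have hex : AlmostAll (pow N) μ fun A => T A (app f A) := by
    refine hU.mono₂ hfu hs (fun A hA h1 h2 => ?_) (by fun_prop) (by fun_prop)
      (hT.comp (g := fun A => (A, app f A)) (by fun_prop))
    obtain ⟨t, ht, h3, h4⟩ := (hc' _ _ (hg A hA)).1 h2
    obtain ⟨u, hu, h5⟩ := exists_assignment_code hNb ht
    have h6 : (lam omega fun m => dsec N u m) = t :=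
      (isFunOn_lam (F := fun m => dsec N u m)).ext ht.1 fun m hm => by rw [app_lam hm, h5 m hm]
    refine ((hRp A _).1 (h1 ⟨u, (hRp A u).2 ⟨⟨hA, hu⟩, fun m hm hmI => ?_, ?_⟩⟩)).2
    · rw [h5 m hm, app_eq_ap ht.functional, h3 m hm hmI]
    · rwa [h6]
  -- Decoding the uniformizing function gives a family of assignments, whose class in the ultrapower
  -- is the required witness.
  obtain ⟨g', hg'⟩ : ∃ g' : M, ∀ A : M, A ∈ pow N →
      ap g' A = lam omega fun m => dsec N (app f A) m := by
    refine ⟨lam (pow N) fun A => lam omega fun m => dsec N (app f A) m, fun A hA => ?_⟩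
    rw [ap_lam hA]
  have hs' : IsSeq N g' := fun A hA => by
    rw [hg' A hA]
    exact isFun_lam fun m _ => dsec_mem_W _ _ _
  have hap : ∀ A : M, A ∈ pow N → ∀ m : M, m ∈ (omega : M) →
      ap (ap g' A) m = dsec N (app f A) m := by
    intro A hA m hm
    rw [hg' A hA, ap_lam hm]
  have hTd : Def M fun A => T A (app f A) := hT.comp (g := fun A => (A, app f A)) (by fun_prop)
  refine (hc' _ _ isAssignment_tseq).2 ⟨tseq N μ g', isAssignment_tseq, fun m hm hmI => ?_,
    ((hψ.los hμ h) g' hs').2 ?_⟩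
  · rw [← app_eq_ap isAssignment_tseq.functional, ← app_eq_ap isAssignment_tseq.functional,
      app_tseq hm, app_tseq hm, hμ.val_inj hNb (hs'.val_mem_W hNb hμ hm) (hg.val_mem_W hNb hμ hm)]
    refine hU.mono hex (fun A hA h1 => ?_)
    rw [hap A hA m hm]
    exact h1.1 m hm hmI
  · refine hU.mono hex fun A hA h1 => ?_
    rw [hg' A hA]
    exact h1.2

theorem IsSigma.los_succ {k φ : M} (hφ : IsSigma (succ k) φ)
    (h : ∀ ψ : M, IsSigma k ψ → Los N μ ψ) (hu : Unif N μ k) : Los N μ φ := fun _ hg =>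
  ⟨hφ.los_factors hN hμ hc h hg, hφ.los_ultrapower hN hμ h hu hg⟩

/-- The ultrapower map is `Σ_(k+1)`-elementary if the theorem of Łoś holds for `Σ_k` formulas. -/
theorem isSigmaElementarySelf_ultMap {k : M} (h : ∀ ψ : M, IsSigma k ψ → Los N μ ψ) :
    IsSigmaElementarySelf (succ k) (pow (pow N)) (ultMap N μ) := by
  have hU := hμ.ultra
  refine ⟨isFun_ultMap, fun φ s hφ hs => ?_⟩
  have hconst : ∀ t : M, IsAssignment (pow (pow N)) t →
      ∃ g : M, IsSeq N g ∧ (∀ A : M, A ∈ pow N → ap g A = t) ∧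
        tseq N μ g = lam omega fun m => app (ultMap N μ) (app t m) := by
    intro t ht
    have hg : ∀ A : M, A ∈ pow N → ap (lam (pow N) fun _ => t) A = t := fun A hA => ap_lam hA
    refine ⟨lam (pow N) fun _ => t, fun A hA => by rw [hg A hA]; exact ht, hg, ?_⟩
    refine isAssignment_tseq.ext (isAssignment_comp isFun_ultMap ht) fun m hm => ?_
    rw [app_tseq hm, app_comp isFun_ultMap ht hm, app_ultMap (ht.2 m hm)]
    exact val_congr fun A hA => by rw [hg A hA, app_eq_ap ht.functional]
  constructor
  -- Upward, the images of the witnesses are again witnesses, by Łoś's theorem for `ψ` and a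
  -- constant family.
  · intro hsat
    obtain ⟨I, ψ, hI, hψ, hc'⟩ := hφ.contract
    obtain ⟨t, ht, h1, h2⟩ := (hc' _ _ hs).1 hsat
    obtain ⟨g, hg, hg', e⟩ := hconst t ht
    refine (hc' _ _ (isAssignment_comp isFun_ultMap hs)).2
      ⟨_, isAssignment_comp (isFun_ultMap (μ := μ)) ht, fun m hm hmI => ?_, ?_⟩
    · rw [← app_eq_ap (isAssignment_comp isFun_ultMap ht).functional,
        ← app_eq_ap (isAssignment_comp isFun_ultMap hs).functional, app_comp isFun_ultMap ht hm,
        app_comp isFun_ultMap hs hm, app_eq_ap ht.functional, app_eq_ap hs.functional, h1 m hm hmI]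
    · rw [← e, (hψ.los hμ h) g hg]
      exact hU.all fun A hA => by rw [hg' A hA]; exact h2
  -- Downward, only the passage to the factors is used, so no uniformization at level `k` is
  -- required. This gains one level of elementarity over Łoś's theorem.
  · intro hsat
    obtain ⟨g, hg, hg', e⟩ := hconst s hs
    rw [← e] at hsat
    obtain ⟨A, hA, h1⟩ := hU.exists (hφ.los_factors hN hμ hc h hg hsat)
    rwa [hg' A hA] at h1

end rein

end ZFModel

end

noncomputable section

namespace ZFModel


variable {M : Type u} [Membership M M] [Nonempty M] [ModelsZF M] {α : Type u} [Ctx M α]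

/-! ## The uniformization of definable relations -/

theorem IsPi.ex {k φ i : M} (hk : k ∈ (omega : M)) (hi : i ∈ (omega : M)) (h : IsPi k φ) :
    IsSigma (succ k) (fEx i φ) := by
  rcases h with ⟨rfl, h⟩ | ⟨hk0, ψ, h, rfl⟩
  · exact (IsSigma.one h).ex' hk hi
  · obtain rfl | ⟨m, hm, rfl⟩ := omega_cases hk
    · exact (hk0 rfl).elim
    · exact (h.not' hm).ex' hk hi

theorem IsPi.raise {k φ : M} (h : IsPi k φ) : ∃ φ' : M, IsPi (succ k) φ' ∧
    ∀ A s : M, IsAssignment A s → (Sat A φ s ↔ Sat A φ' s) := by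
  rcases h with ⟨rfl, h⟩ | ⟨_, ψ, h, rfl⟩
  · refine ⟨fNot (fNot φ), .of_succ (.one h.not'), fun A s hs => ?_⟩
    rw [sat_not hs h.isFormula.not', sat_not hs h.isFormula, not_not]
  · obtain ⟨ψ', h', e⟩ := h.raise
    refine ⟨fNot ψ', .of_succ h', fun A s hs => ?_⟩
    rw [sat_not hs h.isFormula, sat_not hs h'.isFormula, e A s hs]

theorem IsPiDefinable.raise {k W R : M} (h : IsPiDefinable k W R) :
    IsPiDefinable (succ k) W R := by
  obtain ⟨φ, s, hφ, hs, h⟩ := h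
  obtain ⟨φ', hφ', e⟩ := hφ.raise
  exact ⟨φ', s, hφ', hs, fun a x ha hx => by rw [h a x ha hx, e W _ ((hs.update ha).update hx)]⟩

theorem Unif.lower {N μ k : M} (h : Unif N μ (succ k)) : Unif N μ k :=
  fun R hR hd => h R hR hd.raise

theorem eq_dsec_iff {N c m b : M} (hm : m ∈ (omega : M)) (hb : b ∈ pow (pow N)) :
    dsec N c m = b ↔ ∀ y : M, y ∈ pow N → (pair m y ∈ c ↔ y ∈ b) := by
  constructor
  · rintro rfl y hy
    rw [mem_dsec]
    simp [hy, hm]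
  · intro h
    apply ext'
    intro y
    rw [mem_dsec]
    constructor
    · exact fun h' => (h y h'.1).1 h'.2.2
    · intro hy
      have h1 := mem_pow.1 hb y hy
      exact ⟨h1, hm, (h y h1).2 hy⟩

/-- The set `u` codes the assignment with code `c`, except that it has the value `A` at `v_0`; in
absolute form. -/
def IsCodeUpdate (w X c A u : M) : Prop := ∀ m : M, m ∈ w → ∀ y : M, y ∈ X →
  (PairMem w m y u ↔ ((∃ t : M, t ∈ m ∧ t = t) ∧ PairMem w m y c) ∨
    ((∀ t : M, t ∈ m → ¬ t = t) ∧ y ∈ A))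

@[fun_prop] theorem D0.isCodeUpdate {β : Type u} [Tup M β] {f g h i k : β → M} (hf : DV M f)
    (hg : DV M g) (hh : DV M h) (hi : DV M i) (hk : DV M k) :
    D0 M fun x => IsCodeUpdate (f x) (g x) (h x) (i x) (k x) := by
  unfold IsCodeUpdate; fun_prop

/-- The variable `v_0` is singled out as the natural number without elements, since the absolute
relation has no constant for `0`. -/
theorem isCodeUpdate_iff {N c A u s : M} (hN : IsBase N) (hs : IsAssignment (pow (pow N)) s)
    (hc : ∀ m : M, m ∈ (omega : M) → dsec N c m = app s m) (hA : A ∈ pow N) :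
    IsCodeUpdate omega (pow N) c A u ↔
      ∀ m : M, m ∈ (omega : M) → dsec N u m = app (update s (num 0) A) m := by
  have h1 := hs.update (i := num 0) (sub_W hN hA)
  unfold IsCodeUpdate
  refine forall₂_congr fun m hm => ?_
  rw [eq_dsec_iff hm (h1.2 m hm)]
  refine forall₂_congr fun y hy => ?_
  rw [pairMem_omega, pairMem_omega, (eq_dsec_iff hm (hs.2 m hm)).1 (hc m hm) y hy]
  by_cases h : m = num 0
  · subst h
    rw [app_update_self hs.functional hm]
    have : ∀ t : M, ¬ t ∈ (num 0 : M) := fun t => not_mem_empty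
    simp [this]
  · rw [app_update_ne hs.functional hm h]
    have : ∃ t : M, t ∈ m := ne_empty_iff.1 h
    have h2 : ¬ ∀ t : M, ¬ t ∈ m := fun h => this.elim h
    simp [this, h2]

section emb
variable {N j : M} (hN : IsBase N) (hj : IsSigmaElementarySelf (num 1) (pow (pow N)) j)
include hN hj

theorem emb_mem_omega {m : M} (hm : m ∈ (omega : M)) : app j m = m :=
  emb_fix hN hj (succ_mem_omega hm) ((V_succ (isOrdinal_of_mem_omega hm)).symm ▸
    mem_pow.2 (sub_V (isOrdinal_of_mem_omega hm))) (hN.pow.pow.omega_sub m hm)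

theorem emb_dsec {c m b : M} (hc : c ∈ pow (pow N)) (hm : m ∈ (omega : M)) (hb : b ∈ pow (pow N))
    (h : dsec N c m = b) : dsec N (app j c) m = app j b := by
  have hmW := hN.pow.pow.omega_sub m hm
  rw [eq_dsec_iff hm hb] at h
  rw [eq_dsec_iff hm (emb_mem_W hN hj hb)]
  have h1 := (emb_preserved hN hj (β := M × M × M × M × M) (P := fun p => ∀ y : M, y ∈ p.2.1 →
    (PairMem p.1 p.2.2.1 y p.2.2.2.1 ↔ y ∈ p.2.2.2.2)) (omega, pow N, m, c, b)
    (by exact ⟨omega_mem_W hN, X_mem_W N, hmW, hc, hb⟩)).1 fun y hy => by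
      simp only [pairMem_omega]; exact h y hy
  change ∀ y : M, y ∈ app j (pow N) →
    (PairMem (app j omega) (app j m) y (app j c) ↔ y ∈ app j b) at h1
  rw [emb_omega hN hj, emb_X hN hj, emb_mem_omega hN hj hm] at h1
  simpa only [pairMem_omega] using h1

theorem IsParamAsg.comp {d e p q s : M} (hde : IsSplit d e) (hs : IsParamAsg N d e p q s) :
    IsParamAsg N d e (app j p) (app j q) (lam omega fun m => app j (app s m)) := by
  have h1 := hs.good.1
  have h2 := isAssignment_comp hj.1 h1
  have key : ∀ m : M, m ∈ (omega : M) →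
      app (lam omega fun m => app j (app s m)) m = app j (app s m) := fun m hm =>
    app_comp hj.1 h1 hm
  refine ⟨⟨h2, ?_, ?_⟩, ?_, ?_, fun m hm => ?_, fun m hm => ?_⟩
  · rw [← app_eq_ap h2.functional, key _ (num_mem_omega 2), app_eq_ap h1.functional, hs.good.2.1,
      emb_X hN hj]
  · rw [← app_eq_ap h2.functional, key _ (num_mem_omega 3), app_eq_ap h1.functional, hs.good.2.2,
      emb_omega hN hj]
  · rw [key _ (num_mem_omega 4), hs.val_p]
  · rw [key _ (num_mem_omega 5), hs.val_q]
  · rw [key _ (hde.left.2 m hm), hs.left m hm]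
    exact emb_mem_omega hN hj empty_mem_omega
  · rw [key _ (hde.right.2 m hm), hs.right m hm, emb_mem_omega hN hj hm]

/-- If a `Σ_(k+1)` formula holds in `P(P(N))` for all `A ∈ σ`, and `N` is in the image of `σ`
under a `Σ_(k+2)`-elementary `j`, then the formula holds for the image of `N`. -/
theorem sat_of_mem_image {k φ s σ a : M} (hk : k ∈ (omega : M))
    (hjk : IsSigmaElementarySelf (succ (succ k)) (pow (pow N)) j) (hφ : IsSigma (succ k) φ)
    (hs : IsAssignment (pow (pow N)) s) (hσ : σ ∈ pow (pow N))
    (h : ∀ A : M, A ∈ σ → Sat (pow (pow N)) φ (update s (num 0) A)) (ha : a ∈ app j σ) :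
    Sat (pow (pow N)) φ (update (lam omega fun m => app j (app s m)) (num 0) a) := by
  have n0 := num_mem_omega (M := M) 0
  have n1 := num_mem_omega (M := M) 1
  obtain ⟨d, e, hde⟩ := exists_isSplit (M := M)
  obtain ⟨c, hc, hcs⟩ := exists_assignment_code hN hs
  -- The side condition says that `v_0` belongs to the value `σ` of `v_5`, and that `v_1` codes the
  -- assignment coded by `v_4` with its value at `0` changed to `v_0`.
  obtain ⟨χ, hχ, hχ'⟩ := exists_isSide hN hde (P := fun p : M × M × M × M × M × M =>
    p.1 ∈ p.2.2.2.2.2 ∧ IsCodeUpdate p.2.2.2.1 p.2.2.1 p.2.2.2.2.1 p.1 p.2.1)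
  obtain ⟨τ, hτ, hτ'⟩ := exists_isSide_true hN hde
  obtain ⟨φ', hφ', hφ''⟩ := hφ.translate hN hde τ (fNot χ) hτ (hχ.not' hN hde)
  -- the formula that expresses the existence of a counterexample
  have hΘ : IsSigma (succ (succ k)) (fEx (num 0) (fEx (num 1) (fNot φ'))) :=
    ((hφ'.not' hk).ex' (succ_mem_omega hk) n1).ex' (succ_mem_omega hk) n0
  -- The parameters are arbitrary because the equivalence is used twice: for `s` and `σ`, and for
  -- their images under `j`.
  have key : ∀ c σ t q : M, IsAssignment (pow (pow N)) t → σ ∈ pow (pow N) →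
      (∀ m : M, m ∈ (omega : M) → dsec N c m = app t m) → IsParamAsg N d e c σ q →
      (Sat (pow (pow N)) (fEx (num 0) (fEx (num 1) (fNot φ'))) q ↔
        ∃ A : M, A ∈ σ ∧ ¬ Sat (pow (pow N)) φ (update t (num 0) A)) := by
    intro c σ t q ht hσ hct hq
    have hq1 := hq.good.1
    have hin : ∀ A u : M, A ∈ pow (pow N) → u ∈ pow (pow N) →
        (Sat (pow (pow N)) (fNot φ') (update (update q (num 0) A) (num 1) u) ↔
          A ∈ σ ∧ u ∈ pow (pow N) ∧ (∀ m : M, m ∈ (omega : M) →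
            dsec N u m = app (update t (num 0) A) m) ∧
            ¬ Sat (pow (pow N)) φ (update t (num 0) A)) := by
      intro A u hA hu
      obtain ⟨h1, h2, h3⟩ := hq.update hN hde hA hu
      rw [sat_not h1.good.1 hφ'.isFormula, hφ'' _ h1.good, sat_not h1.good.1 hχ.1.isFormula,
        hχ' _ h1.good, h1.tr_eq hN hde, h2, h3, h1.val_p, h1.val_q]
      change ¬ (_ ∨ ¬ (A ∈ σ ∧ IsCodeUpdate omega (pow N) c A u)) ↔ _
      rw [not_or, not_not, not_and]
      have hτt := hτ' _ h1.good
      have h4 : (∀ m : M, m ∈ (omega : M) → dsec N u m = app (update t (num 0) A) m) →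
          (lam omega fun m => dsec N u m) = update t (num 0) A := fun h =>
        (isFunOn_lam (F := fun m => dsec N u m)).ext (ht.update hA).1 fun m hm => by
          rw [app_lam hm, h m hm]
      constructor
      · rintro ⟨h5, h6, h7⟩
        have h8 := (isCodeUpdate_iff hN ht hct (mem_pow.1 hσ A h6)).1 h7
        exact ⟨h6, hu, h8, fun h9 => h5 (by rwa [h4 h8]) hτt⟩
      · rintro ⟨h6, _, h8, h9⟩
        exact ⟨fun h10 => (h9 (by rwa [h4 h8] at h10)).elim, h6,
          (isCodeUpdate_iff hN ht hct (mem_pow.1 hσ A h6)).2 h8⟩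
    rw [sat_ex hq1 n0 (hφ'.isFormula.not'.ex' n1)]
    constructor
    · rintro ⟨A, hA, h1⟩
      rw [sat_ex (hq1.update hA) n1 hφ'.isFormula.not'] at h1
      obtain ⟨u, hu, h1⟩ := h1
      have h2 := (hin A u hA hu).1 h1
      exact ⟨A, h2.1, h2.2.2.2⟩
    · rintro ⟨A, hA, h1⟩
      have hAW := sub_W hN (mem_pow.1 hσ A hA)
      obtain ⟨u, hu, h2⟩ := exists_assignment_code hN (ht.update (i := num 0) hAW)
      refine ⟨A, hAW, ?_⟩
      rw [sat_ex (hq1.update hAW) n1 hφ'.isFormula.not']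
      exact ⟨u, hu, (hin A u hAW hu).2 ⟨hA, hu, h2, h1⟩⟩
  have hq := isParamAsg_paramAsg hN hde hc hσ
  have h1 : ¬ Sat (pow (pow N)) (fEx (num 0) (fEx (num 1) (fNot φ'))) (paramAsg N e c σ) := by
    rw [key c σ s _ hs hσ hcs hq]
    rintro ⟨A, hA, h'⟩
    exact h' (h A hA)
  rw [hjk.2 _ _ hΘ hq.good.1, key (app j c) (app j σ) _ _ (isAssignment_comp hj.1 hs)
    (emb_mem_W hN hj hσ) (fun m hm => ?_) (hq.comp hN hj hde)] at h1
  · by_contra h2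
    exact h1 ⟨a, ha, h2⟩
  · rw [app_comp hj.1 hs hm]
    exact emb_dsec hN hj hc hm (hs.2 m hm) (hcs m hm)

end emb

end ZFModel

end

noncomputable section

namespace ZFModel


variable {M : Type u} [Membership M M] [Nonempty M] [ModelsZF M] {α : Type u} [Ctx M α]

/-! ## Łoś's theorem for Reinhardt ultrafilters -/

theorem isPiDefinable_iff {n W R : M} : IsPiDefinable n W R ↔ ∃ φ s : M, IsPi n φ ∧
    IsAssignment W s ∧ ∀ k x : M, k ∈ W → x ∈ W →
      (pair k x ∈ R ↔ Sat W φ (upd (upd s (num 0) k) (num 1) x)) := by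
  refine exists₂_congr fun φ s => and_congr_right fun _ => and_congr_right fun hs => ?_
  refine forall₄_congr fun k x hk hx => ?_
  rw [update_eq_upd (hs.update hk).functional, update_eq_upd hs.functional]

@[fun_prop] theorem Def.isPiDefinable {f g h : α → M} (hf : DefF M f) (hg : DefF M g)
    (hh : DefF M h) : Def M fun x => IsPiDefinable (f x) (g x) (h x) := by
  simp only [isPiDefinable_iff]; fun_prop

@[fun_prop] theorem Def.isRelation {f g h : α → M} (hf : DefF M f) (hg : DefF M g)
    (hh : DefF M h) : Def M fun x => IsRelation (f x) (g x) (h x) := by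
  unfold IsRelation; fun_prop

theorem hasUniformization_iff {X μ R : M} : HasUniformization X μ R ↔ ∃ f : M, IsFunOn f X ∧
    AlmostAll X μ fun k => (∃ x : M, pair k x ∈ R) → pair k (ap f k) ∈ R := by
  refine exists_congr fun f => and_congr_right fun hf => ?_
  simp only [app_eq_ap hf.functional]

@[fun_prop] theorem Def.hasUniformization {f g h : α → M} (hf : DefF M f) (hg : DefF M g)
    (hh : DefF M h) : Def M fun x => HasUniformization (f x) (g x) (h x) := by
  simp only [hasUniformization_iff]; fun_prop

@[fun_prop] theorem Def.unif {f g h : α → M} (hf : DefF M f) (hg : DefF M g)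
    (hh : DefF M h) : Def M fun x => Unif (f x) (g x) (h x) := by
  unfold Unif; fun_prop

section emb
variable {N j : M} (hN : IsLevel N) (hc : Covers N)
include hN hc

/-- If almost every `A` has a partner, so has `j``N`, by `sat_of_mem_image`. A partner `x` of `j``N`
is `[seed N x]`, while `j``N = [id]` and the parameters are moved by `j` to the classes of
constants. Łoś's theorem for `Π_k` formulas then says that `seed N x A` is a partner of almost every
`A`. -/
theorem unif_der {k : M} (hk : k ∈ (omega : M))
    (hj : IsSigmaElementarySelf (succ (succ k)) (pow (pow N)) j)
    (hlos : ∀ ψ : M, IsSigma k ψ → Los N (der N j) ψ) : Unif N (der N j) k := by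
  have hNb := hN.toIsBase
  have hj1 : IsSigmaElementarySelf (num 1) (pow (pow N)) j := hj.pred.to_one hk
  have fj := hj.1.functional
  have hμ := isRein_der hNb hj1
  have hU := hμ.ultra
  have n0 := num_mem_omega (M := M) 0
  have n1 := num_mem_omega (M := M) 1
  rintro R hR ⟨φ, s, hφ, hs, h⟩
  have fs := hs.functional
  have hex := hφ.ex hk n1
  by_cases hσ : AlmostAll (pow N) (der N j) fun A =>
      Sat (pow (pow N)) (fEx (num 1) φ) (upd s (num 0) A)
  · have h1 := sat_of_mem_image hNb hj1 hk hj hex hs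
      (mem_pow.2 fun A hA => ((mem_sep).1 hA).1)
      (fun A hA => by rw [update_eq_upd fs]; exact ((mem_sep).1 hA).2) ((mem_der fj).1 hσ).2
    have haW := sub_W hNb (range_mem_X hNb hj1)
    have hjs := isAssignment_comp hj.1 hs
    rw [sat_ex (hjs.update haW) n1 hφ.isFormula] at h1
    obtain ⟨x, hx, h1⟩ := h1
    obtain ⟨g, hg⟩ : ∃ g : M, ∀ A : M, A ∈ pow N →
        ap g A = upd (upd s (num 0) A) (num 1) (seed N x A) :=
      ⟨lam (pow N) fun A => upd (upd s (num 0) A) (num 1) (seed N x A), fun A hA => ap_lam hA⟩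
    have hup : ∀ A : M, A ∈ pow N → ap g A = update (update s (num 0) A) (num 1) (seed N x A) ∧
        IsAssignment (pow (pow N)) (update s (num 0) A) := by
      intro A hA
      have h2 := hs.update (i := num 0) (sub_W hNb hA)
      exact ⟨by rw [update_eq_upd h2.functional, update_eq_upd fs, hg A hA], h2⟩
    have hgs : IsSeq N g := fun A hA => by
      rw [(hup A hA).1]
      exact (hup A hA).2.update (seed_mem_W _ _ _)
    have hap : ∀ m A : M, m ∈ (omega : M) → A ∈ pow N → ap (ap g A) m = open Classical in
        if m = num 1 then seed N x A else if m = num 0 then A else app s m := by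
      intro m A hm hA
      rw [← app_eq_ap (hgs A hA).functional, (hup A hA).1,
        app_update (hup A hA).2.functional hm, app_update fs hm]
    have e : tseq N (der N j) g =
        update (update (lam omega fun m => app j (app s m)) (num 0) (image j N)) (num 1) x := by
      refine isAssignment_tseq.ext ((hjs.update haW).update hx) fun m hm => ?_
      rw [app_tseq hm, app_update (hjs.update haW).functional hm, app_update hjs.functional hm]
      split_ifs with h2 h3
      · rw [val_congr (G := fun A => seed N x A) fun A hA => by rw [hap m A hm hA, if_pos h2]]
        exact hμ.val_seed hN hc hx
      · rw [val_congr (G := fun A => A) fun A hA => by rw [hap m A hm hA, if_neg h2, if_pos h3],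
          hμ.val_id hNb, ultMap_der hNb hj1]
      · rw [val_congr (G := fun _ => app s m) fun A hA => by
          rw [hap m A hm hA, if_neg h2, if_neg h3], app_comp hj.1 hs hm, ← app_ultMap (hs.2 m hm),
          ultMap_der hNb hj1]
    have h2 := ((hφ.los hμ hlos) g hgs).1 (by rw [e]; exact h1)
    have hfun : IsFunOn (lam (pow N) fun A => seed N x A) (pow N) := isFunOn_lam
    have ff := hfun.functional
    refine ⟨_, hfun, hU.mono h2 fun A hA h3 _ => ?_⟩
    rw [app_lam hA, h A _ (sub_W hNb hA) (seed_mem_W _ _ _), ← (hup A hA).1]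
    exact h3
  · have hfun : IsFunOn (lam (pow N) fun _ => (empty : M)) (pow N) := isFunOn_lam
    have ff := hfun.functional
    refine ⟨_, hfun, hU.mono (hU.not.2 hσ) fun A hA h3 h4 => (h3 ?_).elim⟩
    obtain ⟨x, hx⟩ := h4
    obtain ⟨A', x', _, hx', e⟩ := hR _ hx
    rw [pair_inj] at e
    rw [← e.2] at hx'
    have hAW := sub_W hNb hA
    rw [← update_eq_upd fs, sat_ex (hs.update hAW) n1 hφ.isFormula]
    exact ⟨x, hx', (h A x hAW hx').1 hx⟩

/-- Induction on `k`, interleaved with `unif_der`: Łoś's theorem for `Σ_k` and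
`Σ_(k+2)`-elementarity of `j` give uniformization at level `k`, which gives Łoś's theorem for
`Σ_(k+1)`. -/
theorem los_der {k : M} (hk : k ∈ (omega : M)) :
    IsSigmaElementarySelf (succ k) (pow (pow N)) j → ∀ ψ : M, IsSigma k ψ → Los N (der N j) ψ := by
  have hNb := hN.toIsBase
  by_cases hj1 : IsSigmaElementarySelf (num 1) (pow (pow N)) j
  swap
  · exact fun h => (hj1 (h.to_one hk)).elim
  have fj := hj1.1.functional
  have hμ := isRein_der hNb hj1
  -- The derived ultrafilter becomes a plain parameter, so that the predicate of the induction is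
  -- definable.
  obtain ⟨μ, e⟩ : ∃ μ : M, der N j = μ := ⟨_, rfl⟩
  have hu : ∀ k : M, k ∈ (omega : M) → IsSigmaElementarySelf (succ (succ k)) (pow (pow N)) j →
      (∀ ψ : M, IsSigma k ψ → Los N μ ψ) → Unif N μ k := fun k hk h1 h2 => by
    rw [← e] at h2 ⊢
    exact unif_der hN hc hk h1 h2
  rw [e] at hμ ⊢
  refine omega_induction (P := fun k : M => IsSigmaElementarySelf (succ k) (pow (pow N)) j →
    ∀ ψ : M, IsSigma k ψ → Los N μ ψ) (fun _ ψ hψ => hψ.isSigmaZero.los hNb hμ)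
    (fun k hk ih h ψ hψ => ?_) hk
  exact hψ.los_succ hN hμ hc (ih h.pred) (hu k hk h (ih h.pred))

omit hc in
/-- The relations on `P(N)` are definable over `P(P(N))`. -/
theorem IsRelation.isPiDefinable {k R : M} (hk : k ∈ (omega : M)) (hR : IsRelation R (pow N) (pow N)) :
    IsPiDefinable k (pow (pow N)) R := by
  have hNb := hN.toIsBase
  have hRW : R ∈ pow (pow N) := mem_pow.2 fun z hz => by
    obtain ⟨x, y, hx, hy, rfl⟩ := hR z hz
    exact hNb.pow.pair_mem _ _ hx hy
  refine omega_induction (P := fun k : M => IsPiDefinable k (pow (pow N)) R) ?_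
    (fun k _ h => h.raise) hk
  have hD : D0 M fun p : M × M × M × M => PairMem p.2.2.1 p.1 p.2.1 p.2.2.2 := by fun_prop
  obtain ⟨φ, h1, h2⟩ := hD (num 0, num 1, num 2, num 3)
    ⟨num_mem_omega 0, num_mem_omega 1, num_mem_omega 2, num_mem_omega 3⟩
  have h0 : IsAssignment (pow (pow N)) (lam omega fun _ => (omega : M)) :=
    .lam fun _ _ => omega_mem_W hNb
  have hs := h0.update (i := num 3) hRW
  refine ⟨φ, _, .of_zero h1, hs, fun a x ha hx => ?_⟩
  rw [h2 _ _ hNb.transitive.pow.pow ((hs.update ha).update hx)]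
  generalize ht : update (update (update (lam omega fun _ => omega) (num 3) R) (num 0) a) (num 1) x = t
  change _ ↔ PairMem (app t (num 2)) (app t (num 0)) (app t (num 1)) (app t (num 3))
  subst ht
  have hu := hs.update (i := num 0) ha
  rw [app_update_self hu.functional (num_mem_omega 1),
    app_update_ne hu.functional (num_mem_omega 0) (num_ne (by omega)),
    app_update_ne hu.functional (num_mem_omega 2) (num_ne (by omega)),
    app_update_ne hu.functional (num_mem_omega 3) (num_ne (by omega)),
    app_update_self hs.functional (num_mem_omega 0),
    app_update_ne hs.functional (num_mem_omega 2) (num_ne (by omega)),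
    app_update_ne hs.functional (num_mem_omega 3) (num_ne (by omega)),
    app_update_ne h0.functional (num_mem_omega 2) (num_ne (by omega)),
    app_update_self h0.functional (num_mem_omega 3), app_lam (num_mem_omega 2), pairMem_omega]

/-- Uniformization at one level implies it at all lower levels (`Unif.lower`), so the assumption at
the predecessor of `k` feeds the whole induction. -/
theorem IsRein.los {μ k : M} (hμ : IsRein N μ) (hk : k ∈ (omega : M)) :
    (∀ m : M, m ∈ (omega : M) → k = succ m → Unif N μ m) →
      ∀ ψ : M, IsSigma k ψ → Los N μ ψ := by
  refine omega_induction (P := fun k : M => (∀ m : M, m ∈ (omega : M) → k = succ m → Unif N μ m) →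
      ∀ ψ : M, IsSigma k ψ → Los N μ ψ) (fun _ ψ hψ => hψ.isSigmaZero.los hN.toIsBase hμ)
      (fun k hk ih h ψ hψ => ?_) hk
  have h1 := h k hk rfl
  refine hψ.los_succ hN hμ hc (ih fun m hm e => ?_) h1
  subst e
  exact h1.lower

end emb

end ZFModel

end

noncomputable section

namespace ZFModel


variable {M : Type u} [Membership M M] [Nonempty M] [ModelsZF M] {α : Type u} [Ctx M α]

/-! ## Reinhardt ultrafilters over infinite levels -/

section infinite
variable {l n : M} (hl : IsEven l) (hlo : ¬ l ∈ (omega : M)) (hn : n ∈ (omega : M))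
include hl hlo hn

/-- Uniformization of relations on `X` is required explicitly only for `n = 0`. For `n = m + 1` it
follows, as such a relation is an element of `W` and hence definable over `W` with itself as a
parameter. -/
theorem isReinhardt_iff {μ : M} : IsReinhardt l n μ ↔
    IsRein (V l) μ ∧ ∀ m : M, m ∈ (omega : M) → n = succ m → Unif (V l) μ m := by
  have hN := (hl.level_covers hlo).1
  have ho := hl.isOrdinal
  unfold IsReinhardt Unif
  rw [isPreReinhardt_unif_iff ho, V_succ ho.succ, V_succ ho]
  constructor
  · rintro ⟨h1, h2, h3⟩
    refine ⟨⟨h1, fun R hR => ?_⟩, h3⟩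
    rcases omega_cases hn with rfl | ⟨m, hm, rfl⟩
    · exact h2 rfl R hR
    · refine h3 m hm rfl R (fun z hz => ?_) (hR.isPiDefinable hN hm)
      obtain ⟨x, y, hx, hy, e⟩ := hR z hz
      exact ⟨x, y, hx, sub_W hN.toIsBase hy, e⟩
  · exact fun ⟨⟨h1, h2⟩, h3⟩ => ⟨h1, fun _ => h2, h3⟩

theorem isReinhardt_derived {j : M}
    (hj : IsSigmaElementarySelf (succ n) (V (succ (succ l))) j) :
    IsReinhardt l n (derived l j) ∧
      ∃ π : M, IsUltCollapse (V (succ l)) (V (succ (succ l))) (derived l j) π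
        (V (succ (succ l))) ∧
        IsUltMap (V (succ l)) (V (succ (succ l))) (derived l j) π (V (succ (succ l))) j := by
  obtain ⟨hN, hc⟩ := hl.level_covers hlo
  have hNb := hN.toIsBase
  have ho := hl.isOrdinal
  rw [isReinhardt_iff hl hlo hn, derived_eq ho]
  rw [V_succ ho.succ, V_succ ho] at hj ⊢
  have hj1 := hj.to_one hn
  have hμ := isRein_der hNb hj1
  refine ⟨⟨hμ, ?_⟩, ?_⟩
  · rintro m hm rfl
    exact unif_der hN hc hm hj (los_der hN hc hm hj.pred)
  · obtain ⟨π, h1, h2, _⟩ := hμ.exists_collapse hNb fun y hy => hμ.exists_val_eq hN hc hy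
    rw [ultMap_der hNb hj1] at h2
    exact ⟨π, h1, h2⟩

theorem IsReinhardt.eq_derived {μ : M} (h : IsReinhardt l n μ) :
    ∃ π j : M, IsUltCollapse (V (succ l)) (V (succ (succ l))) μ π (V (succ (succ l))) ∧
      IsUltMap (V (succ l)) (V (succ (succ l))) μ π (V (succ (succ l))) j ∧
      μ = derived l j ∧
      app π (ultClass (V (succ l)) (V (succ (succ l))) μ (lam (V (succ l)) fun A => A)) =
        image j (V l) ∧
      (∀ x : M, x ∈ V (succ (succ l)) →
        x = app π (ultClass (V (succ l)) (V (succ (succ l))) μ (seedFun l x)) ∧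
        x = liftApp j (V (succ l)) (seedFun l x) (image j (V l))) ∧
      IsSigmaElementarySelf (succ n) (V (succ (succ l))) j := by
  obtain ⟨hN, hc⟩ := hl.level_covers hlo
  have hNb := hN.toIsBase
  have ho := hl.isOrdinal
  rw [isReinhardt_iff hl hlo hn] at h
  obtain ⟨hμ, hu⟩ := h
  obtain ⟨π, h1, h2, h3⟩ := hμ.exists_collapse hNb fun y hy => hμ.exists_val_eq hN hc hy
  have hj := isSigmaElementarySelf_ultMap hN hμ hc (hμ.los hN hc hn hu)
  have hd := hμ.eq_der hNb
  have hj1 := hj.to_one hn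
  have hid : IsFun (lam (pow (V l)) fun A => A) (pow (V l)) (pow (pow (V l))) :=
    isFun_lam fun A hA => sub_W hNb hA
  simp only [derived_eq ho]
  rw [V_succ ho.succ, V_succ ho]
  refine ⟨π, ultMap (V l) μ, h1, h2, hd, ?_, fun x hx => ?_, hj⟩
  · rw [h3 _ hid, ← hμ.val_id hNb]
    exact val_congr fun A hA => app_lam hA
  · have hf : IsFun (seedFun l x) (pow (V l)) (pow (pow (V l))) := by
      rw [seedFun_eq ho]
      exact isFun_lam fun A _ => seed_mem_W _ _ _
    have ff := hf.functional
    have e : val (V l) μ (fun A => app (seedFun l x) A) = x := by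
      rw [seedFun_eq ho]
      exact (val_congr fun A hA => app_lam hA).trans (hμ.val_seed hN hc hx)
    refine ⟨by rw [h3 _ hf, e], ?_⟩
    -- Since `μ` is derived from its ultrapower map, `[f_x]` is also the section at `j``V_λ` of the
    -- image of the code of `f_x`.
    have h4 := val_der hNb hj1 (F := fun A => app (seedFun l x) A) hf.2
    rw [← hd, e] at h4
    exact h4

end infinite

end ZFModel

end

noncomputable section

namespace ZFModel


variable {M : Type u} [Membership M M] [Nonempty M] [ModelsZF M] {α : Type u} [Ctx M α]

/-! ## Reinhardt ultrafilters over finite levels -/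

/-- `μ` is the principal ultrafilter over `P(N)` generated by `N`. -/
def IsPrincipal (N μ : M) : Prop := ∀ σ : M, σ ∈ μ ↔ Sub σ (pow N) ∧ N ∈ σ

section principal
variable {N μ : M} (hμ : IsPrincipal N μ)
include hμ

theorem IsPrincipal.almostAll_iff {P : M → Prop}
    (hP : Def M P := by fun_prop (disch := assumption)) : AlmostAll (pow N) μ P ↔ P N := by
  unfold AlmostAll
  rw [hμ, mem_sep]
  exact ⟨fun h => h.2.2, fun h => ⟨fun A hA => ((mem_sep).1 hA).1, N_mem_X N, h⟩⟩

theorem IsPrincipal.isUltrafilter : IsUltrafilter (pow N) μ := by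
  have hN := N_mem_X N
  refine ⟨fun σ h => ((hμ σ).1 h).1, (hμ _).2 ⟨Sub.refl _, hN⟩,
    fun h => not_mem_empty ((hμ _).1 h).2, fun σ τ h h' => ?_, fun σ τ h hs ht => ?_,
    fun σ h => ?_⟩
  · rw [hμ] at *
    exact ⟨fun x hx => h.1 x (mem_inter.1 hx).1, mem_inter.2 ⟨h.2, h'.2⟩⟩
  · exact (hμ _).2 ⟨ht, hs _ ((hμ _).1 h).2⟩
  · by_cases h1 : N ∈ σ
    · exact Or.inl ((hμ _).2 ⟨h, h1⟩)
    · exact Or.inr ((hμ _).2 ⟨fun x hx => (mem_diff.1 hx).1, mem_diff.2 ⟨hN, h1⟩⟩)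

/-- Only the point `N` matters, so a constant function with one suitable value is enough. -/
theorem IsPrincipal.hasUniformization (R : M) : HasUniformization (pow N) μ R := by
  obtain ⟨x, hx⟩ : ∃ x : M, (∃ x : M, pair N x ∈ R) → pair N x ∈ R := by
    by_cases h : ∃ x : M, pair N x ∈ R
    · obtain ⟨x, hx⟩ := h
      exact ⟨x, fun _ => hx⟩
    · exact ⟨empty, fun h' => (h h').elim⟩
  have hf : IsFunOn (lam (pow N) fun _ => x) (pow N) := isFunOn_lam
  have ff := hf.functional
  refine ⟨_, hf, (hμ.almostAll_iff).2 ?_⟩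
  rw [app_lam (N_mem_X N)]
  exact hx

/-- Evaluation at `N` is the collapse. -/
theorem IsPrincipal.exists_collapse {W : M} (hW : IsTransitive W) :
    ∃ π : M, IsUltCollapse (pow N) W μ π W ∧
      ∀ f : M, IsFun f (pow N) W → app π (ultClass (pow N) W μ f) = app f N := by
  obtain ⟨π, h1, h2⟩ := exists_ultCollapse (E := fun f => ap f N) hμ.isUltrafilter hW
    (by fun_prop) (fun f hf => by rw [← app_eq_ap hf.functional]; exact hf.2 _ (N_mem_X N))
    (fun y hy => by
      have hf : IsFun (lam (pow N) fun _ => y) (pow N) W := isFun_lam fun _ _ => hy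
      refine ⟨_, hf, ?_⟩
      rw [← app_eq_ap hf.functional, app_lam (N_mem_X N)])
    (fun f g hf hg => by
      have ff := hf.functional
      have fg := hg.functional
      rw [hμ.almostAll_iff, app_eq_ap ff, app_eq_ap fg])
    (fun f g hf hg => by
      have ff := hf.functional
      have fg := hg.functional
      rw [hμ.almostAll_iff, app_eq_ap ff, app_eq_ap fg])
  exact ⟨π, h1, fun f hf => by rw [h2 f hf, app_eq_ap hf.functional]⟩

end principal

theorem isIso_id (N : M) : IsIso N N (lam N fun x => x) where
  isFunOn := isFunOn_lam
  mem_range y := ⟨fun h => ⟨y, h, (app_lam (F := fun x => x) h).symm⟩, fun ⟨x, hx, e⟩ => by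
    rw [e, app_lam hx]; exact hx⟩
  mem_iff x x' hx hx' := by rw [app_lam hx, app_lam hx']

theorem IsSigmaZeroElementary.eq_of_mem_omega {a j : M} (ha : a ∈ (omega : M))
    (hj : IsSigmaZeroElementary (V a) (V a) j) {x : M} (hx : x ∈ V a) : app j x = x :=
  have ho := isOrdinal_of_mem_omega ha
  hj.fix (V_transitive ho) (V_transitive ho) (fun _ _ => V_sub_mem ho) ha x hx hx

theorem isSigmaElementarySelf_id {k W : M} : IsSigmaElementarySelf k W (lam W fun x => x) := by
  have hj : IsFun (lam W fun x => x) W W := isFun_lam fun x hx => hx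
  refine ⟨hj, fun φ s hφ hs => ?_⟩
  have : (lam omega fun m => app (lam W fun x => x) (app s m)) = s :=
    (isAssignment_comp hj hs).ext hs fun m hm => by
      rw [app_comp hj hs hm, app_lam (hs.2 m hm)]
  rw [this]

section finite
variable {l : M} (hl : l ∈ (omega : M))
include hl

/-- If `A ≼ N` and `k : N → A` is an isomorphism, then `k` is an elementary map of a set of
hereditarily finite sets into itself. It is the identity, and `A = N`. -/
theorem isPreReinhardt_iff_isPrincipal {μ : M} :
    IsPreReinhardt l μ ↔ IsPrincipal (V l) μ := by
  have ho := isOrdinal_of_mem_omega hl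
  rw [isPreReinhardt_iff ho]
  constructor
  · rintro ⟨hU, h, _⟩
    have h1 : AlmostAll (pow (V l)) μ fun A => A = V l := by
      refine hU.mono h fun A hA ⟨hA1, k, hk⟩ => ?_
      have hke := (hk.isElementarySelf (V_transitive ho) hA1).sigmaZero
      apply ext'
      intro y
      rw [hk.mem_range]
      constructor
      · rintro ⟨x, hx, rfl⟩
        rwa [hke.eq_of_mem_omega hl hx]
      · exact fun hy => ⟨y, hy, (hke.eq_of_mem_omega hl hy).symm⟩
    intro σ
    constructor
    · intro hσ
      have h2 : AlmostAll (pow (V l)) μ fun A => A ∈ σ := hU.of_mem hσ fun _ h => h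
      obtain ⟨A, _, h3, rfl⟩ := hU.exists (hU.and h2 h1)
      exact ⟨hU.sub hσ, h3⟩
    · rintro ⟨hσ, h2⟩
      exact hU.upward h1 (fun A hA => by rw [((mem_sep).1 hA).2]; exact h2) hσ
  · intro h
    refine ⟨h.isUltrafilter, (h.almostAll_iff).2
      ⟨⟨Sub.refl _, fun _ _ _ _ => Iff.rfl⟩, _, isIso_id _⟩,
      fun x hx => (h.almostAll_iff).2 hx, fun σ hσ => ?_⟩
    have fσ := hσ.functional
    exact (h.almostAll_iff).2 fun x hx => ((h _).1 (hσ.2 x hx)).2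

theorem isReinhardt_iff_isPrincipal {n μ : M} :
    IsReinhardt l n μ ↔ IsPrincipal (V l) μ := by
  have ho := isOrdinal_of_mem_omega hl
  unfold IsReinhardt
  rw [isPreReinhardt_iff_isPrincipal hl, V_succ ho]
  exact ⟨fun h => h.1, fun h => ⟨h, fun _ R _ => h.hasUniformization R,
    fun _ _ _ R _ _ => h.hasUniformization R⟩⟩

/-- All elements of `V_(λ+2)` are hereditarily finite and fixed by `j`, so the seed is `V_λ` itself.
-/
theorem isPrincipal_derived {j : M} (hj : IsSigmaZeroElementary (V (succ (succ l)))
    (V (succ (succ l))) j) : IsPrincipal (V l) (derived l j) ∧ image j (V l) = V l := by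
  have ho := isOrdinal_of_mem_omega hl
  have hl2 := succ_mem_omega (succ_mem_omega hl)
  have fj := hj.1.functional
  have hfix : ∀ x : M, x ∈ V (succ (succ l)) → app j x = x := fun x hx =>
    hj.eq_of_mem_omega hl2 hx
  have himg : image j (V l) = V l := by
    apply ext'
    intro y
    rw [mem_image fj]
    have h1 : ∀ x : M, x ∈ V l → app j x = x := fun x hx =>
      hfix x (V_mono ho.succ.succ (mem_succ_self _) _ (V_mono ho.succ (mem_succ_self _) _ hx))
    constructor
    · rintro ⟨x, hx, rfl⟩
      rwa [h1 x hx]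
    · exact fun hy => ⟨y, hy, (h1 y hy).symm⟩
  refine ⟨fun σ => ?_, himg⟩
  rw [derived_eq ho, mem_der fj, himg, mem_pow]
  refine and_congr_right fun h => ?_
  rw [hfix σ (by rw [V_succ ho.succ, V_succ ho]; exact mem_pow.2 h)]

end finite

end ZFModel

end

/-! ### The main theorem -/

theorem mainTheorem5 {M : Type u} [Membership M M] [Nonempty M] [ModelsZF M]
    (l n : M) (hl : ZFModel.IsEven l) (hn : n ∈ (ZFModel.omega : M)) :
    let X : M := ZFModel.V (ZFModel.succ l)
    let W : M := ZFModel.V (ZFModel.succ (ZFModel.succ l))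
    -- every `Σ_(n+1)`-elementary `j : W → W` comes from its derived ultrafilter
    (∀ j : M, ZFModel.IsSigmaElementarySelf (ZFModel.succ n) W j →
      ZFModel.IsReinhardt l n (ZFModel.derived l j) ∧
      ZFModel.UltWellfounded X W (ZFModel.derived l j) ∧
      ZFModel.UltExtensional X W (ZFModel.derived l j) ∧
      ∃ π : M, ZFModel.IsUltCollapse X W (ZFModel.derived l j) π W ∧
        ZFModel.IsUltMap X W (ZFModel.derived l j) π W j) ∧
    -- every Reinhardt ultrafilter comes from its ultrapower map
    (∀ μ : M, ZFModel.IsReinhardt l n μ →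
      ZFModel.UltWellfounded X W μ ∧ ZFModel.UltExtensional X W μ ∧
      ∃ π j : M, ZFModel.IsUltCollapse X W μ π W ∧ ZFModel.IsUltMap X W μ π W j ∧
        μ = ZFModel.derived l j ∧
        ZFModel.app π (ZFModel.ultClass X W μ (ZFModel.lam X fun A => A)) =
          ZFModel.image j (ZFModel.V l) ∧
        (¬ l ∈ (ZFModel.omega : M) → ∀ x : M, x ∈ W →
          x = ZFModel.app π (ZFModel.ultClass X W μ (ZFModel.seedFun l x)) ∧
          x = ZFModel.liftApp j X (ZFModel.seedFun l x) (ZFModel.image j (ZFModel.V l))) ∧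
        ZFModel.IsSigmaElementarySelf (ZFModel.succ n) W j) := by
  have ho := hl.isOrdinal
  intro X W
  -- For finite `λ` the embedding is the identity and the ultrafilter is principal, independently of
  -- `n`; the representation by `f_x` is claimed only for infinite `λ`.
  by_cases hlo : l ∈ (ZFModel.omega : M)
  · have hX : X = ZFModel.pow (ZFModel.V l) := ZFModel.V_succ ho
    have hNX : ZFModel.V l ∈ X := hX ▸ ZFModel.N_mem_X _
    have hW : ZFModel.IsTransitive W := ZFModel.V_transitive ho.succ.succ
    have hNW : ∀ x : M, x ∈ X → x ∈ W :=
      ZFModel.V_mono ho.succ.succ (ZFModel.mem_succ_self _)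
    refine ⟨fun j hj => ?_, fun μ hμ => ?_⟩
    · have hj0 := (hj.to_one hn).sigmaZero
      have hp := (ZFModel.isPrincipal_derived hlo hj0).1
      obtain ⟨π, h1, h2⟩ := hp.exists_collapse hW
      rw [← hX] at h1 h2
      refine ⟨(ZFModel.isReinhardt_iff_isPrincipal hlo).2 hp, h1.wellfounded, h1.extensional,
        π, h1, hj.1, fun x hx => ?_⟩
      rw [h2 _ (ZFModel.isFun_lam fun _ _ => hx), ZFModel.app_lam hNX]
      exact hj0.eq_of_mem_omega (ZFModel.succ_mem_omega (ZFModel.succ_mem_omega hlo)) hx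
    · have hp := (ZFModel.isReinhardt_iff_isPrincipal hlo).1 hμ
      obtain ⟨π, h1, h2⟩ := hp.exists_collapse hW
      rw [← hX] at h1 h2
      have hj : ∀ k : M, ZFModel.IsSigmaElementarySelf k W (ZFModel.lam W fun x => x) := fun k =>
        ZFModel.isSigmaElementarySelf_id
      obtain ⟨h3, h4⟩ := ZFModel.isPrincipal_derived hlo (hj (ZFModel.num 1)).sigmaZero
      refine ⟨h1.wellfounded, h1.extensional, π, ZFModel.lam W fun x => x, h1,
        ⟨(hj ZFModel.empty).1, fun x hx => ?_⟩, ?_, ?_, fun h => (h hlo).elim, hj _⟩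
      · rw [ZFModel.app_lam (F := fun x => x) hx, h2 _ (ZFModel.isFun_lam fun _ _ => hx),
          ZFModel.app_lam hNX]
      · exact ZFModel.ext' fun σ => by rw [hp, h3]
      · rw [h2 _ (ZFModel.isFun_lam hNW), ZFModel.app_lam hNX, h4]
  · refine ⟨fun j hj => ?_, fun μ hμ => ?_⟩
    · obtain ⟨h1, π, h2, h3⟩ := ZFModel.isReinhardt_derived hl hlo hn hj
      exact ⟨h1, h2.wellfounded, h2.extensional, π, h2, h3⟩
    · obtain ⟨π, j, h1, h2, h3, h4, h5, h6⟩ := hμ.eq_derived hl hlo hn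
      exact ⟨h1.wellfounded, h1.extensional, π, j, h1, h2, h3, h4, fun _ => h5, h6⟩
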